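/- **Setting.** Consider real systems $(S)$: $\dot x=p(x,y)=p_0+p_1+p_2$, $\dot y=q(x,y)=q_0+q_1+q_2$ with $p_0=a_{00}$, $p_1=a_{10}x+a_{01}y$, $p_2=a_{20}x^2+2a_{11}xy+a_{02}y^2$ and $q_0=b_{00}$, $q_1=b_{10}x+b_{01}y$, $q_2=b_{20}x^2+2b_{11}xy+b_{02}y^2$, identified with their coefficient vectors $a\in\mathbb R^{12}$. Let $\mathbf{QS}$ be the set of systems with $\gcd(p,q)=1$ and $\max(\deg p,\deg q)=2$. Put $P=Z^2p(X/Z,Y/Z)$, $Q=Z^2q(X/Z,Y/Z)$, $C=YP-XQ$. An affine line $ux+vy+w=0$ ($u,v,w\in\mathbb C$, $(u,v)\neq(0,0)$) is invariant if $ux+vy+w$ divides $up+vq$ in $\mathbb C[x,y]$; the line $Z=0$ is always counted as invariant. An affine line has multiplicity $m$ if $m$ is the largest number such that there are real quadratic systems $S_k\to S$ (in $\mathbb R^{12}$) each having $m$ distinct invariant affine lines whose coefficient vectors all converge to $(u,v,w)$; $Z=0$ has multiplicity $m$ if $m$ is the largest number such that there are real quadratic systems $S_k\to S$ each having $m-1$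 distinct invariant affine lines whose coefficient vectors all converge to $(0,0,1)$. $\mathbf{QSL}_6$ is the class of systems in $\mathbf{QS}$ with $Z\nmid C$ whose invariant lines (complex ones and $Z=0$ included) are finite in number with multiplicities of sum $6$. The configuration of $S$ consists of its invariant lines with multiplicities, the real finite singular points $w$ on its invariant affine lines with the intersection number $I_w(p,q)$, and the real singular points $w$ at infinity (points of $Z=0=C$) with $(I_w(C,Z),I_w(P,Q))$. The group acting is generated by the real affine transformations and the time rescalings $t\mapsto rt$, $r\in\mathbb R\setminus\{0\}$. **Comitants.** $(f,g)^{(k)}=\sum_{h=0}^k(-1)^h\binom kh\frac{\partial^kf}{\partial x^{k-h}\partial y^h}\frac{\partial^kg}{\partial x^h\partial y^{k-h}}$, $C_i=yp_i-xq_i$, $D_1=\partial_xp_1+\partial_yq_1$. Let $(c_{ij})$ be the symmetric $3\times3$ matrix of the quadratic form $\alpha P+\beta Q$ in $(X,Y,Z)$ and $\Delta(\alpha,\beta)$ its determinant; $D=4\Delta(y,-x)$ and $H=4(c_{11}c_{22}-c_{12}^2)|_{(\alpha,\beta)=(-y,x)}$. Further $B_3=(C_2,D)^{(1)}$, $M=2\,\mathrm{Hess}(C_2)$,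 $\eta=\mathrm{Discriminant}(C_2)$, $K=\mathrm{Jacob}(p_2,q_2)$, $N=K+H$, $H_1=-(((C_2,C_2)^{(2)},C_2)^{(1)},D)^{(3)}$, $H_2=(C_1,2H-N)^{(1)}-2D_1N$, $H_3=(C_2,D)^{(2)}$, $N_1=C_1(C_2,C_2)^{(2)}-2C_2(C_1,C_2)^{(2)}$, $N_2=D_1(C_1,C_2)^{(2)}-((C_2,C_2)^{(2)},C_0)^{(1)}$, $N_3=(C_2,C_1)^{(1)}$, $N_4=4(C_2,C_0)^{(1)}-3C_1D_1$. For a form $U(x,y)$, $U>0$ (resp. $U<0$) means that $U$ is not the zero form and is positive (resp. negative) wherever it does not vanish; $U=0$ means that it is the zero form. **Theorem.** Consider the following systems, conditions and configurations (multiplicities greater than $1$ of lines in parentheses after the line; finite real singular points with $I_w(p,q)$; real singular points at infinity with $(I_w(C,Z),I_w(P,Q))$). 1. $\dot x=x^2-1,\ \dot y=y^2-1$; $\eta>0,\ H_1>0$. Lines $x=\pm1$, $y=\pm1$, $y=x$, $Z=0$; points $(\pm1,\pm1)$ (all four): $1$; $[1:0:0],[0:1:0],[1:1:0]$: $(1,0)$.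 2. $\dot x=x^2+1,\ \dot y=y^2+1$; $\eta>0,\ H_1<0$. Lines $x=\pm i$, $y=\pm i$, $y=x$, $Z=0$; $[1:0:0],[0:1:0],[1:1:0]$: $(1,0)$. 3. $\dot x=2xy,\ \dot y=y^2-x^2-1$; $\eta<0,\ H_1<0$. Lines $x=0$, $x+iy=\pm i$, $x-iy=\pm i$, $Z=0$; $(0,\pm1)$: $1$; $[0:1:0]$: $(1,0)$. 4. $\dot x=2xy,\ \dot y=y^2-x^2+1$; $\eta<0,\ H_1>0$. Lines $x=0$, $x+iy=\pm1$, $x-iy=\pm1$, $Z=0$; $(\pm1,0)$: $1$; $[0:1:0]$: $(1,0)$. 5. $\dot x=x^2,\ \dot y=y^2$; $\eta>0,\ H_1=0$. Lines $x=0$ (2), $y=0$ (2), $y=x$, $Z=0$; $(0,0)$: $4$; $[1:0:0],[0:1:0],[1:1:0]$: $(1,0)$. 6. $\dot x=2xy,\ \dot y=y^2-x^2$; $\eta<0,\ H_1=0$. Lines $x=0$, $x+iy=0$ (2), $x-iy=0$ (2), $Z=0$; $(0,0)$: $4$; $[0:1:0]$: $(1,0)$. 7. $\dot x=x^2-1,\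 \dot y=2y$; $MD\ne0,\ \eta=H=N_1=N_2=0$. Lines $x=1$ (2), $x=-1$, $y=0$, $Z=0$ (2); $(\pm1,0)$: $1$; $[0:1:0]$: $(2,2)$, $[1:0:0]$: $(1,0)$. 8. $\dot x=1-x^2,\ \dot y=-2xy$; $MH\ne0,\ \eta=H_2=0,\ H_3>0$. Lines $x=1$ (2), $x=-1$ (2), $y=0$, $Z=0$; $(\pm1,0)$: $1$; $[0:1:0]$: $(2,2)$, $[1:0:0]$: $(1,0)$. 9. $\dot x=-1-x^2,\ \dot y=-2xy$; $MH\ne0,\ \eta=H_2=0,\ H_3<0$. Lines $x=i$ (2), $x=-i$ (2), $y=0$, $Z=0$; $[0:1:0]$: $(2,2)$, $[1:0:0]$: $(1,0)$. 10. $\dot x=x^2,\ \dot y=1$; $M\ne0,\ \eta=H=D=N_1=N_2=0$. Lines $x=0$ (3), $Z=0$ (3); $[0:1:0]$: $(2,4)$, $[1:0:0]$: $(1,0)$. 11. $\dot x=x,\ \dot y=y-x^2$; $\eta=M=N_3=N_4=0$. Lines $x=0$ (3), $Z=0$ (3); $(0,0)$: $1$; $[0:1:0]$: $(3,3)$. Then: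 (i) $\mathbf{QSL}_6$ is the disjoint union of the orbits of the systems 1–11, which are pairwise distinct. System $i$ has exactly the $i$-th configuration, and a system of $\mathbf{QSL}_6$ is in the orbit of system $i$ if and only if its configuration is the image of the $i$-th one under a real affine transformation. (ii) A system in $\mathbf{QS}$ (in particular, one in $\mathbf{QSL}_6$) is in the orbit of system $i$ if and only if $B_3=0=N$ and the $i$-th conditions hold. For each $i$ these conditions, on $\mathbb R^{12}$, are invariant under real affine transformations and time rescaling. (iii) $H_1,H_2,H_3,N_1,\dots,N_4$ are $GL$-comitants: for some integer $\chi$, $U(ga,g(x,y))=(\det g)^{-\chi}U(a,x,y)$ for all $g\in GL(2,\mathbb R)$. $H_1,H_2,H_3$ do not change under translations of the system; the following subsets of $\mathbb R^{12}$ are invariant under affine transformations, and on them the following polynomials do not change under translations: $\{\eta=0,H=0\}$ for $N_1$, $\{\eta=0,H=0,B_3=0\}$ for $N_2$, $\{M=0,N=0\}$ for $N_3$, $\{M=0,N=0,N_3=0\}$ for $N_4$. -/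

import Mathlib

open MvPolynomial Filter Topology

namespace QuadSL

noncomputable section

/-- A planar system `x' = p(x,y)`, `y' = q(x,y)` with `p`, `q` real of degree at most two is its tuple of coefficients
`(a₀₀, a₁₀, a₀₁, a₂₀, a₁₁, a₀₂, b₀₀, b₁₀, b₀₁, b₂₀, b₁₁, b₀₂)`, where
`p = a₀₀ + a₁₀ x + a₀₁ y + a₂₀ x² + 2 a₁₁ x y + a₀₂ y²` and likewise `q` with the `b`'s. -/
abbrev Sys := Fin 12 → ℝ

/-- Real polynomials in `x = X 0`, `y = X 1`. -/
abbrev Poly := MvPolynomial (Fin 2) ℝ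

def p0 (a : Sys) : Poly := C (a 0)
def p1 (a : Sys) : Poly := C (a 1) * X 0 + C (a 2) * X 1
def p2 (a : Sys) : Poly := C (a 3) * X 0 ^ 2 + C (2 * a 4) * X 0 * X 1 + C (a 5) * X 1 ^ 2
def q0 (a : Sys) : Poly := C (a 6)
def q1 (a : Sys) : Poly := C (a 7) * X 0 + C (a 8) * X 1
def q2 (a : Sys) : Poly := C (a 9) * X 0 ^ 2 + C (2 * a 10) * X 0 * X 1 + C (a 11) * X 1 ^ 2

def p (a : Sys) : Poly := p0 a + p1 a + p2 a
def q (a : Sys) : Poly := q0 a + q1 a + q2 a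

/-- `max (deg p, deg q) = 2`. -/
def IsQuadratic (a : Sys) : Prop := max (p a).totalDegree (q a).totalDegree = 2

/-- The class `QS` of nondegenerate quadratic systems: `gcd (p, q) = 1` and `max (deg p, deg q) = 2`. -/
def IsQS (a : Sys) : Prop := IsRelPrime (p a) (q a) ∧ IsQuadratic a

/-! ### Projective data: `X = X 0`, `Y = X 1`, `Z = X 2` -/

def P (a : Sys) : MvPolynomial (Fin 3) ℝ :=
  C (a 0) * X 2 ^ 2 + (C (a 1) * X 0 + C (a 2) * X 1) * X 2
    + (C (a 3) * X 0 ^ 2 + C (2 * a 4) * X 0 * X 1 + C (a 5) * X 1 ^ 2)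

def Q (a : Sys) : MvPolynomial (Fin 3) ℝ :=
  C (a 6) * X 2 ^ 2 + (C (a 7) * X 0 + C (a 8) * X 1) * X 2
    + (C (a 9) * X 0 ^ 2 + C (2 * a 10) * X 0 * X 1 + C (a 11) * X 1 ^ 2)

/-- `C(X,Y,Z) = Y P - X Q`. -/
def CP (a : Sys) : MvPolynomial (Fin 3) ℝ := X 1 * P a - X 0 * Q a

/-- Complexification of a real polynomial. -/
def cplx {σ : Type} (f : MvPolynomial σ ℝ) : MvPolynomial σ ℂ := MvPolynomial.map (algebraMap ℝ ℂ) f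

/-! ### Invariant lines and their multiplicities -/

/-- `f = 0` is an affine algebraic invariant curve: `deg f ≥ 1` and `p f_x + q f_y = f k` for some complex
polynomial `k`. -/
def IsInvariantCurve (a : Sys) (f : MvPolynomial (Fin 2) ℂ) : Prop :=
  1 ≤ f.totalDegree ∧ f ∣ cplx (p a) * pderiv 0 f + cplx (q a) * pderiv 1 f

/-- The polynomial `u x + v y + w` of `l = (u, v, w)`. -/
def lineForm (l : Fin 3 → ℂ) : MvPolynomial (Fin 2) ℂ := C (l 0) * X 0 + C (l 1) * X 1 + C (l 2)

/-- `u x + v y + w = 0`, `(u, v) ≠ (0, 0)`, is an invariant affine line. -/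
def IsInvAffineLine (a : Sys) (l : Fin 3 → ℂ) : Prop :=
  (l 0, l 1) ≠ (0, 0) ∧ IsInvariantCurve a (lineForm l)

/-- `u X + v Y + w Z = 0` is the line at infinity `Z = 0`. -/
def IsLineAtInfinity (l : Fin 3 → ℂ) : Prop := l 0 = 0 ∧ l 1 = 0 ∧ l 2 ≠ 0

/-- `u X + v Y + w Z = 0` is an invariant line in the complex projective plane: the line at infinity or the
projective completion of an invariant affine line. -/
def IsInvLine (a : Sys) (l : Fin 3 → ℂ) : Prop := IsLineAtInfinity l ∨ IsInvAffineLine a l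

/-- There is a sequence of real quadratic systems that converges to `a`, each with `m` distinct invariant affine
lines whose coefficients converge to `l`. -/
def IsLimitOfLines (a : Sys) (l : Fin 3 → ℂ) (m : ℕ) : Prop :=
  ∃ (A : ℕ → Sys) (L : ℕ → Fin m → Fin 3 → ℂ),
    (∀ k, IsQuadratic (A k)) ∧ Tendsto A atTop (𝓝 a) ∧
    (∀ k j, IsInvAffineLine (A k) (L k j)) ∧
    (∀ k i j, i ≠ j → ∀ c : ℂ, L k i ≠ c • L k j) ∧
    ∀ j, Tendsto (fun k => L k j) atTop (𝓝 l)

open scoped Classical in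
/-- The multiplicity of the line with coefficients `l`. For an affine line it is the largest `m` such that `m`
distinct invariant lines of systems tending to `a` tend to the line; for `Z = 0` it is the largest `m` such that
`m - 1` distinct invariant affine lines of systems tending to `a` tend to `Z = 0`. -/
def lineMult (a : Sys) (l : Fin 3 → ℂ) : ℕ∞ :=
  (if IsLineAtInfinity l then 1 else 0) + ⨆ (m : ℕ) (_ : IsLimitOfLines a l m), (m : ℕ∞)

/-- The set `IL(S)` of invariant lines in the (dual) projective plane. -/
def IL (a : Sys) : Set (Projectivization ℂ (Fin 3 → ℂ)) := {l | IsInvLine a l.rep}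

/-- The invariant lines, the line at infinity included and each counted with its multiplicity, are `n` in number. -/
def HasTotalMult (a : Sys) (n : ℕ) : Prop :=
  (IL a).Finite ∧ ∑ᶠ l ∈ IL a, lineMult a l.rep = n

/-- The class `QSL₆`. -/
def IsQSL6 (a : Sys) : Prop := IsQS a ∧ ¬ (X 2 ∣ CP a) ∧ HasTotalMult a 6

/-! ### Intersection numbers -/

/-- The maximal ideal of the point `c` of the complex affine plane. -/
def pointIdeal (c : Fin 2 → ℂ) : Ideal (MvPolynomial (Fin 2) ℂ) :=
  RingHom.ker (MvPolynomial.eval c : MvPolynomial (Fin 2) ℂ →+* ℂ)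

instance (c : Fin 2 → ℂ) : (pointIdeal c).IsPrime := RingHom.ker_isPrime _

/-- The local ring of the affine plane at `c`. -/
abbrev LocalRingAt (c : Fin 2 → ℂ) := Localization.AtPrime (pointIdeal c)

/-- The intersection number `dim_ℂ (O_c / (f, g))` of two affine curves at `c`. -/
def affInt (f g : MvPolynomial (Fin 2) ℂ) (c : Fin 2 → ℂ) : ℕ∞ :=
  Cardinal.toENat (Module.rank ℂ
    (LocalRingAt c ⧸ Ideal.span
      {algebraMap (MvPolynomial (Fin 2) ℂ) (LocalRingAt c) f, algebraMap _ (LocalRingAt c) g}))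

/-- Dehomogenization: the `i`-th variable becomes `1`. -/
def dehom (i : Fin 3) (F : MvPolynomial (Fin 3) ℂ) : MvPolynomial (Fin 2) ℂ :=
  aeval (i.insertNth (1 : MvPolynomial (Fin 2) ℂ) (fun j => X j) : Fin 3 → MvPolynomial (Fin 2) ℂ) F

/-- The coordinates of the point `w` of the projective plane in the chart where the `i`-th coordinate is `1`. -/
def chartPt (i : Fin 3) (w : Fin 3 → ℂ) : Fin 2 → ℂ := fun j => w (i.succAbove j) / w i

open scoped Classical in
/-- A chart that contains the point `w`. -/
def chartOf (w : Fin 3 → ℂ) : Fin 3 := if w 2 ≠ 0 then 2 else if w 1 ≠ 0 then 1 else 0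

/-- The intersection number `I_w(F, G)` of two projective curves at the point `w = [w₀ : w₁ : w₂]`. -/
def projInt (F G : MvPolynomial (Fin 3) ℂ) (w : Fin 3 → ℂ) : ℕ∞ :=
  affInt (dehom (chartOf w) F) (dehom (chartOf w) G) (chartPt (chartOf w) w)

/-- The complex point of the affine plane given by a real one. -/
def toC (z : Fin 2 → ℝ) : Fin 2 → ℂ := fun i => (z i : ℂ)

/-- The point `[x : y : 0]` at infinity. -/
def infPt (z : Fin 2 → ℝ) : Fin 3 → ℂ := ![(z 0 : ℂ), (z 1 : ℂ), 0]

/-! ### The affine group and time rescaling -/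

/-- A real affine transformation `z ↦ M z + b`. -/
structure AffTransf where
  M : Matrix (Fin 2) (Fin 2) ℝ
  b : Fin 2 → ℝ
  det_ne : M.det ≠ 0

/-- The point `g z = M z + b`. -/
def AffTransf.apply (g : AffTransf) (z : Fin 2 → ℝ) : Fin 2 → ℝ := g.M.mulVec z + g.b

/-- The identity transformation. -/
def AffTransf.id : AffTransf := ⟨1, 0, by simp⟩

/-- The coefficients of the line `g⁻¹ l`, that is of the form `(x, y) ↦ l (g (x, y))`. -/
def AffTransf.pullLine (g : AffTransf) (l : Fin 3 → ℂ) : Fin 3 → ℂ :=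
  ![l 0 * g.M 0 0 + l 1 * g.M 1 0, l 0 * g.M 0 1 + l 1 * g.M 1 1, l 0 * g.b 0 + l 1 * g.b 1 + l 2]

/-- The vector field `(p, q)`. -/
def field (a : Sys) (z : Fin 2 → ℝ) : Fin 2 → ℝ := ![eval z (p a), eval z (q a)]

/-- `a'` is the system obtained from `a` by the affine transformation `g` and multiplication of the vector field by
`r` (a rescaling of time). -/
def Transforms (g : AffTransf) (r : ℝ) (a a' : Sys) : Prop :=
  ∀ z, field a' (g.apply z) = r • g.M.mulVec (field a z)

/-- `a` and `a'` are in one orbit under the real affine group and time rescaling. -/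
def SameOrbit (a a' : Sys) : Prop := ∃ (g : AffTransf) (r : ℝ), r ≠ 0 ∧ Transforms g r a a'

/-! ### Configurations of invariant lines -/

/-- A finite singular point. -/
def IsSing (a : Sys) (z : Fin 2 → ℝ) : Prop := eval z (p a) = 0 ∧ eval z (q a) = 0

/-- The point `z` lies on an invariant affine line, real or complex. -/
def OnInvLine (a : Sys) (z : Fin 2 → ℝ) : Prop :=
  ∃ l, IsInvAffineLine a l ∧ eval (toC z) (lineForm l) = 0

/-- The real point `[x : y : 0]` of the line at infinity is singular, that is, it lies on `C = 0`. -/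
def IsSingInf (a : Sys) (w : Fin 2 → ℝ) : Prop := w ≠ 0 ∧ eval (infPt w) (cplx (CP a)) = 0

/-- A list of lines `u X + v Y + w Z = 0` with multiplicities, of real points `(x, y)` with multiplicities, and of
real points `[x : y : 0]` with pairs of multiplicities. -/
structure ConfigData where
  lines : List ((Fin 3 → ℂ) × ℕ∞)
  fin : List ((Fin 2 → ℝ) × ℕ∞)
  inf : List ((Fin 2 → ℝ) × ℕ∞ × ℕ∞)

/-- The configuration of invariant lines of `a` is the image under `g` of the configuration `K`: the invariant lines
of `a` are the images of the lines of `K`, with the same multiplicities, the real finite singular points on the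
invariant lines are the images of the finite points of `K`, with `I_w(p, q)` as listed, and the real singular points
at infinity are the images of those of `K`, with `(I_w(C, Z), I_w(P, Q))` as listed. -/
def HasConfig (a : Sys) (g : AffTransf) (K : ConfigData) : Prop :=
  ((∀ l, IsInvLine a l → ∃ e ∈ K.lines, ∃ c : ℂ, c ≠ 0 ∧ g.pullLine l = c • e.1) ∧
    ∀ e ∈ K.lines, ∀ l, g.pullLine l = e.1 → IsInvLine a l ∧ lineMult a l = e.2) ∧
  ((∀ z, IsSing a z → OnInvLine a z → ∃ e ∈ K.fin, z = g.apply e.1) ∧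
    ∀ e ∈ K.fin, IsSing a (g.apply e.1) ∧ OnInvLine a (g.apply e.1) ∧
      affInt (cplx (p a)) (cplx (q a)) (toC (g.apply e.1)) = e.2) ∧
  ((∀ w, IsSingInf a w → ∃ e ∈ K.inf, ∃ c : ℝ, c ≠ 0 ∧ w = c • g.M.mulVec e.1) ∧
    ∀ e ∈ K.inf, IsSingInf a (g.M.mulVec e.1) ∧
      projInt (cplx (CP a)) (X 2) (infPt (g.M.mulVec e.1)) = e.2.1 ∧
      projInt (cplx (P a)) (cplx (Q a)) (infPt (g.M.mulVec e.1)) = e.2.2)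

/-- The eleven representatives `(VI.1)`, ..., `(VI.11)`. -/
def rep : Fin 11 → Sys := ![
  -- x' = x² - 1, y' = y² - 1
  ![-1, 0, 0, 1, 0, 0,   -1, 0, 0, 0, 0, 1],
  -- x' = x² + 1, y' = y² + 1
  ![1, 0, 0, 1, 0, 0,   1, 0, 0, 0, 0, 1],
  -- x' = 2xy, y' = y² - x² - 1
  ![0, 0, 0, 0, 1, 0,   -1, 0, 0, -1, 0, 1],
  -- x' = 2xy, y' = y² - x² + 1
  ![0, 0, 0, 0, 1, 0,   1, 0, 0, -1, 0, 1],
  -- x' = x², y' = y²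
  ![0, 0, 0, 1, 0, 0,   0, 0, 0, 0, 0, 1],
  -- x' = 2xy, y' = y² - x²
  ![0, 0, 0, 0, 1, 0,   0, 0, 0, -1, 0, 1],
  -- x' = x² - 1, y' = 2y
  ![-1, 0, 0, 1, 0, 0,   0, 0, 2, 0, 0, 0],
  -- x' = 1 - x², y' = -2xy
  ![1, 0, 0, -1, 0, 0,   0, 0, 0, 0, -1, 0],
  -- x' = -1 - x², y' = -2xy
  ![-1, 0, 0, -1, 0, 0,   0, 0, 0, 0, -1, 0],
  -- x' = x², y' = 1
  ![0, 0, 0, 1, 0, 0,   1, 0, 0, 0, 0, 0],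
  -- x' = x, y' = y - x²
  ![0, 1, 0, 0, 0, 0,   0, 0, 1, -1, 0, 0]]

open Complex in
/-- The eleven configurations `6.1`, ..., `6.11`, as realized by the representatives. -/
def config : Fin 11 → ConfigData := ![
  { lines := [(![1, 0, -1], 1), (![1, 0, 1], 1), (![0, 1, -1], 1), (![0, 1, 1], 1), (![1, -1, 0], 1),
      (![0, 0, 1], 1)]
    fin := [(![1, 1], 1), (![1, -1], 1), (![-1, 1], 1), (![-1, -1], 1)]
    inf := [(![1, 0], 1, 0), (![0, 1], 1, 0), (![1, 1], 1, 0)] },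
  { lines := [(![1, 0, -I], 1), (![1, 0, I], 1), (![0, 1, -I], 1), (![0, 1, I], 1), (![1, -1, 0], 1),
      (![0, 0, 1], 1)]
    fin := []
    inf := [(![1, 0], 1, 0), (![0, 1], 1, 0), (![1, 1], 1, 0)] },
  { lines := [(![1, 0, 0], 1), (![1, I, -I], 1), (![1, I, I], 1), (![1, -I, -I], 1), (![1, -I, I], 1),
      (![0, 0, 1], 1)]
    fin := [(![0, 1], 1), (![0, -1], 1)]
    inf := [(![0, 1], 1, 0)] },
  { lines := [(![1, 0, 0], 1), (![1, I, -1], 1), (![1, I, 1], 1), (![1, -I, -1], 1), (![1, -I, 1], 1),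
      (![0, 0, 1], 1)]
    fin := [(![1, 0], 1), (![-1, 0], 1)]
    inf := [(![0, 1], 1, 0)] },
  { lines := [(![1, 0, 0], 2), (![0, 1, 0], 2), (![1, -1, 0], 1), (![0, 0, 1], 1)]
    fin := [(![0, 0], 4)]
    inf := [(![1, 0], 1, 0), (![0, 1], 1, 0), (![1, 1], 1, 0)] },
  { lines := [(![1, 0, 0], 1), (![1, I, 0], 2), (![1, -I, 0], 2), (![0, 0, 1], 1)]
    fin := [(![0, 0], 4)]
    inf := [(![0, 1], 1, 0)] },
  { lines := [(![1, 0, -1], 2), (![1, 0, 1], 1), (![0, 1, 0], 1), (![0, 0, 1], 2)]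
    fin := [(![1, 0], 1), (![-1, 0], 1)]
    inf := [(![0, 1], 2, 2), (![1, 0], 1, 0)] },
  { lines := [(![1, 0, -1], 2), (![1, 0, 1], 2), (![0, 1, 0], 1), (![0, 0, 1], 1)]
    fin := [(![1, 0], 1), (![-1, 0], 1)]
    inf := [(![0, 1], 2, 2), (![1, 0], 1, 0)] },
  { lines := [(![1, 0, -I], 2), (![1, 0, I], 2), (![0, 1, 0], 1), (![0, 0, 1], 1)]
    fin := []
    inf := [(![0, 1], 2, 2), (![1, 0], 1, 0)] },
  { lines := [(![1, 0, 0], 3), (![0, 0, 1], 3)]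
    fin := []
    inf := [(![0, 1], 2, 4), (![1, 0], 1, 0)] },
  { lines := [(![1, 0, 0], 3), (![0, 0, 1], 3)]
    fin := [(![0, 0], 1)]
    inf := [(![0, 1], 3, 3)] }]

/-! ### Comitants -/

/-- `∂^(i+j) f / ∂x^i ∂y^j`. -/
def dxy (i j : ℕ) (f : Poly) : Poly := (pderiv (0 : Fin 2))^[i] ((pderiv (1 : Fin 2))^[j] f)

/-- The transvectant `(f, g)^(k)`. -/
def transv (f g : Poly) (k : ℕ) : Poly :=
  ∑ h ∈ Finset.range (k + 1), (-1) ^ h * (k.choose h : Poly) * dxy (k - h) h f * dxy h (k - h) g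

/-- The Jacobian `f_x g_y - f_y g_x`. -/
def jacob (f g : Poly) : Poly := pderiv 0 f * pderiv 1 g - pderiv 1 f * pderiv 0 g

/-- The Hessian `f_xx f_yy - f_xy ^ 2`. -/
def hess (f : Poly) : Poly := dxy 2 0 f * dxy 0 2 f - dxy 1 1 f ^ 2

def C0 (a : Sys) : Poly := X 1 * p0 a - X 0 * q0 a
def C1 (a : Sys) : Poly := X 1 * p1 a - X 0 * q1 a
def C2 (a : Sys) : Poly := X 1 * p2 a - X 0 * q2 a
def D1 (a : Sys) : Poly := pderiv 0 (p1 a) + pderiv 1 (q1 a)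

/-- The symmetric matrix of the conic `α P + β Q`. -/
def pencil (a : Sys) (α β : Poly) : Matrix (Fin 3) (Fin 3) Poly :=
  !![C (a 3) * α + C (a 9) * β, C (a 4) * α + C (a 10) * β, C (a 1 / 2) * α + C (a 7 / 2) * β;
     C (a 4) * α + C (a 10) * β, C (a 5) * α + C (a 11) * β, C (a 2 / 2) * α + C (a 8 / 2) * β;
     C (a 1 / 2) * α + C (a 7 / 2) * β, C (a 2 / 2) * α + C (a 8 / 2) * β, C (a 0) * α + C (a 6) * β]

/-- `D(a, x, y) = 4 Δ(a, y, -x)`, where `Δ(a, α, β)` is the determinant of the conic `α P + β Q`. -/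
def D (a : Sys) : Poly := 4 * (pencil a (X 1) (-X 0)).det

/-- Four times the determinant of the quadratic part of the conic `-y P + x Q`. -/
def H (a : Sys) : Poly :=
  4 * ((pencil a (-X 1) (X 0)).submatrix (Fin.castSucc : Fin 2 → Fin 3) Fin.castSucc).det

def B3 (a : Sys) : Poly := transv (C2 a) (D a) 1
def M (a : Sys) : Poly := 2 * hess (C2 a)
def K (a : Sys) : Poly := jacob (p2 a) (q2 a)
def N (a : Sys) : Poly := K a + H a

/-- The coefficients of the binary cubic form `C2`. -/
def cubicC2 (a : Sys) : Cubic ℝ := ⟨-a 9, a 3 - 2 * a 10, 2 * a 4 - a 11, a 5⟩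

theorem C2_eq (a : Sys) : C2 a = C (cubicC2 a).a * X 0 ^ 3 + C (cubicC2 a).b * X 0 ^ 2 * X 1
    + C (cubicC2 a).c * X 0 * X 1 ^ 2 + C (cubicC2 a).d * X 1 ^ 3 := by
  simp only [C2, p2, q2, cubicC2, map_sub, map_neg]
  ring

/-- The discriminant of the binary form `C2`. -/
def eta (a : Sys) : ℝ := (cubicC2 a).discr

/-- A polynomial of degree `0` in `x`, `y`. -/
def H1 (a : Sys) : Poly := -transv (transv (transv (C2 a) (C2 a) 2) (C2 a) 1) (D a) 3
def H2 (a : Sys) : Poly := transv (C1 a) (2 * H a - N a) 1 - 2 * D1 a * N a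
def H3 (a : Sys) : Poly := transv (C2 a) (D a) 2
def N1 (a : Sys) : Poly := C1 a * transv (C2 a) (C2 a) 2 - 2 * C2 a * transv (C1 a) (C2 a) 2
def N2 (a : Sys) : Poly := D1 a * transv (C1 a) (C2 a) 2 - transv (transv (C2 a) (C2 a) 2) (C0 a) 1
def N3 (a : Sys) : Poly := transv (C2 a) (C1 a) 1
def N4 (a : Sys) : Poly := 4 * transv (C2 a) (C0 a) 1 - 3 * C1 a * D1 a

/-- `f > 0` for a binary form `f`: it is not zero, and it is positive wherever it does not vanish. -/
def FormPos (f : Poly) : Prop := f ≠ 0 ∧ ∀ z, eval z f ≠ 0 → 0 < eval z f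

/-- `f < 0` for a binary form `f`. -/
def FormNeg (f : Poly) : Prop := f ≠ 0 ∧ ∀ z, eval z f ≠ 0 → eval z f < 0

/-- The conditions that distinguish the eleven orbits. -/
def rowCond (a : Sys) : Fin 11 → Prop := ![
  0 < eta a ∧ FormPos (H1 a),
  0 < eta a ∧ FormNeg (H1 a),
  eta a < 0 ∧ FormNeg (H1 a),
  eta a < 0 ∧ FormPos (H1 a),
  0 < eta a ∧ H1 a = 0,
  eta a < 0 ∧ H1 a = 0,
  M a * D a ≠ 0 ∧ eta a = 0 ∧ H a = 0 ∧ N1 a = 0 ∧ N2 a = 0,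
  M a * H a ≠ 0 ∧ eta a = 0 ∧ H2 a = 0 ∧ FormPos (H3 a),
  M a * H a ≠ 0 ∧ eta a = 0 ∧ H2 a = 0 ∧ FormNeg (H3 a),
  M a ≠ 0 ∧ eta a = 0 ∧ H a = 0 ∧ D a = 0 ∧ N1 a = 0 ∧ N2 a = 0,
  eta a = 0 ∧ M a = 0 ∧ N3 a = 0 ∧ N4 a = 0]

/-- `B3 = N = 0` together with the conditions of the `i`-th orbit. -/
def OrbitCond (i : Fin 11) (a : Sys) : Prop := B3 a = 0 ∧ N a = 0 ∧ rowCond a i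

/-- `U` is a `GL`-comitant: `U(r_g a, g(x, y)) = (det g)^(-χ) U(a, x, y)` for linear `g`, with an integer weight `χ`. -/
def IsGLComitant (U : Sys → Poly) : Prop :=
  ∃ χ : ℤ, ∀ (g : AffTransf) (a a' : Sys), g.b = 0 → Transforms g 1 a a' →
    ∀ z, eval (g.apply z) (U a') = g.M.det ^ (-χ) * eval z (U a)

/-- `U` is a `CT`-comitant on the algebraic set `V`: it is a `GL`-comitant, `V` is invariant under the affine group,
and on `V` the coefficients of `U` do not change under translations. -/
def IsCTComitant (U : Sys → Poly) (V : Set Sys) : Prop :=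
  IsGLComitant U ∧ (∀ g a a', Transforms g 1 a a' → a ∈ V → a' ∈ V) ∧
    ∀ g a a', g.M = 1 → Transforms g 1 a a' → a ∈ V → U a' = U a

end

end QuadSL

open QuadSL

namespace QuadSL

noncomputable section

/-! ### Explicit form of the group action -/

/-- The coefficients of the quadratic polynomial `c₀ + c₁ x + c₂ y + c₃ x² + 2 c₄ x y + c₅ y²` composed with `g`. -/
def quadComp (g : AffTransf) (c0 c1 c2 c3 c4 c5 : ℝ) : Fin 6 → ℝ :=
  ![c0 + c1 * g.b 0 + c2 * g.b 1 + c3 * g.b 0 ^ 2 + 2 * c4 * g.b 0 * g.b 1 + c5 * g.b 1 ^ 2,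
    c1 * g.M 0 0 + c2 * g.M 1 0 + 2 * c3 * g.M 0 0 * g.b 0
      + 2 * c4 * (g.M 0 0 * g.b 1 + g.M 1 0 * g.b 0) + 2 * c5 * g.M 1 0 * g.b 1,
    c1 * g.M 0 1 + c2 * g.M 1 1 + 2 * c3 * g.M 0 1 * g.b 0
      + 2 * c4 * (g.M 0 1 * g.b 1 + g.M 1 1 * g.b 0) + 2 * c5 * g.M 1 1 * g.b 1,
    c3 * g.M 0 0 ^ 2 + 2 * c4 * g.M 0 0 * g.M 1 0 + c5 * g.M 1 0 ^ 2,
    c3 * g.M 0 0 * g.M 0 1 + c4 * (g.M 0 0 * g.M 1 1 + g.M 0 1 * g.M 1 0) + c5 * g.M 1 0 * g.M 1 1,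
    c3 * g.M 0 1 ^ 2 + 2 * c4 * g.M 0 1 * g.M 1 1 + c5 * g.M 1 1 ^ 2]

/-- The system with vector field `z ↦ s · adj(M) · field a (M z + b)`. -/
def pull (g : AffTransf) (s : ℝ) (a : Sys) : Sys :=
  let u := quadComp g (a 0) (a 1) (a 2) (a 3) (a 4) (a 5)
  let v := quadComp g (a 6) (a 7) (a 8) (a 9) (a 10) (a 11)
  ![s * (g.M 1 1 * u 0 - g.M 0 1 * v 0), s * (g.M 1 1 * u 1 - g.M 0 1 * v 1),
    s * (g.M 1 1 * u 2 - g.M 0 1 * v 2), s * (g.M 1 1 * u 3 - g.M 0 1 * v 3),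
    s * (g.M 1 1 * u 4 - g.M 0 1 * v 4), s * (g.M 1 1 * u 5 - g.M 0 1 * v 5),
    s * (g.M 0 0 * v 0 - g.M 1 0 * u 0), s * (g.M 0 0 * v 1 - g.M 1 0 * u 1),
    s * (g.M 0 0 * v 2 - g.M 1 0 * u 2), s * (g.M 0 0 * v 3 - g.M 1 0 * u 3),
    s * (g.M 0 0 * v 4 - g.M 1 0 * u 4), s * (g.M 0 0 * v 5 - g.M 1 0 * u 5)]

theorem eval_p (a : Sys) (z : Fin 2 → ℝ) : eval z (p a) = a 0 + a 1 * z 0 + a 2 * z 1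
    + a 3 * z 0 ^ 2 + 2 * a 4 * z 0 * z 1 + a 5 * z 1 ^ 2 := by
  simp [p, p0, p1, p2]; ring

theorem eval_q (a : Sys) (z : Fin 2 → ℝ) : eval z (q a) = a 6 + a 7 * z 0 + a 8 * z 1
    + a 9 * z 0 ^ 2 + 2 * a 10 * z 0 * z 1 + a 11 * z 1 ^ 2 := by
  simp [q, q0, q1, q2]; ring

theorem apply_zero (g : AffTransf) (z : Fin 2 → ℝ) :
    g.apply z 0 = g.M 0 0 * z 0 + g.M 0 1 * z 1 + g.b 0 := by
  simp [AffTransf.apply, Matrix.mulVec, dotProduct, Fin.sum_univ_two]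

theorem apply_one (g : AffTransf) (z : Fin 2 → ℝ) :
    g.apply z 1 = g.M 1 0 * z 0 + g.M 1 1 * z 1 + g.b 1 := by
  simp [AffTransf.apply, Matrix.mulVec, dotProduct, Fin.sum_univ_two]

/-- A quadratic polynomial function determines its coefficients. -/
theorem quad_coeff_eq {c d : Fin 6 → ℝ} (h : ∀ x y : ℝ,
    c 0 + c 1 * x + c 2 * y + c 3 * x ^ 2 + 2 * c 4 * x * y + c 5 * y ^ 2
      = d 0 + d 1 * x + d 2 * y + d 3 * x ^ 2 + 2 * d 4 * x * y + d 5 * y ^ 2) : c = d := by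
  have h0 := h 0 0
  have h1 := h 1 0
  have h2 := h (-1) 0
  have h3 := h 0 1
  have h4 := h 0 (-1)
  have h5 := h 1 1
  ext i
  fin_cases i <;> simp <;> linarith

theorem field_injective : Function.Injective field := by
  intro a a' h
  have hp : ∀ x y : ℝ, _ := fun x y => by
    have := congrFun (congrFun h ![x, y]) 0
    simpa [field, eval_p] using this
  have hq : ∀ x y : ℝ, _ := fun x y => by
    have := congrFun (congrFun h ![x, y]) 1
    simpa [field, eval_q] using this
  have e1 := quad_coeff_eq (c := ![a 0, a 1, a 2, a 3, a 4, a 5])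
    (d := ![a' 0, a' 1, a' 2, a' 3, a' 4, a' 5]) (by simpa using hp)
  have e2 := quad_coeff_eq (c := ![a 6, a 7, a 8, a 9, a 10, a 11])
    (d := ![a' 6, a' 7, a' 8, a' 9, a' 10, a' 11]) (by simpa using hq)
  ext i
  fin_cases i
  exacts [congrFun e1 0, congrFun e1 1, congrFun e1 2, congrFun e1 3, congrFun e1 4, congrFun e1 5,
    congrFun e2 0, congrFun e2 1, congrFun e2 2, congrFun e2 3, congrFun e2 4, congrFun e2 5]

theorem field_pull (g : AffTransf) (s : ℝ) (a : Sys) (z : Fin 2 → ℝ) :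
    field (pull g s a) z = s • g.M.adjugate.mulVec (field a (g.apply z)) := by
  ext i
  fin_cases i <;>
  simp [field, eval_p, eval_q, apply_zero, apply_one, Matrix.adjugate_fin_two, Matrix.mulVec, dotProduct,
    Fin.sum_univ_two, pull, quadComp] <;> ring

theorem transforms_pull (g : AffTransf) {r : ℝ} (hr : r ≠ 0) (a : Sys) :
    Transforms g r (pull g (1 / (r * g.M.det)) a) a := by
  intro z
  have := g.det_ne
  rw [field_pull, Matrix.mulVec_smul, Matrix.mulVec_mulVec, Matrix.mul_adjugate, Matrix.smul_mulVec,
    Matrix.one_mulVec, smul_smul, smul_smul]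
  have h : r * (1 / (r * g.M.det)) * g.M.det = 1 := by field_simp
  rw [h, one_smul]

theorem Transforms.eq_pull {g : AffTransf} {r : ℝ} (hr : r ≠ 0) {a a' : Sys} (h : Transforms g r a a') :
    a = pull g (1 / (r * g.M.det)) a' := by
  apply field_injective
  funext z
  have h1 := h z
  rw [transforms_pull g hr a' z] at h1
  have h2 := smul_right_injective _ hr h1
  have hM : IsUnit g.M := (Matrix.isUnit_iff_isUnit_det _).2 g.det_ne.isUnit
  exact ((Matrix.mulVec_injective_iff_isUnit.2 hM) h2).symm

/-! ### The group -/

def AffTransf.mul (g h : AffTransf) : AffTransf :=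
  ⟨g.M * h.M, g.M.mulVec h.b + g.b, by rw [Matrix.det_mul]; exact mul_ne_zero g.det_ne h.det_ne⟩

theorem AffTransf.mul_apply (g h : AffTransf) (z : Fin 2 → ℝ) : (g.mul h).apply z = g.apply (h.apply z) := by
  simp only [AffTransf.apply, AffTransf.mul, Matrix.mulVec_add, Matrix.mulVec_mulVec, add_assoc]

def AffTransf.inv (g : AffTransf) : AffTransf :=
  ⟨g.M⁻¹, -(g.M⁻¹.mulVec g.b), by
    rw [Matrix.det_nonsing_inv, Ring.inverse_eq_inv']; exact inv_ne_zero g.det_ne⟩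

theorem AffTransf.inv_mul_M (g : AffTransf) : g.M⁻¹ * g.M = 1 := Matrix.nonsing_inv_mul _ g.det_ne.isUnit
theorem AffTransf.mul_inv_M (g : AffTransf) : g.M * g.M⁻¹ = 1 := Matrix.mul_nonsing_inv _ g.det_ne.isUnit

theorem AffTransf.inv_apply_apply (g : AffTransf) (z : Fin 2 → ℝ) : g.inv.apply (g.apply z) = z := by
  simp only [AffTransf.apply, AffTransf.inv, Matrix.mulVec_add, Matrix.mulVec_mulVec, g.inv_mul_M,
    Matrix.one_mulVec, add_neg_cancel_right]

theorem AffTransf.apply_inv_apply (g : AffTransf) (z : Fin 2 → ℝ) : g.apply (g.inv.apply z) = z := by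
  simp only [AffTransf.apply, AffTransf.inv, Matrix.mulVec_add, Matrix.mulVec_mulVec, g.mul_inv_M,
    Matrix.one_mulVec, Matrix.mulVec_neg, neg_add_cancel_right]

theorem Transforms.trans {g h : AffTransf} {r s : ℝ} {a b c : Sys} (h1 : Transforms g r a b)
    (h2 : Transforms h s b c) : Transforms (h.mul g) (s * r) a c := by
  intro z
  rw [AffTransf.mul_apply, h2, h1, Matrix.mulVec_smul, Matrix.mulVec_mulVec, smul_smul]
  rfl

theorem Transforms.symm {g : AffTransf} {r : ℝ} {a b : Sys} (hr : r ≠ 0) (h1 : Transforms g r a b) :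
    Transforms g.inv r⁻¹ b a := by
  intro z
  have := h1 (g.inv.apply z)
  rw [AffTransf.apply_inv_apply] at this
  rw [this, Matrix.mulVec_smul, Matrix.mulVec_mulVec, smul_smul, inv_mul_cancel₀ hr]
  simp [AffTransf.inv, g.inv_mul_M]

theorem SameOrbit.symm {a b : Sys} : SameOrbit a b → SameOrbit b a :=
  fun ⟨_, _, hr, h⟩ => ⟨_, _, inv_ne_zero hr, h.symm hr⟩

theorem SameOrbit.trans {a b c : Sys} : SameOrbit a b → SameOrbit b c → SameOrbit a c :=
  fun ⟨_, _, hr, h⟩ ⟨_, _, hs, h'⟩ => ⟨_, _, mul_ne_zero hs hr, h.trans h'⟩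

theorem sameOrbit_pull (g : AffTransf) {s : ℝ} (hs : s ≠ 0) (a : Sys) : SameOrbit (pull g s a) a := by
  have := g.det_ne
  refine ⟨g, 1 / (s * g.M.det), by positivity, ?_⟩
  have h := transforms_pull g (r := 1 / (s * g.M.det)) (by positivity) a
  convert h using 2
  field_simp

/-! ### Substitutions -/

/-- The linear substitution `f ↦ f(M z)`. -/
def linSubst (g : AffTransf) : Poly →ₐ[ℝ] Poly :=
  aeval ![C (g.M 0 0) * X 0 + C (g.M 0 1) * X 1, C (g.M 1 0) * X 0 + C (g.M 1 1) * X 1]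

/-- The affine substitution `f ↦ f(M z + b)`. -/
def affSubst (g : AffTransf) : Poly →ₐ[ℝ] Poly :=
  aeval ![C (g.M 0 0) * X 0 + C (g.M 0 1) * X 1 + C (g.b 0), C (g.M 1 0) * X 0 + C (g.M 1 1) * X 1 + C (g.b 1)]

theorem eval_linSubst (g : AffTransf) (f : Poly) (z : Fin 2 → ℝ) :
    eval z (linSubst g f) = eval (g.M.mulVec z) f := by
  have : (aeval z : Poly →ₐ[ℝ] ℝ).comp (linSubst g) = aeval (g.M.mulVec z) := by
    apply MvPolynomial.algHom_ext
    intro i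
    fin_cases i <;> simp [linSubst, Matrix.mulVec, dotProduct, Fin.sum_univ_two]
  simpa [aeval_eq_eval] using DFunLike.congr_fun this f

theorem eval_affSubst (g : AffTransf) (f : Poly) (z : Fin 2 → ℝ) :
    eval z (affSubst g f) = eval (g.apply z) f := by
  have : (aeval z : Poly →ₐ[ℝ] ℝ).comp (affSubst g) = aeval (g.apply z) := by
    apply MvPolynomial.algHom_ext
    intro i
    fin_cases i <;> simp [affSubst, apply_zero, apply_one]
  simpa [aeval_eq_eval] using DFunLike.congr_fun this f

theorem mulVec_bij (g : AffTransf) : Function.Bijective g.M.mulVec := by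
  have hM : IsUnit g.M := (Matrix.isUnit_iff_isUnit_det _).2 g.det_ne.isUnit
  exact ⟨Matrix.mulVec_injective_iff_isUnit.2 hM, Matrix.mulVec_surjective_iff_isUnit.2 hM⟩

theorem linSubst_injective (g : AffTransf) : Function.Injective (linSubst g) := by
  intro f f' h
  apply MvPolynomial.funext
  intro z
  obtain ⟨w, rfl⟩ := (mulVec_bij g).2 z
  rw [← eval_linSubst, h, eval_linSubst]

/-! ### Equivariance of transvectants -/

theorem pderiv_comm' (f : Poly) : pderiv (1 : Fin 2) (pderiv (0 : Fin 2) f) = pderiv 0 (pderiv 1 f) := by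
  induction f using MvPolynomial.induction_on with
  | C r => simp
  | add f g hf hg => simp [hf, hg]
  | mul_X f i hf =>
    fin_cases i <;> simp [Derivation.leibniz, hf, pderiv_X] <;> ring

theorem pderiv_linSubst (g : AffTransf) (i : Fin 2) (f : Poly) :
    pderiv i (linSubst g f)
      = C (g.M 0 i) * linSubst g (pderiv 0 f) + C (g.M 1 i) * linSubst g (pderiv 1 f) := by
  induction f using MvPolynomial.induction_on with
  | C r => simp [linSubst]
  | add f g hf hg => simp only [map_add, hf, hg]; ring
  | mul_X f j hf =>
    rw [map_mul, Derivation.leibniz, hf]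
    simp only [Derivation.leibniz, map_add, map_mul, smul_eq_mul, pderiv_X]
    fin_cases i <;> fin_cases j <;> simp [linSubst, pderiv_X, Derivation.leibniz, pderiv_C] <;> ring

theorem transv_linSubst_one (g : AffTransf) (f h : Poly) :
    transv (linSubst g f) (linSubst g h) 1 = C g.M.det * linSubst g (transv f h 1) := by
  simp only [transv, dxy, Finset.sum_range_succ, Finset.sum_range_zero, Function.iterate_succ,
    Function.comp, Function.iterate_zero, id, pderiv_linSubst, map_add, map_mul, map_sub,
    Matrix.det_fin_two, map_pow, map_neg, map_one, map_natCast, Nat.sub_self, Nat.sub_zero,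
    Nat.choose_zero_right, Nat.choose_self, Nat.cast_one, zero_add]
  ring

theorem transv_linSubst_two (g : AffTransf) (f h : Poly) :
    transv (linSubst g f) (linSubst g h) 2 = C (g.M.det ^ 2) * linSubst g (transv f h 2) := by
  simp only [transv, dxy, Finset.sum_range_succ, Finset.sum_range_zero, Function.iterate_succ,
    Function.comp, Function.iterate_zero, id, pderiv_linSubst, map_add, map_mul, map_sub,
    Matrix.det_fin_two, map_pow, map_neg, map_one, map_natCast, Nat.sub_self, Nat.sub_zero,
    Nat.choose_zero_right, Nat.choose_self, Nat.cast_one, zero_add, pderiv_C_mul, pderiv_comm',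
    Nat.reduceSub,
    show Nat.choose 2 1 = 2 from rfl, show Nat.choose 3 1 = 3 from rfl, show Nat.choose 3 2 = 3 from rfl,
    Nat.cast_ofNat, map_ofNat]
  ring

theorem transv_linSubst_three (g : AffTransf) (f h : Poly) :
    transv (linSubst g f) (linSubst g h) 3 = C (g.M.det ^ 3) * linSubst g (transv f h 3) := by
  simp only [transv, dxy, Finset.sum_range_succ, Finset.sum_range_zero, Function.iterate_succ,
    Function.comp, Function.iterate_zero, id, pderiv_linSubst, map_add, map_mul, map_sub,
    Matrix.det_fin_two, map_pow, map_neg, map_one, map_natCast, Nat.sub_self, Nat.sub_zero,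
    Nat.choose_zero_right, Nat.choose_self, Nat.cast_one, zero_add, pderiv_C_mul, pderiv_comm',
    Nat.reduceSub,
    show Nat.choose 2 1 = 2 from rfl, show Nat.choose 3 1 = 3 from rfl, show Nat.choose 3 2 = 3 from rfl,
    Nat.cast_ofNat, map_ofNat]
  ring

theorem iterate_pderiv_C_mul (i : Fin 2) (n : ℕ) (c : ℝ) (f : Poly) :
    (pderiv i)^[n] (C c * f) = C c * (pderiv i)^[n] f := by
  induction n generalizing f with
  | zero => rfl
  | succ n ih => rw [Function.iterate_succ_apply, Function.iterate_succ_apply, pderiv_C_mul, ih]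

theorem dxy_C_mul (i j : ℕ) (c : ℝ) (f : Poly) : dxy i j (C c * f) = C c * dxy i j f := by
  simp only [dxy, iterate_pderiv_C_mul]

theorem transv_C_mul (c d : ℝ) (f h : Poly) (k : ℕ) :
    transv (C c * f) (C d * h) k = C (c * d) * transv f h k := by
  simp only [transv, dxy_C_mul, Finset.mul_sum, map_mul]
  exact Finset.sum_congr rfl fun i _ => by ring

theorem jacob_linSubst (g : AffTransf) (f h : Poly) :
    jacob (linSubst g f) (linSubst g h) = C g.M.det * linSubst g (jacob f h) := by
  simp only [jacob, pderiv_linSubst, map_add, map_mul, map_sub, Matrix.det_fin_two]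
  ring

theorem hess_eq_transv (f : Poly) : 2 * hess f = transv f f 2 := by
  simp only [transv, dxy, hess, Finset.sum_range_succ, Finset.sum_range_zero, Function.iterate_succ,
    Function.comp, Function.iterate_zero, id, pderiv_comm']
  norm_num
  ring

/-! ### Behaviour of the basic comitants under the group -/

theorem p2_pull (g : AffTransf) (s : ℝ) (a : Sys) :
    p2 (pull g s a) = C s * (C (g.M 1 1) * linSubst g (p2 a) - C (g.M 0 1) * linSubst g (q2 a)) := by
  refine MvPolynomial.funext fun z => ?_
  simp [p2, q2, pull, quadComp, linSubst]; ring

theorem q2_pull (g : AffTransf) (s : ℝ) (a : Sys) :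
    q2 (pull g s a) = C s * (C (g.M 0 0) * linSubst g (q2 a) - C (g.M 1 0) * linSubst g (p2 a)) := by
  refine MvPolynomial.funext fun z => ?_
  simp [p2, q2, pull, quadComp, linSubst]; ring

theorem C2_pull (g : AffTransf) (s : ℝ) (a : Sys) : C2 (pull g s a) = C s * linSubst g (C2 a) := by
  simp only [C2, p2_pull, q2_pull, map_sub, map_mul]
  simp [linSubst]; ring

theorem C1_pull {g : AffTransf} (hb : g.b = 0) (s : ℝ) (a : Sys) :
    C1 (pull g s a) = C s * linSubst g (C1 a) := by
  simp [C1, p1, q1, pull, quadComp, linSubst, hb]; ring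

theorem C0_pull {g : AffTransf} (hb : g.b = 0) (s : ℝ) (a : Sys) :
    C0 (pull g s a) = C s * linSubst g (C0 a) := by
  simp [C0, p0, q0, pull, quadComp, linSubst, hb]; ring

theorem D1_eq (a : Sys) : D1 a = C (a 1 + a 8) := by
  simp [D1, p1, q1, pderiv_X, Derivation.leibniz]

theorem D1_pull {g : AffTransf} (hb : g.b = 0) (s : ℝ) (a : Sys) :
    D1 (pull g s a) = C (s * g.M.det) * linSubst g (D1 a) := by
  rw [D1_eq, D1_eq, show linSubst g (C (a 1 + a 8)) = C (a 1 + a 8) by simp [linSubst], ← C_mul]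
  congr 1
  simp [pull, quadComp, hb, Matrix.det_fin_two]; ring

theorem K_pull (g : AffTransf) (s : ℝ) (a : Sys) :
    K (pull g s a) = C (s ^ 2 * g.M.det ^ 2) * linSubst g (K a) := by
  have h : K (pull g s a) = C (s ^ 2 * g.M.det) * jacob (linSubst g (p2 a)) (linSubst g (q2 a)) := by
    simp only [K, jacob, p2_pull, q2_pull, pderiv_C_mul, map_sub, Matrix.det_fin_two, map_mul, map_pow]
    ring
  rw [h, jacob_linSubst, K, ← mul_assoc, ← C_mul]
  congr 2; ring

/-- The matrix of the affine substitution in homogeneous coordinates. -/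
def homMat (g : AffTransf) : Matrix (Fin 3) (Fin 3) Poly :=
  !![C (g.M 0 0), C (g.M 0 1), C (g.b 0); C (g.M 1 0), C (g.M 1 1), C (g.b 1); 0, 0, 1]

theorem det_homMat (g : AffTransf) : (homMat g).det = C g.M.det := by
  simp [homMat, Matrix.det_fin_three, Matrix.det_fin_two]

set_option maxHeartbeats 1000000 in
theorem pencil_pull (g : AffTransf) (s : ℝ) (a : Sys) :
    pencil (pull g s a) (X 1) (-X 0)
      = (C s : Poly) • ((homMat g).transpose * pencil a (linSubst g (X 1)) (-linSubst g (X 0)) * homMat g) := by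
  ext1 i j
  refine MvPolynomial.funext fun z => ?_
  fin_cases i <;> fin_cases j <;>
    simp [pencil, homMat, Matrix.mul_apply, Fin.sum_univ_three, pull, quadComp, linSubst,
      Matrix.vecMul, dotProduct] <;> ring

theorem D_pull (g : AffTransf) (s : ℝ) (a : Sys) :
    D (pull g s a) = C (s ^ 3 * g.M.det ^ 2) * linSubst g (D a) := by
  have h : linSubst g (pencil a (X 1) (-X 0)).det
      = (pencil a (linSubst g (X 1)) (-linSubst g (X 0))).det := by
    rw [AlgHom.map_det]
    congr 1
    ext1 i j
    fin_cases i <;> fin_cases j <;> simp [pencil, linSubst] <;> ring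
  rw [D, D, pencil_pull, Matrix.det_smul, Matrix.det_mul, Matrix.det_mul, Matrix.det_transpose, det_homMat,
    show (4 : Poly) = C 4 from (map_ofNat C 4).symm, map_mul (linSubst g), h]
  simp [map_mul, map_pow, linSubst]
  ring

theorem H_eq (a : Sys) : H a = 4 * ((C (a 9) * X 0 - C (a 3) * X 1) * (C (a 11) * X 0 - C (a 5) * X 1)
    - (C (a 10) * X 0 - C (a 4) * X 1) ^ 2) := by
  simp [H, pencil, Matrix.det_fin_two]
  ring

theorem H_pull (g : AffTransf) (s : ℝ) (a : Sys) :
    H (pull g s a) = C (s ^ 2 * g.M.det ^ 2) * linSubst g (H a) := by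
  refine MvPolynomial.funext fun z => ?_
  rw [map_mul, eval_linSubst, H_eq, H_eq]
  simp only [pull, quadComp, Matrix.det_fin_two, Matrix.mulVec, dotProduct, Fin.sum_univ_two, map_mul, map_sub,
    map_pow, eval_C, eval_X, map_ofNat, Matrix.cons_val]
  ring

theorem N_pull (g : AffTransf) (s : ℝ) (a : Sys) :
    N (pull g s a) = C (s ^ 2 * g.M.det ^ 2) * linSubst g (N a) := by
  rw [N, N, K_pull, H_pull, map_add]; ring

theorem M_pull (g : AffTransf) (s : ℝ) (a : Sys) :
    M (pull g s a) = C (s ^ 2 * g.M.det ^ 2) * linSubst g (M a) := by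
  rw [M, M, hess_eq_transv, hess_eq_transv, C2_pull, transv_C_mul, transv_linSubst_two, ← mul_assoc, ← C_mul]
  congr 2; ring

theorem B3_pull (g : AffTransf) (s : ℝ) (a : Sys) :
    B3 (pull g s a) = C (s ^ 4 * g.M.det ^ 3) * linSubst g (B3 a) := by
  rw [B3, B3, C2_pull, D_pull, transv_C_mul, transv_linSubst_one, ← mul_assoc, ← C_mul]
  congr 2; ring

theorem H1_pull (g : AffTransf) (s : ℝ) (a : Sys) :
    H1 (pull g s a) = C (s ^ 6 * g.M.det ^ 8) * linSubst g (H1 a) := by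
  rw [H1, H1, C2_pull, D_pull, transv_C_mul, transv_linSubst_two, ← mul_assoc, ← C_mul, transv_C_mul,
    transv_linSubst_one, ← mul_assoc, ← C_mul, transv_C_mul, transv_linSubst_three, map_neg, mul_neg, ← mul_assoc, ← C_mul]
  congr 3; ring

theorem H3_pull (g : AffTransf) (s : ℝ) (a : Sys) :
    H3 (pull g s a) = C (s ^ 4 * g.M.det ^ 4) * linSubst g (H3 a) := by
  rw [H3, H3, C2_pull, D_pull, transv_C_mul, transv_linSubst_two, ← mul_assoc, ← C_mul]
  congr 2; ring

theorem H2_pull_linear {g : AffTransf} (hb : g.b = 0) (s : ℝ) (a : Sys) :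
    H2 (pull g s a) = C (s ^ 3 * g.M.det ^ 3) * linSubst g (H2 a) := by
  have h : (2 * H (pull g s a) - N (pull g s a)) = C (s ^ 2 * g.M.det ^ 2) * linSubst g (2 * H a - N a) := by
    rw [H_pull, N_pull, map_sub, map_mul (linSubst g), map_ofNat (linSubst g)]; ring
  rw [H2, H2, h, C1_pull hb, transv_C_mul, transv_linSubst_one, D1_pull hb, N_pull]
  simp only [map_sub, map_mul, map_pow, map_ofNat]
  ring

theorem N1_pull_linear {g : AffTransf} (hb : g.b = 0) (s : ℝ) (a : Sys) :
    N1 (pull g s a) = C (s ^ 3 * g.M.det ^ 2) * linSubst g (N1 a) := by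
  rw [N1, N1, C1_pull hb, C2_pull, transv_C_mul, transv_C_mul, transv_linSubst_two, transv_linSubst_two]
  simp only [map_sub, map_mul, map_pow, map_ofNat]
  ring

theorem N2_pull_linear {g : AffTransf} (hb : g.b = 0) (s : ℝ) (a : Sys) :
    N2 (pull g s a) = C (s ^ 3 * g.M.det ^ 3) * linSubst g (N2 a) := by
  rw [N2, N2, C1_pull hb, C2_pull, C0_pull hb, D1_pull hb, transv_C_mul, transv_C_mul, transv_linSubst_two,
    transv_linSubst_two, ← mul_assoc (C (s * s)), ← mul_assoc (C (s * s)), ← C_mul, transv_C_mul,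
    transv_linSubst_one]
  simp only [map_sub, map_mul, map_pow, map_ofNat]
  ring

theorem N3_pull_linear {g : AffTransf} (hb : g.b = 0) (s : ℝ) (a : Sys) :
    N3 (pull g s a) = C (s ^ 2 * g.M.det) * linSubst g (N3 a) := by
  rw [N3, N3, C1_pull hb, C2_pull, transv_C_mul, transv_linSubst_one]
  simp only [map_sub, map_mul, map_pow, map_ofNat]
  ring

theorem N4_pull_linear {g : AffTransf} (hb : g.b = 0) (s : ℝ) (a : Sys) :
    N4 (pull g s a) = C (s ^ 2 * g.M.det) * linSubst g (N4 a) := by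
  rw [N4, N4, C1_pull hb, C2_pull, C0_pull hb, D1_pull hb, transv_C_mul, transv_linSubst_one]
  simp only [map_sub, map_mul, map_pow, map_ofNat]
  ring

/-! ### Explicit forms -/

/-- The linear, quadratic, cubic and quartic binary forms with given coefficients. -/
def lf (u v : ℝ) : Poly := C u * X 0 + C v * X 1
def qf (u v w : ℝ) : Poly := C u * X 0 ^ 2 + C v * (X 0 * X 1) + C w * X 1 ^ 2
def cf (t u v w : ℝ) : Poly :=
  C t * X 0 ^ 3 + C u * (X 0 ^ 2 * X 1) + C v * (X 0 * X 1 ^ 2) + C w * X 1 ^ 3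
def rf (s t u v w : ℝ) : Poly :=
  C s * X 0 ^ 4 + C t * (X 0 ^ 3 * X 1) + C u * (X 0 ^ 2 * X 1 ^ 2) + C v * (X 0 * X 1 ^ 3) + C w * X 1 ^ 4

theorem eval_lf (u v : ℝ) (z : Fin 2 → ℝ) : eval z (lf u v) = u * z 0 + v * z 1 := by simp [lf]
theorem eval_qf (u v w : ℝ) (z : Fin 2 → ℝ) :
    eval z (qf u v w) = u * z 0 ^ 2 + v * (z 0 * z 1) + w * z 1 ^ 2 := by simp [qf]
theorem eval_cf (t u v w : ℝ) (z : Fin 2 → ℝ) : eval z (cf t u v w)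
    = t * z 0 ^ 3 + u * (z 0 ^ 2 * z 1) + v * (z 0 * z 1 ^ 2) + w * z 1 ^ 3 := by simp [cf]
theorem eval_rf (s t u v w : ℝ) (z : Fin 2 → ℝ) : eval z (rf s t u v w)
    = s * z 0 ^ 4 + t * (z 0 ^ 3 * z 1) + u * (z 0 ^ 2 * z 1 ^ 2) + v * (z 0 * z 1 ^ 3) + w * z 1 ^ 4 := by
  simp [rf]

theorem lf_inj {u v u' v' : ℝ} : lf u v = lf u' v' ↔ u = u' ∧ v = v' := by
  refine ⟨fun h => ?_, fun ⟨h1, h2⟩ => by rw [h1, h2]⟩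
  have h0 := congrArg (eval ![1, 0]) h
  have h1 := congrArg (eval ![0, 1]) h
  simp [eval_lf] at h0 h1
  exact ⟨h0, h1⟩

theorem qf_inj {u v w u' v' w' : ℝ} : qf u v w = qf u' v' w' ↔ u = u' ∧ v = v' ∧ w = w' := by
  refine ⟨fun h => ?_, fun ⟨h1, h2, h3⟩ => by rw [h1, h2, h3]⟩
  have h0 := congrArg (eval ![1, 0]) h
  have h1 := congrArg (eval ![0, 1]) h
  have h2 := congrArg (eval ![1, 1]) h
  simp [eval_qf] at h0 h1 h2
  refine ⟨h0, ?_, h1⟩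
  linarith

theorem cf_inj {t u v w t' u' v' w' : ℝ} :
    cf t u v w = cf t' u' v' w' ↔ t = t' ∧ u = u' ∧ v = v' ∧ w = w' := by
  refine ⟨fun h => ?_, fun ⟨h1, h2, h3, h4⟩ => by rw [h1, h2, h3, h4]⟩
  have h0 := congrArg (eval ![1, 0]) h
  have h1 := congrArg (eval ![0, 1]) h
  have h2 := congrArg (eval ![1, 1]) h
  have h3 := congrArg (eval ![1, -1]) h
  simp [eval_cf] at h0 h1 h2 h3
  norm_num at h3
  refine ⟨h0, ?_, ?_, h1⟩ <;> linarith

theorem rf_inj {s t u v w s' t' u' v' w' : ℝ} :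
    rf s t u v w = rf s' t' u' v' w' ↔ s = s' ∧ t = t' ∧ u = u' ∧ v = v' ∧ w = w' := by
  refine ⟨fun h => ?_, fun ⟨h1, h2, h3, h4, h5⟩ => by rw [h1, h2, h3, h4, h5]⟩
  have h0 := congrArg (eval ![1, 0]) h
  have h1 := congrArg (eval ![0, 1]) h
  have h2 := congrArg (eval ![1, 1]) h
  have h3 := congrArg (eval ![1, -1]) h
  have h4 := congrArg (eval ![1, 2]) h
  simp [eval_rf] at h0 h1 h2 h3 h4
  norm_num at h3 h4
  refine ⟨h0, ?_, ?_, ?_, h1⟩ <;> linarith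

theorem zero_eq_lf : (0 : Poly) = lf 0 0 := by simp [lf]
theorem zero_eq_qf : (0 : Poly) = qf 0 0 0 := by simp [qf]
theorem zero_eq_cf : (0 : Poly) = cf 0 0 0 0 := by simp [cf]
theorem zero_eq_rf : (0 : Poly) = rf 0 0 0 0 0 := by simp [rf]

theorem qf_eq_zero {u v w : ℝ} : qf u v w = 0 ↔ u = 0 ∧ v = 0 ∧ w = 0 := by rw [zero_eq_qf, qf_inj]
theorem cf_eq_zero {t u v w : ℝ} : cf t u v w = 0 ↔ t = 0 ∧ u = 0 ∧ v = 0 ∧ w = 0 := by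
  rw [zero_eq_cf, cf_inj]
theorem rf_eq_zero {s t u v w : ℝ} : rf s t u v w = 0 ↔ s = 0 ∧ t = 0 ∧ u = 0 ∧ v = 0 ∧ w = 0 := by
  rw [zero_eq_rf, rf_inj]

theorem pderiv_zero_lf (u v : ℝ) : pderiv 0 (lf u v) = C u := by
  simp [lf, pderiv_X]
theorem pderiv_one_lf (u v : ℝ) : pderiv 1 (lf u v) = C v := by
  simp [lf, pderiv_X]
theorem pderiv_zero_qf (u v w : ℝ) : pderiv 0 (qf u v w) = lf (2 * u) v := by
  refine MvPolynomial.funext fun z => ?_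
  simp [qf, lf, pderiv_X, Derivation.leibniz, Derivation.leibniz_pow]; ring
theorem pderiv_one_qf (u v w : ℝ) : pderiv 1 (qf u v w) = lf v (2 * w) := by
  refine MvPolynomial.funext fun z => ?_
  simp [qf, lf, pderiv_X, Derivation.leibniz, Derivation.leibniz_pow]; ring
theorem pderiv_zero_cf (t u v w : ℝ) : pderiv 0 (cf t u v w) = qf (3 * t) (2 * u) v := by
  refine MvPolynomial.funext fun z => ?_
  simp [qf, cf, pderiv_X, Derivation.leibniz, Derivation.leibniz_pow]; ring
theorem pderiv_one_cf (t u v w : ℝ) : pderiv 1 (cf t u v w) = qf u (2 * v) (3 * w) := by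
  refine MvPolynomial.funext fun z => ?_
  simp [qf, cf, pderiv_X, Derivation.leibniz, Derivation.leibniz_pow]; ring

theorem transv_one (f h : Poly) :
    transv f h 1 = pderiv 0 f * pderiv 1 h - pderiv 1 f * pderiv 0 h := by
  simp [transv, dxy, Finset.sum_range_succ]; ring

theorem transv_two (f h : Poly) :
    transv f h 2 = pderiv 0 (pderiv 0 f) * pderiv 1 (pderiv 1 h)
      - 2 * pderiv 0 (pderiv 1 f) * pderiv 0 (pderiv 1 h) + pderiv 1 (pderiv 1 f) * pderiv 0 (pderiv 0 h) := by
  simp [transv, dxy, Finset.sum_range_succ]; ring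

theorem transv_three (f h : Poly) :
    transv f h 3 = pderiv 0 (pderiv 0 (pderiv 0 f)) * pderiv 1 (pderiv 1 (pderiv 1 h))
      - 3 * pderiv 0 (pderiv 0 (pderiv 1 f)) * pderiv 0 (pderiv 1 (pderiv 1 h))
      + 3 * pderiv 0 (pderiv 1 (pderiv 1 f)) * pderiv 0 (pderiv 0 (pderiv 1 h))
      - pderiv 1 (pderiv 1 (pderiv 1 f)) * pderiv 0 (pderiv 0 (pderiv 0 h)) := by
  simp [transv, dxy, Finset.sum_range_succ, show Nat.choose 3 2 = 3 from rfl]; ring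

theorem transv_qf_qf_one (u v w u' v' w' : ℝ) : transv (qf u v w) (qf u' v' w') 1
    = qf (2 * (u * v' - v * u')) (4 * (u * w' - w * u')) (2 * (v * w' - w * v')) := by
  rw [transv_one]
  simp only [pderiv_zero_qf, pderiv_one_qf]
  refine MvPolynomial.funext fun z => ?_
  simp only [map_sub, map_mul, map_add, map_ofNat, eval_lf, eval_qf]; ring

theorem transv_qf_lf_one (u v w u' v' : ℝ) : transv (qf u v w) (lf u' v') 1
    = lf (2 * u * v' - v * u') (v * v' - 2 * w * u') := by
  rw [transv_one]
  simp only [pderiv_zero_qf, pderiv_one_qf, pderiv_zero_lf, pderiv_one_lf]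
  refine MvPolynomial.funext fun z => ?_
  simp only [map_sub, map_mul, map_add, map_ofNat, eval_lf, eval_C]; ring

theorem transv_cf_lf_one (t u v w u' v' : ℝ) : transv (cf t u v w) (lf u' v') 1
    = qf (3 * t * v' - u * u') (2 * u * v' - 2 * v * u') (v * v' - 3 * w * u') := by
  rw [transv_one]
  simp only [pderiv_zero_cf, pderiv_one_cf, pderiv_zero_lf, pderiv_one_lf]
  refine MvPolynomial.funext fun z => ?_
  simp only [map_sub, map_mul, map_add, map_ofNat, eval_qf, eval_C]; ring

theorem transv_cf_qf_one (t u v w u' v' w' : ℝ) : transv (cf t u v w) (qf u' v' w') 1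
    = cf (3 * t * v' - 2 * u * u') (6 * t * w' + u * v' - 4 * v * u') (4 * u * w' - v * v' - 6 * w * u')
      (2 * v * w' - 3 * w * v') := by
  rw [transv_one]
  simp only [pderiv_zero_cf, pderiv_one_cf, pderiv_zero_qf, pderiv_one_qf]
  refine MvPolynomial.funext fun z => ?_
  simp only [map_sub, map_mul, map_add, map_ofNat, eval_qf, eval_lf, eval_cf]; ring

theorem transv_qf_cf_one (t u v w u' v' w' : ℝ) : transv (qf u' v' w') (cf t u v w) 1
    = cf (-(3 * t * v' - 2 * u * u')) (-(6 * t * w' + u * v' - 4 * v * u'))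
      (-(4 * u * w' - v * v' - 6 * w * u')) (-(2 * v * w' - 3 * w * v')) := by
  rw [transv_one]
  simp only [pderiv_zero_cf, pderiv_one_cf, pderiv_zero_qf, pderiv_one_qf]
  refine MvPolynomial.funext fun z => ?_
  simp only [map_sub, map_mul, map_add, map_ofNat, eval_qf, eval_lf, eval_cf]; ring

theorem transv_cf_cf_one (t u v w t' u' v' w' : ℝ) : transv (cf t u v w) (cf t' u' v' w') 1
    = rf (3 * (t * u' - u * t')) (6 * (t * v' - v * t')) (9 * (t * w' - w * t') + 3 * (u * v' - v * u'))
      (6 * (u * w' - w * u')) (3 * (v * w' - w * v')) := by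
  rw [transv_one]
  simp only [pderiv_zero_cf, pderiv_one_cf]
  refine MvPolynomial.funext fun z => ?_
  simp only [map_sub, map_mul, map_add, map_ofNat, eval_qf, eval_rf]; ring

theorem transv_cf_cf_two (t u v w t' u' v' w' : ℝ) : transv (cf t u v w) (cf t' u' v' w') 2
    = qf (12 * (t * v' + v * t') - 8 * u * u') (36 * (t * w' + w * t') - 4 * (u * v' + v * u'))
      (12 * (u * w' + w * u') - 8 * v * v') := by
  rw [transv_two]
  simp only [pderiv_zero_cf, pderiv_one_cf, pderiv_zero_qf, pderiv_one_qf]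
  refine MvPolynomial.funext fun z => ?_
  simp only [map_sub, map_mul, map_add, map_ofNat, eval_lf, eval_qf]; ring

theorem transv_qf_cf_two (t u v w u' v' w' : ℝ) : transv (qf u' v' w') (cf t u v w) 2
    = lf (4 * u' * v - 4 * v' * u + 12 * w' * t) (12 * u' * w - 4 * v' * v + 4 * w' * u) := by
  rw [transv_two]
  simp only [pderiv_zero_cf, pderiv_one_cf, pderiv_zero_qf, pderiv_one_qf, pderiv_zero_lf, pderiv_one_lf]
  refine MvPolynomial.funext fun z => ?_
  simp only [map_sub, map_mul, map_add, map_ofNat, eval_lf, eval_C]; ring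

theorem transv_cf_cf_three (t u v w t' u' v' w' : ℝ) : transv (cf t u v w) (cf t' u' v' w') 3
    = C (36 * (t * w' - w * t') - 12 * (u * v' - v * u')) := by
  rw [transv_three]
  simp only [pderiv_zero_cf, pderiv_one_cf, pderiv_zero_qf, pderiv_one_qf, pderiv_zero_lf, pderiv_one_lf]
  refine MvPolynomial.funext fun z => ?_
  simp only [map_sub, map_mul, map_add, map_ofNat, eval_C]; ring

theorem C0_eq_lf (a : Sys) : C0 a = lf (-a 6) (a 0) := by
  simp [C0, p0, q0, lf]; ring
theorem C1_eq_qf (a : Sys) : C1 a = qf (-a 7) (a 1 - a 8) (a 2) := by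
  simp [C1, p1, q1, qf]; ring
theorem C2_eq_cf (a : Sys) : C2 a = cf (-a 9) (a 3 - 2 * a 10) (2 * a 4 - a 11) (a 5) := by
  rw [C2_eq]; simp [cf, cubicC2]; ring

/-- The coefficients of `D`. -/
def dcoef (a : Sys) : Fin 4 → ℝ :=
  ![-(4 * a 6 * a 9 * a 11 - 4 * a 6 * a 10 ^ 2 - a 8 ^ 2 * a 9 + 2 * a 7 * a 8 * a 10 - a 7 ^ 2 * a 11),
    4 * (a 0 * a 9 * a 11 + a 6 * a 3 * a 11 + a 6 * a 9 * a 5) - 4 * (a 0 * a 10 ^ 2 + 2 * a 6 * a 4 * a 10)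
      - (a 3 * a 8 ^ 2 + 2 * a 9 * a 2 * a 8)
      + 2 * (a 4 * a 7 * a 8 + a 10 * a 1 * a 8 + a 10 * a 7 * a 2) - (a 5 * a 7 ^ 2 + 2 * a 11 * a 1 * a 7),
    -(4 * (a 6 * a 3 * a 5 + a 0 * a 9 * a 5 + a 0 * a 3 * a 11) - 4 * (a 6 * a 4 ^ 2 + 2 * a 0 * a 4 * a 10)
      - (a 9 * a 2 ^ 2 + 2 * a 3 * a 2 * a 8)
      + 2 * (a 10 * a 1 * a 2 + a 4 * a 7 * a 2 + a 4 * a 1 * a 8) - (a 11 * a 1 ^ 2 + 2 * a 5 * a 1 * a 7)),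
    4 * a 0 * a 3 * a 5 - 4 * a 0 * a 4 ^ 2 - a 2 ^ 2 * a 3 + 2 * a 1 * a 2 * a 4 - a 1 ^ 2 * a 5]

theorem D_eq_cf (a : Sys) : D a = cf (dcoef a 0) (dcoef a 1) (dcoef a 2) (dcoef a 3) := by
  refine MvPolynomial.funext fun z => ?_
  rw [eval_cf]
  simp [D, pencil, Matrix.det_fin_three, dcoef]
  ring

theorem H_eq_qf (a : Sys) : H a = qf (4 * (a 9 * a 11 - a 10 ^ 2))
    (4 * (2 * a 10 * a 4 - a 9 * a 5 - a 3 * a 11)) (4 * (a 3 * a 5 - a 4 ^ 2)) := by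
  refine MvPolynomial.funext fun z => ?_
  rw [H_eq, eval_qf]
  simp
  ring

theorem p2_eq_qf (a : Sys) : p2 a = qf (a 3) (2 * a 4) (a 5) := by simp [p2, qf]; ring
theorem q2_eq_qf (a : Sys) : q2 a = qf (a 9) (2 * a 10) (a 11) := by simp [q2, qf]; ring

theorem K_eq_qf (a : Sys) : K a = qf (4 * (a 3 * a 10 - a 4 * a 9)) (4 * (a 3 * a 11 - a 5 * a 9))
    (4 * (a 4 * a 11 - a 5 * a 10)) := by
  have : K a = transv (p2 a) (q2 a) 1 := by rw [transv_one]; rfl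
  rw [this, p2_eq_qf, q2_eq_qf, transv_qf_qf_one, qf_inj]
  refine ⟨?_, ?_, ?_⟩ <;> ring

theorem qf_add (u v w u' v' w' : ℝ) : qf u v w + qf u' v' w' = qf (u + u') (v + v') (w + w') := by
  simp [qf]; ring
theorem qf_sub (u v w u' v' w' : ℝ) : qf u v w - qf u' v' w' = qf (u - u') (v - v') (w - w') := by
  simp [qf]; ring
theorem C_mul_qf (c u v w : ℝ) : C c * qf u v w = qf (c * u) (c * v) (c * w) := by
  simp [qf]; ring

theorem N_eq_qf (a : Sys) : N a = qf (4 * (a 3 * a 10 - a 4 * a 9 + a 9 * a 11 - a 10 ^ 2))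
    (4 * (2 * a 10 * a 4 - 2 * a 5 * a 9)) (4 * (a 4 * a 11 - a 5 * a 10 + a 3 * a 5 - a 4 ^ 2)) := by
  rw [N, K_eq_qf, H_eq_qf, qf_add, qf_inj]
  refine ⟨?_, ?_, ?_⟩ <;> ring

theorem M_eq_qf (a : Sys) : M a = qf (24 * (cubicC2 a).a * (cubicC2 a).c - 8 * (cubicC2 a).b ^ 2)
    (72 * (cubicC2 a).a * (cubicC2 a).d - 8 * (cubicC2 a).b * (cubicC2 a).c)
    (24 * (cubicC2 a).b * (cubicC2 a).d - 8 * (cubicC2 a).c ^ 2) := by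
  rw [M, hess_eq_transv, C2_eq_cf, transv_cf_cf_two, qf_inj]
  simp only [cubicC2]
  refine ⟨?_, ?_, ?_⟩ <;> ring

theorem H2_eq_qf (a : Sys) : ∃ u v w : ℝ, H2 a = qf u v w ∧
    u = 2 * ((-a 7) * (8 * (2 * a 10 * a 4 - a 9 * a 5 - a 3 * a 11) - 4 * (2 * a 10 * a 4 - 2 * a 5 * a 9))
        - (a 1 - a 8) * (8 * (a 9 * a 11 - a 10 ^ 2) - 4 * (a 3 * a 10 - a 4 * a 9 + a 9 * a 11 - a 10 ^ 2)))
      - 8 * (a 1 + a 8) * (a 3 * a 10 - a 4 * a 9 + a 9 * a 11 - a 10 ^ 2) ∧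
    v = 4 * ((-a 7) * (8 * (a 3 * a 5 - a 4 ^ 2) - 4 * (a 4 * a 11 - a 5 * a 10 + a 3 * a 5 - a 4 ^ 2))
        - a 2 * (8 * (a 9 * a 11 - a 10 ^ 2) - 4 * (a 3 * a 10 - a 4 * a 9 + a 9 * a 11 - a 10 ^ 2)))
      - 8 * (a 1 + a 8) * (2 * a 10 * a 4 - 2 * a 5 * a 9) ∧
    w = 2 * ((a 1 - a 8) * (8 * (a 3 * a 5 - a 4 ^ 2) - 4 * (a 4 * a 11 - a 5 * a 10 + a 3 * a 5 - a 4 ^ 2))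
        - a 2 * (8 * (2 * a 10 * a 4 - a 9 * a 5 - a 3 * a 11) - 4 * (2 * a 10 * a 4 - 2 * a 5 * a 9)))
      - 8 * (a 1 + a 8) * (a 4 * a 11 - a 5 * a 10 + a 3 * a 5 - a 4 ^ 2) := by
  refine ⟨_, _, _, ?_, rfl, rfl, rfl⟩
  rw [H2, C1_eq_qf, D1_eq, H_eq_qf, N_eq_qf, show (2 : Poly) = C 2 from (map_ofNat C 2).symm, ← C_mul, C_mul_qf, C_mul_qf, qf_sub,
    transv_qf_qf_one, qf_sub, qf_inj]
  refine ⟨?_, ?_, ?_⟩ <;> ring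

theorem H2_pull_translation {g : AffTransf} (hM : g.M = 1) (a : Sys) : H2 (pull g 1 a) = H2 a := by
  obtain ⟨u, v, w, e, rfl, rfl, rfl⟩ := H2_eq_qf a
  obtain ⟨u', v', w', e', rfl, rfl, rfl⟩ := H2_eq_qf (pull g 1 a)
  rw [e, e', qf_inj]
  simp [pull, quadComp, hM]
  refine ⟨?_, ?_, ?_⟩ <;> ring

/-! ### Invariance of the conditions -/

/-- The linear transformation with the given matrix entries. -/
def linG (m n k l : ℝ) (h : m * l - n * k ≠ 0) : AffTransf :=
  ⟨!![m, n; k, l], 0, by rwa [Matrix.det_fin_two_of]⟩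

/-- The translation by `b`. -/
def transl (b : Fin 2 → ℝ) : AffTransf := ⟨1, b, by simp⟩

/-- The linear part. -/
def linPart (g : AffTransf) : AffTransf := ⟨g.M, 0, g.det_ne⟩

theorem pull_eq_linPart (g : AffTransf) (s : ℝ) (a : Sys) :
    pull g s a = pull (linPart g) s (pull (transl g.b) 1 a) := by
  apply field_injective
  funext z
  simp only [field_pull, linPart, transl, AffTransf.apply, Matrix.adjugate_one, Matrix.one_mulVec, one_smul,
    add_zero]

theorem pull_translation_linear {g h : AffTransf} (hb : g.b = 0) (hM : h.M = 1) (a : Sys) :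
    pull g 1 (pull h 1 a) = pull (transl (g.M⁻¹.mulVec h.b)) 1 (pull g 1 a) := by
  apply field_injective
  funext z
  simp only [field_pull, transl, AffTransf.apply, Matrix.adjugate_one, Matrix.one_mulVec, one_smul,
    add_zero, hb, hM, Matrix.mulVec_add, Matrix.mulVec_mulVec, g.mul_inv_M,
    Matrix.one_mul]

theorem C_mul_linSubst_eq_zero {c : ℝ} (hc : c ≠ 0) (g : AffTransf) (f : Poly) :
    C c * linSubst g f = 0 ↔ f = 0 := by
  rw [mul_eq_zero, C_eq_zero, or_iff_right hc, map_eq_zero_iff _ (linSubst_injective g)]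

theorem formPos_linSubst {c : ℝ} (hc : 0 < c) (g : AffTransf) (f : Poly) :
    FormPos (C c * linSubst g f) ↔ FormPos f := by
  rw [FormPos, FormPos, Ne, C_mul_linSubst_eq_zero hc.ne']
  refine and_congr_right fun _ => ?_
  simp only [map_mul, eval_C, eval_linSubst]
  constructor
  · intro h z hz
    obtain ⟨w, rfl⟩ := (mulVec_bij g).2 z
    exact (mul_pos_iff_of_pos_left hc).1 (h w (mul_ne_zero hc.ne' hz))
  · intro h z hz
    exact mul_pos hc (h _ (right_ne_zero_of_mul hz))

theorem formNeg_iff (f : Poly) : FormNeg f ↔ FormPos (-f) := by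
  simp [FormNeg, FormPos]

theorem formNeg_linSubst {c : ℝ} (hc : 0 < c) (g : AffTransf) (f : Poly) :
    FormNeg (C c * linSubst g f) ↔ FormNeg f := by
  rw [formNeg_iff, formNeg_iff, ← formPos_linSubst hc g (-f), map_neg, mul_neg]

theorem linSubst_qf (g : AffTransf) (u v w : ℝ) : linSubst g (qf u v w)
    = qf (u * g.M 0 0 ^ 2 + v * g.M 0 0 * g.M 1 0 + w * g.M 1 0 ^ 2)
      (2 * u * g.M 0 0 * g.M 0 1 + v * (g.M 0 0 * g.M 1 1 + g.M 0 1 * g.M 1 0) + 2 * w * g.M 1 0 * g.M 1 1)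
      (u * g.M 0 1 ^ 2 + v * g.M 0 1 * g.M 1 1 + w * g.M 1 1 ^ 2) := by
  refine MvPolynomial.funext fun z => ?_
  rw [eval_linSubst, eval_qf, eval_qf]
  simp only [Matrix.mulVec, dotProduct, Fin.sum_univ_two]
  ring

theorem linSubst_cf (g : AffTransf) (t u v w : ℝ) : linSubst g (cf t u v w)
    = cf (t * g.M 0 0 ^ 3 + u * g.M 0 0 ^ 2 * g.M 1 0 + v * g.M 0 0 * g.M 1 0 ^ 2 + w * g.M 1 0 ^ 3)
      (3 * t * g.M 0 0 ^ 2 * g.M 0 1 + u * (g.M 0 0 ^ 2 * g.M 1 1 + 2 * g.M 0 0 * g.M 0 1 * g.M 1 0)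
        + v * (2 * g.M 0 0 * g.M 1 0 * g.M 1 1 + g.M 0 1 * g.M 1 0 ^ 2) + 3 * w * g.M 1 0 ^ 2 * g.M 1 1)
      (3 * t * g.M 0 0 * g.M 0 1 ^ 2 + u * (2 * g.M 0 0 * g.M 0 1 * g.M 1 1 + g.M 0 1 ^ 2 * g.M 1 0)
        + v * (g.M 0 0 * g.M 1 1 ^ 2 + 2 * g.M 0 1 * g.M 1 0 * g.M 1 1) + 3 * w * g.M 1 0 * g.M 1 1 ^ 2)
      (t * g.M 0 1 ^ 3 + u * g.M 0 1 ^ 2 * g.M 1 1 + v * g.M 0 1 * g.M 1 1 ^ 2 + w * g.M 1 1 ^ 3) := by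
  refine MvPolynomial.funext fun z => ?_
  rw [eval_linSubst, eval_cf, eval_cf]
  simp only [Matrix.mulVec, dotProduct, Fin.sum_univ_two]
  ring

theorem eta_pull (g : AffTransf) (s : ℝ) (a : Sys) : eta (pull g s a) = s ^ 4 * g.M.det ^ 6 * eta a := by
  have h := M_pull g s a
  rw [M_eq_qf, M_eq_qf, linSubst_qf, C_mul_qf, qf_inj] at h
  obtain ⟨h1, h2, h3⟩ := h
  have key : ∀ c : Cubic ℝ, c.discr = -1 / 192 * ((72 * c.a * c.d - 8 * c.b * c.c) ^ 2
      - 4 * (24 * c.a * c.c - 8 * c.b ^ 2) * (24 * c.b * c.d - 8 * c.c ^ 2)) := by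
    intro c; rw [Cubic.discr]; ring
  rw [eta, eta, key, key, h1, h2, h3, Matrix.det_fin_two]
  ring

theorem eta_of_C2 {a : Sys} {t u v w : ℝ} (h : C2 a = cf t u v w) :
    eta a = u ^ 2 * v ^ 2 - 4 * t * v ^ 3 - 4 * u ^ 3 * w - 27 * t ^ 2 * w ^ 2 + 18 * t * u * v * w := by
  rw [C2_eq_cf, cf_inj] at h
  obtain ⟨rfl, rfl, rfl, rfl⟩ := h
  simp only [eta, Cubic.discr, cubicC2]

/-! ### Real normal forms of binary cubics -/

theorem exists_root_cubic (u v w : ℝ) : ∃ n : ℝ, n ^ 3 + u * n ^ 2 + v * n + w = 0 := by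
  have hc : Continuous fun n : ℝ => n ^ 3 + u * n ^ 2 + v * n + w := by fun_prop
  set R := 1 + |u| + |v| + |w| with hR
  have hu := abs_nonneg u
  have hv := abs_nonneg v
  have hw := abs_nonneg w
  have hR1 : 1 ≤ R := by linarith
  have hu1 := neg_abs_le u
  have hv1 := neg_abs_le v
  have hw1 := neg_abs_le w
  have hu2 := le_abs_self u
  have hv2 := le_abs_self v
  have hw2 := le_abs_self w
  have hRR : R ≤ R ^ 2 := by nlinarith
  have h3 : R ^ 3 = R ^ 2 + (|u| + |v| + |w|) * R ^ 2 := by rw [hR]; ring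
  have e1 : |u| * R ^ 2 ≥ u * R ^ 2 ∧ |u| * R ^ 2 ≥ -(u * R ^ 2) := by constructor <;> nlinarith
  have e2 : |v| * R ^ 2 ≥ v * R ∧ |v| * R ^ 2 ≥ -(v * R) := by constructor <;> nlinarith
  have e3 : |w| * R ^ 2 ≥ w ∧ |w| * R ^ 2 ≥ -w := by constructor <;> nlinarith
  obtain ⟨n, hn⟩ := mem_range_of_exists_le_of_exists_ge hc (c := 0)
    ⟨-R, by nlinarith [e1.1, e2.2, e3.1]⟩ ⟨R, by nlinarith [e1.2, e2.2, e3.2]⟩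
  exact ⟨n, hn⟩

theorem exists_cube_root {c : ℝ} (hc : c ≠ 0) : ∃ n : ℝ, n ≠ 0 ∧ n ^ 3 = c := by
  obtain ⟨n, hn⟩ := exists_root_cubic 0 0 (-c)
  refine ⟨n, ?_, by linarith⟩
  rintro rfl
  apply hc
  linarith

/-- `f` can be brought to `f'` by a linear substitution. -/
def LinEquiv' (f f' : Poly) : Prop := ∃ g : AffTransf, g.b = 0 ∧ linSubst g f = f'

theorem LinEquiv'.trans {f f' f'' : Poly} : LinEquiv' f f' → LinEquiv' f' f'' → LinEquiv' f f'' := by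
  rintro ⟨g, hg, rfl⟩ ⟨h, hh, rfl⟩
  refine ⟨g.mul h, by simp [AffTransf.mul, hg, hh], ?_⟩
  refine MvPolynomial.funext fun z => ?_
  rw [eval_linSubst, eval_linSubst, eval_linSubst, Matrix.mulVec_mulVec]
  rfl

theorem linEquiv_cf {t u v w t' u' v' w' : ℝ} (m n k l : ℝ) (h : m * l - n * k ≠ 0)
    (h1 : t * m ^ 3 + u * m ^ 2 * k + v * m * k ^ 2 + w * k ^ 3 = t')
    (h2 : 3 * t * m ^ 2 * n + u * (m ^ 2 * l + 2 * m * n * k) + v * (2 * m * k * l + n * k ^ 2)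
      + 3 * w * k ^ 2 * l = u')
    (h3 : 3 * t * m * n ^ 2 + u * (2 * m * n * l + n ^ 2 * k) + v * (m * l ^ 2 + 2 * n * k * l)
      + 3 * w * k * l ^ 2 = v')
    (h4 : t * n ^ 3 + u * n ^ 2 * l + v * n * l ^ 2 + w * l ^ 3 = w') :
    LinEquiv' (cf t u v w) (cf t' u' v' w') := by
  refine ⟨linG m n k l h, rfl, ?_⟩
  rw [linSubst_cf, cf_inj]
  simp only [linG, Matrix.of_apply, Matrix.cons_val', Matrix.cons_val_zero, Matrix.cons_val_one,
    Matrix.cons_val_fin_one]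
  exact ⟨h1, h2, h3, h4⟩

theorem cubic_normal_of_factor (α β γ : ℝ) (h : ¬ (α = 0 ∧ β = 0 ∧ γ = 0)) :
    LinEquiv' (cf α β γ 0) (cf 0 1 (-1) 0) ∨ LinEquiv' (cf α β γ 0) (cf 1 0 1 0) ∨
      LinEquiv' (cf α β γ 0) (cf 0 1 0 0) ∨ LinEquiv' (cf α β γ 0) (cf 1 0 0 0) := by
  by_cases hγ : γ = 0
  · subst hγ
    by_cases hβ : β = 0
    · subst hβ
      have hα : α ≠ 0 := fun h' => h ⟨h', rfl, rfl⟩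
      obtain ⟨m, hm, hm3⟩ := exists_cube_root (inv_ne_zero hα)
      refine Or.inr (Or.inr (Or.inr (linEquiv_cf m 0 0 1 (by simpa using hm) ?_ ?_ ?_ ?_)))
      · rw [hm3]; field_simp; ring
      all_goals ring
    · refine Or.inr (Or.inr (Or.inl (linEquiv_cf 1 0 (-α / β) (1 / β) (by simpa using hβ) ?_ ?_ ?_ ?_)))
      all_goals field_simp
      all_goals ring
  · have step : LinEquiv' (cf α β γ 0) (cf (α - β ^ 2 / (4 * γ)) 0 γ 0) := by
      refine linEquiv_cf 1 0 (-β / (2 * γ)) 1 (by norm_num) ?_ ?_ ?_ ?_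
      all_goals field_simp
      all_goals ring
    set δ := α - β ^ 2 / (4 * γ)
    rcases lt_trichotomy (δ * γ) 0 with hs | hs | hs
    · have hδ : δ ≠ 0 := by rintro h0; simp [h0] at hs
      obtain ⟨m, hm, hm3⟩ := exists_cube_root (c := -1 / (4 * δ)) (by
        apply div_ne_zero <;> simp [hδ])
      have hpos : 0 < -δ * m ^ 2 / γ := by
        have hγ2 : 0 < γ ^ 2 := by positivity
        have : -δ * m ^ 2 / γ = -(δ * γ) * m ^ 2 / γ ^ 2 := by field_simp
        rw [this]
        have : 0 < m ^ 2 := by positivity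
        apply div_pos _ hγ2
        nlinarith
      obtain ⟨l, hl, hl2⟩ : ∃ l : ℝ, l ≠ 0 ∧ γ * l ^ 2 = -δ * m ^ 2 := by
        refine ⟨√(-δ * m ^ 2 / γ), (Real.sqrt_pos.2 hpos).ne', ?_⟩
        rw [Real.sq_sqrt hpos.le]; field_simp
      have hm4 : 4 * δ * m ^ 3 = -1 := by rw [hm3]; field_simp
      refine Or.inl (step.trans (linEquiv_cf m (-m) l l ?_ ?_ ?_ ?_ ?_))
      · intro h0
        have : 2 * (m * l) = 0 := by linarith
        simp [hm, hl] at this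
      · linear_combination m * hl2
      · linear_combination -hm4 + m * hl2
      · linear_combination hm4 - m * hl2
      · linear_combination -m * hl2
    · have hδ : δ = 0 := by
        rcases mul_eq_zero.1 hs with h0 | h0
        · exact h0
        · exact absurd h0 hγ
      refine Or.inr (Or.inr (Or.inl (step.trans (linEquiv_cf 0 (1 / γ) 1 0 ?_ ?_ ?_ ?_ ?_))))
      · simpa using hγ
      all_goals rw [hδ]
      all_goals field_simp
      all_goals ring
    · have hδ : δ ≠ 0 := by rintro h0; simp [h0] at hs
      obtain ⟨m, hm, hm3⟩ := exists_cube_root (inv_ne_zero hδ)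
      have hm4 : δ * m ^ 3 = 1 := by rw [hm3]; field_simp
      have hpos : 0 < 1 / (γ * m) := by
        have h1 : 0 < m ^ 2 := by positivity
        have h2 : (γ * m) * (δ * m ^ 3) = (δ * γ) * (m ^ 2) ^ 2 := by ring
        rw [hm4] at h2
        have : 0 < γ * m := by rw [mul_one] at h2; rw [h2]; positivity
        positivity
      have hγm : γ * m ≠ 0 := mul_ne_zero hγ hm
      have hl2 := Real.sq_sqrt hpos.le
      have hl := (Real.sqrt_pos.2 hpos).ne'
      set l := √(1 / (γ * m))
      refine Or.inr (Or.inl (step.trans (linEquiv_cf m 0 0 l ?_ ?_ ?_ ?_ ?_)))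
      · simpa using ⟨hm, hl⟩
      · linear_combination hm4
      · ring
      · have : γ * m * l ^ 2 = 1 := by rw [hl2]; field_simp
        linear_combination this
      · ring

theorem cubic_normal (t u v w : ℝ) (h : cf t u v w ≠ 0) :
    LinEquiv' (cf t u v w) (cf 0 1 (-1) 0) ∨ LinEquiv' (cf t u v w) (cf 1 0 1 0) ∨
      LinEquiv' (cf t u v w) (cf 0 1 0 0) ∨ LinEquiv' (cf t u v w) (cf 1 0 0 0) := by
  have step : ∃ α β γ : ℝ, LinEquiv' (cf t u v w) (cf α β γ 0) := by
    by_cases ht : t = 0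
    · subst ht
      exact ⟨_, _, _, linEquiv_cf 0 1 1 0 (by norm_num) rfl rfl rfl (by ring)⟩
    · obtain ⟨n, hn⟩ := exists_root_cubic (u / t) (v / t) (w / t)
      refine ⟨_, _, _, linEquiv_cf 1 n 0 1 (by norm_num) rfl rfl rfl ?_⟩
      field_simp at hn
      linear_combination hn
  obtain ⟨α, β, γ, hs⟩ := step
  have hne : ¬ (α = 0 ∧ β = 0 ∧ γ = 0) := by
    rintro ⟨rfl, rfl, rfl⟩
    obtain ⟨g, _, hg⟩ := hs
    rw [← zero_eq_cf, map_eq_zero_iff _ (linSubst_injective g)] at hg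
    exact h hg
  rcases cubic_normal_of_factor α β γ hne with h' | h' | h' | h'
  · exact Or.inl (hs.trans h')
  · exact Or.inr (Or.inl (hs.trans h'))
  · exact Or.inr (Or.inr (Or.inl (hs.trans h')))
  · exact Or.inr (Or.inr (Or.inr (hs.trans h')))

/-- Every system with `C₂ ≠ 0` has a linear change of coordinates that normalizes `C₂`. -/
theorem exists_pull_normal (a : Sys) (h : C2 a ≠ 0) : ∃ g : AffTransf, g.b = 0 ∧
    (C2 (pull g 1 a) = cf 0 1 (-1) 0 ∨ C2 (pull g 1 a) = cf 1 0 1 0 ∨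
      C2 (pull g 1 a) = cf 0 1 0 0 ∨ C2 (pull g 1 a) = cf 1 0 0 0) := by
  have h' := h
  rw [C2_eq_cf] at h
  rcases cubic_normal _ _ _ _ h with ⟨g, hb, hg⟩ | ⟨g, hb, hg⟩ | ⟨g, hb, hg⟩ | ⟨g, hb, hg⟩ <;>
    refine ⟨g, hb, ?_⟩ <;> rw [C2_pull, C2_eq_cf, hg] <;> simp

theorem C2_coef {a : Sys} {t u v w : ℝ} (h : C2 a = cf t u v w) :
    a 9 = -t ∧ a 3 = 2 * a 10 + u ∧ a 11 = 2 * a 4 - v ∧ a 5 = w := by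
  rw [C2_eq_cf, cf_inj] at h
  obtain ⟨h1, h2, h3, h4⟩ := h
  exact ⟨by linarith, by linarith, by linarith, h4⟩

/-! ### Translations -/

theorem N1_eq (a : Sys) {t u v w : ℝ} (h : C2 a = cf t u v w) : N1 a =
    qf (-a 7) (a 1 - a 8) (a 2) * qf (24 * t * v - 8 * u ^ 2) (72 * t * w - 8 * u * v) (24 * u * w - 8 * v ^ 2)
      - 2 * cf t u v w * lf (4 * (-a 7) * v - 4 * (a 1 - a 8) * u + 12 * a 2 * t)
        (12 * (-a 7) * w - 4 * (a 1 - a 8) * v + 4 * a 2 * u) := by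
  rw [N1, h, C1_eq_qf, transv_cf_cf_two, transv_qf_cf_two]
  congr 2
  rw [qf_inj]
  refine ⟨?_, ?_, ?_⟩ <;> ring

theorem N2_eq (a : Sys) {t u v w : ℝ} (h : C2 a = cf t u v w) : N2 a =
    C (a 1 + a 8) * lf (4 * (-a 7) * v - 4 * (a 1 - a 8) * u + 12 * a 2 * t)
        (12 * (-a 7) * w - 4 * (a 1 - a 8) * v + 4 * a 2 * u)
      - lf (2 * (24 * t * v - 8 * u ^ 2) * a 0 + (72 * t * w - 8 * u * v) * a 6)
          ((72 * t * w - 8 * u * v) * a 0 + 2 * (24 * u * w - 8 * v ^ 2) * a 6) := by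
  rw [N2, h, C1_eq_qf, transv_cf_cf_two, transv_qf_cf_two, C0_eq_lf, transv_qf_lf_one, D1_eq]
  congr 1
  rw [lf_inj]
  refine ⟨?_, ?_⟩ <;> ring

theorem N3_eq (a : Sys) {t u v w : ℝ} (h : C2 a = cf t u v w) : N3 a =
    cf (3 * t * (a 1 - a 8) + 2 * u * a 7) (6 * t * a 2 + u * (a 1 - a 8) + 4 * v * a 7)
      (4 * u * a 2 - v * (a 1 - a 8) + 6 * w * a 7) (2 * v * a 2 - 3 * w * (a 1 - a 8)) := by
  rw [N3, h, C1_eq_qf, transv_cf_qf_one, cf_inj]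
  refine ⟨?_, ?_, ?_, ?_⟩ <;> ring

theorem N4_eq (a : Sys) {t u v w : ℝ} (h : C2 a = cf t u v w) : N4 a =
    qf (4 * (3 * t * a 0 + u * a 6) + 3 * a 7 * (a 1 + a 8))
      (4 * (2 * u * a 0 + 2 * v * a 6) - 3 * (a 1 - a 8) * (a 1 + a 8))
      (4 * (v * a 0 + 3 * w * a 6) - 3 * a 2 * (a 1 + a 8)) := by
  rw [N4, h, C1_eq_qf, D1_eq, C0_eq_lf, transv_cf_lf_one, show (4 : Poly) = C 4 from (map_ofNat C 4).symm,
    show (3 : Poly) = C 3 from (map_ofNat C 3).symm, mul_right_comm (C 3), ← C_mul, C_mul_qf, C_mul_qf,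
    qf_sub, qf_inj]
  refine ⟨?_, ?_, ?_⟩ <;> ring

theorem linSubst_one {g : AffTransf} (hM : g.M = 1) (f : Poly) : linSubst g f = f := by
  refine MvPolynomial.funext fun z => ?_
  rw [eval_linSubst, hM, Matrix.one_mulVec]

theorem C2_pull_translation {g : AffTransf} (hM : g.M = 1) (a : Sys) : C2 (pull g 1 a) = C2 a := by
  rw [C2_pull, linSubst_one hM, C_1, one_mul]

/-- The coefficients after a translation. -/
theorem pull_transl_coef (b : Fin 2 → ℝ) (a : Sys) : pull (transl b) 1 a =
    ![a 0 + a 1 * b 0 + a 2 * b 1 + a 3 * b 0 ^ 2 + 2 * a 4 * b 0 * b 1 + a 5 * b 1 ^ 2,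
      a 1 + 2 * a 3 * b 0 + 2 * a 4 * b 1, a 2 + 2 * a 4 * b 0 + 2 * a 5 * b 1, a 3, a 4, a 5,
      a 6 + a 7 * b 0 + a 8 * b 1 + a 9 * b 0 ^ 2 + 2 * a 10 * b 0 * b 1 + a 11 * b 1 ^ 2,
      a 7 + 2 * a 9 * b 0 + 2 * a 10 * b 1, a 8 + 2 * a 10 * b 0 + 2 * a 11 * b 1, a 9, a 10, a 11] := by
  ext i
  fin_cases i <;> simp [pull, quadComp, transl]

/-- A comitant that does not change under translations of systems in normal form does not change under
translations at all. -/
theorem translation_invariant_of_normal {U : Sys → Poly} {V : Set Sys} {k j : ℕ}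
    (hU : ∀ {g : AffTransf}, g.b = 0 → ∀ s a, U (pull g s a) = C (s ^ k * g.M.det ^ j) * linSubst g (U a))
    (hV : ∀ g a, a ∈ V → pull g 1 a ∈ V)
    (h0 : ∀ a ∈ V, C2 a = 0 → ∀ b, U (pull (transl b) 1 a) = U a)
    (h1 : ∀ a ∈ V, C2 a = cf 0 1 (-1) 0 ∨ C2 a = cf 1 0 1 0 ∨ C2 a = cf 0 1 0 0 ∨ C2 a = cf 1 0 0 0 →
      ∀ b, U (pull (transl b) 1 a) = U a) (a : Sys) (ha : a ∈ V) (b : Fin 2 → ℝ) :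
    U (pull (transl b) 1 a) = U a := by
  by_cases hC : C2 a = 0
  · exact h0 a ha hC b
  · obtain ⟨g, hb, hg⟩ := exists_pull_normal a hC
    have e1 := hU hb 1 (pull (transl b) 1 a)
    rw [pull_translation_linear hb rfl, h1 _ (hV g a ha) hg, hU hb 1 a] at e1
    have hne : (1 : ℝ) ^ k * g.M.det ^ j ≠ 0 := by simpa using fun h => absurd h g.det_ne
    exact (linSubst_injective g (mul_left_cancel₀ (by simpa using fun h => absurd h g.det_ne) e1)).symm

def V1 : Set Sys := {a | eta a = 0 ∧ H a = 0}
def V2 : Set Sys := {a | eta a = 0 ∧ H a = 0 ∧ B3 a = 0}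
def V3 : Set Sys := {a | M a = 0 ∧ N a = 0}
def V4 : Set Sys := {a | M a = 0 ∧ N a = 0 ∧ N3 a = 0}

theorem eta_pull_eq_zero (g : AffTransf) {s : ℝ} (hs : s ≠ 0) (a : Sys) : eta (pull g s a) = 0 ↔ eta a = 0 := by
  have := g.det_ne
  rw [eta_pull, mul_eq_zero, or_iff_right (by positivity)]

theorem H_pull_eq_zero (g : AffTransf) {s : ℝ} (hs : s ≠ 0) (a : Sys) : H (pull g s a) = 0 ↔ H a = 0 := by
  have := g.det_ne
  rw [H_pull, C_mul_linSubst_eq_zero (by positivity)]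
theorem D_pull_eq_zero (g : AffTransf) {s : ℝ} (hs : s ≠ 0) (a : Sys) : D (pull g s a) = 0 ↔ D a = 0 := by
  have := g.det_ne
  rw [D_pull, C_mul_linSubst_eq_zero (by positivity)]
theorem B3_pull_eq_zero (g : AffTransf) {s : ℝ} (hs : s ≠ 0) (a : Sys) : B3 (pull g s a) = 0 ↔ B3 a = 0 := by
  have := g.det_ne
  rw [B3_pull, C_mul_linSubst_eq_zero (by positivity)]
theorem M_pull_eq_zero (g : AffTransf) {s : ℝ} (hs : s ≠ 0) (a : Sys) : M (pull g s a) = 0 ↔ M a = 0 := by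
  have := g.det_ne
  rw [M_pull, C_mul_linSubst_eq_zero (by positivity)]
theorem N_pull_eq_zero (g : AffTransf) {s : ℝ} (hs : s ≠ 0) (a : Sys) : N (pull g s a) = 0 ↔ N a = 0 := by
  have := g.det_ne
  rw [N_pull, C_mul_linSubst_eq_zero (by positivity)]

theorem mem_V1_pull (g : AffTransf) {s : ℝ} (hs : s ≠ 0) (a : Sys) : pull g s a ∈ V1 ↔ a ∈ V1 := by
  simp only [V1, Set.mem_ofPred_eq, eta_pull_eq_zero g hs, H_pull_eq_zero g hs]
theorem mem_V2_pull (g : AffTransf) {s : ℝ} (hs : s ≠ 0) (a : Sys) : pull g s a ∈ V2 ↔ a ∈ V2 := by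
  simp only [V2, Set.mem_ofPred_eq, eta_pull_eq_zero g hs, H_pull_eq_zero g hs, B3_pull_eq_zero g hs]
theorem mem_V3_pull (g : AffTransf) {s : ℝ} (hs : s ≠ 0) (a : Sys) : pull g s a ∈ V3 ↔ a ∈ V3 := by
  simp only [V3, Set.mem_ofPred_eq, M_pull_eq_zero g hs, N_pull_eq_zero g hs]

theorem normal_of_mem_V1 {a : Sys} (ha : a ∈ V1)
    (h : C2 a = cf 0 1 (-1) 0 ∨ C2 a = cf 1 0 1 0 ∨ C2 a = cf 0 1 0 0 ∨ C2 a = cf 1 0 0 0) :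
    (C2 a = cf 0 1 0 0 ∧ a 9 = 0 ∧ a 10 = 0 ∧ a 3 = 1 ∧ a 4 = 0 ∧ a 11 = 0 ∧ a 5 = 0) ∨
    (C2 a = cf 1 0 0 0 ∧ a 9 = -1 ∧ a 10 = 0 ∧ a 3 = 0 ∧ a 4 = 0 ∧ a 11 = 0 ∧ a 5 = 0) := by
  obtain ⟨he, hH⟩ := ha
  rcases h with h | h | h | h
  · rw [eta_of_C2 h] at he; norm_num at he
  · rw [eta_of_C2 h] at he; norm_num at he
  all_goals
    obtain ⟨h1, h2, h3, h4⟩ := C2_coef h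
    rw [H_eq_qf, qf_eq_zero, h1, h2, h3, h4] at hH
    obtain ⟨e1, e2, e3⟩ := hH
  · have e4 : a 4 = 0 := by nlinarith
    have e5 : a 10 = 0 := by nlinarith
    refine Or.inl ⟨h, ?_, e5, ?_, e4, ?_, ?_⟩ <;> linarith
  · have e4 : a 4 = 0 := by nlinarith
    rw [e4] at e1 e2
    have e5 : a 10 = 0 := by nlinarith
    refine Or.inr ⟨h, ?_, e5, ?_, e4, ?_, ?_⟩ <;> linarith

theorem N1_transl (a : Sys) (ha : a ∈ V1) (b : Fin 2 → ℝ) : N1 (pull (transl b) 1 a) = N1 a := by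
  refine translation_invariant_of_normal (V := V1) N1_pull_linear
    (fun g a h => (mem_V1_pull g one_ne_zero a).2 h) ?_ ?_ a ha b
  · intro a ha hC b
    rw [zero_eq_cf] at hC
    rw [N1_eq a hC, N1_eq _ ((C2_pull_translation rfl a).trans hC)]
    simp [← zero_eq_cf, ← zero_eq_qf]
  · intro a ha hC b
    rcases normal_of_mem_V1 ha hC with ⟨h, h9, h10, h3, h4, h11, h5⟩ | ⟨h, h9, h10, h3, h4, h11, h5⟩ <;>
    · rw [N1_eq a h, N1_eq _ ((C2_pull_translation rfl a).trans h)]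
      refine MvPolynomial.funext fun z => ?_
      simp only [map_sub, map_mul, map_ofNat, eval_qf, eval_lf, eval_cf, pull_transl_coef, h9, h10, h3, h4, h11, h5,
        Matrix.cons_val]
      ring

theorem N2_transl (a : Sys) (ha : a ∈ V2) (b : Fin 2 → ℝ) : N2 (pull (transl b) 1 a) = N2 a := by
  refine translation_invariant_of_normal (V := V2) N2_pull_linear
    (fun g a h => (mem_V2_pull g one_ne_zero a).2 h) ?_ ?_ a ha b
  · intro a ha hC b
    rw [zero_eq_cf] at hC
    rw [N2_eq a hC, N2_eq _ ((C2_pull_translation rfl a).trans hC)]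
    simp [← zero_eq_lf]
  · intro a ha hC b
    have hB := ha.2.2
    rw [B3, D_eq_cf] at hB
    rcases normal_of_mem_V1 ⟨ha.1, ha.2.1⟩ hC with
      ⟨h, h9, h10, h3, h4, h11, h5⟩ | ⟨h, h9, h10, h3, h4, h11, h5⟩ <;>
    · rw [h, transv_cf_cf_one, rf_eq_zero] at hB
      simp [dcoef, h9, h10, h3, h4, h11, h5] at hB
      rw [N2_eq a h, N2_eq _ ((C2_pull_translation rfl a).trans h)]
      refine MvPolynomial.funext fun z => ?_
      simp only [map_sub, map_mul, map_ofNat, eval_qf, eval_lf, eval_cf, pull_transl_coef, h9, h10, h3, h4, h11, h5,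
        Matrix.cons_val, eval_C, hB]
      ring

theorem normal_of_mem_V3 {a : Sys} (ha : a ∈ V3)
    (h : C2 a = cf 0 1 (-1) 0 ∨ C2 a = cf 1 0 1 0 ∨ C2 a = cf 0 1 0 0 ∨ C2 a = cf 1 0 0 0) :
    C2 a = cf 1 0 0 0 ∧ a 9 = -1 ∧ a 10 = 0 ∧ a 3 = 0 ∧ a 4 = 0 ∧ a 11 = 0 ∧ a 5 = 0 := by
  obtain ⟨he, hH⟩ := ha
  rw [M, hess_eq_transv] at he
  rcases h with h | h | h | h
  · rw [h, transv_cf_cf_two, qf_eq_zero] at he; norm_num at he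
  · rw [h, transv_cf_cf_two, qf_eq_zero] at he; norm_num at he
  · rw [h, transv_cf_cf_two, qf_eq_zero] at he; norm_num at he
  obtain ⟨h1, h2, h3, h4⟩ := C2_coef h
  rw [N_eq_qf, qf_eq_zero, h1, h2, h3, h4] at hH
  obtain ⟨e1, e2, e3⟩ := hH
  have e4 : a 4 = 0 := by nlinarith
  rw [e4] at e1 e2
  have e5 : a 10 = 0 := by nlinarith
  refine ⟨h, ?_, e5, ?_, e4, ?_, ?_⟩ <;> linarith

theorem quadratic_part_eq_zero {a : Sys} (ha : a ∈ V3) (h : C2 a = 0) :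
    a 3 = 0 ∧ a 4 = 0 ∧ a 5 = 0 ∧ a 9 = 0 ∧ a 10 = 0 ∧ a 11 = 0 := by
  rw [zero_eq_cf] at h
  obtain ⟨h1, h2, h3, h4⟩ := C2_coef h
  have hN := ha.2
  rw [N_eq_qf, qf_eq_zero, h1, h2, h3, h4] at hN
  obtain ⟨e1, e2, e3⟩ := hN
  have e4 : a 4 = 0 := by nlinarith
  have e5 : a 10 = 0 := by nlinarith
  refine ⟨?_, e4, ?_, ?_, e5, ?_⟩ <;> linarith

theorem pull_transl_of_linear {a : Sys} (h : a 3 = 0 ∧ a 4 = 0 ∧ a 5 = 0 ∧ a 9 = 0 ∧ a 10 = 0 ∧ a 11 = 0)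
    (b : Fin 2 → ℝ) : ∃ c d, pull (transl b) 1 a = ![c, a 1, a 2, 0, 0, 0, d, a 7, a 8, 0, 0, 0] := by
  obtain ⟨h3, h4, h5, h9, h10, h11⟩ := h
  refine ⟨a 0 + a 1 * b 0 + a 2 * b 1, a 6 + a 7 * b 0 + a 8 * b 1, ?_⟩
  rw [pull_transl_coef, h3, h4, h5, h9, h10, h11]
  simp only [mul_zero, zero_mul, add_zero]

theorem N3_transl (a : Sys) (ha : a ∈ V3) (b : Fin 2 → ℝ) : N3 (pull (transl b) 1 a) = N3 a := by
  refine translation_invariant_of_normal (V := V3) (k := 2) (j := 1) (by simpa using @N3_pull_linear)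
    (fun g a h => (mem_V3_pull g one_ne_zero a).2 h) ?_ ?_ a ha b
  · intro a ha hC b
    rw [zero_eq_cf] at hC
    rw [N3_eq a hC, N3_eq _ ((C2_pull_translation rfl a).trans hC), cf_inj]
    simp
  · intro a ha hC b
    obtain ⟨h, h9, h10, h3, h4, h11, h5⟩ := normal_of_mem_V3 ha hC
    rw [N3_eq a h, N3_eq _ ((C2_pull_translation rfl a).trans h), cf_inj]
    simp only [pull_transl_coef, h9, h10, h3, h4, h11, h5, Matrix.cons_val]
    refine ⟨?_, ?_, ?_, ?_⟩ <;> ring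

theorem N1_pull (g : AffTransf) (s : ℝ) {a : Sys} (ha : a ∈ V1) :
    N1 (pull g s a) = C (s ^ 3 * g.M.det ^ 2) * linSubst g (N1 a) := by
  rw [pull_eq_linPart, N1_pull_linear rfl, N1_transl a ha]; rfl
theorem N2_pull (g : AffTransf) (s : ℝ) {a : Sys} (ha : a ∈ V2) :
    N2 (pull g s a) = C (s ^ 3 * g.M.det ^ 3) * linSubst g (N2 a) := by
  rw [pull_eq_linPart, N2_pull_linear rfl, N2_transl a ha]; rfl
theorem N3_pull (g : AffTransf) (s : ℝ) {a : Sys} (ha : a ∈ V3) :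
    N3 (pull g s a) = C (s ^ 2 * g.M.det) * linSubst g (N3 a) := by
  rw [pull_eq_linPart, N3_pull_linear rfl, N3_transl a ha]; rfl
theorem H2_pull (g : AffTransf) (s : ℝ) (a : Sys) :
    H2 (pull g s a) = C (s ^ 3 * g.M.det ^ 3) * linSubst g (H2 a) := by
  rw [pull_eq_linPart, H2_pull_linear rfl, H2_pull_translation rfl]; rfl

theorem mem_V4_pull (g : AffTransf) {s : ℝ} (hs : s ≠ 0) (a : Sys) : pull g s a ∈ V4 ↔ a ∈ V4 := by
  have hV : ∀ a, a ∈ V4 ↔ a ∈ V3 ∧ N3 a = 0 := fun a => by simp [V3, V4, and_assoc]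
  have := g.det_ne
  rw [hV, hV, mem_V3_pull g hs]
  refine and_congr_right fun ha => ?_
  rw [N3_pull g s ha, C_mul_linSubst_eq_zero (by positivity)]

theorem N4_transl (a : Sys) (ha : a ∈ V4) (b : Fin 2 → ℝ) : N4 (pull (transl b) 1 a) = N4 a := by
  refine translation_invariant_of_normal (V := V4) (k := 2) (j := 1)
    (by simpa using @N4_pull_linear) (fun g a h => (mem_V4_pull g one_ne_zero a).2 h) ?_ ?_ a ha b
  · intro a ha hC b
    obtain ⟨c, d, e⟩ := pull_transl_of_linear (quadratic_part_eq_zero ⟨ha.1, ha.2.1⟩ hC) b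
    rw [zero_eq_cf] at hC
    rw [N4_eq a hC, N4_eq _ ((C2_pull_translation rfl a).trans hC), qf_inj, e]
    simp
  · intro a ha hC b
    obtain ⟨h, h9, h10, h3, h4, h11, h5⟩ := normal_of_mem_V3 ⟨ha.1, ha.2.1⟩ hC
    have hN := ha.2.2
    rw [N3_eq a h, cf_eq_zero] at hN
    obtain ⟨e1, e2, -, -⟩ := hN
    have e3 : a 8 = a 1 := by linarith
    have e4 : a 2 = 0 := by linarith
    rw [N4_eq a h, N4_eq _ ((C2_pull_translation rfl a).trans h), qf_inj]
    simp only [pull_transl_coef, h9, h10, h3, h4, h11, h5, e3, e4, Matrix.cons_val]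
    refine ⟨?_, ?_, ?_⟩ <;> ring

theorem N4_pull (g : AffTransf) (s : ℝ) {a : Sys} (ha : a ∈ V4) :
    N4 (pull g s a) = C (s ^ 2 * g.M.det) * linSubst g (N4 a) := by
  rw [pull_eq_linPart, N4_pull_linear rfl, N4_transl a ha]; rfl

/-! ### Invariance of the conditions; the comitants -/

theorem orbitCond_pull (i : Fin 11) (g : AffTransf) {s : ℝ} (hs : s ≠ 0) (a : Sys) :
    OrbitCond i (pull g s a) ↔ OrbitCond i a := by
  have hd := g.det_ne
  have he : ∀ x : ℝ, 0 < s ^ 4 * g.M.det ^ 6 * x ↔ 0 < x := fun x =>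
    mul_pos_iff_of_pos_left (by positivity)
  have he' : ∀ x : ℝ, s ^ 4 * g.M.det ^ 6 * x < 0 ↔ x < 0 := fun x => by
    have hp : 0 < s ^ 4 * g.M.det ^ 6 := by positivity
    simp [mul_neg_iff, hp, hp.not_gt]
  have hpos : 0 < s ^ 6 * g.M.det ^ 8 := by positivity
  have hpos3 : 0 < s ^ 4 * g.M.det ^ 4 := by positivity
  have h32 : s ^ 3 * g.M.det ^ 2 ≠ 0 := by positivity
  have h33 : s ^ 3 * g.M.det ^ 3 ≠ 0 := by positivity
  have h21 : s ^ 2 * g.M.det ≠ 0 := by positivity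
  unfold OrbitCond
  rw [B3_pull_eq_zero g hs, N_pull_eq_zero g hs]
  refine and_congr_right fun hB => and_congr_right fun hN => ?_
  have row7 : (eta a = 0 → H a = 0 → (N1 (pull g s a) = 0 ↔ N1 a = 0) ∧ (N2 (pull g s a) = 0 ↔ N2 a = 0)) := by
    intro h1 h2
    rw [N1_pull g s ⟨h1, h2⟩, N2_pull g s ⟨h1, h2, hB⟩, C_mul_linSubst_eq_zero h32, C_mul_linSubst_eq_zero h33]
    exact ⟨Iff.rfl, Iff.rfl⟩
  have row11 : M a = 0 → (N3 (pull g s a) = 0 ∧ N4 (pull g s a) = 0 ↔ N3 a = 0 ∧ N4 a = 0) := by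
    intro h1
    rw [N3_pull g s ⟨h1, hN⟩, C_mul_linSubst_eq_zero h21]
    refine and_congr_right fun h2 => ?_
    rw [N4_pull g s ⟨h1, hN, h2⟩, C_mul_linSubst_eq_zero h21]
  fin_cases i <;> simp only [rowCond, Fin.zero_eta, Fin.mk_one, Fin.reduceFinMk, Matrix.cons_val,
    Matrix.cons_val_zero, Matrix.cons_val_one]
  · rw [eta_pull, he, H1_pull, formPos_linSubst hpos]
  · rw [eta_pull, he, H1_pull, formNeg_linSubst hpos]
  · rw [eta_pull, he', H1_pull, formNeg_linSubst hpos]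
  · rw [eta_pull, he', H1_pull, formPos_linSubst hpos]
  · rw [eta_pull, he, H1_pull, C_mul_linSubst_eq_zero hpos.ne']
  · rw [eta_pull, he', H1_pull, C_mul_linSubst_eq_zero hpos.ne']
  · rw [mul_ne_zero_iff, mul_ne_zero_iff, Ne, Ne, M_pull_eq_zero g hs, D_pull_eq_zero g hs, eta_pull_eq_zero g hs,
      H_pull_eq_zero g hs]
    refine and_congr_right fun _ => and_congr_right fun h1 => and_congr_right fun h2 => ?_
    rw [(row7 h1 h2).1, (row7 h1 h2).2]
  · rw [mul_ne_zero_iff, mul_ne_zero_iff, Ne, Ne, M_pull_eq_zero g hs, H_pull_eq_zero g hs, eta_pull_eq_zero g hs,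
      H2_pull, H3_pull, C_mul_linSubst_eq_zero h33, formPos_linSubst hpos3]
  · rw [mul_ne_zero_iff, mul_ne_zero_iff, Ne, Ne, M_pull_eq_zero g hs, H_pull_eq_zero g hs, eta_pull_eq_zero g hs,
      H2_pull, H3_pull, C_mul_linSubst_eq_zero h33, formNeg_linSubst hpos3]
  · rw [Ne, M_pull_eq_zero g hs, D_pull_eq_zero g hs, eta_pull_eq_zero g hs, H_pull_eq_zero g hs]
    refine and_congr_right fun _ => and_congr_right fun h1 => and_congr_right fun h2 => and_congr_right fun _ => ?_
    rw [(row7 h1 h2).1, (row7 h1 h2).2]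
  · rw [M_pull_eq_zero g hs, eta_pull_eq_zero g hs]
    exact and_congr_right fun _ => and_congr_right fun h1 => row11 h1

theorem orbitCond_transforms (i : Fin 11) (g : AffTransf) (r : ℝ) (a a' : Sys) (hr : r ≠ 0)
    (h : Transforms g r a a') : OrbitCond i a ↔ OrbitCond i a' := by
  rw [h.eq_pull hr]
  have := g.det_ne
  exact orbitCond_pull i g (by positivity) a'

theorem isGLComitant_of_pull {U : Sys → Poly} (k j : ℕ)
    (h : ∀ {g : AffTransf}, g.b = 0 → ∀ s a, U (pull g s a) = C (s ^ k * g.M.det ^ j) * linSubst g (U a)) :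
    IsGLComitant U := by
  refine ⟨(j : ℤ) - k, fun g a a' hb ht z => ?_⟩
  have hd := g.det_ne
  rw [ht.eq_pull one_ne_zero, h hb, map_mul, eval_C, eval_linSubst, AffTransf.apply, hb, add_zero, ← mul_assoc,
    one_mul, neg_sub, zpow_sub₀ hd, zpow_natCast, zpow_natCast, one_div, inv_pow]
  field_simp

theorem isCTComitant_of_pull {U : Sys → Poly} {V : Set Sys} (k j : ℕ)
    (h : ∀ {g : AffTransf}, g.b = 0 → ∀ s a, U (pull g s a) = C (s ^ k * g.M.det ^ j) * linSubst g (U a))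
    (hV : ∀ (g : AffTransf) {s : ℝ}, s ≠ 0 → ∀ a, pull g s a ∈ V ↔ a ∈ V)
    (ht : ∀ a ∈ V, ∀ b, U (pull (transl b) 1 a) = U a) : IsCTComitant U V := by
  refine ⟨isGLComitant_of_pull k j h, fun g a a' hg ha => ?_, fun g a a' hM hg ha => ?_⟩
  · rw [hg.eq_pull one_ne_zero] at ha
    have := g.det_ne
    exact (hV g (by positivity) a').1 ha
  · rw [hg.eq_pull one_ne_zero] at ha ⊢
    have hg' : g = transl g.b := by cases g; simp only [transl] at *; subst hM; rfl
    rw [hM, Matrix.det_one] at ha ⊢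
    rw [hg', one_mul, div_one] at ha ⊢
    rw [ht a' ((hV _ one_ne_zero a').1 ha)]

theorem comitants : IsCTComitant H1 Set.univ ∧ IsCTComitant H2 Set.univ ∧ IsCTComitant H3 Set.univ ∧
      IsCTComitant N1 {a | eta a = 0 ∧ H a = 0} ∧
      IsCTComitant N2 {a | eta a = 0 ∧ H a = 0 ∧ B3 a = 0} ∧
      IsCTComitant N3 {a | M a = 0 ∧ N a = 0} ∧
      IsCTComitant N4 {a | M a = 0 ∧ N a = 0 ∧ N3 a = 0} := by
  refine ⟨isCTComitant_of_pull 6 8 (fun _ => H1_pull _) (by simp) fun a _ b => ?_,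
    isCTComitant_of_pull 3 3 (fun _ => H2_pull _) (by simp) fun a _ b => H2_pull_translation rfl a,
    isCTComitant_of_pull 4 4 (fun _ => H3_pull _) (by simp) fun a _ b => ?_,
    isCTComitant_of_pull 3 2 N1_pull_linear mem_V1_pull N1_transl,
    isCTComitant_of_pull 3 3 N2_pull_linear mem_V2_pull N2_transl,
    isCTComitant_of_pull 2 1 (by simpa using @N3_pull_linear) mem_V3_pull N3_transl,
    isCTComitant_of_pull 2 1 (by simpa using @N4_pull_linear) mem_V4_pull N4_transl⟩
  · rw [H1_pull, linSubst_one rfl]; simp [transl]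
  · rw [H3_pull, linSubst_one rfl]; simp [transl]

/-! ### Transport of the class `QS` -/

theorem lf_isHomogeneous (u v : ℝ) : (lf u v).IsHomogeneous 1 :=
  ((isHomogeneous_C _ u).mul (isHomogeneous_X _ 0)).add ((isHomogeneous_C _ v).mul (isHomogeneous_X _ 1))

theorem qf_isHomogeneous (u v w : ℝ) : (qf u v w).IsHomogeneous 2 := by
  have h1 := (isHomogeneous_C (Fin 2) u).mul ((isHomogeneous_X ℝ (0 : Fin 2)).pow 2)
  have h2 := (isHomogeneous_C (Fin 2) v).mul ((isHomogeneous_X ℝ (0 : Fin 2)).mul (isHomogeneous_X ℝ 1))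
  have h3 := (isHomogeneous_C (Fin 2) w).mul ((isHomogeneous_X ℝ (1 : Fin 2)).pow 2)
  exact (h1.add h2).add h3

theorem totalDegree_quadratic (c u v u' v' w' : ℝ) : (C c + lf u v + qf u' v' w' : Poly).totalDegree ≤ 2 ∧
    ((C c + lf u v + qf u' v' w' : Poly).totalDegree = 2 ↔ ¬ (u' = 0 ∧ v' = 0 ∧ w' = 0)) := by
  have h1 : (C c + lf u v : Poly).totalDegree ≤ 1 :=
    (totalDegree_add _ _).trans (max_le ((totalDegree_C _).trans_le zero_le_one)
      (lf_isHomogeneous u v).totalDegree_le)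
  have h2 : (C c + lf u v + qf u' v' w' : Poly).totalDegree ≤ 2 :=
    (totalDegree_add _ _).trans (max_le (h1.trans one_le_two) (qf_isHomogeneous u' v' w').totalDegree_le)
  refine ⟨h2, ?_⟩
  rw [← qf_eq_zero]
  constructor
  · intro h h0
    rw [h0, add_zero] at h
    omega
  · intro h
    have h3 := (qf_isHomogeneous u' v' w').totalDegree h
    rw [totalDegree_add_eq_right_of_totalDegree_lt, h3]
    omega

theorem p_eq_qf (a : Sys) : p a = C (a 0) + lf (a 1) (a 2) + qf (a 3) (2 * a 4) (a 5) := by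
  rw [← p2_eq_qf]; rfl

theorem q_eq_qf (a : Sys) : q a = C (a 6) + lf (a 7) (a 8) + qf (a 9) (2 * a 10) (a 11) := by
  rw [← q2_eq_qf]; rfl

theorem max_eq_two_iff {m n : ℕ} (hm : m ≤ 2) (hn : n ≤ 2) : max m n = 2 ↔ m = 2 ∨ n = 2 := by omega

theorem isQuadratic_iff (a : Sys) :
    IsQuadratic a ↔ ¬ (a 3 = 0 ∧ a 4 = 0 ∧ a 5 = 0 ∧ a 9 = 0 ∧ a 10 = 0 ∧ a 11 = 0) := by
  obtain ⟨h1, h2⟩ := totalDegree_quadratic (a 0) (a 1) (a 2) (a 3) (2 * a 4) (a 5)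
  obtain ⟨h3, h4⟩ := totalDegree_quadratic (a 6) (a 7) (a 8) (a 9) (2 * a 10) (a 11)
  have e : ∀ x : ℝ, 2 * x = 0 ↔ x = 0 := fun x => by simp
  rw [e] at h2 h4
  rw [IsQuadratic, p_eq_qf, q_eq_qf, max_eq_two_iff h1 h3, h2, h4, ← not_and_or]
  exact not_congr ⟨fun h => ⟨h.1.1, h.1.2.1, h.1.2.2, h.2.1, h.2.2.1, h.2.2.2⟩,
    fun h => ⟨⟨h.1, h.2.1, h.2.2.1⟩, h.2.2.2.1, h.2.2.2.2.1, h.2.2.2.2.2⟩⟩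

theorem affSubst_inv (g : AffTransf) (f : Poly) : affSubst g (affSubst g.inv f) = f := by
  refine MvPolynomial.funext fun z => ?_
  rw [eval_affSubst, eval_affSubst, g.inv_apply_apply]

theorem affSubst_inv' (g : AffTransf) (f : Poly) : affSubst g.inv (affSubst g f) = f := by
  refine MvPolynomial.funext fun z => ?_
  rw [eval_affSubst, eval_affSubst, g.apply_inv_apply]

theorem p_pull (g : AffTransf) (s : ℝ) (a : Sys) : p (pull g s a)
    = C (s * g.M 1 1) * affSubst g (p a) - C (s * g.M 0 1) * affSubst g (q a) := by
  refine MvPolynomial.funext fun z => ?_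
  have := congrFun (field_pull g s a z) 0
  simp only [field, Matrix.cons_val_zero] at this
  rw [this]
  simp [Matrix.adjugate_fin_two, Matrix.mulVec, dotProduct, eval_affSubst]
  ring

theorem q_pull (g : AffTransf) (s : ℝ) (a : Sys) : q (pull g s a)
    = C (s * g.M 0 0) * affSubst g (q a) - C (s * g.M 1 0) * affSubst g (p a) := by
  refine MvPolynomial.funext fun z => ?_
  have := congrFun (field_pull g s a z) 1
  simp only [field, Matrix.cons_val_one] at this
  simp only [Matrix.cons_val_zero] at this
  rw [this]
  simp [Matrix.adjugate_fin_two, Matrix.mulVec, dotProduct, eval_affSubst]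
  ring

theorem IsQuadratic.pull {a : Sys} (h : IsQuadratic a) (g : AffTransf) {s : ℝ} (hs : s ≠ 0) :
    IsQuadratic (pull g s a) := by
  have hd := g.det_ne
  rw [isQuadratic_iff]
  intro h0
  obtain ⟨h3, h4, h5, h9, h10, h11⟩ := h0
  have e1 : p2 (QuadSL.pull g s a) = 0 := by rw [p2_eq_qf, h3, h4, h5]; simp [qf]
  have e2 : q2 (QuadSL.pull g s a) = 0 := by rw [q2_eq_qf, h9, h10, h11]; simp [qf]
  have e3 : C (s * g.M.det) * linSubst g (p2 a) = 0 := by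
    have : C (g.M 0 0) * p2 (QuadSL.pull g s a) + C (g.M 0 1) * q2 (QuadSL.pull g s a) = 0 := by
      rw [e1, e2]; simp
    rw [← this, p2_pull, q2_pull, Matrix.det_fin_two]; simp only [map_mul, map_sub]; ring
  have e4 : C (s * g.M.det) * linSubst g (q2 a) = 0 := by
    have : C (g.M 1 0) * p2 (QuadSL.pull g s a) + C (g.M 1 1) * q2 (QuadSL.pull g s a) = 0 := by
      rw [e1, e2]; simp
    rw [← this, p2_pull, q2_pull, Matrix.det_fin_two]; simp only [map_mul, map_sub]; ring
  rw [C_mul_linSubst_eq_zero (mul_ne_zero hs hd), p2_eq_qf, qf_eq_zero] at e3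
  rw [C_mul_linSubst_eq_zero (mul_ne_zero hs hd), q2_eq_qf, qf_eq_zero] at e4
  refine (isQuadratic_iff a).1 h ⟨e3.1, ?_, e3.2.2, e4.1, ?_, e4.2.2⟩ <;> linarith [e3.2.1, e4.2.1]

theorem IsQS.pull {a : Sys} (h : IsQS a) (g : AffTransf) {s : ℝ} (hs : s ≠ 0) : IsQS (pull g s a) := by
  have hd := g.det_ne
  refine ⟨?_, h.2.pull g hs⟩
  · intro d hp hq
    have e1 : C (g.M 0 0) * p (QuadSL.pull g s a) + C (g.M 0 1) * q (QuadSL.pull g s a)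
        = C (s * g.M.det) * affSubst g (p a) := by
      rw [p_pull, q_pull, Matrix.det_fin_two]; simp only [map_mul, map_sub]; ring
    have e2 : C (g.M 1 0) * p (QuadSL.pull g s a) + C (g.M 1 1) * q (QuadSL.pull g s a)
        = C (s * g.M.det) * affSubst g (q a) := by
      rw [p_pull, q_pull, Matrix.det_fin_two]; simp only [map_mul, map_sub]; ring
    have hu : IsUnit (C (s * g.M.det) : Poly) := (mul_ne_zero hs hd).isUnit.map C
    have h1 : d ∣ affSubst g (p a) := by
      rw [← hu.dvd_mul_left, ← e1]; exact dvd_add (hp.mul_left _) (hq.mul_left _)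
    have h2 : d ∣ affSubst g (q a) := by
      rw [← hu.dvd_mul_left, ← e2]; exact dvd_add (hp.mul_left _) (hq.mul_left _)
    have h3 := map_dvd (affSubst g.inv) h1
    have h4 := map_dvd (affSubst g.inv) h2
    rw [affSubst_inv'] at h3 h4
    have h5 := (h.1 h3 h4).map (affSubst g)
    rwa [affSubst_inv] at h5

/-! ### Orbits of the representatives -/

theorem eta_eq (a : Sys) : eta a = (a 3 - 2 * a 10) ^ 2 * (2 * a 4 - a 11) ^ 2 + 4 * a 9 * (2 * a 4 - a 11) ^ 3
    - 4 * (a 3 - 2 * a 10) ^ 3 * a 5 - 27 * a 9 ^ 2 * a 5 ^ 2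
    - 18 * a 9 * (a 3 - 2 * a 10) * (2 * a 4 - a 11) * a 5 := by
  rw [eta_of_C2 (C2_eq_cf a)]; ring

theorem B3_eq (a : Sys) {t u v w : ℝ} (h : C2 a = cf t u v w) : B3 a =
    rf (3 * (t * dcoef a 1 - u * dcoef a 0)) (6 * (t * dcoef a 2 - v * dcoef a 0))
      (9 * (t * dcoef a 3 - w * dcoef a 0) + 3 * (u * dcoef a 2 - v * dcoef a 1))
      (6 * (u * dcoef a 3 - w * dcoef a 1)) (3 * (v * dcoef a 3 - w * dcoef a 2)) := by
  rw [B3, h, D_eq_cf, transv_cf_cf_one]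

/-- The value of the constant form `H₁`. -/
def h1coef (a : Sys) (t u v w : ℝ) : ℝ :=
  let A := 24 * t * v - 8 * u ^ 2
  let B := 72 * t * w - 8 * u * v
  let E := 24 * u * w - 8 * v ^ 2
  36 * ((3 * t * B - 2 * u * A) * dcoef a 3 - (2 * v * E - 3 * w * B) * dcoef a 0)
    - 12 * ((6 * t * E + u * B - 4 * v * A) * dcoef a 2 - (4 * u * E - v * B - 6 * w * A) * dcoef a 1)

theorem H1_eq (a : Sys) {t u v w : ℝ} (h : C2 a = cf t u v w) : H1 a = C (h1coef a t u v w) := by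
  rw [H1, h, D_eq_cf, transv_cf_cf_two, transv_qf_cf_one, transv_cf_cf_three, ← C_neg]
  congr 1
  simp only [h1coef]
  ring

theorem H3_eq (a : Sys) {t u v w : ℝ} (h : C2 a = cf t u v w) : H3 a =
    qf (12 * (t * dcoef a 2 + v * dcoef a 0) - 8 * u * dcoef a 1)
      (36 * (t * dcoef a 3 + w * dcoef a 0) - 4 * (u * dcoef a 2 + v * dcoef a 1))
      (12 * (u * dcoef a 3 + w * dcoef a 1) - 8 * v * dcoef a 2) := by
  rw [H3, h, D_eq_cf, transv_cf_cf_two]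

theorem formPos_C (c : ℝ) : FormPos (C c) ↔ 0 < c := by
  simp only [FormPos, eval_C, ne_eq, C_eq_zero]
  exact ⟨fun h => h.2 0 h.1, fun h => ⟨h.ne', fun _ _ => h⟩⟩

theorem formNeg_C (c : ℝ) : FormNeg (C c) ↔ c < 0 := by
  rw [formNeg_iff, ← C_neg, formPos_C, neg_pos]

theorem formPos_sq (c : ℝ) : FormPos (qf c 0 0) ↔ 0 < c := by
  simp only [FormPos, eval_qf, Ne, qf_eq_zero]
  constructor
  · intro h
    simpa using h.2 ![1, 0] (by simpa using h.1)
  · intro h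
    refine ⟨fun h0 => h.ne' h0.1, fun z hz => ?_⟩
    have : z 0 ≠ 0 := by rintro h0; simp [h0] at hz
    have : 0 < z 0 ^ 2 := by positivity
    nlinarith

theorem formNeg_sq (c : ℝ) : FormNeg (qf c 0 0) ↔ c < 0 := by
  rw [formNeg_iff, show -qf c 0 0 = qf (-c) 0 0 by simp [qf], formPos_sq, neg_pos]

theorem orbitCond_rep (i : Fin 11) : OrbitCond i (rep i) := by
  have hB : ∀ i, B3 (rep i) = 0 := fun i => by
    rw [B3_eq _ (C2_eq_cf _), rf_eq_zero]
    fin_cases i <;> simp [rep, dcoef] <;> norm_num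
  have hN : ∀ i, N (rep i) = 0 := fun i => by
    rw [N_eq_qf, qf_eq_zero]
    fin_cases i <;> simp [rep] <;> norm_num
  fin_cases i <;> refine ⟨hB _, hN _, ?_⟩
  · show 0 < eta (rep 0) ∧ FormPos (H1 (rep 0))
    rw [eta_eq, H1_eq _ (C2_eq_cf _)]
    simp only [formPos_C, formNeg_C, C_eq_zero]
    simp [rep, h1coef, dcoef] <;> norm_num
  · show 0 < eta (rep 1) ∧ FormNeg (H1 (rep 1))
    rw [eta_eq, H1_eq _ (C2_eq_cf _)]
    simp only [formPos_C, formNeg_C, C_eq_zero]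
    simp [rep, h1coef, dcoef] <;> norm_num
  · show eta (rep 2) < 0 ∧ FormNeg (H1 (rep 2))
    rw [eta_eq, H1_eq _ (C2_eq_cf _)]
    simp only [formPos_C, formNeg_C, C_eq_zero]
    simp [rep, h1coef, dcoef] <;> norm_num
  · show eta (rep 3) < 0 ∧ FormPos (H1 (rep 3))
    rw [eta_eq, H1_eq _ (C2_eq_cf _)]
    simp only [formPos_C, formNeg_C, C_eq_zero]
    simp [rep, h1coef, dcoef] <;> norm_num
  · show 0 < eta (rep 4) ∧ H1 (rep 4) = 0
    rw [eta_eq, H1_eq _ (C2_eq_cf _)]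
    simp only [formPos_C, formNeg_C, C_eq_zero]
    simp [rep, h1coef, dcoef] <;> norm_num
  · show eta (rep 5) < 0 ∧ H1 (rep 5) = 0
    rw [eta_eq, H1_eq _ (C2_eq_cf _)]
    simp only [formPos_C, formNeg_C, C_eq_zero]
    simp [rep, h1coef, dcoef] <;> norm_num
  · show M (rep 6) * D (rep 6) ≠ 0 ∧ eta (rep 6) = 0 ∧ H (rep 6) = 0 ∧ N1 (rep 6) = 0 ∧ N2 (rep 6) = 0
    refine ⟨?_, ?_, ?_, ?_, ?_⟩
    · rw [M_eq_qf, mul_ne_zero_iff, D_eq_cf, ne_eq, ne_eq, qf_eq_zero, cf_eq_zero]; simp [rep, cubicC2, dcoef] <;> norm_num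
    · rw [eta_eq]; simp [rep] <;> norm_num
    · rw [H_eq_qf, qf_eq_zero]; simp [rep] <;> norm_num
    · rw [N1_eq _ (C2_eq_cf _)]; refine MvPolynomial.funext fun z => ?_; simp [rep, eval_qf, eval_cf, eval_lf]; ring
    · rw [N2_eq _ (C2_eq_cf _)]; refine MvPolynomial.funext fun z => ?_; simp [rep, eval_qf, eval_cf, eval_lf]; ring
  · show M (rep 7) * H (rep 7) ≠ 0 ∧ eta (rep 7) = 0 ∧ H2 (rep 7) = 0 ∧ FormPos (H3 (rep 7))
    refine ⟨?_, ?_, ?_, ?_⟩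
    · rw [M_eq_qf, mul_ne_zero_iff, H_eq_qf, ne_eq, ne_eq, qf_eq_zero, qf_eq_zero]; simp [rep, cubicC2] <;> norm_num
    · rw [eta_eq]; simp [rep] <;> norm_num
    · obtain ⟨u, v, w, e, rfl, rfl, rfl⟩ := H2_eq_qf (rep 7)
      rw [e, qf_eq_zero]; simp [rep] <;> norm_num
    · have : H3 (rep 7) = qf 32 0 0 := by
        rw [H3_eq _ (C2_eq_cf _), qf_inj]; simp [rep, dcoef] <;> norm_num
      rw [this, formPos_sq]; norm_num
  · show M (rep 8) * H (rep 8) ≠ 0 ∧ eta (rep 8) = 0 ∧ H2 (rep 8) = 0 ∧ FormNeg (H3 (rep 8))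
    refine ⟨?_, ?_, ?_, ?_⟩
    · rw [M_eq_qf, mul_ne_zero_iff, H_eq_qf, ne_eq, ne_eq, qf_eq_zero, qf_eq_zero]; simp [rep, cubicC2] <;> norm_num
    · rw [eta_eq]; simp [rep] <;> norm_num
    · obtain ⟨u, v, w, e, rfl, rfl, rfl⟩ := H2_eq_qf (rep 8)
      rw [e, qf_eq_zero]; simp [rep] <;> norm_num
    · have : H3 (rep 8) = qf (-32) 0 0 := by
        rw [H3_eq _ (C2_eq_cf _), qf_inj]; simp [rep, dcoef] <;> norm_num
      rw [this, formNeg_sq]; norm_num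
  · show M (rep 9) ≠ 0 ∧ eta (rep 9) = 0 ∧ H (rep 9) = 0 ∧ D (rep 9) = 0 ∧ N1 (rep 9) = 0 ∧ N2 (rep 9) = 0
    refine ⟨?_, ?_, ?_, ?_, ?_, ?_⟩
    · rw [M_eq_qf, ne_eq, qf_eq_zero]; simp [rep, cubicC2] <;> norm_num
    · rw [eta_eq]; simp [rep] <;> norm_num
    · rw [H_eq_qf, qf_eq_zero]; simp [rep] <;> norm_num
    · rw [D_eq_cf, cf_eq_zero]; simp [rep, dcoef] <;> norm_num
    · rw [N1_eq _ (C2_eq_cf _)]; refine MvPolynomial.funext fun z => ?_; simp [rep, eval_qf, eval_cf, eval_lf]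
    · rw [N2_eq _ (C2_eq_cf _)]; refine MvPolynomial.funext fun z => ?_; simp [rep, eval_qf, eval_cf, eval_lf]
  · show eta (rep 10) = 0 ∧ M (rep 10) = 0 ∧ N3 (rep 10) = 0 ∧ N4 (rep 10) = 0
    refine ⟨?_, ?_, ?_, ?_⟩
    · rw [eta_eq]; simp [rep] <;> norm_num
    · rw [M_eq_qf, qf_eq_zero]; simp [rep, cubicC2] <;> norm_num
    · rw [N3_eq _ (C2_eq_cf _), cf_eq_zero]; simp [rep] <;> norm_num
    · rw [N4_eq _ (C2_eq_cf _), qf_eq_zero]; simp [rep] <;> norm_num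

/-- Systems with quadratic part `(x², y²)`. -/
theorem sameOrbit_of_diagonal {a0 a1 b0 b2 : ℝ} (h : a1 ^ 2 - 4 * a0 = b2 ^ 2 - 4 * b0) {a : Sys}
    (ha : a = ![a0, a1, 0, 1, 0, 0, b0, 0, b2, 0, 0, 1]) :
    (4 * a0 < a1 ^ 2 ∧ SameOrbit (rep 0) a) ∨ (a1 ^ 2 < 4 * a0 ∧ SameOrbit (rep 1) a) ∨
      (4 * a0 = a1 ^ 2 ∧ SameOrbit (rep 4) a) := by
  have key : ∀ k : ℝ, k ≠ 0 → ∀ j : Fin 11, ∀ e : ℝ, rep j = ![e, 0, 0, 1, 0, 0, e, 0, 0, 0, 0, 1] →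
      4 * a0 - a1 ^ 2 = 4 * e * k ^ 2 → SameOrbit (rep j) a := by
    intro k hk j e hj hs
    apply SameOrbit.symm
    have hb0 : b0 = b2 ^ 2 / 4 + e * k ^ 2 := by linarith
    have ha0 : a0 = a1 ^ 2 / 4 + e * k ^ 2 := by linarith
    have : a = pull ⟨!![1 / k, 0; 0, 1 / k], ![a1 / (2 * k), b2 / (2 * k)], by simp [hk]⟩ (k ^ 3) (rep j) := by
      rw [hj, ha, hb0, ha0]
      ext i
      fin_cases i <;> simp [pull, quadComp] <;> field_simp <;> ring
    rw [this]
    exact sameOrbit_pull _ (pow_ne_zero _ hk) _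
  rcases lt_trichotomy (4 * a0) (a1 ^ 2) with h1 | h1 | h1
  · refine Or.inl ⟨h1, key (√((a1 ^ 2 - 4 * a0) / 4)) (Real.sqrt_pos.2 (by linarith)).ne' 0 (-1) rfl ?_⟩
    rw [Real.sq_sqrt (by linarith)]; ring
  · exact Or.inr (Or.inr ⟨h1, key 1 one_ne_zero 4 0 rfl (by linarith)⟩)
  · refine Or.inr (Or.inl ⟨h1, key (√((4 * a0 - a1 ^ 2) / 4)) (Real.sqrt_pos.2 (by linarith)).ne' 1 1 rfl ?_⟩)
    rw [Real.sq_sqrt (by linarith)]; ring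

/-- Systems with quadratic part `(2xy, y² - x²)`. -/
theorem sameOrbit_of_conformal {a1 a2 b0 : ℝ} {a : Sys}
    (ha : a = ![a1 * a2 / 2, a1, a2, 0, 1, 0, b0, -a2, a1, -1, 0, 1]) :
    (4 * b0 < a1 ^ 2 - a2 ^ 2 ∧ SameOrbit (rep 2) a) ∨ (a1 ^ 2 - a2 ^ 2 < 4 * b0 ∧ SameOrbit (rep 3) a) ∨
      (4 * b0 = a1 ^ 2 - a2 ^ 2 ∧ SameOrbit (rep 5) a) := by
  have key : ∀ k : ℝ, k ≠ 0 → ∀ j : Fin 11, ∀ e : ℝ, rep j = ![0, 0, 0, 0, 1, 0, e, 0, 0, -1, 0, 1] →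
      4 * b0 - (a1 ^ 2 - a2 ^ 2) = 4 * e * k ^ 2 → SameOrbit (rep j) a := by
    intro k hk j e hj hs
    apply SameOrbit.symm
    have hb0 : b0 = (a1 ^ 2 - a2 ^ 2) / 4 + e * k ^ 2 := by linarith
    have : a = pull ⟨!![1 / k, 0; 0, 1 / k], ![a2 / (2 * k), a1 / (2 * k)], by simp [hk]⟩ (k ^ 3) (rep j) := by
      rw [hj, ha, hb0]
      ext i
      fin_cases i <;> simp [pull, quadComp] <;> field_simp <;> ring
    rw [this]
    exact sameOrbit_pull _ (pow_ne_zero _ hk) _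
  rcases lt_trichotomy (4 * b0) (a1 ^ 2 - a2 ^ 2) with h1 | h1 | h1
  · refine Or.inl ⟨h1, key (√((a1 ^ 2 - a2 ^ 2 - 4 * b0) / 4)) (Real.sqrt_pos.2 (by linarith)).ne' 2 (-1) rfl ?_⟩
    rw [Real.sq_sqrt (by linarith)]; ring
  · exact Or.inr (Or.inr ⟨h1, key 1 one_ne_zero 5 0 rfl (by linarith)⟩)
  · refine Or.inr (Or.inl ⟨h1, key (√((4 * b0 - (a1 ^ 2 - a2 ^ 2)) / 4)) (Real.sqrt_pos.2 (by linarith)).ne' 3 1 rfl ?_⟩)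
    rw [Real.sq_sqrt (by linarith)]; ring

theorem sameOrbit_rep6 {a0 a1 b0 b2 : ℝ} (hb : b2 ≠ 0) (h : a1 ^ 2 - 4 * a0 = b2 ^ 2) {a : Sys}
    (ha : a = ![a0, a1, 0, 1, 0, 0, b0, 0, b2, 0, 0, 0]) : SameOrbit (rep 6) a := by
  apply SameOrbit.symm
  have ha0 : a0 = (a1 ^ 2 - b2 ^ 2) / 4 := by linarith
  have : a = pull ⟨!![2 / b2, 0; 0, 1], ![a1 / b2, b0 / b2], by simp [hb]⟩ (b2 ^ 2 / 4) (rep 6) := by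
    rw [ha, ha0]
    ext i
    fin_cases i <;> simp [pull, quadComp, rep] <;> field_simp <;> ring
  rw [this]
  exact sameOrbit_pull _ (by positivity) _

theorem sameOrbit_rep9 {a1 b0 : ℝ} (hb : b0 ≠ 0) {a : Sys}
    (ha : a = ![a1 ^ 2 / 4, a1, 0, 1, 0, 0, b0, 0, 0, 0, 0, 0]) : SameOrbit (rep 9) a := by
  apply SameOrbit.symm
  have : a = pull ⟨!![1 / b0, 0; 0, 1], ![a1 / (2 * b0), 0], by simp [hb]⟩ (b0 ^ 2) (rep 9) := by
    rw [ha]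
    ext i
    fin_cases i <;> simp [pull, quadComp, rep] <;> field_simp <;> ring
  rw [this]
  exact sameOrbit_pull _ (by positivity) _

theorem sameOrbit_rep7_rep8 {a0 a1 b1 : ℝ} {a : Sys}
    (ha : a = ![a0, a1, 0, -1, 0, 0, -(a1 * b1 / 2), b1, a1, 0, -1, 0]) :
    (0 < a1 ^ 2 + 4 * a0 → SameOrbit (rep 7) a) ∧ (a1 ^ 2 + 4 * a0 < 0 → SameOrbit (rep 8) a) := by
  have key : ∀ k : ℝ, k ≠ 0 → ∀ j : Fin 11, ∀ e : ℝ, rep j = ![e, 0, 0, -1, 0, 0, 0, 0, 0, 0, -1, 0] →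
      a1 ^ 2 + 4 * a0 = 4 * e * k ^ 2 → SameOrbit (rep j) a := by
    intro k hk j e hj hs
    apply SameOrbit.symm
    have ha0 : a0 = e * k ^ 2 - a1 ^ 2 / 4 := by linarith
    have : a = pull ⟨!![1 / k, 0; 0, 1], ![-a1 / (2 * k), -b1 / 2], by simp [hk]⟩ (k ^ 2) (rep j) := by
      rw [hj, ha, ha0]
      ext i
      fin_cases i <;> simp [pull, quadComp] <;> field_simp <;> ring
    rw [this]
    exact sameOrbit_pull _ (pow_ne_zero _ hk) _
  constructor
  · intro h
    refine key (√((a1 ^ 2 + 4 * a0) / 4)) (Real.sqrt_pos.2 (by linarith)).ne' 7 1 rfl ?_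
    rw [Real.sq_sqrt (by linarith)]; ring
  · intro h
    refine key (√(-(a1 ^ 2 + 4 * a0) / 4)) (Real.sqrt_pos.2 (by linarith)).ne' 8 (-1) rfl ?_
    rw [Real.sq_sqrt (by linarith)]; ring

theorem sameOrbit_rep10 {a1 b0 b1 : ℝ} (h1 : a1 ≠ 0) {a : Sys}
    (ha : a = ![-(a1 * b1 / 2), a1, 0, 0, 0, 0, b0, b1, a1, -1, 0, 0]) : SameOrbit (rep 10) a := by
  apply SameOrbit.symm
  have : a = pull ⟨!![1, 0; 0, a1], ![-b1 / 2, b0 + b1 ^ 2 / 4], by simp [h1]⟩ 1 (rep 10) := by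
    rw [ha]
    ext i
    fin_cases i <;> simp [pull, quadComp, rep] <;> ring
  rw [this]
  exact sameOrbit_pull _ one_ne_zero _

theorem eq_vec (a : Sys) : a = ![a 0, a 1, a 2, a 3, a 4, a 5, a 6, a 7, a 8, a 9, a 10, a 11] := by
  ext i; fin_cases i <;> rfl

/-- The normal form of systems with `N = 0` and three real points at infinity. -/
theorem exists_diagonal {a : Sys} (hC : C2 a = cf 0 1 (-1) 0) (hN : N a = 0) :
    ∃ (g : AffTransf) (s : ℝ), s ≠ 0 ∧ C2 (pull g s a) = cf 0 1 (-1) 0 ∧ (pull g s a) 3 = 1 ∧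
      (pull g s a) 4 = 0 ∧ (pull g s a) 5 = 0 ∧
      (pull g s a) 9 = 0 ∧ (pull g s a) 10 = 0 ∧ (pull g s a) 11 = 1 := by
  obtain ⟨h9, h3, h11, h5⟩ := C2_coef hC
  rw [N_eq_qf, qf_eq_zero, h9, h3, h11, h5] at hN
  obtain ⟨e1, e2, e3⟩ := hN
  have f1 : a 10 * (a 10 + 1) = 0 := by linarith
  have f2 : a 10 * a 4 = 0 := by linarith
  have f3 : a 4 * (a 4 + 1) = 0 := by linarith
  rcases mul_eq_zero.1 f1 with h10 | h10
  · rcases mul_eq_zero.1 f3 with h4 | h4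
    · refine ⟨AffTransf.id, 1, one_ne_zero, ?_, ?_⟩
      · rw [C2_pull, linSubst_one rfl, hC]; simp
      · simp [pull, quadComp, AffTransf.id, h9, h3, h11, h5, h10, h4]
    · have h4' : a 4 = -1 := by linarith
      refine ⟨linG 1 (-1) 0 (-1) (by norm_num), -1, by norm_num, ?_, ?_⟩
      · rw [C2_pull, hC, linSubst_cf]
        refine MvPolynomial.funext fun z => ?_
        simp [linG, eval_cf]; ring
      · simp [pull, quadComp, linG, h9, h3, h11, h5, h10, h4']; norm_num
  · have h10' : a 10 = -1 := by linarith
    have h4 : a 4 = 0 := by rw [h10'] at f2; linarith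
    refine ⟨linG (-1) 0 (-1) 1 (by norm_num), -1, by norm_num, ?_, ?_⟩
    · rw [C2_pull, hC, linSubst_cf]
      refine MvPolynomial.funext fun z => ?_
      simp [linG, eval_cf]; ring
    · simp [pull, quadComp, linG, h9, h3, h11, h5, h10', h4]; norm_num

/-- The systems with `N = 0` and one real point at infinity. -/
theorem conformal_of_N {a : Sys} (hC : C2 a = cf 1 0 1 0) (hN : N a = 0) :
    a 3 = 0 ∧ a 4 = 1 ∧ a 5 = 0 ∧ a 9 = -1 ∧ a 10 = 0 ∧ a 11 = 1 := by
  obtain ⟨h9, h3, h11, h5⟩ := C2_coef hC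
  rw [N_eq_qf, qf_eq_zero, h9, h3, h11, h5] at hN
  obtain ⟨e1, e2, e3⟩ := hN
  have f2 : a 10 * a 4 = 0 := by linarith
  have f1 : a 10 ^ 2 - a 4 + 1 = 0 := by linarith
  have h10 : a 10 = 0 := by
    rcases mul_eq_zero.1 f2 with h | h
    · exact h
    · nlinarith
  have h4 : a 4 = 1 := by rw [h10] at f1; linarith
  refine ⟨?_, h4, h5, h9, h10, ?_⟩ <;> linarith

/-- The systems with `N = 0` and a double point at infinity. -/
theorem double_of_N {a : Sys} (hC : C2 a = cf 0 1 0 0) (hN : N a = 0) :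
    a 4 = 0 ∧ a 5 = 0 ∧ a 9 = 0 ∧ a 11 = 0 ∧ ((a 3 = 1 ∧ a 10 = 0) ∨ (a 3 = -1 ∧ a 10 = -1)) := by
  obtain ⟨h9, h3, h11, h5⟩ := C2_coef hC
  rw [N_eq_qf, qf_eq_zero, h9, h3, h11, h5] at hN
  obtain ⟨e1, e2, e3⟩ := hN
  have f1 : a 10 * (a 10 + 1) = 0 := by linarith
  have h4 : a 4 = 0 := by nlinarith
  refine ⟨h4, h5, by linarith, by linarith, ?_⟩
  rcases mul_eq_zero.1 f1 with h10 | h10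
  · exact Or.inl ⟨by linarith, h10⟩
  · exact Or.inr ⟨by linarith, by linarith⟩

theorem IsQS.p_ne_zero {a : Sys} (h : IsQS a) : p a ≠ 0 := by
  intro h0
  have hu := h.1 (h0 ▸ dvd_zero (q a)) dvd_rfl
  have h1 := (isUnit_iff_totalDegree_of_isReduced.1 hu).2
  have h2 := h.2
  rw [IsQuadratic, h0, h1] at h2
  simp at h2

theorem IsQS.q_ne_zero {a : Sys} (h : IsQS a) : q a ≠ 0 := by
  intro h0
  have hu := h.1 dvd_rfl (h0 ▸ dvd_zero (p a))
  have h1 := (isUnit_iff_totalDegree_of_isReduced.1 hu).2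
  have h2 := h.2
  rw [IsQuadratic, h0, h1] at h2
  simp at h2

theorem sameOrbit_of_diagonal_cond {a : Sys} (hC : C2 a = cf 0 1 (-1) 0) (h3 : a 3 = 1) (h4 : a 4 = 0)
    (h5 : a 5 = 0) (h9 : a 9 = 0) (h10 : a 10 = 0) (h11 : a 11 = 1) (hB : B3 a = 0) :
    (FormPos (H1 a) → SameOrbit (rep 0) a) ∧ (FormNeg (H1 a) → SameOrbit (rep 1) a) ∧
      (H1 a = 0 → SameOrbit (rep 4) a) := by
  rw [B3_eq a hC, rf_eq_zero] at hB
  obtain ⟨h7, -, hk, h2, -⟩ := hB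
  simp [dcoef, h3, h4, h5, h9, h10, h11] at h7 h2
  simp [dcoef, h3, h4, h5, h9, h10, h11, h7, h2] at hk
  have hH : H1 a = C (576 * (a 1 ^ 2 - 4 * a 0)) := by
    rw [H1_eq a hC]
    congr 1
    simp [h1coef, dcoef, h3, h4, h5, h9, h10, h11, h7, h2]
    linarith
  have e := eq_vec a
  rw [h2, h3, h4, h5, h7, h9, h10, h11] at e
  have key := sameOrbit_of_diagonal (by linarith) e
  rw [hH, formPos_C, formNeg_C, C_eq_zero]
  rcases key with ⟨h, h'⟩ | ⟨h, h'⟩ | ⟨h, h'⟩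
  · exact ⟨fun _ => h', fun h'' => by linarith, fun h'' => by linarith⟩
  · exact ⟨fun h'' => by linarith, fun _ => h', fun h'' => by linarith⟩
  · exact ⟨fun h'' => by linarith, fun h'' => by linarith, fun _ => h'⟩

theorem sameOrbit_of_conformal_cond {a : Sys} (hC : C2 a = cf 1 0 1 0) (hN : N a = 0) (hB : B3 a = 0) :
    (FormNeg (H1 a) → SameOrbit (rep 2) a) ∧ (FormPos (H1 a) → SameOrbit (rep 3) a) ∧
      (H1 a = 0 → SameOrbit (rep 5) a) := by
  obtain ⟨h3, h4, h5, h9, h10, h11⟩ := conformal_of_N hC hN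
  rw [B3_eq a hC, rf_eq_zero] at hB
  simp only [zero_mul, mul_zero, one_mul, sub_zero, zero_sub] at hB
  obtain ⟨hd1, hd2, -, -, hd3⟩ := hB
  have e1 : dcoef a 1 = 0 := by linarith
  have e3 : dcoef a 3 = 0 := by linarith
  have e2 : dcoef a 2 = dcoef a 0 := by linarith
  have f1 := e1
  have f2 := e2
  have f3 := e3
  simp [dcoef, h3, h4, h5, h9, h10, h11] at f1 f2 f3
  have g1 : (a 8 - a 1) * (a 2 + a 7) = 0 := by linarith
  have g2 : (a 8 - a 1) ^ 2 = (a 2 + a 7) ^ 2 := by linarith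
  have g3 : a 8 - a 1 = 0 ∧ a 2 + a 7 = 0 := by
    rcases mul_eq_zero.1 g1 with h | h
    · rw [h] at g2; exact ⟨h, by nlinarith⟩
    · rw [h] at g2; exact ⟨by nlinarith, h⟩
  have h8 : a 8 = a 1 := by linarith [g3.1]
  have h7 : a 7 = -a 2 := by linarith [g3.2]
  have h0 : a 0 = a 1 * a 2 / 2 := by linarith
  have hH : H1 a = C (2304 * (4 * a 6 - (a 1 ^ 2 - a 2 ^ 2))) := by
    rw [H1_eq a hC]
    congr 1
    simp only [h1coef, e1, e3, e2]
    simp [dcoef, h9, h10, h11, h7, h8]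
    ring
  have e := eq_vec a
  rw [h0, h3, h4, h5, h7, h8, h9, h10, h11] at e
  have key := sameOrbit_of_conformal e
  rw [hH, formPos_C, formNeg_C, C_eq_zero]
  rcases key with ⟨h, h'⟩ | ⟨h, h'⟩ | ⟨h, h'⟩
  · exact ⟨fun _ => h', fun h'' => by linarith, fun h'' => by linarith⟩
  · exact ⟨fun h'' => by linarith, fun _ => h', fun h'' => by linarith⟩
  · exact ⟨fun h'' => by linarith, fun h'' => by linarith, fun _ => h'⟩

theorem sameOrbit_of_double_cond {a : Sys} (ha : IsQS a) (hC : C2 a = cf 0 1 0 0) (hN : N a = 0) (hB : B3 a = 0) :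
    (H a = 0 ∧ N1 a = 0 ∧ N2 a = 0 → (D a ≠ 0 → SameOrbit (rep 6) a) ∧ (D a = 0 → SameOrbit (rep 9) a)) ∧
    (H a ≠ 0 ∧ H2 a = 0 → (FormPos (H3 a) → SameOrbit (rep 7) a) ∧ (FormNeg (H3 a) → SameOrbit (rep 8) a)) := by
  obtain ⟨h4, h5, h9, h11, h⟩ := double_of_N hC hN
  rcases h with ⟨h3, h10⟩ | ⟨h3, h10⟩
  · refine ⟨fun ⟨_, h1, h2⟩ => ?_, fun ⟨hH, _⟩ => ?_⟩
    · rw [N1_eq a hC] at h1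
      rw [N2_eq a hC] at h2
      have f1 := congrArg (eval ![1, 0]) h1
      have f2 := congrArg (eval ![1, 1]) h1
      have f3 := congrArg (eval ![1, 0]) h2
      simp [eval_qf, eval_cf, eval_lf] at f1 f2 f3
      have g2 : a 2 = 0 := by rw [f1] at f2; linarith
      have hD : D a = cf 0 (-(a 8 ^ 2)) 0 0 := by
        rw [D_eq_cf]; simp [dcoef, h3, h4, h5, h9, h10, h11, f1, g2]
      have e := eq_vec a
      rw [g2, h3, h4, h5, f1, h9, h10, h11] at e
      have hk : a 1 ^ 2 - 4 * a 0 = a 8 ^ 2 := by linarith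
      rw [hD, ne_eq, cf_eq_zero]
      constructor
      · intro h8
        exact sameOrbit_rep6 (b2 := a 8) (fun h0 => h8 (by simp [h0])) hk e
      · rintro ⟨-, h8, -⟩
        have h8' : a 8 = 0 := by simpa using h8
        have h0 : a 0 = a 1 ^ 2 / 4 := by rw [h8'] at hk; linarith
        have h6 : a 6 ≠ 0 := by
          intro h6
          apply ha.q_ne_zero
          rw [q_eq_qf, h6, f1, h8', h9, h10, h11]
          simp [lf, qf]
        rw [h0, h8'] at e
        exact sameOrbit_rep9 h6 e
    · exact absurd (by rw [H_eq_qf, qf_eq_zero, h4, h5, h9, h10, h11]; simp) hH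
  · refine ⟨fun ⟨hH, _⟩ => ?_, fun ⟨_, hH⟩ => ?_⟩
    · rw [H_eq_qf, qf_eq_zero, h9, h10] at hH
      exact absurd hH.1 (by norm_num)
    · obtain ⟨u, v, w, e, rfl, rfl, rfl⟩ := H2_eq_qf a
      rw [e, qf_eq_zero] at hH
      obtain ⟨e1, e2, -⟩ := hH
      simp only [h3, h4, h5, h9, h10, h11] at e1 e2
      have h8 : a 8 = a 1 := by linarith
      have h2 : a 2 = 0 := by linarith
      rw [B3_eq a hC, rf_eq_zero] at hB
      obtain ⟨f1, -, f2, f3, -⟩ := hB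
      have k0 : dcoef a 0 = 0 := by linarith
      have k2 : dcoef a 2 = 0 := by linarith
      have k3 : dcoef a 3 = 0 := by linarith
      have k1 : dcoef a 1 = -(a 1 ^ 2 + 4 * a 0) := by
        simp [dcoef, h2, h3, h4, h5, h8, h9, h10, h11]; ring
      have hH3 : H3 a = qf (8 * (a 1 ^ 2 + 4 * a 0)) 0 0 := by
        rw [H3_eq a hC, k0, k1, k2, k3, qf_inj]; refine ⟨?_, ?_, ?_⟩ <;> ring
      simp [dcoef, h9, h10, h11, h8] at k0
      have h6 : a 6 = -(a 1 * a 7 / 2) := by linarith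
      have e := eq_vec a
      rw [h2, h3, h4, h5, h6, h8, h9, h10, h11] at e
      have key := sameOrbit_rep7_rep8 e
      rw [hH3, formPos_sq, formNeg_sq]
      exact ⟨fun h => key.1 (by linarith), fun h => key.2 (by linarith)⟩

theorem sameOrbit_of_triple_cond {a : Sys} (ha : IsQS a) (hC : C2 a = cf 1 0 0 0) (hN : N a = 0)
    (h3 : N3 a = 0) (h4 : N4 a = 0) : SameOrbit (rep 10) a := by
  obtain ⟨h9, h3', h11, h5⟩ := C2_coef hC
  rw [N_eq_qf, qf_eq_zero, h9, h3', h11, h5] at hN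
  obtain ⟨e1, e2, e3⟩ := hN
  have g4 : a 4 = 0 := by nlinarith
  have g10 : a 10 = 0 := by rw [g4] at e1; nlinarith
  rw [g10] at h3'
  rw [g4] at h11
  rw [N3_eq a hC, cf_eq_zero] at h3
  obtain ⟨f1, f2, -, -⟩ := h3
  rw [N4_eq a hC, qf_eq_zero] at h4
  obtain ⟨f3, -, -⟩ := h4
  have h2 : a 2 = 0 := by linarith
  have h8 : a 8 = a 1 := by linarith
  have h0 : a 0 = -(a 1 * a 7 / 2) := by rw [h8] at f3; linarith
  have e := eq_vec a
  have g3 : a 3 = 0 := by linarith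
  have g11 : a 11 = 0 := by linarith
  rw [h0, h2, g3, g4, h5, h8, h9, g10, g11] at e
  refine sameOrbit_rep10 ?_ e
  intro h1
  apply ha.p_ne_zero
  rw [p_eq_qf, h0, h1, h2, g3, g4, h5]
  simp [lf, qf]

theorem C2_ne_zero_of_N {a : Sys} (ha : IsQS a) (hN : N a = 0) : C2 a ≠ 0 := by
  intro h
  have h' : C2 a = cf 0 0 0 0 := by rw [h]; simp [cf]
  obtain ⟨h9, h3, h11, h5⟩ := C2_coef h'
  rw [N_eq_qf, qf_eq_zero, h9, h3, h11, h5] at hN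
  obtain ⟨e1, e2, e3⟩ := hN
  refine (isQuadratic_iff a).1 ha.2 ⟨?_, ?_, h5, ?_, ?_, ?_⟩ <;> nlinarith

theorem M_ne_zero_of_double {a : Sys} (hC : C2 a = cf 0 1 0 0) : M a ≠ 0 := by
  rw [M, hess_eq_transv, hC, transv_cf_cf_two, ne_eq, qf_eq_zero]; norm_num

theorem M_eq_zero_of_triple {a : Sys} (hC : C2 a = cf 1 0 0 0) : M a = 0 := by
  obtain ⟨h9, h3, h11, h5⟩ := C2_coef hC
  rw [M_eq_qf, qf_eq_zero]; simp [cubicC2, h9, h3, h11, h5]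

theorem sameOrbit_of_orbitCond {a : Sys} (ha : IsQS a) (i : Fin 11) (h : OrbitCond i a) : SameOrbit (rep i) a := by
  obtain ⟨g, -, hg⟩ := exists_pull_normal a (C2_ne_zero_of_N ha h.2.1)
  have hs : ∀ j, SameOrbit (rep j) (pull g 1 a) → SameOrbit (rep j) a := fun j hj =>
    hj.trans (sameOrbit_pull g one_ne_zero a)
  apply hs
  rw [← orbitCond_pull i g one_ne_zero] at h
  have ha' := ha.pull g one_ne_zero
  generalize pull g 1 a = a' at *
  clear hs ha a
  rcases hg with hC | hC | hC | hC
  · have he : eta a' = 1 := by rw [eta_of_C2 hC]; norm_num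
    obtain ⟨g, s, hs, hC', h3, h4, h5, h9, h10, h11⟩ := exists_diagonal hC h.2.1
    have key := sameOrbit_of_diagonal_cond hC' h3 h4 h5 h9 h10 h11
    rw [← orbitCond_pull i g hs] at h
    refine SameOrbit.trans ?_ (sameOrbit_pull g hs a')
    have he : eta (pull g s a') = 1 := by rw [eta_of_C2 hC']; norm_num
    generalize pull g s a' = a at *
    obtain ⟨hB, hN, hr⟩ := h
    obtain ⟨k1, k2, k3⟩ := key hB
    fin_cases i
    · exact k1 hr.2
    · exact k2 hr.2
    · exact absurd hr.1 (by rw [he]; norm_num)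
    · exact absurd hr.1 (by rw [he]; norm_num)
    · exact k3 hr.2
    · exact absurd hr.1 (by rw [he]; norm_num)
    · exact absurd hr.2.1 (by rw [he]; norm_num)
    · exact absurd hr.2.1 (by rw [he]; norm_num)
    · exact absurd hr.2.1 (by rw [he]; norm_num)
    · exact absurd hr.2.1 (by rw [he]; norm_num)
    · exact absurd hr.1 (by rw [he]; norm_num)
  · have he : eta a' = -4 := by rw [eta_of_C2 hC]; norm_num
    obtain ⟨hB, hN, hr⟩ := h
    obtain ⟨k1, k2, k3⟩ := sameOrbit_of_conformal_cond hC hN hB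
    fin_cases i
    · exact absurd hr.1 (by rw [he]; norm_num)
    · exact absurd hr.1 (by rw [he]; norm_num)
    · exact k1 hr.2
    · exact k2 hr.2
    · exact absurd hr.1 (by rw [he]; norm_num)
    · exact k3 hr.2
    · exact absurd hr.2.1 (by rw [he]; norm_num)
    · exact absurd hr.2.1 (by rw [he]; norm_num)
    · exact absurd hr.2.1 (by rw [he]; norm_num)
    · exact absurd hr.2.1 (by rw [he]; norm_num)
    · exact absurd hr.1 (by rw [he]; norm_num)
  · have he : eta a' = 0 := by rw [eta_of_C2 hC]; norm_num
    obtain ⟨hB, hN, hr⟩ := h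
    obtain ⟨k1, k2⟩ := sameOrbit_of_double_cond ha' hC hN hB
    fin_cases i
    · exact absurd hr.1 (by rw [he]; norm_num)
    · exact absurd hr.1 (by rw [he]; norm_num)
    · exact absurd hr.1 (by rw [he]; norm_num)
    · exact absurd hr.1 (by rw [he]; norm_num)
    · exact absurd hr.1 (by rw [he]; norm_num)
    · exact absurd hr.1 (by rw [he]; norm_num)
    · exact (k1 hr.2.2).1 (right_ne_zero_of_mul hr.1)
    · exact (k2 ⟨right_ne_zero_of_mul hr.1, hr.2.2.1⟩).1 hr.2.2.2
    · exact (k2 ⟨right_ne_zero_of_mul hr.1, hr.2.2.1⟩).2 hr.2.2.2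
    · exact (k1 ⟨hr.2.2.1, hr.2.2.2.2⟩).2 hr.2.2.2.1
    · exact absurd hr.2.1 (M_ne_zero_of_double hC)
  · have he : eta a' = 0 := by rw [eta_of_C2 hC]; norm_num
    obtain ⟨hB, hN, hr⟩ := h
    have hM := M_eq_zero_of_triple hC
    fin_cases i
    · exact absurd hr.1 (by rw [he]; norm_num)
    · exact absurd hr.1 (by rw [he]; norm_num)
    · exact absurd hr.1 (by rw [he]; norm_num)
    · exact absurd hr.1 (by rw [he]; norm_num)
    · exact absurd hr.1 (by rw [he]; norm_num)
    · exact absurd hr.1 (by rw [he]; norm_num)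
    · exact absurd hM (left_ne_zero_of_mul hr.1)
    · exact absurd hM (left_ne_zero_of_mul hr.1)
    · exact absurd hM (left_ne_zero_of_mul hr.1)
    · exact absurd hM hr.1
    · exact sameOrbit_of_triple_cond ha' hC hN hr.2.2.1 hr.2.2.2

theorem orbitCond_of_sameOrbit {a : Sys} {i : Fin 11} (h : SameOrbit (rep i) a) : OrbitCond i a := by
  obtain ⟨g, r, hr, ht⟩ := h
  exact (orbitCond_transforms i g r _ _ hr ht).1 (orbitCond_rep i)

theorem FormPos.not_formNeg {f : Poly} (h : FormPos f) : ¬ FormNeg f := by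
  intro h'
  obtain ⟨z, hz⟩ : ∃ z, eval z f ≠ 0 := by
    by_contra! h0
    exact h.1 (MvPolynomial.funext fun z => by simpa using h0 z)
  linarith [h.2 z hz, h'.2 z hz]

open scoped Classical in
/-- The index of the orbit, computed from the comitants. -/
def orbitIndex (a : Sys) : Fin 11 :=
  if 0 < eta a then if FormPos (H1 a) then 0 else if FormNeg (H1 a) then 1 else 4
  else if eta a < 0 then if FormNeg (H1 a) then 2 else if FormPos (H1 a) then 3 else 5
  else if M a = 0 then 10
  else if H a = 0 then if D a = 0 then 9 else 6
  else if FormPos (H3 a) then 7 else 8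

theorem orbitIndex_eq {a : Sys} {i : Fin 11} (h : OrbitCond i a) : orbitIndex a = i := by
  obtain ⟨-, -, h⟩ := h
  have hp : ∀ {f : Poly}, FormNeg f → ¬ FormPos f := fun h h' => h'.not_formNeg h
  have hp0 : ∀ {f : Poly}, f = 0 → ¬ FormPos f := fun h h' => h'.1 h
  have hn0 : ∀ {f : Poly}, f = 0 → ¬ FormNeg f := fun h h' => h'.1 h
  unfold orbitIndex
  fin_cases i
  · exact (if_pos h.1).trans (if_pos h.2)
  · exact (if_pos h.1).trans ((if_neg (hp h.2)).trans (if_pos h.2))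
  · exact (if_neg (not_lt.2 h.1.le)).trans ((if_pos h.1).trans (if_pos h.2))
  · exact (if_neg (not_lt.2 h.1.le)).trans ((if_pos h.1).trans ((if_neg h.2.not_formNeg).trans (if_pos h.2)))
  · exact (if_pos h.1).trans ((if_neg (hp0 h.2)).trans (if_neg (hn0 h.2)))
  · exact (if_neg (not_lt.2 h.1.le)).trans ((if_pos h.1).trans ((if_neg (hn0 h.2)).trans (if_neg (hp0 h.2))))
  · exact (if_neg h.2.1.not_gt).trans ((if_neg h.2.1.not_lt).trans ((if_neg (left_ne_zero_of_mul h.1)).trans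
      ((if_pos h.2.2.1).trans (if_neg (right_ne_zero_of_mul h.1)))))
  · exact (if_neg h.2.1.not_gt).trans ((if_neg h.2.1.not_lt).trans ((if_neg (left_ne_zero_of_mul h.1)).trans
      ((if_neg (right_ne_zero_of_mul h.1)).trans (if_pos h.2.2.2))))
  · exact (if_neg h.2.1.not_gt).trans ((if_neg h.2.1.not_lt).trans ((if_neg (left_ne_zero_of_mul h.1)).trans
      ((if_neg (right_ne_zero_of_mul h.1)).trans (if_neg (hp h.2.2.2)))))
  · exact (if_neg h.2.1.not_gt).trans ((if_neg h.2.1.not_lt).trans ((if_neg h.1).trans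
      ((if_pos h.2.2.1).trans (if_pos h.2.2.2.1))))
  · exact (if_neg h.1.not_gt).trans ((if_neg h.1.not_lt).trans (if_pos h.2.1))

/-- The conditions of two different orbits exclude each other. -/
theorem orbitCond_unique {a : Sys} {i j : Fin 11} (hi : OrbitCond i a) (hj : OrbitCond j a) : i = j :=
  (orbitIndex_eq hi).symm.trans (orbitIndex_eq hj)

/-! ### Linear forms and divisibility -/

/-- The linear form `l 0 X + l 1 Y + l 2 Z`. -/
def linForm {K : Type*} [CommSemiring K] (l : Fin 3 → K) : MvPolynomial (Fin 3) K :=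
  C (l 0) * X 0 + C (l 1) * X 1 + C (l 2) * X 2

theorem eval_linForm {K : Type*} [CommSemiring K] (l z : Fin 3 → K) :
    eval z (linForm l) = l 0 * z 0 + l 1 * z 1 + l 2 * z 2 := by
  simp [linForm]

/-- A polynomial is congruent to the result of a substitution that changes the variables by multiples of `L`. -/
theorem dvd_sub_aeval {σ K : Type*} [CommRing K] {L : MvPolynomial σ K} {s : σ → MvPolynomial σ K}
    (hs : ∀ j, L ∣ X j - s j) (F : MvPolynomial σ K) : L ∣ F - aeval s F := by
  induction F using MvPolynomial.induction_on with
  | C r => simp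
  | add f g hf hg => rw [map_add, add_sub_add_comm]; exact dvd_add hf hg
  | mul_X f j hf =>
    rw [map_mul, aeval_X, show f * X j - aeval s f * s j = (f - aeval s f) * X j + aeval s f * (X j - s j) by ring]
    exact dvd_add (hf.mul_right _) ((hs j).mul_left _)

theorem dvd_of_eval_aeval {σ K : Type*} [Field K] [Infinite K] {L : MvPolynomial σ K}
    {s : σ → MvPolynomial σ K} (hs : ∀ j, L ∣ X j - s j) {F : MvPolynomial σ K}
    (hF : ∀ z, eval (fun j => eval z (s j)) F = 0) : L ∣ F := by
  have h0 : aeval s F = 0 := by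
    refine MvPolynomial.funext fun z => ?_
    have e : (aeval z : MvPolynomial σ K →ₐ[K] K).comp (aeval s) = aeval fun j => eval z (s j) := by
      ext j; simp [aeval_eq_eval]
    have := DFunLike.congr_fun e F
    simp only [AlgHom.comp_apply, aeval_eq_eval, RingHom.coe_coe, coe_aeval_eq_eval] at this
    rw [map_zero, ← hF z, ← this]
  have := dvd_sub_aeval hs F
  rwa [h0, sub_zero] at this

theorem linForm_dvd_iff {K : Type*} [Field K] [Infinite K] {l : Fin 3 → K} (hl : l ≠ 0)
    (F : MvPolynomial (Fin 3) K) :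
    linForm l ∣ F ↔ ∀ z : Fin 3 → K, l 0 * z 0 + l 1 * z 1 + l 2 * z 2 = 0 → eval z F = 0 := by
  constructor
  · rintro ⟨G, rfl⟩ z hz
    rw [map_mul, eval_linForm, hz, zero_mul]
  · intro h
    obtain ⟨c, hc⟩ : ∃ c : Fin 3 → K, l 0 * c 0 + l 1 * c 1 + l 2 * c 2 = 1 := by
      obtain ⟨i, hi⟩ := Function.ne_iff.1 hl
      refine ⟨Pi.single i (l i)⁻¹, ?_⟩
      fin_cases i <;> simp at hi <;> simp [Pi.single_apply, hi]
    refine dvd_of_eval_aeval (s := fun j => X j - C (c j) * linForm l) (fun j => ?_) (fun z => h _ ?_)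
    · rw [sub_sub_cancel]; exact dvd_mul_left _ _
    · simp only [map_sub, map_mul, eval_X, eval_C, eval_linForm]
      linear_combination (-(l 0 * z 0 + l 1 * z 1 + l 2 * z 2)) * hc

/-- The affine linear polynomial of a line. -/
def affForm {K : Type*} [CommSemiring K] (l : Fin 3 → K) : MvPolynomial (Fin 2) K :=
  C (l 0) * X 0 + C (l 1) * X 1 + C (l 2)

theorem eval_affForm {K : Type*} [CommSemiring K] (l : Fin 3 → K) (z : Fin 2 → K) :
    eval z (affForm l) = l 0 * z 0 + l 1 * z 1 + l 2 := by
  simp [affForm]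

theorem affForm_dvd_iff {K : Type*} [Field K] [Infinite K] {l : Fin 3 → K} (hl : (l 0, l 1) ≠ (0, 0))
    (F : MvPolynomial (Fin 2) K) :
    affForm l ∣ F ↔ ∀ z : Fin 2 → K, l 0 * z 0 + l 1 * z 1 + l 2 = 0 → eval z F = 0 := by
  constructor
  · rintro ⟨G, rfl⟩ z hz
    rw [map_mul, eval_affForm, hz, zero_mul]
  · intro h
    obtain ⟨c, hc⟩ : ∃ c : Fin 2 → K, l 0 * c 0 + l 1 * c 1 = 1 := by
      by_cases h0 : l 0 = 0
      · have h1 : l 1 ≠ 0 := fun h1 => hl (by rw [h0, h1])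
        exact ⟨![0, (l 1)⁻¹], by simp [h1]⟩
      · exact ⟨![(l 0)⁻¹, 0], by simp [h0]⟩
    refine dvd_of_eval_aeval (s := fun j => X j - C (c j) * affForm l) (fun j => ?_) (fun z => h _ ?_)
    · rw [sub_sub_cancel]; exact dvd_mul_left _ _
    · simp only [map_sub, map_mul, eval_X, eval_C, eval_affForm]
      linear_combination (-(l 0 * z 0 + l 1 * z 1 + l 2)) * hc

theorem linForm_isHomogeneous {K : Type*} [CommSemiring K] (l : Fin 3 → K) : (linForm l).IsHomogeneous 1 :=
  (((isHomogeneous_C _ _).mul (isHomogeneous_X _ 0)).add ((isHomogeneous_C _ _).mul (isHomogeneous_X _ 1))).add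
    ((isHomogeneous_C _ _).mul (isHomogeneous_X _ 2))

theorem linForm_ne_zero {K : Type*} [CommSemiring K] {l : Fin 3 → K} (hl : l ≠ 0) : linForm l ≠ 0 := by
  intro h
  apply hl
  funext i
  have := congrArg (eval (Pi.single i 1)) h
  rw [eval_linForm, map_zero] at this
  fin_cases i <;> simpa [Pi.single_apply] using this

theorem totalDegree_linForm {K : Type*} [CommSemiring K] {l : Fin 3 → K} (hl : l ≠ 0) :
    (linForm l).totalDegree = 1 :=
  (linForm_isHomogeneous l).totalDegree (linForm_ne_zero hl)

theorem linForm_smul {K : Type*} [CommSemiring K] (c : K) (l : Fin 3 → K) : linForm (c • l) = C c * linForm l := by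
  simp only [linForm, Pi.smul_apply, smul_eq_mul, C_mul]; ring

theorem linForm_dvd_linForm {K : Type*} [Field K] [Infinite K] {l m : Fin 3 → K} (hl : l ≠ 0)
    (h : linForm l ∣ linForm m) : ∃ c : K, m = c • l := by
  rw [linForm_dvd_iff hl] at h
  simp only [eval_linForm] at h
  obtain ⟨i, hi⟩ := Function.ne_iff.1 hl
  refine ⟨m i / l i, ?_⟩
  have key : ∀ i j : Fin 3, i ≠ j → l i ≠ 0 → m j = m i / l i * l j := by
    intro i j hij hi
    have := h (l j • Pi.single i 1 - l i • Pi.single j 1)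
    field_simp
    fin_cases i <;> fin_cases j <;> simp_all [Pi.single_apply] <;>
      (have := this (by ring); linear_combination -this)
  funext j
  by_cases hij : i = j
  · subst hij
    simp at hi
    simp [hi]
  · simpa using key i j hij (by simpa using hi)

theorem linForm_prime {K : Type*} [Field K] [Infinite K] {l : Fin 3 → K} (hl : l ≠ 0) : Prime (linForm l) := by
  have : Irreducible (linForm l) := by
    refine MvPolynomial.irreducible_of_totalDegree_eq_one (totalDegree_linForm hl) fun x hx => ?_
    obtain ⟨i, hi⟩ := Function.ne_iff.1 hl
    have e := hx (Finsupp.single i 1)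
    have hc : coeff (Finsupp.single i 1) (linForm l) = l i := by
      simp only [linForm, coeff_add, coeff_C_mul, coeff_X']
      fin_cases i <;> simp [Finsupp.single_left_inj]
    rw [hc] at e
    exact isUnit_iff_ne_zero.2 fun h0 => hi (by rw [h0] at e; simpa using zero_dvd_iff.1 e)
  exact this.prime

theorem linForm_isRelPrime {K : Type*} [Field K] [Infinite K] {l m : Fin 3 → K} (hl : l ≠ 0) (hm : m ≠ 0)
    (h : ∀ c : K, m ≠ c • l) : IsRelPrime (linForm l) (linForm m) := by
  rw [(linForm_prime hl).irreducible.isRelPrime_iff_not_dvd]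
  intro hd
  obtain ⟨c, hc⟩ := linForm_dvd_linForm hl hd
  exact h c hc

/-! ### Invariant lines -/

/-- The value of `P`. -/
def Pv (a : Sys) (z : Fin 3 → ℂ) : ℂ :=
  a 0 * z 2 ^ 2 + (a 1 * z 0 + a 2 * z 1) * z 2 + (a 3 * z 0 ^ 2 + 2 * a 4 * z 0 * z 1 + a 5 * z 1 ^ 2)

/-- The value of `Q`. -/
def Qv (a : Sys) (z : Fin 3 → ℂ) : ℂ :=
  a 6 * z 2 ^ 2 + (a 7 * z 0 + a 8 * z 1) * z 2 + (a 9 * z 0 ^ 2 + 2 * a 10 * z 0 * z 1 + a 11 * z 1 ^ 2)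

theorem eval_P (a : Sys) (z : Fin 3 → ℂ) : eval z (cplx (P a)) = Pv a z := by
  simp [cplx, P, Pv]

theorem eval_Q (a : Sys) (z : Fin 3 → ℂ) : eval z (cplx (Q a)) = Qv a z := by
  simp [cplx, Q, Qv]

theorem eval_cplx_p (a : Sys) (z : Fin 2 → ℂ) : eval z (cplx (p a)) = Pv a ![z 0, z 1, 1] := by
  simp [cplx, p, p0, p1, p2, Pv]

theorem eval_cplx_q (a : Sys) (z : Fin 2 → ℂ) : eval z (cplx (q a)) = Qv a ![z 0, z 1, 1] := by
  simp [cplx, q, q0, q1, q2, Qv]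

theorem ne_zero_of_affine {l : Fin 3 → ℂ} (h : (l 0, l 1) ≠ (0, 0)) : l ≠ 0 := by
  rintro rfl; simp at h

theorem lineForm_eq (l : Fin 3 → ℂ) : lineForm l = affForm l := rfl

theorem one_le_totalDegree_lineForm {l : Fin 3 → ℂ} (h : (l 0, l 1) ≠ (0, 0)) : 1 ≤ (lineForm l).totalDegree := by
  rw [Nat.one_le_iff_ne_zero]
  intro h0
  rw [totalDegree_eq_zero_iff_eq_C] at h0
  have e : ∀ z, eval z (lineForm l) = eval 0 (lineForm l) := fun z => by rw [h0, eval_C, eval_C]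
  have e0 := e ![1, 0]
  have e1 := e ![0, 1]
  rw [lineForm_eq, eval_affForm, eval_affForm] at e0 e1
  simp at e0 e1
  exact h (by rw [e0, e1])

theorem pderiv_lineForm (l : Fin 3 → ℂ) : pderiv 0 (lineForm l) = C (l 0) ∧ pderiv 1 (lineForm l) = C (l 1) := by
  simp [lineForm, pderiv_X, Pi.single_apply]

theorem isInvAffineLine_iff_affine (a : Sys) (l : Fin 3 → ℂ) : IsInvAffineLine a l ↔ (l 0, l 1) ≠ (0, 0) ∧
    ∀ x y : ℂ, l 0 * x + l 1 * y + l 2 = 0 → l 0 * Pv a ![x, y, 1] + l 1 * Qv a ![x, y, 1] = 0 := by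
  refine and_congr_right fun h => ?_
  rw [IsInvariantCurve, and_iff_right (one_le_totalDegree_lineForm h), (pderiv_lineForm l).1,
    (pderiv_lineForm l).2, lineForm_eq, affForm_dvd_iff h]
  simp only [map_add, map_mul, eval_C, eval_cplx_p, eval_cplx_q]
  constructor
  · intro hz x y hxy
    have := hz ![x, y] (by simpa using hxy)
    simp at this
    linear_combination this
  · intro hz z hxy
    have := hz (z 0) (z 1) hxy
    linear_combination this

/-- An affine line is invariant iff `u P + v Q` vanishes on it. -/
theorem isInvAffineLine_iff (a : Sys) (l : Fin 3 → ℂ) : IsInvAffineLine a l ↔ (l 0, l 1) ≠ (0, 0) ∧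
    ∀ z : Fin 3 → ℂ, l 0 * z 0 + l 1 * z 1 + l 2 * z 2 = 0 → l 0 * Pv a z + l 1 * Qv a z = 0 := by
  rw [isInvAffineLine_iff_affine]
  refine and_congr_right fun h => ⟨fun hxy => ?_, fun hz x y hxy => hz _ (by simpa using hxy)⟩
  set F : MvPolynomial (Fin 3) ℂ := C (l 0) * cplx (P a) + C (l 1) * cplx (Q a) with hF
  have hFz : ∀ z, eval z F = l 0 * Pv a z + l 1 * Qv a z := fun z => by simp [hF, eval_P, eval_Q]
  have h1 : linForm l ∣ X 2 * F := by
    rw [linForm_dvd_iff (ne_zero_of_affine h)]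
    intro z hz
    rw [map_mul, hFz, eval_X]
    by_cases h2 : z 2 = 0
    · rw [h2, zero_mul]
    · have := hxy (z 0 / z 2) (z 1 / z 2) (by field_simp; linear_combination hz)
      have e : l 0 * Pv a z + l 1 * Qv a z = z 2 ^ 2 *
          (l 0 * Pv a ![z 0 / z 2, z 1 / z 2, 1] + l 1 * Qv a ![z 0 / z 2, z 1 / z 2, 1]) := by
        simp [Pv, Qv]; field_simp
      rw [e, this]; ring
  have h2 : linForm l ∣ F := by
    refine ((linForm_prime (ne_zero_of_affine h)).dvd_or_dvd h1).resolve_left fun hX => ?_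
    rw [show (X 2 : MvPolynomial (Fin 3) ℂ) = linForm ![0, 0, 1] by simp [linForm]] at hX
    obtain ⟨c, hc⟩ := linForm_dvd_linForm (ne_zero_of_affine h) hX
    have e0 := congrFun hc 0
    have e1 := congrFun hc 1
    have e2 := congrFun hc 2
    simp at e0 e1 e2
    have hc0 : c ≠ 0 := by rintro rfl; simp at e2
    apply h
    rw [e0.resolve_left hc0, e1.resolve_left hc0]
  intro z hz
  rw [← hFz]
  exact (linForm_dvd_iff (ne_zero_of_affine h) F).1 h2 z hz

/-- The derivatives of `P` and `Q`. -/
def dP0 (a : Sys) (z : Fin 3 → ℂ) : ℂ := a 1 * z 2 + 2 * a 3 * z 0 + 2 * a 4 * z 1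
def dP1 (a : Sys) (z : Fin 3 → ℂ) : ℂ := a 2 * z 2 + 2 * a 4 * z 0 + 2 * a 5 * z 1
def dQ0 (a : Sys) (z : Fin 3 → ℂ) : ℂ := a 7 * z 2 + 2 * a 9 * z 0 + 2 * a 10 * z 1
def dQ1 (a : Sys) (z : Fin 3 → ℂ) : ℂ := a 8 * z 2 + 2 * a 10 * z 0 + 2 * a 11 * z 1

theorem Pv_add (a : Sys) (z : Fin 3 → ℂ) {d : Fin 3 → ℂ} (hd : d 2 = 0) :
    Pv a (z + d) = Pv a z + Pv a d + (d 0 * dP0 a z + d 1 * dP1 a z) := by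
  simp only [Pv, dP0, dP1, Pi.add_apply, hd]; ring

theorem Qv_add (a : Sys) (z : Fin 3 → ℂ) {d : Fin 3 → ℂ} (hd : d 2 = 0) :
    Qv a (z + d) = Qv a z + Qv a d + (d 0 * dQ0 a z + d 1 * dQ1 a z) := by
  simp only [Qv, dQ0, dQ1, Pi.add_apply, hd]; ring

/-- The extactic polynomial of lines `P δQ - Q δP`, `δ = P ∂/∂X + Q ∂/∂Y`. -/
def extactic (a : Sys) : MvPolynomial (Fin 3) ℂ :=
  cplx (P a) ^ 2 * linForm ![2 * (a 9 : ℂ), 2 * a 10, a 7]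
    + cplx (P a) * cplx (Q a) * (linForm ![2 * (a 10 : ℂ), 2 * a 11, a 8] - linForm ![2 * (a 3 : ℂ), 2 * a 4, a 1])
    - cplx (Q a) ^ 2 * linForm ![2 * (a 4 : ℂ), 2 * a 5, a 2]

theorem eval_extactic (a : Sys) (z : Fin 3 → ℂ) : eval z (extactic a) =
    Pv a z ^ 2 * dQ0 a z + Pv a z * Qv a z * (dQ1 a z - dP0 a z) - Qv a z ^ 2 * dP1 a z := by
  simp [extactic, eval_P, eval_Q, eval_linForm, dP0, dP1, dQ0, dQ1]; ring

theorem P_isHomogeneous (a : Sys) : (P a).IsHomogeneous 2 := by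
  have hC : ∀ c : ℝ, (C c : MvPolynomial (Fin 3) ℝ).IsHomogeneous 0 := fun c => isHomogeneous_C _ c
  have hX : ∀ i, (X i : MvPolynomial (Fin 3) ℝ).IsHomogeneous 1 := isHomogeneous_X ℝ
  exact (((hC _).mul ((hX 2).pow 2)).add ((((hC _).mul (hX 0)).add ((hC _).mul (hX 1))).mul (hX 2))).add
    ((((hC _).mul ((hX 0).pow 2)).add (((hC _).mul (hX 0)).mul (hX 1))).add ((hC _).mul ((hX 1).pow 2)))

theorem Q_isHomogeneous (a : Sys) : (Q a).IsHomogeneous 2 := by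
  have hC : ∀ c : ℝ, (C c : MvPolynomial (Fin 3) ℝ).IsHomogeneous 0 := fun c => isHomogeneous_C _ c
  have hX : ∀ i, (X i : MvPolynomial (Fin 3) ℝ).IsHomogeneous 1 := isHomogeneous_X ℝ
  exact (((hC _).mul ((hX 2).pow 2)).add ((((hC _).mul (hX 0)).add ((hC _).mul (hX 1))).mul (hX 2))).add
    ((((hC _).mul ((hX 0).pow 2)).add (((hC _).mul (hX 0)).mul (hX 1))).add ((hC _).mul ((hX 1).pow 2)))

theorem extactic_isHomogeneous (a : Sys) : (extactic a).IsHomogeneous 5 := by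
  have hP : (cplx (P a)).IsHomogeneous 2 := (P_isHomogeneous a).map _
  have hQ : (cplx (Q a)).IsHomogeneous 2 := (Q_isHomogeneous a).map _
  have hl := fun l : Fin 3 → ℂ => linForm_isHomogeneous l
  exact (((hP.pow 2).mul (hl _)).add ((hP.mul hQ).mul ((hl _).sub (hl _)))).sub ((hQ.pow 2).mul (hl _))

/-- The invariant affine lines divide the extactic polynomial. -/
theorem IsInvAffineLine.dvd_extactic {a : Sys} {l : Fin 3 → ℂ} (h : IsInvAffineLine a l) :
    linForm l ∣ extactic a := by
  rw [isInvAffineLine_iff] at h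
  obtain ⟨h0, h⟩ := h
  rw [linForm_dvd_iff (ne_zero_of_affine h0)]
  intro z hz
  have hz' := h z hz
  set d : Fin 3 → ℂ := ![Pv a z, Qv a z, 0] with hd
  have hd' : l 0 * d 0 + l 1 * d 1 + l 2 * d 2 = 0 := by simp [hd]; linear_combination hz'
  have h1 := h d hd'
  have h2 := h (z + d) (by simp only [Pi.add_apply]; linear_combination hz + hd')
  have e1 := Pv_add a z (d := d) rfl
  have e2 := Qv_add a z (d := d) rfl
  have d0 : d 0 = Pv a z := rfl
  have d1 : d 1 = Qv a z := rfl
  rw [d0, d1] at e1 e2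
  rw [e1, e2] at h2
  have h3 : l 0 * (Pv a z * dP0 a z + Qv a z * dP1 a z) + l 1 * (Pv a z * dQ0 a z + Qv a z * dQ1 a z) = 0 := by
    linear_combination h2 - hz' - h1
  rw [eval_extactic]
  by_cases hl : l 0 = 0
  · have hl1 : l 1 ≠ 0 := fun h1 => h0 (by rw [hl, h1])
    apply mul_left_cancel₀ hl1
    linear_combination Pv a z * h3 - hz' * (Pv a z * dP0 a z + Qv a z * dP1 a z)
  · apply mul_left_cancel₀ hl
    linear_combination -Qv a z * h3 + hz' * (Pv a z * dQ0 a z + Qv a z * dQ1 a z)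

/-- The direction of an invariant line is a root of `C₂`. -/
theorem IsInvAffineLine.direction {a : Sys} {l : Fin 3 → ℂ} (h : IsInvAffineLine a l) {x y : ℂ}
    (hxy : l 0 * x + l 1 * y = 0) : y * Pv a ![x, y, 0] - x * Qv a ![x, y, 0] = 0 := by
  rw [isInvAffineLine_iff] at h
  obtain ⟨h0, h⟩ := h
  have := h ![x, y, 0] (by simpa using hxy)
  by_cases hl : l 0 = 0
  · have hl1 : l 1 ≠ 0 := fun h1 => h0 (by rw [hl, h1])
    apply mul_left_cancel₀ hl1
    linear_combination Pv a ![x, y, 0] * hxy - x * this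
  · apply mul_left_cancel₀ hl
    linear_combination -Qv a ![x, y, 0] * hxy + y * this

theorem IsInvAffineLine.smul {a : Sys} {l : Fin 3 → ℂ} (h : IsInvAffineLine a l) {c : ℂ} (hc : c ≠ 0) :
    IsInvAffineLine a (c • l) := by
  rw [isInvAffineLine_iff] at h ⊢
  obtain ⟨h0, h⟩ := h
  refine ⟨fun h' => h0 ?_, fun z hz => ?_⟩
  · simp [hc] at h'; rw [h'.1, h'.2]
  · simp only [Pi.smul_apply, smul_eq_mul] at hz ⊢
    have := h z (by apply mul_left_cancel₀ hc; linear_combination hz)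
    linear_combination c * this

theorem IsInvLine.ne_zero {a : Sys} {l : Fin 3 → ℂ} (h : IsInvLine a l) : l ≠ 0 := by
  rcases h with h | h
  · rintro rfl; exact h.2.2 rfl
  · exact ne_zero_of_affine h.1

theorem IsInvLine.smul {a : Sys} {l : Fin 3 → ℂ} (h : IsInvLine a l) {c : ℂ} (hc : c ≠ 0) :
    IsInvLine a (c • l) := by
  rcases h with ⟨h0, h1, h2⟩ | h
  · exact Or.inl ⟨by simp [h0], by simp [h1], by simp [h2, hc]⟩
  · exact Or.inr (h.smul hc)

theorem isInvLine_smul_iff {a : Sys} {l : Fin 3 → ℂ} {c : ℂ} (hc : c ≠ 0) :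
    IsInvLine a (c • l) ↔ IsInvLine a l :=
  ⟨fun h => by simpa [smul_smul, hc] using h.smul (inv_ne_zero hc), fun h => h.smul hc⟩

/-! ### Limits of products of linear forms -/

/-- Convergence of the coefficients of polynomials. -/
def CoeffTendsto (F : ℕ → MvPolynomial (Fin 3) ℂ) (F₀ : MvPolynomial (Fin 3) ℂ) : Prop :=
  ∀ m, Tendsto (fun k => coeff m (F k)) atTop (𝓝 (coeff m F₀))

theorem CoeffTendsto.mul {F G : ℕ → MvPolynomial (Fin 3) ℂ} {F₀ G₀ : MvPolynomial (Fin 3) ℂ}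
    (hF : CoeffTendsto F F₀) (hG : CoeffTendsto G G₀) : CoeffTendsto (fun k => F k * G k) (F₀ * G₀) := by
  intro m
  simp only [coeff_mul]
  exact tendsto_finsetSum _ fun x _ => (hF x.1).mul (hG x.2)

theorem CoeffTendsto.add {F G : ℕ → MvPolynomial (Fin 3) ℂ} {F₀ G₀ : MvPolynomial (Fin 3) ℂ}
    (hF : CoeffTendsto F F₀) (hG : CoeffTendsto G G₀) : CoeffTendsto (fun k => F k + G k) (F₀ + G₀) := fun m => by
  simpa only [coeff_add] using (hF m).add (hG m)

theorem CoeffTendsto.sub {F G : ℕ → MvPolynomial (Fin 3) ℂ} {F₀ G₀ : MvPolynomial (Fin 3) ℂ}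
    (hF : CoeffTendsto F F₀) (hG : CoeffTendsto G G₀) : CoeffTendsto (fun k => F k - G k) (F₀ - G₀) := fun m => by
  simpa only [coeff_sub] using (hF m).sub (hG m)

theorem coeffTendsto_const (F : MvPolynomial (Fin 3) ℂ) : CoeffTendsto (fun _ => F) F := fun _ => tendsto_const_nhds

theorem coeffTendsto_C {c : ℕ → ℂ} {c₀ : ℂ} (h : Tendsto c atTop (𝓝 c₀)) :
    CoeffTendsto (fun k => C (c k)) (C c₀) := by
  intro m
  simp only [coeff_C]
  by_cases hm : 0 = m <;> simp [hm, h]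

theorem CoeffTendsto.unique {F : ℕ → MvPolynomial (Fin 3) ℂ} {F₀ F₁ : MvPolynomial (Fin 3) ℂ}
    (h₀ : CoeffTendsto F F₀) (h₁ : CoeffTendsto F F₁) : F₀ = F₁ :=
  MvPolynomial.ext _ _ fun m => tendsto_nhds_unique (h₀ m) (h₁ m)

theorem coeffTendsto_linForm {l : ℕ → Fin 3 → ℂ} {l₀ : Fin 3 → ℂ} (h : Tendsto l atTop (𝓝 l₀)) :
    CoeffTendsto (fun k => linForm (l k)) (linForm l₀) := by
  rw [tendsto_pi_nhds] at h
  exact (((coeffTendsto_C (h 0)).mul (coeffTendsto_const _)).add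
    ((coeffTendsto_C (h 1)).mul (coeffTendsto_const _))).add ((coeffTendsto_C (h 2)).mul (coeffTendsto_const _))

theorem cplx_P (a : Sys) : cplx (P a) = C (a 0 : ℂ) * X 2 ^ 2 + C (a 1 : ℂ) * (X 0 * X 2) + C (a 2 : ℂ) * (X 1 * X 2)
    + C (a 3 : ℂ) * X 0 ^ 2 + C (a 4 : ℂ) * (2 * X 0 * X 1) + C (a 5 : ℂ) * X 1 ^ 2 := by
  refine MvPolynomial.funext fun z => ?_
  rw [eval_P]; simp [Pv]; ring

theorem cplx_Q (a : Sys) : cplx (Q a) = C (a 6 : ℂ) * X 2 ^ 2 + C (a 7 : ℂ) * (X 0 * X 2) + C (a 8 : ℂ) * (X 1 * X 2)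
    + C (a 9 : ℂ) * X 0 ^ 2 + C (a 10 : ℂ) * (2 * X 0 * X 1) + C (a 11 : ℂ) * X 1 ^ 2 := by
  refine MvPolynomial.funext fun z => ?_
  rw [eval_Q]; simp [Qv]; ring

theorem coeffTendsto_extactic {A : ℕ → Sys} {a : Sys} (h : Tendsto A atTop (𝓝 a)) :
    CoeffTendsto (fun k => extactic (A k)) (extactic a) := by
  rw [tendsto_pi_nhds] at h
  have hc : ∀ i, Tendsto (fun k => ((A k i : ℝ) : ℂ)) atTop (𝓝 (a i : ℂ)) := fun i =>
    (Complex.continuous_ofReal.tendsto _).comp (h i)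
  have hl : ∀ (f : Sys → Fin 3 → ℂ), (∀ j, Tendsto (fun k => f (A k) j) atTop (𝓝 (f a j))) →
      CoeffTendsto (fun k => linForm (f (A k))) (linForm (f a)) := fun f hf =>
    coeffTendsto_linForm (tendsto_pi_nhds.2 hf)
  have hl' : ∀ i j n : Fin 12, CoeffTendsto (fun k => linForm ![2 * ((A k i : ℝ) : ℂ), 2 * ((A k j : ℝ) : ℂ), (A k n : ℝ)])
      (linForm ![2 * (a i : ℂ), 2 * (a j : ℂ), (a n : ℂ)]) := fun i j n =>
    hl (fun a => ![2 * (a i : ℂ), 2 * (a j : ℂ), (a n : ℂ)]) fun s => by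
      fin_cases s
      · exact (hc i).const_mul 2
      · exact (hc j).const_mul 2
      · exact hc n
  have hm := fun i (f : MvPolynomial (Fin 3) ℂ) => (coeffTendsto_C (hc i)).mul (coeffTendsto_const f)
  have hP : CoeffTendsto (fun k => cplx (P (A k))) (cplx (P a)) := by
    simp only [cplx_P]
    exact (((((hm 0 _).add (hm 1 _)).add (hm 2 _)).add (hm 3 _)).add (hm 4 _)).add (hm 5 _)
  have hQ : CoeffTendsto (fun k => cplx (Q (A k))) (cplx (Q a)) := by
    simp only [cplx_Q]
    exact (((((hm 6 _).add (hm 7 _)).add (hm 8 _)).add (hm 9 _)).add (hm 10 _)).add (hm 11 _)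
  simp only [extactic, pow_two]
  exact (((hP.mul hP).mul (hl' _ _ _)).add ((hP.mul hQ).mul ((hl' _ _ _).sub (hl' _ _ _)))).sub
    ((hQ.mul hQ).mul (hl' _ _ _))

/-- If the products `L_k G_k` converge and the linear forms `L_k` converge to a nonzero form, then the `G_k` converge. -/
theorem exists_limit_quotient {l : ℕ → Fin 3 → ℂ} {l₀ : Fin 3 → ℂ} (hl : Tendsto l atTop (𝓝 l₀)) (h₀ : l₀ ≠ 0)
    {G : ℕ → MvPolynomial (Fin 3) ℂ} {F₀ : MvPolynomial (Fin 3) ℂ} {d : ℕ} (hd : ∀ k, (G k).totalDegree ≤ d)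
    (hF : CoeffTendsto (fun k => linForm (l k) * G k) F₀) :
    ∃ G₀ : MvPolynomial (Fin 3) ℂ, CoeffTendsto G G₀ ∧ F₀ = linForm l₀ * G₀ := by
  obtain ⟨i, hi⟩ := Function.ne_iff.1 h₀
  have hl' := tendsto_pi_nhds.1 hl
  have hz : ∀ k m, d < m.degree → coeff m (G k) = 0 := fun k m hm =>
    coeff_eq_zero_of_totalDegree_lt ((hd k).trans_lt hm)
  have key : ∀ n m, d < m i + n → ∃ c, Tendsto (fun k => coeff m (G k)) atTop (𝓝 c) := by
    intro n
    induction n with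
    | zero =>
      intro m hm
      refine ⟨0, ?_⟩
      have : ∀ k, coeff m (G k) = 0 := fun k => hz k m (lt_of_lt_of_le hm (Finsupp.le_degree i m))
      simp [this]
    | succ n ih =>
      intro m hm
      have hc : ∀ k, coeff (m + Finsupp.single i 1) (linForm (l k) * G k) = l k i * coeff m (G k)
          + ∑ j ∈ Finset.univ.erase i, l k j * (if j ∈ (m + Finsupp.single i 1).support then
            coeff (m + Finsupp.single i 1 - Finsupp.single j 1) (G k) else 0) := by
        intro k
        have : linForm (l k) = ∑ j, C (l k j) * X j := by rw [Fin.sum_univ_three]; rfl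
        rw [this, Finset.sum_mul, coeff_sum, ← Finset.add_sum_erase _ _ (Finset.mem_univ i)]
        congr 1
        · rw [mul_assoc, coeff_C_mul, coeff_X_mul', if_pos (by simp), add_tsub_cancel_right]
        · refine Finset.sum_congr rfl fun j _ => ?_
          rw [mul_assoc, coeff_C_mul, coeff_X_mul']
      have hs : ∃ c, Tendsto (fun k => ∑ j ∈ Finset.univ.erase i, l k j *
          (if j ∈ (m + Finsupp.single i 1).support then
            coeff (m + Finsupp.single i 1 - Finsupp.single j 1) (G k) else 0)) atTop (𝓝 c) := by
        have : ∀ j : Fin 3, ∃ c, j ∈ Finset.univ.erase i → Tendsto (fun k => l k j *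
            (if j ∈ (m + Finsupp.single i 1).support then
              coeff (m + Finsupp.single i 1 - Finsupp.single j 1) (G k) else 0)) atTop (𝓝 c) := by
          intro j
          by_cases hj : j ∈ (m + Finsupp.single i 1).support
          · by_cases hij : j = i
            · exact ⟨0, fun h => absurd hij (Finset.ne_of_mem_erase h)⟩
            · obtain ⟨c, hc⟩ := ih (m + Finsupp.single i 1 - Finsupp.single j 1) (by
                simp [Finsupp.single_apply, hij]; omega)
              exact ⟨_, fun _ => by simpa only [hj, if_true] using (hl' j).mul hc⟩
          · exact ⟨0, fun _ => by simp [hj]⟩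
        choose c hc using this
        exact ⟨_, tendsto_finsetSum _ fun j hj => hc j hj⟩
      obtain ⟨c, hs⟩ := hs
      refine ⟨(l₀ i)⁻¹ * (coeff (m + Finsupp.single i 1) F₀ - c), ?_⟩
      refine (((hl' i).inv₀ hi).mul ((hF (m + Finsupp.single i 1)).sub hs)).congr' ?_
      filter_upwards [(hl' i).eventually_ne hi] with k hk
      rw [hc k, add_sub_cancel_right, inv_mul_cancel_left₀ hk]
  choose c hc using fun m => key (d + 1) m (by omega)
  have hfin := Finsupp.finite_of_degree_le (σ := Fin 3) d
  have hG : CoeffTendsto G (∑ m ∈ hfin.toFinset, monomial m (c m)) := by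
    intro m
    have : coeff m (∑ m ∈ hfin.toFinset, monomial m (c m)) = c m := by
      rw [coeff_sum]
      simp only [coeff_monomial, Finset.sum_ite_eq', Set.Finite.mem_toFinset, Set.mem_ofPred_eq]
      by_cases hm : m.degree ≤ d
      · rw [if_pos hm]
      · rw [if_neg hm]
        refine tendsto_nhds_unique ?_ (hc m)
        simp [hz _ m (not_le.1 hm)]
    rw [this]
    exact hc m
  exact ⟨_, hG, hF.unique ((coeffTendsto_linForm hl).mul hG)⟩

theorem linForm_pow_dvd_of_tendsto {l₀ : Fin 3 → ℂ} (h₀ : l₀ ≠ 0) {d : ℕ} (m : ℕ) :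
    ∀ {F : ℕ → MvPolynomial (Fin 3) ℂ} {F₀ : MvPolynomial (Fin 3) ℂ} (L : ℕ → Fin m → Fin 3 → ℂ),
      CoeffTendsto F F₀ → (∀ k, (F k).totalDegree ≤ d) → (∀ k j, L k j ≠ 0) → 
      (∀ k, ∏ j, linForm (L k j) ∣ F k) →
      (∀ j, Tendsto (fun k => L k j) atTop (𝓝 l₀)) → linForm l₀ ^ m ∣ F₀ := by
  induction m with
  | zero => intros; simp
  | succ m ih =>
    intro F F₀ L hF hd hL hdvd hlim
    choose G hG using hdvd
    have hG' : ∀ k, F k = linForm (L k 0) * ((∏ j : Fin m, linForm (L k j.succ)) * G k) := fun k => by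
      rw [hG k, Fin.prod_univ_succ, mul_assoc]
    have hd' : ∀ k, ((∏ j : Fin m, linForm (L k j.succ)) * G k).totalDegree ≤ d := by
      intro k
      by_cases h : (∏ j : Fin m, linForm (L k j.succ)) * G k = 0
      · rw [h]; simp
      · have := hd k
        rw [hG' k, totalDegree_mul_of_isDomain (linForm_ne_zero (hL k 0)) h] at this
        omega
    have hF' : CoeffTendsto (fun k => linForm (L k 0) * ((∏ j : Fin m, linForm (L k j.succ)) * G k)) F₀ := by
      intro n
      simpa only [hG'] using hF n
    obtain ⟨G₀, h1, h2⟩ := exists_limit_quotient (hlim 0) h₀ hd' hF'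
    have := ih (fun k j => L k j.succ) h1 hd' (fun k j => hL k _) (fun k => dvd_mul_right _ _)
      (fun j => hlim j.succ)
    rw [h2, pow_succ']
    exact mul_dvd_mul_left _ this

/-- The multiplicity of an invariant line is bounded by its multiplicity in the extactic polynomial. -/
theorem IsLimitOfLines.pow_dvd {a : Sys} {l : Fin 3 → ℂ} {m : ℕ} (hl : l ≠ 0) (h : IsLimitOfLines a l m) :
    linForm l ^ m ∣ extactic a := by
  obtain ⟨A, L, -, hA, hinv, hne, hlim⟩ := h
  have hL : ∀ k j, L k j ≠ 0 := fun k j => ne_zero_of_affine (hinv k j).1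
  refine linForm_pow_dvd_of_tendsto hl m L (coeffTendsto_extactic hA)
    (fun k => (extactic_isHomogeneous (A k)).totalDegree_le) hL (fun k => ?_) hlim
  refine Finset.prod_dvd_of_isRelPrime (fun i _ j _ hij => ?_) fun j _ => (hinv k j).dvd_extactic
  exact linForm_isRelPrime (hL k i) (hL k j) (hne k j i hij.symm)

/-! ### The extactic polynomial of a nondegenerate system -/

/-- The derivatives of `p` and `q`. -/
def affLin (c u v : ℝ) : Poly := C c + lf u v

theorem eval_affLin (c u v : ℝ) (z : Fin 2 → ℝ) : eval z (affLin c u v) = c + (u * z 0 + v * z 1) := by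
  simp [affLin, eval_lf]

theorem affLin_eq_zero {c u v : ℝ} : affLin c u v = 0 ↔ c = 0 ∧ u = 0 ∧ v = 0 := by
  constructor
  · intro h
    have h0 := congrArg (eval ![0, 0]) h
    have h1 := congrArg (eval ![1, 0]) h
    have h2 := congrArg (eval ![0, 1]) h
    rw [eval_affLin, map_zero] at h0 h1 h2
    simp at h0 h1 h2
    rw [h0] at h1 h2
    exact ⟨h0, by simpa using h1, by simpa using h2⟩
  · rintro ⟨rfl, rfl, rfl⟩
    simp [affLin, lf]

theorem totalDegree_affLin_le (c u v : ℝ) : (affLin c u v).totalDegree ≤ 1 :=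
  (totalDegree_add _ _).trans (max_le ((totalDegree_C _).trans_le zero_le_one)
      (lf_isHomogeneous u v).totalDegree_le)

/-- A quadratic polynomial does not divide its derivatives. -/
theorem eq_zero_of_dvd_derivative {c u v u' v' w' : ℝ} {s : ℝ} {f : Poly} (hs : s = u ∨ s = v)
    (hf : u' = 0 → v' = 0 → w' = 0 → f = C s) (hdeg : f.totalDegree ≤ 1)
    (h : (C c + lf u v + qf u' v' w' : Poly) ∣ f) : f = 0 := by
  by_contra hf0
  obtain ⟨k, hk⟩ := h
  have hne : (C c + lf u v + qf u' v' w' : Poly) ≠ 0 := by rintro h0; rw [h0, zero_mul] at hk; exact hf0 hk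
  have hk0 : k ≠ 0 := by rintro rfl; rw [mul_zero] at hk; exact hf0 hk
  have h1 := totalDegree_mul_of_isDomain hne hk0
  rw [← hk] at h1
  obtain ⟨h2, h3⟩ := totalDegree_quadratic c u v u' v' w'
  have h4 : u' = 0 ∧ v' = 0 ∧ w' = 0 := by
    by_contra h5
    have := h3.2 h5
    omega
  obtain ⟨rfl, rfl, rfl⟩ := h4
  have h6 := hf rfl rfl rfl
  rw [h6, totalDegree_C] at h1
  have h7 : (C c + lf u v + qf 0 0 0 : Poly).totalDegree = 0 := by omega
  rw [totalDegree_eq_zero_iff_eq_C] at h7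
  have e : ∀ z, eval z (C c + lf u v + qf 0 0 0 : Poly) = eval 0 (C c + lf u v + qf 0 0 0 : Poly) := fun z => by
    rw [h7, eval_C, eval_C]
  have e0 := e ![1, 0]
  have e1 := e ![0, 1]
  simp only [map_add, eval_C, eval_lf, eval_qf, Pi.zero_apply, Matrix.cons_val] at e0 e1
  rcases hs with rfl | rfl
  · rw [show s = 0 by linarith, C_0] at h6; exact hf0 h6
  · rw [show s = 0 by linarith, C_0] at h6; exact hf0 h6

theorem Pv_ofReal (a : Sys) (x y : ℝ) : Pv a ![(x : ℂ), y, 1] = ((eval ![x, y] (p a) : ℝ) : ℂ) := by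
  simp [Pv, p, p0, p1, p2]

theorem Qv_ofReal (a : Sys) (x y : ℝ) : Qv a ![(x : ℂ), y, 1] = ((eval ![x, y] (q a) : ℝ) : ℂ) := by
  simp [Qv, q, q0, q1, q2]

theorem extactic_ne_zero {a : Sys} (ha : IsQS a) : extactic a ≠ 0 := by
  intro h0
  have h1 : p a ^ 2 * affLin (a 7) (2 * a 9) (2 * a 10) + p a * q a *
      (affLin (a 8) (2 * a 10) (2 * a 11) - affLin (a 1) (2 * a 3) (2 * a 4))
      - q a ^ 2 * affLin (a 2) (2 * a 4) (2 * a 5) = 0 := by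
    refine MvPolynomial.funext fun z => ?_
    have h2 := congrArg (eval ![(z 0 : ℂ), z 1, 1]) h0
    rw [eval_extactic, Pv_ofReal, Qv_ofReal, map_zero] at h2
    simp only [dP0, dP1, dQ0, dQ1, Matrix.cons_val] at h2
    have h3 : (![z 0, z 1] : Fin 2 → ℝ) = z := by ext i; fin_cases i <;> rfl
    rw [h3] at h2
    simp only [map_add, map_sub, map_mul, map_pow, eval_affLin, map_zero]
    apply Complex.ofReal_injective
    push_cast
    linear_combination h2
  have hp : affLin (a 2) (2 * a 4) (2 * a 5) = 0 := by
    have h2 : p a ∣ affLin (a 2) (2 * a 4) (2 * a 5) := by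
      refine (ha.1.pow_right (n := 2)).dvd_of_dvd_mul_left ⟨p a * affLin (a 7) (2 * a 9) (2 * a 10) + q a *
        (affLin (a 8) (2 * a 10) (2 * a 11) - affLin (a 1) (2 * a 3) (2 * a 4)), ?_⟩
      linear_combination -h1
    rw [p_eq_qf] at h2
    refine eq_zero_of_dvd_derivative (s := a 2) (Or.inr rfl) (fun _ e1 e2 => ?_) (totalDegree_affLin_le _ _ _) h2
    rw [affLin, e1, e2]; simp [lf]
  have hq : affLin (a 7) (2 * a 9) (2 * a 10) = 0 := by
    have h2 : q a ∣ affLin (a 7) (2 * a 9) (2 * a 10) := by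
      refine (ha.1.symm.pow_right (n := 2)).dvd_of_dvd_mul_left ⟨q a * affLin (a 2) (2 * a 4) (2 * a 5) - p a *
        (affLin (a 8) (2 * a 10) (2 * a 11) - affLin (a 1) (2 * a 3) (2 * a 4)), ?_⟩
      linear_combination h1
    rw [q_eq_qf] at h2
    refine eq_zero_of_dvd_derivative (s := a 7) (Or.inl rfl) (fun e1 e2 _ => ?_) (totalDegree_affLin_le _ _ _) h2
    rw [affLin, e1, e2]; simp [lf]
  rw [hp, hq] at h1
  have h2 : p a * q a * (affLin (a 8) (2 * a 10) (2 * a 11) - affLin (a 1) (2 * a 3) (2 * a 4)) = 0 := by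
    linear_combination h1
  have h3 := (mul_eq_zero.1 h2).resolve_left (mul_ne_zero ha.p_ne_zero ha.q_ne_zero)
  rw [affLin_eq_zero] at hp hq
  have h4 : affLin (a 8 - a 1) (2 * a 10 - 2 * a 3) (2 * a 11 - 2 * a 4) = 0 := by
    rw [← h3]; simp only [affLin, lf, C_sub]; ring
  rw [affLin_eq_zero] at h4
  refine (isQuadratic_iff a).1 ha.2 ⟨?_, ?_, ?_, ?_, ?_, ?_⟩ <;> linarith [hp.2.1, hp.2.2, hq.2.1, hq.2.2, h4.2.1, h4.2.2]

/-! ### Multiplicities and splitting -/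

theorem lineMult_le {a : Sys} {l : Fin 3 → ℂ} (hl : l ≠ 0) {n : ℕ} (h : ¬ linForm l ^ (n + 1) ∣ extactic a) :
    lineMult a l ≤ (open scoped Classical in if IsLineAtInfinity l then 1 else 0) + (n : ℕ∞) := by
  unfold lineMult
  refine add_le_add le_rfl (iSup₂_le fun m hm => ?_)
  rw [Nat.cast_le]
  by_contra! hlt
  exact h ((pow_dvd_pow _ hlt).trans (hm.pow_dvd hl))

/-- Every factor of `F` that vanishes at a point is divisible by an invariant line through this point. -/
def Splits (a : Sys) (F : MvPolynomial (Fin 3) ℂ) : Prop :=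
  ∀ G, G ∣ F → ∀ z, eval z G = 0 → ∃ l, IsInvLine a l ∧ linForm l ∣ G ∧ l 0 * z 0 + l 1 * z 1 + l 2 * z 2 = 0

theorem splits_C (a : Sys) {κ : ℂ} (hκ : κ ≠ 0) : Splits a (C κ) := by
  intro G hG z hz
  have := map_dvd (eval z) hG
  rw [hz, eval_C, zero_dvd_iff] at this
  exact absurd this hκ

theorem Splits.linForm_mul {a : Sys} {F : MvPolynomial (Fin 3) ℂ} (h : Splits a F) {l : Fin 3 → ℂ}
    (hl : IsInvLine a l) : Splits a (linForm l * F) := by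
  intro G hG z hz
  have hp := linForm_prime hl.ne_zero
  by_cases hd : linForm l ∣ G
  · obtain ⟨G', rfl⟩ := hd
    by_cases h0 : eval z (linForm l) = 0
    · exact ⟨l, hl, dvd_mul_right _ _, by rwa [eval_linForm] at h0⟩
    · rw [map_mul] at hz
      obtain ⟨m, h1, h2, h3⟩ := h G' ((mul_dvd_mul_iff_left hp.ne_zero).1 hG) z
        ((mul_eq_zero.1 hz).resolve_left h0)
      exact ⟨m, h1, h2.mul_left _, h3⟩
  · obtain ⟨H, hH⟩ := hG
    obtain ⟨H', rfl⟩ := (hp.dvd_or_dvd (hH ▸ dvd_mul_right _ _)).resolve_left hd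
    refine h G ⟨H', ?_⟩ z hz
    apply mul_left_cancel₀ hp.ne_zero
    rw [hH]; ring

theorem Splits.of_dvd {a : Sys} {F G : MvPolynomial (Fin 3) ℂ} (h : Splits a F) (hG : G ∣ F) : Splits a G :=
  fun G' hG' => h G' (hG'.trans hG)

theorem splits_prod {a : Sys} {κ : ℂ} (hκ : κ ≠ 0) {ι : Type*} (S : Finset ι) (l : ι → Fin 3 → ℂ) (n : ι → ℕ)
    (hl : ∀ i ∈ S, IsInvLine a (l i)) : Splits a ((∏ i ∈ S, linForm (l i) ^ n i) * C κ) := by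
  classical
  induction S using Finset.induction_on with
  | empty => simpa using splits_C a hκ
  | insert i S hi ih =>
    rw [Finset.prod_insert hi, mul_assoc]
    have h1 := ih fun j hj => hl j (Finset.mem_insert_of_mem hj)
    induction n i with
    | zero => simpa using h1
    | succ m ihm =>
      rw [pow_succ', mul_assoc]
      exact ihm.linForm_mul (hl i (Finset.mem_insert_self _ _))

theorem IsLineAtInfinity.mk_eq {l m : Projectivization ℂ (Fin 3 → ℂ)} (hl : IsLineAtInfinity l.rep)
    (hm : IsLineAtInfinity m.rep) : l = m := by
  rw [← l.mk_rep, ← m.mk_rep, Projectivization.mk_eq_mk_iff']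
  refine ⟨l.rep 2 / m.rep 2, ?_⟩
  have := hm.2.2
  ext i
  fin_cases i
  · simp [hl.1, hm.1]
  · simp [hl.2.1, hm.2.1]
  · simp [this]

theorem IsQSL6.splits {a : Sys} (h : IsQSL6 a) : Splits a (extactic a) := by
  classical
  obtain ⟨hq, -, hfin, hsum⟩ := h
  have hE := extactic_ne_zero hq
  set S := hfin.toFinset with hS
  have hmem : ∀ l ∈ S, IsInvLine a l.rep := fun l hl => by simpa [hS, IL] using hl
  set n : Projectivization ℂ (Fin 3 → ℂ) → ℕ := fun l => multiplicity (linForm l.rep) (extactic a) with hn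
  have hne : ∀ l : Projectivization ℂ (Fin 3 → ℂ), l.rep ≠ 0 := fun l => l.rep_nonzero
  have hfm : ∀ l : Projectivization ℂ (Fin 3 → ℂ), FiniteMultiplicity (linForm l.rep) (extactic a) := fun l =>
    FiniteMultiplicity.of_prime_left (linForm_prime (hne l)) hE
  have h1 : ∀ l ∈ S, lineMult a l.rep ≤ (if IsLineAtInfinity l.rep then 1 else 0 : ℕ∞) + (n l : ℕ∞) := fun l _ => by
    convert lineMult_le (hne l) ((hfm l).not_pow_dvd_of_multiplicity_lt (Nat.lt_succ_self _))
  have h2 : (6 : ℕ∞) ≤ 1 + ((∑ l ∈ S, n l : ℕ) : ℕ∞) := by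
    rw [finsum_mem_eq_finite_toFinset_sum _ hfin] at hsum
    have h3 := (Finset.sum_le_sum h1)
    rw [hsum, Finset.sum_add_distrib] at h3
    push_cast at h3 ⊢
    refine h3.trans (add_le_add ?_ le_rfl)
    rw [Finset.sum_boole]
    have : (S.filter fun l => IsLineAtInfinity l.rep).card ≤ 1 := Finset.card_le_one.2 fun l hl m hm =>
      (Finset.mem_filter.1 hl).2.mk_eq (Finset.mem_filter.1 hm).2
    exact_mod_cast this
  have h3 : 5 ≤ ∑ l ∈ S, n l := by
    have : ((6 : ℕ) : ℕ∞) ≤ ((1 + ∑ l ∈ S, n l : ℕ) : ℕ∞) := by push_cast at h2 ⊢; exact h2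
    rw [Nat.cast_le] at this
    omega
  have h4 : ∏ l ∈ S, linForm l.rep ^ n l ∣ extactic a := by
    refine Finset.prod_dvd_of_isRelPrime (fun l _ m _ hlm => ?_) fun l _ => pow_multiplicity_dvd _ _
    refine IsRelPrime.pow (linForm_isRelPrime (hne l) (hne m) fun c hc => hlm ?_)
    rw [← l.mk_rep, ← m.mk_rep, eq_comm, Projectivization.mk_eq_mk_iff']
    exact ⟨c, hc.symm⟩
  have h5 : (∏ l ∈ S, linForm l.rep ^ n l).IsHomogeneous (∑ l ∈ S, n l) :=
    IsHomogeneous.prod _ _ _ fun l _ => by simpa using (linForm_isHomogeneous l.rep).pow (n l)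
  have h6 : ∏ l ∈ S, linForm l.rep ^ n l ≠ 0 := Finset.prod_ne_zero_iff.2 fun l _ =>
    pow_ne_zero _ (linForm_ne_zero (hne l))
  obtain ⟨G, hG⟩ := h4
  have hG0 : G ≠ 0 := by rintro rfl; rw [mul_zero] at hG; exact hE hG
  have h7 := totalDegree_mul_of_isDomain h6 hG0
  rw [← hG, h5.totalDegree h6] at h7
  have h8 := (extactic_isHomogeneous a).totalDegree_le
  have h9 : G.totalDegree = 0 := by omega
  rw [totalDegree_eq_zero_iff_eq_C] at h9
  rw [hG, h9]
  refine splits_prod (fun h0 => hG0 (by rw [h9, h0, C_0])) S _ n hmem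

theorem Splits.exists_affine {a : Sys} {F : MvPolynomial (Fin 3) ℂ} (h : Splits a F) {x y : ℂ}
    (hF : eval ![x, y, 1] F = 0) :
    ∃ l, IsInvAffineLine a l ∧ linForm l ∣ F ∧ l 0 * x + l 1 * y + l 2 = 0 := by
  obtain ⟨l, h1, h2, h3⟩ := h F dvd_rfl _ hF
  simp at h3
  refine ⟨l, h1.resolve_left fun h4 => h4.2.2 ?_, h2, h3⟩
  rwa [h4.1, h4.2.1, zero_mul, zero_mul, zero_add, zero_add] at h3

theorem Splits.exists_direction {a : Sys} {F : MvPolynomial (Fin 3) ℂ} (h : Splits a F) {x y x' y' : ℂ}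
    (hF : eval ![x, y, 0] F = 0) (hF' : eval ![x', y', 0] F ≠ 0) :
    ∃ l, IsInvAffineLine a l ∧ linForm l ∣ F ∧ l 0 * x + l 1 * y = 0 := by
  obtain ⟨l, h1, h2, h3⟩ := h F dvd_rfl _ hF
  simp at h3
  refine ⟨l, h1.resolve_left fun h4 => hF' ?_, h2, h3⟩
  have := map_dvd (eval ![x', y', 0]) h2
  rw [eval_linForm] at this
  simpa [h4.1, h4.2.1] using this

/-! ### Transport of invariant lines and their multiplicities -/

/-- The complexified and homogenized affine transformation. -/
def AffTransf.act (g : AffTransf) (z : Fin 3 → ℂ) : Fin 3 → ℂ :=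
  ![g.M 0 0 * z 0 + g.M 0 1 * z 1 + g.b 0 * z 2, g.M 1 0 * z 0 + g.M 1 1 * z 1 + g.b 1 * z 2, z 2]

theorem Pv_pull (g : AffTransf) (s : ℝ) (a : Sys) (z : Fin 3 → ℂ) :
    Pv (pull g s a) z = s * (g.M 1 1 * Pv a (g.act z) - g.M 0 1 * Qv a (g.act z)) := by
  simp [Pv, Qv, pull, quadComp, AffTransf.act]; ring

theorem Qv_pull (g : AffTransf) (s : ℝ) (a : Sys) (z : Fin 3 → ℂ) :
    Qv (pull g s a) z = s * (g.M 0 0 * Qv a (g.act z) - g.M 1 0 * Pv a (g.act z)) := by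
  simp [Pv, Qv, pull, quadComp, AffTransf.act]; ring

theorem pullLine_dot (g : AffTransf) (l z : Fin 3 → ℂ) :
    g.pullLine l 0 * z 0 + g.pullLine l 1 * z 1 + g.pullLine l 2 * z 2 =
      l 0 * g.act z 0 + l 1 * g.act z 1 + l 2 * g.act z 2 := by
  simp [AffTransf.pullLine, AffTransf.act]; ring

theorem det_ne' (g : AffTransf) : (g.M 0 0 : ℂ) * g.M 1 1 - g.M 0 1 * g.M 1 0 ≠ 0 := by
  have := g.det_ne
  rw [Matrix.det_fin_two] at this
  exact_mod_cast this

theorem act_inv (g : AffTransf) (z : Fin 3 → ℂ) : g.act (g.inv.act z) = z := by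
  have hM := g.mul_inv_M
  have key : ∀ i j, ((g.M i 0 : ℝ) : ℂ) * (g.inv.M 0 j : ℝ) + (g.M i 1 : ℝ) * (g.inv.M 1 j : ℝ)
      = if i = j then 1 else 0 := by
    intro i j
    have := congrFun (congrFun hM i) j
    rw [Matrix.mul_apply, Fin.sum_univ_two, Matrix.one_apply] at this
    rw [show g.inv.M = g.M⁻¹ from rfl]
    have h := congrArg Complex.ofReal this
    rw [apply_ite Complex.ofReal] at h
    simpa using h
  have hb : ∀ i, ((g.M i 0 : ℝ) : ℂ) * (g.inv.b 0 : ℝ) + (g.M i 1 : ℝ) * (g.inv.b 1 : ℝ) + (g.b i : ℝ) = 0 := by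
    intro i
    have := congrFun (g.apply_inv_apply 0) i
    simp only [AffTransf.apply, Matrix.mulVec_zero, zero_add, Pi.add_apply, Matrix.mulVec, dotProduct,
      Fin.sum_univ_two, Pi.zero_apply] at this
    exact_mod_cast congrArg (fun x : ℝ => (x : ℂ)) this
  have k00 := key 0 0
  have k01 := key 0 1
  have k10 := key 1 0
  have k11 := key 1 1
  simp only [if_true, Fin.isValue, zero_ne_one, one_ne_zero, if_false] at k00 k01 k10 k11
  ext i
  fin_cases i
  · simp only [AffTransf.act, Fin.zero_eta, Fin.isValue, Matrix.cons_val]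
    linear_combination z 0 * k00 + z 1 * k01 + z 2 * hb 0
  · simp only [AffTransf.act, Fin.mk_one, Fin.isValue, Matrix.cons_val]
    linear_combination z 0 * k10 + z 1 * k11 + z 2 * hb 1
  · rfl

theorem pullLine_smul (g : AffTransf) (c : ℂ) (l : Fin 3 → ℂ) : g.pullLine (c • l) = c • g.pullLine l := by
  ext i
  fin_cases i <;> simp [AffTransf.pullLine] <;> ring

theorem eq_of_dot_eq {l m : Fin 3 → ℂ} (h : ∀ z : Fin 3 → ℂ, l 0 * z 0 + l 1 * z 1 + l 2 * z 2
    = m 0 * z 0 + m 1 * z 1 + m 2 * z 2) : l = m := by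
  ext i
  have := h (Pi.single i 1)
  fin_cases i <;> simpa [Pi.single_apply] using this

theorem pullLine_pullLine_inv (g : AffTransf) (l : Fin 3 → ℂ) : g.inv.pullLine (g.pullLine l) = l :=
  eq_of_dot_eq fun z => by rw [pullLine_dot, pullLine_dot, act_inv]

theorem pullLine_injective (g : AffTransf) : Function.Injective g.pullLine :=
  Function.LeftInverse.injective (pullLine_pullLine_inv g)

theorem pullLine_bijective (g : AffTransf) : Function.Bijective g.pullLine := by
  refine ⟨pullLine_injective g, fun l => ⟨g.inv.pullLine l, ?_⟩⟩
  apply pullLine_injective g.inv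
  rw [pullLine_pullLine_inv]

theorem pullLine_zero (g : AffTransf) : g.pullLine 0 = 0 := by
  simpa using pullLine_smul g 0 0

theorem pullLine_ne_zero (g : AffTransf) {l : Fin 3 → ℂ} (hl : l ≠ 0) : g.pullLine l ≠ 0 := fun h =>
  hl (pullLine_injective g (h.trans (pullLine_zero g).symm))

theorem pullLine_affine_iff (g : AffTransf) (l : Fin 3 → ℂ) :
    (g.pullLine l 0 = 0 ∧ g.pullLine l 1 = 0) ↔ (l 0 = 0 ∧ l 1 = 0) := by
  simp only [AffTransf.pullLine, Matrix.cons_val]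
  have hd := det_ne' g
  constructor
  · rintro ⟨h0, h1⟩
    constructor <;> apply mul_right_cancel₀ hd
    · linear_combination (g.M 1 1 : ℂ) * h0 - (g.M 1 0 : ℂ) * h1
    · linear_combination (g.M 0 0 : ℂ) * h1 - (g.M 0 1 : ℂ) * h0
  · rintro ⟨h0, h1⟩; simp [h0, h1]

theorem isLineAtInfinity_pullLine (g : AffTransf) (l : Fin 3 → ℂ) :
    IsLineAtInfinity (g.pullLine l) ↔ IsLineAtInfinity l := by
  unfold IsLineAtInfinity
  rw [← and_assoc, pullLine_affine_iff, ← and_assoc]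
  refine and_congr_right fun h => ?_
  simp [AffTransf.pullLine, h.1, h.2]

theorem isInvAffineLine_pull (g : AffTransf) {s : ℝ} (hs : s ≠ 0) (a : Sys) (l : Fin 3 → ℂ) :
    IsInvAffineLine (pull g s a) (g.pullLine l) ↔ IsInvAffineLine a l := by
  rw [isInvAffineLine_iff, isInvAffineLine_iff, ne_eq, ne_eq, Prod.mk.injEq, Prod.mk.injEq,
    pullLine_affine_iff]
  refine and_congr_right fun _ => ?_
  have e : ∀ z, g.pullLine l 0 * Pv (pull g s a) z + g.pullLine l 1 * Qv (pull g s a) z =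
      s * ((g.M 0 0 : ℂ) * g.M 1 1 - g.M 0 1 * g.M 1 0) * (l 0 * Pv a (g.act z) + l 1 * Qv a (g.act z)) := by
    intro z
    rw [Pv_pull, Qv_pull]
    simp only [AffTransf.pullLine, Matrix.cons_val]; ring
  have hc : (s : ℂ) * ((g.M 0 0 : ℂ) * g.M 1 1 - g.M 0 1 * g.M 1 0) ≠ 0 :=
    mul_ne_zero (by exact_mod_cast hs) (det_ne' g)
  constructor
  · intro h z hz
    have h1 := h (g.inv.act z) (by rw [pullLine_dot, act_inv]; exact hz)
    rw [e, act_inv] at h1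
    exact (mul_eq_zero.1 h1).resolve_left hc
  · intro h z hz
    rw [pullLine_dot] at hz
    rw [e, h _ hz, mul_zero]

theorem isInvLine_pull (g : AffTransf) {s : ℝ} (hs : s ≠ 0) (a : Sys) (l : Fin 3 → ℂ) :
    IsInvLine (pull g s a) (g.pullLine l) ↔ IsInvLine a l := by
  rw [IsInvLine, IsInvLine, isLineAtInfinity_pullLine, isInvAffineLine_pull g hs]

theorem continuous_pull (g : AffTransf) (s : ℝ) : Continuous (pull g s) := by
  rw [continuous_pi_iff]
  intro i
  fin_cases i <;> simp only [pull, quadComp, Fin.reduceFinMk, Fin.zero_eta, Fin.mk_one, Matrix.cons_val] <;> fun_prop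

theorem continuous_pullLine (g : AffTransf) : Continuous g.pullLine := by
  rw [continuous_pi_iff]
  intro i
  fin_cases i <;> simp only [AffTransf.pullLine, Fin.reduceFinMk, Fin.zero_eta, Fin.mk_one, Matrix.cons_val] <;> fun_prop

theorem IsLimitOfLines.pull {a : Sys} {l : Fin 3 → ℂ} {m : ℕ} (h : IsLimitOfLines a l m) (g : AffTransf) {s : ℝ}
    (hs : s ≠ 0) : IsLimitOfLines (pull g s a) (g.pullLine l) m := by
  obtain ⟨A, L, h1, h2, h3, h4, h5⟩ := h
  refine ⟨fun k => QuadSL.pull g s (A k), fun k j => g.pullLine (L k j), fun k => (h1 k).pull g hs,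
    ((continuous_pull g s).tendsto a).comp h2, fun k j => (isInvAffineLine_pull g hs _ _).2 (h3 k j),
    fun k i j hij c hc => h4 k i j hij c (pullLine_injective g (hc.trans (pullLine_smul _ _ _).symm)),
    fun j => ((continuous_pullLine g).tendsto l).comp (h5 j)⟩

theorem exists_eq_pull_inv (g : AffTransf) {s : ℝ} (hs : s ≠ 0) (a : Sys) :
    ∃ s' : ℝ, s' ≠ 0 ∧ a = pull g.inv s' (pull g s a) := by
  have hd := g.det_ne
  have h1 := transforms_pull g (r := 1 / (s * g.M.det)) (by positivity) a
  have e : 1 / (1 / (s * g.M.det) * g.M.det) = s := by field_simp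
  rw [e] at h1
  have h2 := h1.symm (by positivity)
  exact ⟨_, one_div_ne_zero (mul_ne_zero (by positivity) g.inv.det_ne), h2.eq_pull (by positivity)⟩

theorem lineMult_pull (g : AffTransf) {s : ℝ} (hs : s ≠ 0) (a : Sys) (l : Fin 3 → ℂ) :
    lineMult (pull g s a) (g.pullLine l) = lineMult a l := by
  have key : ∀ m, IsLimitOfLines (pull g s a) (g.pullLine l) m ↔ IsLimitOfLines a l m := by
    intro m
    refine ⟨fun h => ?_, fun h => h.pull g hs⟩
    obtain ⟨s', hs', e⟩ := exists_eq_pull_inv g hs a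
    have := h.pull g.inv hs'
    rwa [← e, pullLine_pullLine_inv] at this
  simp only [lineMult, key]
  by_cases h : IsLineAtInfinity l
  · rw [if_pos h, if_pos ((isLineAtInfinity_pullLine g l).2 h)]
  · rw [if_neg h, if_neg (mt (isLineAtInfinity_pullLine g l).1 h)]

theorem IsLimitOfLines.smul {a : Sys} {l : Fin 3 → ℂ} {m : ℕ} (h : IsLimitOfLines a l m) {c : ℂ} (hc : c ≠ 0) :
    IsLimitOfLines a (c • l) m := by
  obtain ⟨A, L, h1, h2, h3, h4, h5⟩ := h
  refine ⟨A, fun k j => c • L k j, h1, h2, fun k j => (h3 k j).smul hc, fun k i j hij d hd => h4 k i j hij d ?_,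
    fun j => (h5 j).const_smul c⟩
  rw [smul_comm] at hd
  exact smul_right_injective _ hc hd

theorem lineMult_smul (a : Sys) (l : Fin 3 → ℂ) {c : ℂ} (hc : c ≠ 0) : lineMult a (c • l) = lineMult a l := by
  have key : ∀ m, IsLimitOfLines a (c • l) m ↔ IsLimitOfLines a l m := fun m =>
    ⟨fun h => by simpa [smul_smul, hc] using h.smul (inv_ne_zero hc), fun h => h.smul hc⟩
  have k2 : IsLineAtInfinity (c • l) ↔ IsLineAtInfinity l := by simp [IsLineAtInfinity, hc]
  simp only [lineMult, key]
  by_cases h : IsLineAtInfinity l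
  · rw [if_pos h, if_pos (k2.2 h)]
  · rw [if_neg h, if_neg (mt k2.1 h)]

theorem mem_IL_mk {a : Sys} {l : Fin 3 → ℂ} (hl : l ≠ 0) : Projectivization.mk ℂ l hl ∈ IL a ↔ IsInvLine a l := by
  obtain ⟨c, hc⟩ := Projectivization.exists_smul_eq_mk_rep ℂ l hl
  change IsInvLine a (Projectivization.mk ℂ l hl).rep ↔ _
  rw [← hc]
  exact isInvLine_smul_iff c.ne_zero

theorem lineMult_mk {a : Sys} {l : Fin 3 → ℂ} (hl : l ≠ 0) :
    lineMult a (Projectivization.mk ℂ l hl).rep = lineMult a l := by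
  obtain ⟨c, hc⟩ := Projectivization.exists_smul_eq_mk_rep ℂ l hl
  rw [← hc]
  exact lineMult_smul a l c.ne_zero

theorem HasTotalMult.pull {a : Sys} {n : ℕ} (h : HasTotalMult a n) (g : AffTransf) {s : ℝ} (hs : s ≠ 0) :
    HasTotalMult (pull g s a) n := by
  set φ : Projectivization ℂ (Fin 3 → ℂ) → Projectivization ℂ (Fin 3 → ℂ) := fun l =>
    Projectivization.mk ℂ (g.pullLine l.rep) (pullLine_ne_zero g l.rep_nonzero) with hφ
  have hb : Set.BijOn φ (IL a) (IL (QuadSL.pull g s a)) := by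
    refine ⟨fun l hl => ?_, fun l _ m _ hlm => ?_, fun m hm => ?_⟩
    · exact (mem_IL_mk _).2 ((isInvLine_pull g hs a _).2 hl)
    · obtain ⟨c, hc⟩ := (Projectivization.mk_eq_mk_iff' _ _ _ _ _).1 hlm
      rw [← pullLine_smul] at hc
      rw [← l.mk_rep, ← m.mk_rep, Projectivization.mk_eq_mk_iff']
      exact ⟨c, pullLine_injective g hc⟩
    · obtain ⟨l, hl⟩ := (pullLine_bijective g).2 m.rep
      have hl0 : l ≠ 0 := by
        rintro rfl
        rw [pullLine_zero] at hl
        exact m.rep_nonzero hl.symm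
      refine ⟨Projectivization.mk ℂ l hl0, (mem_IL_mk _).2 ?_, ?_⟩
      · rw [← isInvLine_pull g hs, hl]; exact hm
      · obtain ⟨c, hc⟩ := Projectivization.exists_smul_eq_mk_rep ℂ l hl0
        rw [hφ, ← m.mk_rep]
        simp only
        rw [Projectivization.mk_eq_mk_iff']
        refine ⟨c, ?_⟩
        rw [← hc, ← hl]
        exact (pullLine_smul g c l).symm
  refine ⟨hb.image_eq ▸ h.1.image φ, ?_⟩
  rw [← h.2, eq_comm]
  refine finsum_mem_eq_of_bijOn φ hb fun l _ => ?_
  rw [lineMult_mk, lineMult_pull g hs]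

theorem X2_dvd_CP_iff (a : Sys) : X 2 ∣ CP a ↔ C2 a = 0 := by
  have hX : (X 2 : MvPolynomial (Fin 3) ℝ) = linForm ![0, 0, 1] := by simp [linForm]
  rw [hX, linForm_dvd_iff (fun h => one_ne_zero (congrFun h 2))]
  have e : ∀ z : Fin 3 → ℝ, z 2 = 0 → eval z (CP a) = eval ![z 0, z 1] (C2 a) := by
    intro z hz
    simp [CP, P, Q, C2, p2, q2, hz]
  constructor
  · intro h
    refine MvPolynomial.funext fun z => ?_
    have h1 := h ![z 0, z 1, 0] (by simp)
    rw [e _ rfl] at h1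
    have h3 : (![z 0, z 1] : Fin 2 → ℝ) = z := by ext i; fin_cases i <;> rfl
    simpa [h3] using h1
  · intro h z hz
    rw [e z (by simpa using hz), h, map_zero]

theorem IsQSL6.C2_ne_zero {a : Sys} (h : IsQSL6 a) : C2 a ≠ 0 := fun h0 => h.2.1 ((X2_dvd_CP_iff a).2 h0)

theorem IsQSL6.pull {a : Sys} (h : IsQSL6 a) (g : AffTransf) {s : ℝ} (hs : s ≠ 0) : IsQSL6 (pull g s a) := by
  refine ⟨h.1.pull g hs, ?_, h.2.2.pull g hs⟩
  rw [X2_dvd_CP_iff, C2_pull]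
  rw [C_mul_linSubst_eq_zero hs]
  exact h.C2_ne_zero

/-! ### The leading coefficients of the extactic polynomial -/

def ext5 (a : Sys) (x y : ℂ) : ℂ :=
  let A := a 3 * x ^ 2 + 2 * a 4 * x * y + a 5 * y ^ 2
  let B := a 9 * x ^ 2 + 2 * a 10 * x * y + a 11 * y ^ 2
  A ^ 2 * (2 * a 9 * x + 2 * a 10 * y) + A * B * (2 * a 10 * x + 2 * a 11 * y - (2 * a 3 * x + 2 * a 4 * y))
    - B ^ 2 * (2 * a 4 * x + 2 * a 5 * y)

def ext4 (a : Sys) (x y : ℂ) : ℂ :=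
  let A := a 3 * x ^ 2 + 2 * a 4 * x * y + a 5 * y ^ 2
  let B := a 9 * x ^ 2 + 2 * a 10 * x * y + a 11 * y ^ 2
  let A' := a 1 * x + a 2 * y
  let B' := a 7 * x + a 8 * y
  2 * A * A' * (2 * a 9 * x + 2 * a 10 * y) + A ^ 2 * a 7
    + (A * B' + A' * B) * (2 * a 10 * x + 2 * a 11 * y - (2 * a 3 * x + 2 * a 4 * y)) + A * B * (a 8 - a 1)
    - 2 * B * B' * (2 * a 4 * x + 2 * a 5 * y) - B ^ 2 * a 2

def ext3 (a : Sys) (x y : ℂ) : ℂ :=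
  let A := a 3 * x ^ 2 + 2 * a 4 * x * y + a 5 * y ^ 2
  let B := a 9 * x ^ 2 + 2 * a 10 * x * y + a 11 * y ^ 2
  let A' := a 1 * x + a 2 * y
  let B' := a 7 * x + a 8 * y
  (A' ^ 2 + 2 * A * a 0) * (2 * a 9 * x + 2 * a 10 * y) + 2 * A * A' * a 7
    + (A * a 6 + A' * B' + a 0 * B) * (2 * a 10 * x + 2 * a 11 * y - (2 * a 3 * x + 2 * a 4 * y))
    + (A * B' + A' * B) * (a 8 - a 1)
    - (B' ^ 2 + 2 * B * a 6) * (2 * a 4 * x + 2 * a 5 * y) - 2 * B * B' * a 2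

/-- The part of the extactic polynomial of degree at least three in `Z`, divided by `Z ^ 3`. -/
def extRest (a : Sys) (x y z : ℂ) : ℂ :=
  let A := a 3 * x ^ 2 + 2 * a 4 * x * y + a 5 * y ^ 2
  let B := a 9 * x ^ 2 + 2 * a 10 * x * y + a 11 * y ^ 2
  let A' := a 1 * x + a 2 * y
  let B' := a 7 * x + a 8 * y
  let q' := 2 * a 9 * x + 2 * a 10 * y
  let m' := 2 * a 10 * x + 2 * a 11 * y - (2 * a 3 * x + 2 * a 4 * y)
  let p' := 2 * a 4 * x + 2 * a 5 * y
  (2 * A' * a 0 * q' + (A' ^ 2 + 2 * A * a 0) * a 7 + (A' * a 6 + a 0 * B') * m'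
      + (A * a 6 + A' * B' + a 0 * B) * (a 8 - a 1) - 2 * B' * a 6 * p' - (B' ^ 2 + 2 * B * a 6) * a 2)
    + z * (a 0 ^ 2 * q' + 2 * A' * a 0 * a 7 + a 0 * a 6 * m' + (A' * a 6 + a 0 * B') * (a 8 - a 1)
      - a 6 ^ 2 * p' - 2 * B' * a 6 * a 2)
    + z ^ 2 * (a 0 ^ 2 * a 7 + a 0 * a 6 * (a 8 - a 1) - a 6 ^ 2 * a 2)

theorem eval_extactic_eq (a : Sys) (x y z : ℂ) : eval ![x, y, z] (extactic a) =
    ext5 a x y + z * (ext4 a x y + z * (ext3 a x y + z * extRest a x y z)) := by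
  rw [eval_extactic]
  simp only [Pv, Qv, dP0, dP1, dQ0, dQ1, ext5, ext4, ext3, extRest, Matrix.cons_val]
  ring

theorem exists_X2_factor {F : MvPolynomial (Fin 3) ℂ} {f : ℂ → ℂ → ℂ → ℂ} (hf : ∀ x y, Continuous (f x y))
    (h : ∀ x y z, eval ![x, y, z] F = z * f x y z) :
    ∃ G, F = X 2 * G ∧ ∀ x y z, eval ![x, y, z] G = f x y z := by
  have hX : (X 2 : MvPolynomial (Fin 3) ℂ) = linForm ![0, 0, 1] := by simp [linForm]
  obtain ⟨G, hG⟩ : X 2 ∣ F := by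
    rw [hX, linForm_dvd_iff (fun h => one_ne_zero (congrFun h 2))]
    intro z hz
    have := h (z 0) (z 1) (z 2)
    have e : ![z 0, z 1, z 2] = z := by ext i; fin_cases i <;> rfl
    have hz' : z 2 = 0 := by simpa using hz
    rwa [e, hz', zero_mul] at this
  refine ⟨G, hG, fun x y => ?_⟩
  have h1 : Continuous fun z : ℂ => eval ![x, y, z] G := by
    have : Continuous fun z : ℂ => (![x, y, z] : Fin 3 → ℂ) := by
      rw [continuous_pi_iff]; intro i; fin_cases i <;> simp <;> fun_prop
    exact (MvPolynomial.continuous_eval G).comp this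
  have h2 : (fun z : ℂ => eval ![x, y, z] G) = f x y := by
    refine h1.ext_on (dense_compl_singleton (0 : ℂ)) (hf x y) fun z hz => ?_
    have := h x y z
    rw [hG, map_mul, eval_X] at this
    exact mul_left_cancel₀ hz this
  exact fun z => congrFun h2 z

theorem exists_factor4 {a : Sys} (h5 : ∀ x y, ext5 a x y = 0) :
    ∃ F, F ∣ extactic a ∧ ∀ x y, eval ![x, y, 0] F = ext4 a x y := by
  obtain ⟨G, h1, h2⟩ := exists_X2_factor (F := extactic a)
    (f := fun x y z => ext4 a x y + z * (ext3 a x y + z * extRest a x y z))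
    (fun x y => by unfold extRest; fun_prop) (fun x y z => by rw [eval_extactic_eq, h5, zero_add])
  exact ⟨G, h1 ▸ dvd_mul_left _ _, fun x y => by rw [h2, zero_mul, add_zero]⟩

theorem exists_factor3 {a : Sys} (h5 : ∀ x y, ext5 a x y = 0) (h4 : ∀ x y, ext4 a x y = 0) :
    ∃ F, F ∣ extactic a ∧ ∀ x y, eval ![x, y, 0] F = ext3 a x y := by
  obtain ⟨G, h1, h2⟩ := exists_X2_factor (F := extactic a)
    (f := fun x y z => z * (ext3 a x y + z * extRest a x y z))
    (fun x y => by unfold extRest; fun_prop) (fun x y z => by rw [eval_extactic_eq, h5, h4, zero_add, zero_add])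
  obtain ⟨G', h3, h4⟩ := exists_X2_factor (F := G)
    (f := fun x y z => ext3 a x y + z * extRest a x y z)
    (fun x y => by unfold extRest; fun_prop) (fun x y z => by rw [h2])
  exact ⟨G', (h3 ▸ dvd_mul_left G' (X 2)).trans (h1 ▸ dvd_mul_left G (X 2)), fun x y => by rw [h4, zero_mul, add_zero]⟩

theorem eval_extactic_zero (a : Sys) (x y : ℂ) : eval ![x, y, 0] (extactic a) = ext5 a x y := by
  rw [eval_extactic_eq]; ring

/-! ### Vertical and horizontal invariant lines -/

theorem Pv_eq (a : Sys) (x y z : ℂ) : Pv a ![x, y, z] = a 0 * z ^ 2 + (a 1 * x + a 2 * y) * z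
    + (a 3 * x ^ 2 + 2 * a 4 * x * y + a 5 * y ^ 2) := rfl

theorem Qv_eq (a : Sys) (x y z : ℂ) : Qv a ![x, y, z] = a 6 * z ^ 2 + (a 7 * x + a 8 * y) * z
    + (a 9 * x ^ 2 + 2 * a 10 * x * y + a 11 * y ^ 2) := rfl

theorem IsInvAffineLine.vertical {a : Sys} {l : Fin 3 → ℂ} (h : IsInvAffineLine a l) (h1 : l 1 = 0) :
    l 0 ≠ 0 ∧ ∃ c : ℂ, l = l 0 • ![1, 0, -c] ∧ (a 5 : ℂ) = 0 ∧ 2 * a 4 * c + a 2 = 0 ∧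
      (a 3 : ℂ) * c ^ 2 + a 1 * c + a 0 = 0 := by
  rw [isInvAffineLine_iff_affine] at h
  obtain ⟨h0, h⟩ := h
  have hl : l 0 ≠ 0 := fun h2 => h0 (by rw [h1, h2])
  refine ⟨hl, -l 2 / l 0, ?_, ?_⟩
  · ext i; fin_cases i
    · simp
    · simp [h1]
    · simp; field_simp
  · have key : ∀ y, Pv a ![-l 2 / l 0, y, 1] = 0 := fun y => by
      have := h (-l 2 / l 0) y (by rw [h1]; field_simp; ring)
      rw [h1, zero_mul, add_zero] at this
      exact (mul_eq_zero.1 this).resolve_left hl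
    simp only [Pv_eq] at key
    generalize -l 2 / l 0 = c at *
    have k0 := key 0
    have k1 := key 1
    have k2 := key (-1)
    refine ⟨?_, ?_, ?_⟩
    · linear_combination (k1 + k2) / 2 - k0
    · linear_combination (k1 - k2) / 2
    · linear_combination k0

theorem IsInvAffineLine.horizontal {a : Sys} {l : Fin 3 → ℂ} (h : IsInvAffineLine a l) (h1 : l 0 = 0) :
    l 1 ≠ 0 ∧ ∃ c : ℂ, l = l 1 • ![0, 1, -c] ∧ (a 9 : ℂ) = 0 ∧ 2 * a 10 * c + a 7 = 0 ∧
      (a 11 : ℂ) * c ^ 2 + a 8 * c + a 6 = 0 := by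
  rw [isInvAffineLine_iff_affine] at h
  obtain ⟨h0, h⟩ := h
  have hl : l 1 ≠ 0 := fun h2 => h0 (by rw [h1, h2])
  refine ⟨hl, -l 2 / l 1, ?_, ?_⟩
  · ext i; fin_cases i
    · simp [h1]
    · simp
    · simp; field_simp
  · have key : ∀ x, Qv a ![x, -l 2 / l 1, 1] = 0 := fun x => by
      have := h x (-l 2 / l 1) (by rw [h1]; field_simp; ring)
      rw [h1, zero_mul, zero_add] at this
      exact (mul_eq_zero.1 this).resolve_left hl
    simp only [Qv_eq] at key
    generalize -l 2 / l 1 = c at *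
    have k0 := key 0
    have k1 := key 1
    have k2 := key (-1)
    refine ⟨?_, ?_, ?_⟩
    · linear_combination (k1 + k2) / 2 - k0
    · linear_combination (k1 - k2) / 2
    · linear_combination k0

/-- A nondegenerate system has no line of singular points. -/
theorem IsQS.not_common_line {a : Sys} (h : IsQS a) {l : Fin 3 → ℝ} (hl : (l 0, l 1) ≠ (0, 0))
    (hp : ∀ x y : ℝ, l 0 * x + l 1 * y + l 2 = 0 → eval ![x, y] (p a) = 0)
    (hq : ∀ x y : ℝ, l 0 * x + l 1 * y + l 2 = 0 → eval ![x, y] (q a) = 0) : False := by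
  have e : ∀ z : Fin 2 → ℝ, ![z 0, z 1] = z := fun z => by ext i; fin_cases i <;> rfl
  have h1 : affForm l ∣ p a := (affForm_dvd_iff hl _).2 fun z hz => by simpa [e] using hp (z 0) (z 1) hz
  have h2 : affForm l ∣ q a := (affForm_dvd_iff hl _).2 fun z hz => by simpa [e] using hq (z 0) (z 1) hz
  obtain ⟨k, hk⟩ := (h.1 h1 h2).exists_left_inv
  obtain ⟨x, y, hxy⟩ : ∃ x y : ℝ, l 0 * x + l 1 * y + l 2 = 0 := by
    by_cases h0 : l 0 = 0
    · have h1 : l 1 ≠ 0 := fun h1 => hl (by rw [h0, h1])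
      exact ⟨0, -l 2 / l 1, by rw [h0]; field_simp; ring⟩
    · exact ⟨-l 2 / l 0, 0, by field_simp; ring⟩
  have := congrArg (eval ![x, y]) hk
  rw [map_mul, eval_affForm] at this
  simp [hxy] at this

theorem IsQS.not_common_vertical {a : Sys} (h : IsQS a) (c : ℝ) (hp : ∀ y : ℝ, eval ![c, y] (p a) = 0)
    (hq : ∀ y : ℝ, eval ![c, y] (q a) = 0) : False :=
  h.not_common_line (l := ![1, 0, -c]) (by simp)
    (fun x y hxy => by
      have : x = c := by simp at hxy; linarith
      rw [this]; exact hp y)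
    (fun x y hxy => by
      have : x = c := by simp at hxy; linarith
      rw [this]; exact hq y)

/-- In a simple direction the extactic polynomial has at most one factor, if there is a single invariant line. -/
theorem no_double_vertical {a : Sys} (ha : IsQS a) (hs : Splits a (extactic a)) (h4 : a 4 ≠ 0)
    (h11 : a 11 ≠ 2 * a 4) {F : MvPolynomial (Fin 3) ℂ} (hF : F ∣ extactic a) {R : ℂ → ℂ → ℂ}
    (hR : ∀ y, Continuous fun x => R x y) (hFR : ∀ x y, eval ![x, y, 0] F = x ^ 2 * R x y) {x' y' : ℂ}
    (hne : eval ![x', y', 0] F ≠ 0) : False := by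
  have h4' : (a 4 : ℂ) ≠ 0 := by exact_mod_cast h4
  obtain ⟨c, hc⟩ : ∃ c : ℝ, c = -a 2 / (2 * a 4) := ⟨_, rfl⟩
  have key : ∀ {G}, G ∣ extactic a → eval ![0, 1, 0] G = 0 → eval ![x', y', 0] G ≠ 0 →
      linForm ![1, 0, -(c : ℂ)] ∣ G ∧ a 5 = 0 ∧ a 3 * c ^ 2 + a 1 * c + a 0 = 0 := by
    intro G hG h0 h1
    obtain ⟨l, hl, hd, h2⟩ := (hs.of_dvd hG).exists_direction h0 h1
    obtain ⟨hl0, c', hc', e5, e2, e0⟩ := hl.vertical (by simpa using h2)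
    have hcc : c' = c := by
      rw [hc]; push_cast
      field_simp
      linear_combination e2
    rw [hcc] at hc' e0
    rw [hc', linForm_smul] at hd
    exact ⟨dvd_of_mul_left_dvd hd, by exact_mod_cast e5, by exact_mod_cast e0⟩
  obtain ⟨⟨G, hG⟩, h5, h0⟩ := key hF (by rw [hFR]; ring) hne
  have hGR : ∀ y, eval ![0, y, 0] G = 0 := by
    intro y
    have h1 : Continuous fun x : ℂ => eval ![x, y, 0] G := by
      have : Continuous fun x : ℂ => (![x, y, 0] : Fin 3 → ℂ) := by
        rw [continuous_pi_iff]; intro i; fin_cases i <;> simp <;> fun_prop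
      exact (MvPolynomial.continuous_eval G).comp this
    have h2 : (fun x : ℂ => eval ![x, y, 0] G) = fun x => x * R x y := by
      refine h1.ext_on (dense_compl_singleton (0 : ℂ)) (continuous_id.mul (hR y)) fun x hx => ?_
      have := hFR x y
      rw [hG, map_mul, eval_linForm] at this
      simp at this
      apply mul_left_cancel₀ hx
      linear_combination this
    have := congrFun h2 0
    simpa using this
  have hne' : eval ![x', y', 0] G ≠ 0 := fun h => hne (by rw [hG, map_mul, h, mul_zero])
  obtain ⟨⟨G', hG'⟩, -⟩ := key ((Dvd.intro_left _ hG.symm).trans hF) (hGR 1) hne'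
  set L : MvPolynomial (Fin 3) ℂ := linForm ![1, 0, -(c : ℂ)] with hL
  have hL0 : (![1, 0, -(c : ℂ)] : Fin 3 → ℂ) ≠ 0 := fun h => one_ne_zero (congrFun h 0)
  have hLp : Prime L := linForm_prime hL0
  have hLL : L * L ∣ extactic a := by
    refine Dvd.dvd.trans ⟨G', ?_⟩ hF
    rw [hG, hG', mul_assoc]
  have h2 : 2 * a 4 * c + a 2 = 0 := by rw [hc]; field_simp; ring
  have h2' : 2 * (a 4 : ℂ) * c + a 2 = 0 := by exact_mod_cast h2
  have h0' : (a 3 : ℂ) * c ^ 2 + a 1 * c + a 0 = 0 := by exact_mod_cast h0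
  set K : MvPolynomial (Fin 3) ℂ := linForm ![(a 3 : ℂ), 2 * a 4, a 1 + c * a 3] with hK
  set W : MvPolynomial (Fin 3) ℂ := K * linForm ![2 * (a 10 : ℂ), 2 * a 11, a 8] - K ^ 2
    - C (2 * (a 4 : ℂ)) * cplx (Q a) with hW
  set B : MvPolynomial (Fin 3) ℂ := K ^ 2 * linForm ![2 * (a 9 : ℂ), 2 * a 10, a 7]
    - C (a 3 : ℂ) * K * cplx (Q a) with hB
  have hE : extactic a = L * (L * B + cplx (Q a) * W) := by
    refine MvPolynomial.funext fun z => ?_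
    have hP : Pv a z = (z 0 - c * z 2) * (a 3 * z 0 + 2 * a 4 * z 1 + (a 1 + c * a 3) * z 2) := by
      simp only [Pv, h5]; push_cast
      linear_combination (z 1 * z 2) * h2' + z 2 ^ 2 * h0'
    rw [eval_extactic, hP]
    simp only [hW, hB, hK, hL, map_add, map_sub, map_mul, map_pow, eval_linForm, eval_Q, eval_C, dP0, dP1, dQ0, dQ1,
      Matrix.cons_val, h5]
    push_cast
    linear_combination -(Qv a z ^ 2 * z 2) * h2'
  rw [hE, mul_dvd_mul_iff_left hLp.ne_zero] at hLL
  have hQW := (dvd_add_right (dvd_mul_right L B)).1 hLL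
  rcases hLp.dvd_or_dvd hQW with h | h
  · refine ha.not_common_vertical c (fun y => ?_) fun y => ?_
    · rw [eval_p]; simp [h5]; linear_combination y * h2 + h0
    · have := (linForm_dvd_iff hL0 _).1 h ![c, y, 1] (by simp)
      rw [eval_Q, Qv_ofReal] at this
      exact_mod_cast this
  · have := (linForm_dvd_iff hL0 _).1 h ![0, 1, 0] (by simp)
    simp [hW, hK, eval_linForm, eval_Q, Qv] at this
    have h6 : (a 4 : ℂ) * (a 11 - 2 * a 4) = 0 := by linear_combination this / 2
    have h7 : a 4 * (a 11 - 2 * a 4) = 0 := by exact_mod_cast h6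
    rcases mul_eq_zero.1 h7 with h8 | h8
    · exact h4 h8
    · exact h11 (by linarith)

/-- Roots of the leading coefficients give invariant lines. -/
theorem Splits.line_of_ext5 {a : Sys} (hs : Splits a (extactic a)) {x y x' y' : ℂ} (h : ext5 a x y = 0)
    (h' : ext5 a x' y' ≠ 0) : ∃ l, IsInvAffineLine a l ∧ l 0 * x + l 1 * y = 0 := by
  rw [← eval_extactic_zero] at h h'
  obtain ⟨l, h1, -, h2⟩ := hs.exists_direction h h'
  exact ⟨l, h1, h2⟩

theorem Splits.line_of_ext4 {a : Sys} (hs : Splits a (extactic a)) (h5 : ∀ x y, ext5 a x y = 0)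
    {x y x' y' : ℂ} (h : ext4 a x y = 0)
    (h' : ext4 a x' y' ≠ 0) : ∃ l, IsInvAffineLine a l ∧ l 0 * x + l 1 * y = 0 := by
  obtain ⟨F, hF, e⟩ := exists_factor4 h5
  rw [← e] at h h'
  obtain ⟨l, h1, -, h2⟩ := (hs.of_dvd hF).exists_direction h h'
  exact ⟨l, h1, h2⟩

theorem Splits.line_of_ext3 {a : Sys} (hs : Splits a (extactic a)) (h5 : ∀ x y, ext5 a x y = 0)
    (h4 : ∀ x y, ext4 a x y = 0) {x y x' y' : ℂ} (h : ext3 a x y = 0)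
    (h' : ext3 a x' y' ≠ 0) : ∃ l, IsInvAffineLine a l ∧ l 0 * x + l 1 * y = 0 := by
  obtain ⟨F, hF, e⟩ := exists_factor3 h5 h4
  rw [← e] at h h'
  obtain ⟨l, h1, -, h2⟩ := (hs.of_dvd hF).exists_direction h h'
  exact ⟨l, h1, h2⟩

theorem direction_of_C2 {a : Sys} {t u v w : ℝ} (hC : C2 a = cf t u v w) {l : Fin 3 → ℂ} (hl : IsInvAffineLine a l)
    {x y : ℂ} (h : l 0 * x + l 1 * y = 0) : t * x ^ 3 + u * x ^ 2 * y + v * x * y ^ 2 + w * y ^ 3 = 0 := by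
  have := hl.direction h
  obtain ⟨h9, h3, h11, h5⟩ := C2_coef hC
  rw [Pv_eq, Qv_eq, h9, h3, h11, h5] at this
  push_cast at this
  linear_combination this

/-! ### Three real points at infinity -/

/-- The interchange of the coordinates. -/
def swapG : AffTransf := linG 0 1 1 0 (by norm_num)

/-- The transformation with `x - y` and `-y` as new coordinates. -/
def shearG : AffTransf := linG 1 (-1) 0 (-1) (by norm_num)

theorem pull_swapG (a : Sys) : pull swapG (-1) a =
    ![a 6, a 8, a 7, a 11, a 10, a 9, a 0, a 2, a 1, a 5, a 4, a 3] := by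
  ext i
  fin_cases i <;> simp [pull, quadComp, swapG, linG]

theorem pull_shearG (a : Sys) : pull shearG (-1) a =
    ![a 0 - a 6, a 1 - a 7, -(a 1 + a 2) + (a 7 + a 8), a 3 - a 9, -(a 3 + a 4) + (a 9 + a 10),
      a 3 + 2 * a 4 + a 5 - (a 9 + 2 * a 10 + a 11), -a 6, -a 7, a 7 + a 8, -a 9, a 9 + a 10,
      -(a 9 + 2 * a 10 + a 11)] := by
  ext i
  fin_cases i <;> simp [pull, quadComp, shearG, linG] <;> ring

theorem C2_of_coef {a : Sys} {t u v w : ℝ} (h9 : a 9 = -t) (h3 : a 3 = 2 * a 10 + u) (h11 : a 11 = 2 * a 4 - v)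
    (h5 : a 5 = w) : C2 a = cf t u v w := by
  rw [C2_eq_cf, cf_inj, h9, h3, h11, h5]
  refine ⟨?_, ?_, ?_, ?_⟩ <;> ring

/-- The quadratic parts with `C₂ = x y (x - y)`. -/
def Threefold (a : Sys) (g h : ℝ) : Prop :=
  a 3 = g ∧ a 4 = (h - 1) / 2 ∧ a 5 = 0 ∧ a 9 = 0 ∧ a 10 = (g - 1) / 2 ∧ a 11 = h

theorem Threefold.C2_eq {a : Sys} {g h : ℝ} (ha : Threefold a g h) : C2 a = cf 0 1 (-1) 0 := by
  obtain ⟨h3, h4, h5, h9, h10, h11⟩ := ha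
  apply C2_of_coef <;> linarith

theorem threefold_of_C2 {a : Sys} (hC : C2 a = cf 0 1 (-1) 0) : Threefold a (a 3) (a 11) := by
  obtain ⟨h9, h3, h11, h5⟩ := C2_coef hC
  refine ⟨rfl, ?_, h5, ?_, ?_, rfl⟩ <;> linarith

theorem Threefold.swap {a : Sys} {g h : ℝ} (ha : Threefold a g h) : Threefold (pull swapG (-1) a) h g := by
  obtain ⟨h3, h4, h5, h9, h10, h11⟩ := ha
  rw [pull_swapG]
  exact ⟨h11, h10, h9, h5, h4, h3⟩

theorem Threefold.shear {a : Sys} {g h : ℝ} (ha : Threefold a g h) :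
    Threefold (pull shearG (-1) a) g (1 - g - h) := by
  obtain ⟨h3, h4, h5, h9, h10, h11⟩ := ha
  rw [pull_shearG]
  refine ⟨?_, ?_, ?_, ?_, ?_, ?_⟩ <;> simp [h3, h4, h5, h9, h10, h11] <;> ring

theorem Threefold.ext5_eq {a : Sys} {g h : ℝ} (ha : Threefold a g h) (x y : ℂ) : ext5 a x y =
    -(x * y * (x - y)) * (g * (g - 1) * x ^ 2 + 2 * g * h * x * y + h * (h - 1) * y ^ 2) := by
  obtain ⟨h3, h4, h5, h9, h10, h11⟩ := ha
  simp only [ext5, h3, h4, h5, h9, h10, h11]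
  push_cast
  ring

theorem Threefold.ext4_eq {a : Sys} (ha : Threefold a 1 0) (x y : ℂ) : ext4 a x y =
    -(x * (x - y)) * (a 7 * x ^ 2 + 2 * a 8 * x * y - a 8 * y ^ 2) := by
  obtain ⟨h3, h4, h5, h9, h10, h11⟩ := ha
  simp only [ext4, h3, h4, h5, h9, h10, h11]
  push_cast
  ring

theorem Threefold.direction {a : Sys} {g h : ℝ} (ha : Threefold a g h) {l : Fin 3 → ℂ}
    (hl : IsInvAffineLine a l) {x y : ℂ} (hxy : l 0 * x + l 1 * y = 0) : x * y * (x - y) = 0 := by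
  have := direction_of_C2 ha.C2_eq hl hxy
  push_cast at this
  linear_combination this

theorem Threefold.not_double {a : Sys} (hq : IsQSL6 a) {g : ℝ} (ha : Threefold a g 0) {F : MvPolynomial (Fin 3) ℂ}
    (hF : F ∣ extactic a) {R : ℂ → ℂ → ℂ} (hR : ∀ y, Continuous fun x => R x y)
    (hFR : ∀ x y, eval ![x, y, 0] F = x ^ 2 * R x y) {x' y' : ℂ} (hne : eval ![x', y', 0] F ≠ 0) : False := by
  refine no_double_vertical hq.1 hq.splits ?_ ?_ hF hR hFR hne
  · rw [ha.2.1]; norm_num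
  · rw [ha.2.1, ha.2.2.2.2.2]; norm_num

theorem Threefold.not_isQSL6_one_zero_aux {a : Sys} (ha : Threefold a 1 0) (hq : IsQSL6 a) (h8 : a 8 = 0)
    (h7 : a 7 ≠ 0) : False := by
  have h7' : (a 7 : ℂ) ≠ 0 := by exact_mod_cast h7
  obtain ⟨F, hF, hFe⟩ := exists_factor4 (a := a) (fun x y => by rw [ha.ext5_eq]; push_cast; ring)
  refine ha.not_double hq hF (R := fun x y => -(a 7 * x * (x - y))) (fun y => by fun_prop)
    (fun x y => by rw [hFe, ha.ext4_eq, h8]; push_cast; ring) (x' := 1) (y' := 0) ?_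
  rw [hFe, ha.ext4_eq, h8]
  simpa using h7

theorem Threefold.not_isQSL6_one_zero {a : Sys} (ha : Threefold a 1 0) (hq : IsQSL6 a) : False := by
  have hs := hq.splits
  have e5 : ∀ x y, ext5 a x y = 0 := fun x y => by rw [ha.ext5_eq]; push_cast; ring
  by_cases h8 : a 8 = 0
  · by_cases h7 : a 7 = 0
    · have e4 : ∀ x y, ext4 a x y = 0 := fun x y => by rw [ha.ext4_eq, h7, h8]; push_cast; ring
      have e3 : ∀ x y, ext3 a x y = -a 6 * (x * (x - y) * (2 * x - y)) := fun x y => by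
        obtain ⟨h3, h4, h5, h9, h10, h11⟩ := ha
        simp only [ext3, h3, h4, h5, h7, h8, h9, h10, h11]
        push_cast
        ring
      have h6 : a 6 ≠ 0 := by
        intro h6
        obtain ⟨h3, h4, h5, h9, h10, h11⟩ := ha
        apply hq.1.q_ne_zero
        rw [q_eq_qf, h6, h7, h8, h9, h10, h11]
        simp [lf, qf]
      have h6' : (a 6 : ℂ) ≠ 0 := by exact_mod_cast h6
      obtain ⟨l, hl, hxy⟩ := hs.line_of_ext3 e5 e4 (x := 1) (y := 2) (x' := 1) (y' := -1)
        (by rw [e3]; ring) (by rw [e3]; norm_num [h6'])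
      have := ha.direction hl hxy
      norm_num at this
    · exact ha.not_isQSL6_one_zero_aux hq h8 h7
  · by_cases h78 : a 7 + a 8 = 0
    · have h := ha.shear
      norm_num at h
      refine h.not_isQSL6_one_zero_aux (hq.pull shearG (by norm_num)) ?_ ?_
      · rw [pull_shearG]; simpa using h78
      · rw [pull_shearG]; simp; intro h7; apply h8; linarith
    · have h8' : (a 8 : ℂ) ≠ 0 := by exact_mod_cast h8
      have h78' : (a 7 : ℂ) + a 8 ≠ 0 := by exact_mod_cast h78
      obtain ⟨s, hs'⟩ := IsAlgClosed.exists_pow_nat_eq (((a 7 : ℂ) + a 8) / a 8) (n := 2) (by norm_num)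
      have hs0 : s ≠ 0 := by
        rintro rfl
        have : ((a 7 : ℂ) + a 8) / a 8 = 0 := by rw [← hs']; norm_num
        exact div_ne_zero h78' h8' this
      have hs2 : (a 8 : ℂ) * s ^ 2 = a 7 + a 8 := by rw [hs']; field_simp
      have hne : ∃ x' y', ext4 a x' y' ≠ 0 := by
        by_contra! h0
        have h1 := h0 1 (-1)
        have h2 := h0 1 2
        rw [ha.ext4_eq] at h1 h2
        apply h8'
        linear_combination h1 / 6 + h2 / 3
      obtain ⟨x', y', hne⟩ := hne
      have key : ∀ t : ℂ, t ^ 2 = s ^ 2 → (1 + t) * t = 0 := by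
        intro t ht
        obtain ⟨l, hl, hxy⟩ := hs.line_of_ext4 e5 (x := 1) (y := 1 + t)
          (by rw [ha.ext4_eq]; linear_combination -t * (hs2 + a 8 * ht)) hne
        have := ha.direction hl hxy
        linear_combination -this
      have k1 := key s rfl
      have k2 := key (-s) (by ring)
      apply hs0
      linear_combination (k1 - k2) / 2

theorem Threefold.not_isQSL6_left {a : Sys} {g : ℝ} (ha : Threefold a g 0) (hq : IsQSL6 a) : False := by
  by_cases h0 : g = 0
  · subst h0
    have h1 := ha.shear.swap
    norm_num at h1
    exact h1.not_isQSL6_one_zero ((hq.pull shearG (by norm_num)).pull swapG (by norm_num))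
  by_cases h1 : g = 1
  · subst h1
    exact ha.not_isQSL6_one_zero hq
  have h0' : (g : ℂ) ≠ 0 := by exact_mod_cast h0
  have h1' : (g : ℂ) - 1 ≠ 0 := sub_ne_zero.2 (by exact_mod_cast h1)
  refine ha.not_double hq dvd_rfl (R := fun x y => -(x * y * (x - y)) * (g * (g - 1))) (fun y => by fun_prop)
    (fun x y => by rw [eval_extactic_zero, ha.ext5_eq]; push_cast; ring) (x' := 1) (y' := -1) ?_
  rw [eval_extactic_zero, ha.ext5_eq]
  norm_num [h0', h1']

theorem Threefold.not_isQSL6 {a : Sys} {g h : ℝ} (ha : Threefold a g h) (hq : IsQSL6 a)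
    (hgh : g * h * (1 - g - h) = 0) : False := by
  rcases mul_eq_zero.1 hgh with h0 | h0
  · rcases mul_eq_zero.1 h0 with h0 | h0
    · rw [h0] at ha
      exact ha.swap.not_isQSL6_left (hq.pull swapG (by norm_num))
    · rw [h0] at ha
      exact ha.not_isQSL6_left hq
  · have := ha.shear
    rw [h0] at this
    exact this.not_isQSL6_left (hq.pull shearG (by norm_num))

/-- The invariant lines force `N = 0`. -/
theorem Threefold.N_eq_zero {a : Sys} {g h : ℝ} (ha : Threefold a g h) (hq : IsQSL6 a) : N a = 0 := by
  have hbad := fun hgh => ha.not_isQSL6 hq hgh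
  have hg : g ≠ 0 := fun h => hbad (by rw [h]; ring)
  have hh : h ≠ 0 := fun h => hbad (by rw [h]; ring)
  have hk : 1 - g - h ≠ 0 := fun h => hbad (by rw [h]; ring)
  suffices hN : (g = 1 ∧ h = 1) ∨ (g = 1 ∧ h = -1) ∨ (g = -1 ∧ h = 1) by
    obtain ⟨h3, h4, h5, h9, h10, h11⟩ := ha
    rw [N_eq_qf, qf_eq_zero, h3, h4, h5, h9, h10, h11]
    rcases hN with ⟨rfl, rfl⟩ | ⟨rfl, rfl⟩ | ⟨rfl, rfl⟩ <;> norm_num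
  have hs := hq.splits
  have hg' : (g : ℂ) ≠ 0 := by exact_mod_cast hg
  have hh' : (h : ℂ) ≠ 0 := by exact_mod_cast hh
  have hk' : (1 : ℂ) - g - h ≠ 0 := by exact_mod_cast hk
  have hne : ∃ x' y', ext5 a x' y' ≠ 0 := by
    by_contra! h0
    have h1 := h0 1 (-1)
    have h2 := h0 2 1
    have h3 := h0 1 2
    rw [ha.ext5_eq] at h1 h2 h3
    have : (g : ℂ) * h = 0 := by linear_combination (-h2 + h3 - 5 * h1) / 36
    exact mul_ne_zero hg' hh' this
  obtain ⟨x', y', hne⟩ := hne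
  have key : ∀ x y : ℂ, g * (g - 1) * x ^ 2 + 2 * g * h * x * y + h * (h - 1) * y ^ 2 = 0 →
      x * y * (x - y) = 0 := by
    intro x y hxy
    obtain ⟨l, hl, h1⟩ := hs.line_of_ext5 (x := x) (y := y) (by rw [ha.ext5_eq, hxy, mul_zero]) hne
    exact ha.direction hl h1
  by_cases h1 : g = 1
  · subst h1
    have := key (1 - h) 2 (by push_cast; ring)
    have h2 : (1 - h) * (1 + h) = 0 := by
      have : ((1 : ℂ) - h) * (1 + h) = 0 := by linear_combination -this / 2
      exact_mod_cast this
    rcases mul_eq_zero.1 h2 with h2 | h2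
    · exact Or.inl ⟨rfl, by linarith⟩
    · exact Or.inr (Or.inl ⟨rfl, by linarith⟩)
  · have h1' : (g : ℂ) - 1 ≠ 0 := sub_ne_zero.2 (by exact_mod_cast h1)
    obtain ⟨s, hs'⟩ := IsAlgClosed.exists_pow_nat_eq
      (((g : ℂ) * h) ^ 2 - g * (g - 1) * (h * (h - 1))) (n := 2) (by norm_num)
    have hA : (g : ℂ) * (g - 1) ≠ 0 := mul_ne_zero hg' h1'
    have key2 : ∀ t : ℂ, t ^ 2 = s ^ 2 → t = g * h ∨ t = g * h + g * (g - 1) := by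
      intro t ht
      have := key (t - g * h) (g * (g - 1)) (by linear_combination g * (g - 1) * (ht + hs'))
      rcases mul_eq_zero.1 this with h2 | h2
      · exact Or.inl (sub_eq_zero.1 ((mul_eq_zero.1 h2).resolve_right hA))
      · right; linear_combination h2
    have hgh := mul_ne_zero hg' hh'
    rcases key2 s rfl with e1 | e1 <;> rcases key2 (-s) (by ring) with e2 | e2
    · exact absurd (by linear_combination (-e1 - e2) / 2) hgh
    · right; right
      have h2 : (g : ℂ) * (2 * h + g - 1) = 0 := by linear_combination -e1 - e2
      have h3 : ((g : ℂ) * (g - 1)) * (h * (h - 1)) = 0 := by rw [e1] at hs'; linear_combination hs'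
      have h4 := (mul_eq_zero.1 h2).resolve_left hg'
      have h5 := (mul_eq_zero.1 ((mul_eq_zero.1 h3).resolve_left hA)).resolve_left hh'
      have h6 : h = 1 := by
        have : (h : ℂ) = 1 := by linear_combination h5
        exact_mod_cast this
      refine ⟨?_, h6⟩
      have : (g : ℂ) = -1 := by linear_combination h4 - 2 * h5
      exact_mod_cast this
    · right; right
      have h2 : (g : ℂ) * (2 * h + g - 1) = 0 := by linear_combination -e1 - e2
      have h3 : ((g : ℂ) * (g - 1)) * (h * (h - 1)) = 0 := by
        have e3 : s = -((g : ℂ) * h) := by linear_combination -e2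
        rw [e3] at hs'; linear_combination hs'
      have h4 := (mul_eq_zero.1 h2).resolve_left hg'
      have h5 := (mul_eq_zero.1 ((mul_eq_zero.1 h3).resolve_left hA)).resolve_left hh'
      have h6 : h = 1 := by
        have : (h : ℂ) = 1 := by linear_combination h5
        exact_mod_cast this
      refine ⟨?_, h6⟩
      have : (g : ℂ) = -1 := by linear_combination h4 - 2 * h5
      exact_mod_cast this
    · exfalso
      have h2 : (g : ℂ) * (1 - g - h) = 0 := by linear_combination (e1 + e2) / 2
      exact mul_ne_zero hg' hk' h2

theorem IsQSL6.orbit_of_threefold {a : Sys} (hq : IsQSL6 a) (hC : C2 a = cf 0 1 (-1) 0) :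
    ∃ i, SameOrbit (rep i) a := by
  have hN := (threefold_of_C2 hC).N_eq_zero hq
  obtain ⟨g, s, hs, hC', h3, h4, h5, h9, h10, h11⟩ := exists_diagonal hC hN
  suffices ∃ i, SameOrbit (rep i) (QuadSL.pull g s a) by
    obtain ⟨i, hi⟩ := this
    exact ⟨i, hi.trans (sameOrbit_pull g hs a)⟩
  have hq' := hq.pull g hs
  generalize QuadSL.pull g s a = b at *
  clear hq hN hC
  have hs := hq'.splits
  have e5 : ∀ x y, ext5 b x y = -2 * (x * y) ^ 2 * (x - y) := fun x y => by
    simp only [ext5, h3, h4, h5, h9, h10, h11]; push_cast; ring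
  have hne : ext5 b 1 (-1) ≠ 0 := by rw [e5]; norm_num
  obtain ⟨l, hl, hxy⟩ := hs.line_of_ext5 (x := 0) (y := 1) (by rw [e5]; ring) hne
  obtain ⟨-, c, -, -, e2, -⟩ := hl.vertical (by simpa using hxy)
  have h2 : b 2 = 0 := by
    rw [h4] at e2
    have : (b 2 : ℂ) = 0 := by push_cast at e2; linear_combination e2
    exact_mod_cast this
  obtain ⟨l, hl, hxy⟩ := hs.line_of_ext5 (x := 1) (y := 0) (by rw [e5]; ring) hne
  obtain ⟨-, c, -, -, e2, -⟩ := hl.horizontal (by simpa using hxy)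
  have h7 : b 7 = 0 := by
    rw [h10] at e2
    have : (b 7 : ℂ) = 0 := by push_cast at e2; linear_combination e2
    exact_mod_cast this
  obtain ⟨l, hl, hxy⟩ := hs.line_of_ext5 (x := 1) (y := 1) (by rw [e5]; ring) hne
  rw [isInvAffineLine_iff_affine] at hl
  obtain ⟨hl0, hl⟩ := hl
  have hl1 : l 1 = -l 0 := by linear_combination hxy
  have hl00 : l 0 ≠ 0 := fun h => hl0 (by rw [hl1, h, neg_zero])
  obtain ⟨w, hw⟩ : ∃ w, l 2 = -(l 0 * w) := ⟨-l 2 / l 0, by field_simp⟩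
  have k : ∀ y, Pv b ![y + w, y, 1] - Qv b ![y + w, y, 1] = 0 := fun y => by
    have := hl (y + w) y (by rw [hl1, hw]; ring)
    rw [hl1] at this
    apply mul_left_cancel₀ hl00
    linear_combination this
  simp only [Pv_eq, Qv_eq, h2, h3, h4, h5, h7, h9, h10, h11] at k
  have k0 := k 0
  have k1 := k 1
  push_cast at k0 k1
  have f1 : 2 * w + b 1 - b 8 = 0 := by linear_combination k1 - k0
  have f2 : (b 1 : ℂ) ^ 2 - 4 * b 0 = b 8 ^ 2 - 4 * b 6 := by
    linear_combination -4 * k0 + (2 * w + b 1 + b 8) * f1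
  have f3 : b 1 ^ 2 - 4 * b 0 = b 8 ^ 2 - 4 * b 6 := by exact_mod_cast f2
  have e := eq_vec b
  rw [h2, h3, h4, h5, h7, h9, h10, h11] at e
  rcases sameOrbit_of_diagonal f3 e with h | h | h
  · exact ⟨0, h.2⟩
  · exact ⟨1, h.2⟩
  · exact ⟨4, h.2⟩

/-! ### One real point at infinity -/

theorem sq_add_sq_ne_zero {x y : ℝ} (h : (x : ℂ) ^ 2 + (y : ℂ) ^ 2 = 0) : x = 0 ∧ y = 0 := by
  have h1 : x ^ 2 + y ^ 2 = 0 := by exact_mod_cast h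
  constructor <;> nlinarith [sq_nonneg x, sq_nonneg y]

theorem not_isQSL6_of_circular {a : Sys} (hq : IsQSL6 a) (h3 : a 3 = 0) (h4 : a 4 = 0) (h5 : a 5 = 0)
    (h9 : a 9 = -1) (h10 : a 10 = 0) (h11 : a 11 = -1) : False := by
  have hs := hq.splits
  have hC : C2 a = cf 1 0 1 0 := by apply C2_of_coef <;> linarith
  have hdir : ∀ {l}, IsInvAffineLine a l → ∀ {x y : ℂ}, l 0 * x + l 1 * y = 0 → x * (x ^ 2 + y ^ 2) = 0 := by
    intro l hl x y h
    have := direction_of_C2 hC hl h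
    push_cast at this
    linear_combination this
  have e5 : ∀ x y, ext5 a x y = 0 := fun x y => by
    simp only [ext5, h3, h4, h5, h9, h10, h11]; push_cast; ring
  have e4 : ∀ x y, ext4 a x y = -(x ^ 2 + y ^ 2) * (a 2 * x ^ 2 - 2 * a 1 * x * y - a 2 * y ^ 2) := fun x y => by
    simp only [ext4, h3, h4, h5, h9, h10, h11]; push_cast; ring
  by_cases h2 : a 2 = 0
  · by_cases h1 : a 1 = 0
    · have e4' : ∀ x y, ext4 a x y = 0 := fun x y => by rw [e4, h1, h2]; push_cast; ring
      have e3 : ∀ x y, ext3 a x y = 2 * a 0 * (x ^ 2 + y ^ 2) * y := fun x y => by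
        simp only [ext3, h1, h2, h3, h4, h5, h9, h10, h11]; push_cast; ring
      have h0 : a 0 ≠ 0 := by
        intro h0
        apply hq.1.p_ne_zero
        rw [p_eq_qf, h0, h1, h2, h3, h4, h5]
        simp [lf, qf]
      obtain ⟨l, hl, hxy⟩ := hs.line_of_ext3 e5 e4' (x := 1) (y := 0) (x' := 0) (y' := 1)
        (by rw [e3]; ring) (by rw [e3]; simpa using h0)
      simpa using hdir hl hxy
    · obtain ⟨l, hl, hxy⟩ := hs.line_of_ext4 e5 (x := 1) (y := 0) (x' := 1) (y' := 1)
        (by rw [e4, h2]; push_cast; ring) (by rw [e4, h2]; norm_num; exact h1)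
      simpa using hdir hl hxy
  · have h2' : (a 2 : ℂ) ≠ 0 := by exact_mod_cast h2
    obtain ⟨s, hs2⟩ := IsAlgClosed.exists_pow_nat_eq ((a 1 : ℂ) ^ 2 + a 2 ^ 2) (n := 2) (by norm_num)
    have key : ∀ t : ℂ, t ^ 2 = s ^ 2 → (a 1 + t) ^ 2 + (a 2 : ℂ) ^ 2 = 0 := by
      intro t ht
      obtain ⟨l, hl, hxy⟩ := hs.line_of_ext4 e5 (x := a 1 + t) (y := a 2) (x' := 1) (y' := 0)
        (by rw [e4]; linear_combination (-((a 1 + t) ^ 2 + (a 2 : ℂ) ^ 2) * a 2) * (ht + hs2))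
        (by rw [e4]; simpa using h2)
      refine (mul_eq_zero.1 (hdir hl hxy)).resolve_left fun h0 => h2' ?_
      have ht1 : t = -a 1 := by linear_combination h0
      rw [ht1] at ht
      have : (a 2 : ℂ) ^ 2 = 0 := by linear_combination -ht - hs2
      exact pow_eq_zero_iff (two_ne_zero) |>.1 this
    have k1 := key s rfl
    have k2 := key (-s) (by ring)
    have : (a 1 : ℂ) ^ 2 + (a 2 : ℂ) ^ 2 = 0 := by linear_combination (k1 + k2) / 4 - hs2 / 2
    exact h2 (sq_add_sq_ne_zero this).2

theorem IsQSL6.orbit_of_onefold {a : Sys} (hq : IsQSL6 a) (hC : C2 a = cf 1 0 1 0) :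
    ∃ i, SameOrbit (rep i) a := by
  have hs := hq.splits
  have hdir : ∀ {l}, IsInvAffineLine a l → ∀ {x y : ℂ}, l 0 * x + l 1 * y = 0 → x * (x ^ 2 + y ^ 2) = 0 := by
    intro l hl x y h
    have := direction_of_C2 hC hl h
    push_cast at this
    linear_combination this
  obtain ⟨h9, h3, h11, h5⟩ := C2_coef hC
  obtain ⟨g, hg⟩ : ∃ g, g = 2 * a 10 := ⟨_, rfl⟩
  obtain ⟨h, hh⟩ : ∃ h, h = a 11 := ⟨_, rfl⟩
  have h4 : a 4 = (h + 1) / 2 := by linarith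
  have h10 : a 10 = g / 2 := by linarith
  rw [← hg, add_zero] at h3
  rw [← hh] at h11
  have h11' : a 11 = h := hh.symm
  have e5 : ∀ x y, ext5 a x y = -(x * (x ^ 2 + y ^ 2)) *
      ((g ^ 2 + h + 1) * x ^ 2 + 2 * g * h * x * y + (h ^ 2 + h) * y ^ 2) := fun x y => by
    simp only [ext5, h3, h4, h5, h9, h10, h11']; push_cast; ring
  have main : g = 0 ∧ h = 1 := by
    by_cases hD : h * (h + 1) = 0
    · exfalso
      rcases mul_eq_zero.1 hD with h0 | h0
      · rw [h0] at h4 h11' e5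
        refine no_double_vertical hq.1 hs (by rw [h4]; norm_num) (by rw [h4, h11']; norm_num) dvd_rfl
          (R := fun x y => -(x * (x ^ 2 + y ^ 2)) * (g ^ 2 + 1)) (fun y => by fun_prop)
          (fun x y => by rw [eval_extactic_zero, e5]; push_cast; ring) (x' := 1) (y' := 0) ?_
        rw [eval_extactic_zero, e5]
        have : (g : ℂ) ^ 2 + 1 ≠ 0 := by
          have : g ^ 2 + 1 ≠ 0 := by positivity
          exact_mod_cast this
        simpa [neg_eq_zero] using fun h => this (by linear_combination -h)
      · have h1 : h = -1 := by linarith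
        rw [h1] at h4 h11' e5
        by_cases hg0 : g = 0
        · exact not_isQSL6_of_circular hq (by rw [h3, hg0]) (by rw [h4]; norm_num) h5 h9 (by rw [h10, hg0]; norm_num)
            h11'
        · have hg0' : (g : ℂ) ≠ 0 := by exact_mod_cast hg0
          obtain ⟨l, hl, hxy⟩ := hs.line_of_ext5 (x := 2) (y := g) (x' := 1) (y' := 0)
            (by rw [e5]; push_cast; ring) (by rw [e5]; simpa using hg0)
          have h2 := hdir hl hxy
          have h3 : ((2 : ℝ) : ℂ) ^ 2 + (g : ℂ) ^ 2 = 0 := by push_cast; linear_combination h2 / 2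
          exact two_ne_zero (sq_add_sq_ne_zero h3).1
    · have hD' : (h : ℂ) ^ 2 + h ≠ 0 := by
        intro h0
        apply hD
        have : h ^ 2 + h = 0 := by exact_mod_cast h0
        linarith
      obtain ⟨s, hs2⟩ := IsAlgClosed.exists_pow_nat_eq (((g : ℂ) * h) ^ 2 - (g ^ 2 + h + 1) * (h ^ 2 + h)) (n := 2)
        (by norm_num)
      have hne : ∃ x' y', ext5 a x' y' ≠ 0 := by
        by_contra! h0
        have k1 := h0 1 1
        have k2 := h0 1 (-1)
        have k3 := h0 1 2
        have k4 := h0 1 (-2)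
        rw [e5] at k1 k2 k3 k4
        apply hD'
        linear_combination (k1 + k2) / 12 - (k3 + k4) / 30
      obtain ⟨x', y', hne⟩ := hne
      have key : ∀ t : ℂ, t ^ 2 = s ^ 2 → ((h : ℂ) ^ 2 + h) ^ 2 + (t - g * h) ^ 2 = 0 := by
        intro t ht
        obtain ⟨l, hl, hxy⟩ := hs.line_of_ext5 (x := (h : ℂ) ^ 2 + h) (y := t - g * h)
          (by
            rw [e5]
            have : ((g : ℂ) ^ 2 + h + 1) * ((h : ℂ) ^ 2 + h) ^ 2 + 2 * g * h * ((h : ℂ) ^ 2 + h) * (t - g * h)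
              + ((h : ℂ) ^ 2 + h) * (t - g * h) ^ 2 = 0 := by
              linear_combination ((h : ℂ) ^ 2 + h) * (ht + hs2)
            rw [this, mul_zero]) hne
        exact (mul_eq_zero.1 (hdir hl hxy)).resolve_left hD'
      have k1 := key s rfl
      have k2 := key (-s) (by ring)
      have k3 : s * ((g : ℂ) * h) = 0 := by linear_combination (k2 - k1) / 4
      have hh0 : h ≠ 0 := by rintro rfl; simp at hD
      have hh1 : h + 1 ≠ 0 := fun h0 => hD (by rw [h0, mul_zero])
      rcases mul_eq_zero.1 k3 with h0 | h0
      · exfalso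
        rw [h0] at k1
        have : ((h ^ 2 + h : ℝ) : ℂ) ^ 2 + ((g * h : ℝ) : ℂ) ^ 2 = 0 := by push_cast; linear_combination k1
        apply hD
        linarith [(sq_add_sq_ne_zero this).1]
      · have hg0 : g = 0 := by
          have : g * h = 0 := by exact_mod_cast h0
          exact (mul_eq_zero.1 this).resolve_right hh0
        refine ⟨hg0, ?_⟩
        rw [hg0] at k1 hs2
        have : ((h : ℂ) ^ 2 + h) * (h ^ 2 - 1) = 0 := by push_cast at k1 hs2; linear_combination k1 - hs2
        have h2 := (mul_eq_zero.1 this).resolve_left hD'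
        have h3 : (h - 1) * (h + 1) = 0 := by
          have : h ^ 2 - 1 = 0 := by exact_mod_cast h2
          linarith
        linarith [(mul_eq_zero.1 h3).resolve_right hh1]
  obtain ⟨hg0, hh1⟩ := main
  rw [hg0] at h3 h10 e5
  rw [hh1] at h4 h11' e5
  norm_num at h4 h10
  have hne : ext5 a 1 0 ≠ 0 := by rw [e5]; norm_num
  obtain ⟨l, hl, hxy⟩ := hs.line_of_ext5 (x := 0) (y := 1) (by rw [e5]; ring) hne
  obtain ⟨-, c, -, -, e2, e0⟩ := hl.vertical (by simpa using hxy)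
  rw [h4] at e2
  rw [h3] at e0
  rw [Complex.ofReal_one] at e2
  rw [Complex.ofReal_zero] at e0
  have h0 : a 0 = a 1 * a 2 / 2 := by
    have : (a 0 : ℂ) = a 1 * a 2 / 2 := by linear_combination e0 - a 1 / 2 * e2
    exact_mod_cast this
  obtain ⟨l, hl, hxy⟩ := hs.line_of_ext5 (x := 1) (y := Complex.I)
    (by rw [e5, Complex.I_sq]; ring) hne
  rw [isInvAffineLine_iff_affine] at hl
  obtain ⟨hl0, hl⟩ := hl
  have hl1 : l 0 = -Complex.I * l 1 := by linear_combination hxy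
  have hl00 : l 1 ≠ 0 := fun h => hl0 (by rw [hl1, h, mul_zero])
  obtain ⟨w, hw⟩ : ∃ w, l 2 = l 1 * w := ⟨l 2 / l 1, by field_simp⟩
  have k : ∀ x, -Complex.I * Pv a ![x, Complex.I * x - w, 1] + Qv a ![x, Complex.I * x - w, 1] = 0 := fun x => by
    have := hl x (Complex.I * x - w) (by rw [hl1, hw]; ring)
    rw [hl1] at this
    apply mul_left_cancel₀ hl00
    linear_combination this
  simp only [Pv_eq, Qv_eq, h3, h4, h5, h9, h10, h11'] at k
  have k0 := k 0
  have k1 := k 1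
  push_cast at k0 k1
  have f : ((a 2 + a 7 : ℝ) : ℂ) + ((a 8 - a 1 : ℝ) : ℂ) * Complex.I = 0 := by
    push_cast
    linear_combination k1 - k0 + (1 + a 2 + 0 : ℂ) * Complex.I_sq
  have f1 := congrArg Complex.re f
  have f2 := congrArg Complex.im f
  simp at f1 f2
  have h7 : a 7 = -a 2 := by linarith
  have h8 : a 8 = a 1 := by linarith
  have e := eq_vec a
  rw [h0, h3, h4, h5, h7, h8, h9, h10, h11'] at e
  rcases sameOrbit_of_conformal e with h | h | h
  · exact ⟨2, h.2⟩
  · exact ⟨3, h.2⟩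
  · exact ⟨5, h.2⟩

/-! ### Two real points at infinity -/

/-- The quadratic parts with `C₂ = x² y`. -/
theorem twofold_of_C2 {a : Sys} (hC : C2 a = cf 0 1 0 0) :
    a 4 = a 11 / 2 ∧ a 5 = 0 ∧ a 9 = 0 ∧ a 10 = (a 3 - 1) / 2 := by
  obtain ⟨h9, h3, h11, h5⟩ := C2_coef hC
  refine ⟨?_, h5, ?_, ?_⟩ <;> linarith

theorem Splits.line_of_twofold {a : Sys} (hs : Splits a (extactic a)) (hC : C2 a = cf 0 1 0 0) {x y : ℂ}
    (h : eval ![x, y, 1] (extactic a) = 0) :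
    (2 * a 4 * x + a 2 = 0 ∧ (a 3 : ℂ) * x ^ 2 + a 1 * x + a 0 = 0) ∨
      (2 * a 10 * y + a 7 = 0 ∧ (a 11 : ℂ) * y ^ 2 + a 8 * y + a 6 = 0) := by
  obtain ⟨l, hl, -, hxy⟩ := hs.exists_affine h
  have := direction_of_C2 hC hl (x := l 1) (y := -l 0) (by ring)
  push_cast at this
  have h01 : l 1 ^ 2 * l 0 = 0 := by linear_combination -this
  rcases mul_eq_zero.1 h01 with h1 | h0
  · left
    have h1 := pow_eq_zero_iff (two_ne_zero) |>.1 h1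
    obtain ⟨hl0, c, hc, -, e2, e0⟩ := hl.vertical h1
    have h2 : l 2 = l 0 * -c := by simpa using congrFun hc 2
    have : c = x := by
      apply mul_left_cancel₀ hl0
      rw [h1, h2] at hxy
      linear_combination -hxy
    rw [← this]
    exact ⟨e2, e0⟩
  · right
    obtain ⟨hl0, c, hc, -, e2, e0⟩ := hl.horizontal h0
    have h2 : l 2 = l 1 * -c := by simpa using congrFun hc 2
    have : c = y := by
      apply mul_left_cancel₀ hl0
      rw [h0, h2] at hxy
      linear_combination -hxy
    rw [← this]
    exact ⟨e2, e0⟩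

theorem exists_sq (z : ℂ) : ∃ s, s ^ 2 = z := IsAlgClosed.exists_pow_nat_eq z (by norm_num)

theorem IsQSL6.twofold_normal {a : Sys} (hq : IsQSL6 a) (hC : C2 a = cf 0 1 0 0) : a 11 = 0 := by
  by_contra hh
  have hs := hq.splits
  obtain ⟨h4, h5, h9, h10⟩ := twofold_of_C2 hC
  generalize hg : a 3 = g at *
  generalize hh' : a 11 = h at *
  have hhc : (h : ℂ) ≠ 0 := by exact_mod_cast hh
  have e5 : ∀ x y, ext5 a x y = -(x ^ 2 * y) * (g * (g - 1) * x ^ 2 + 2 * g * h * x * y + h ^ 2 * y ^ 2) :=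
    fun x y => by simp only [ext5, hg, hh', h4, h5, h9, h10]; push_cast; ring
  have hne : ∃ x' y', ext5 a x' y' ≠ 0 := by
    by_contra! h0
    have k1 := h0 1 1
    have k2 := h0 1 (-1)
    have k3 := h0 1 2
    rw [e5] at k1 k2 k3
    apply pow_ne_zero 2 hhc
    linear_combination -(k3 / 2 - k1 - (k1 + k2) / 2) / 3
  obtain ⟨x', y', hne⟩ := hne
  obtain ⟨s, hs2⟩ := exists_sq (g : ℂ)
  have key : ∀ t : ℂ, t ^ 2 = s ^ 2 → t = g := by
    intro t ht
    obtain ⟨l, hl, hxy⟩ := hs.line_of_ext5 (x := (h : ℂ)) (y := t - g)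
      (by rw [e5]; linear_combination (-((h : ℂ) ^ 2 * (t - g))) * h ^ 2 * (ht + hs2)) hne
    have := direction_of_C2 hC hl hxy
    push_cast at this
    have h1 : (h : ℂ) ^ 2 * (t - g) = 0 := by linear_combination this
    exact sub_eq_zero.1 ((mul_eq_zero.1 h1).resolve_left (pow_ne_zero 2 hhc))
  have k1 := key s rfl
  have k2 := key (-s) (by ring)
  have hg0 : g = 0 := by
    have : (g : ℂ) = 0 := by linear_combination -(k1 + k2) / 2
    exact_mod_cast this
  subst hg0
  have hq' := hq.pull swapG (s := -1) (by norm_num)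
  have e5' : ∀ x y, ext5 (QuadSL.pull swapG (-1) a) x y = x ^ 2 * (h ^ 2 * x * y ^ 2) := fun x y => by
    rw [pull_swapG]
    simp only [ext5, Matrix.cons_val, hg, hh', h4, h5, h9, h10]
    push_cast
    ring
  refine no_double_vertical hq'.1 hq'.splits (by rw [pull_swapG]; simp [h10])
    (by rw [pull_swapG]; simp [h10, hg]) dvd_rfl (R := fun x y => h ^ 2 * x * y ^ 2) (fun y => by fun_prop)
    (fun x y => by rw [eval_extactic_zero, e5']) (x' := 1) (y' := 1) ?_
  rw [eval_extactic_zero, e5']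
  simpa using hh

theorem eval_p' (a : Sys) (x y : ℝ) : eval ![x, y] (p a) =
    a 0 + (a 1 * x + a 2 * y) + (a 3 * x ^ 2 + 2 * a 4 * x * y + a 5 * y ^ 2) := by
  simp [p, p0, p1, p2]

theorem eval_q' (a : Sys) (x y : ℝ) : eval ![x, y] (q a) =
    a 6 + (a 7 * x + a 8 * y) + (a 9 * x ^ 2 + 2 * a 10 * x * y + a 11 * y ^ 2) := by
  simp [q, q0, q1, q2]

theorem IsQSL6.orbit_of_twofold_ne_one {a : Sys} (hq : IsQSL6 a) (hC : C2 a = cf 0 1 0 0) (h1 : a 3 ≠ 1)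
    (h2 : a 2 = 0) {c : ℂ} (hc1 : (2 * a 10 : ℂ) * c + a 7 = 0) (hc0 : (a 11 : ℂ) * c ^ 2 + a 8 * c + a 6 = 0) :
    ∃ i, SameOrbit (rep i) a := by
  have hs := hq.splits
  have h11 := hq.twofold_normal hC
  obtain ⟨h4, h5, h9, h10⟩ := twofold_of_C2 hC
  rw [h11, zero_div] at h4
  have hg : a 3 - 1 ≠ 0 := sub_ne_zero.2 h1
  have hgc : (a 3 : ℂ) - 1 ≠ 0 := by exact_mod_cast hg
  rw [h10] at hc1
  rw [h11] at hc0
  push_cast at hc1 hc0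
  have hc1' : ((a 3 : ℂ) - 1) * c + a 7 = 0 := by linear_combination hc1
  have hc0' : (a 8 : ℂ) * c + a 6 = 0 := by linear_combination hc0
  have key : ∀ r : ℂ, (a 3 - 1) * (a 3 * r ^ 2 + a 1 * r + a 0) + ((a 3 - 1) * r + a 8) ^ 2
      - ((a 3 - 1) * r + a 8) * (2 * a 3 * r + a 1) = 0 → (a 3 : ℂ) * r ^ 2 + a 1 * r + a 0 = 0 := by
    intro r hr
    rcases hs.line_of_twofold hC (x := r) (y := c + 1) (by
      rw [eval_extactic]
      simp only [Pv, Qv, dP0, dP1, dQ0, dQ1, Matrix.cons_val, h2, h4, h5, h9, h10, h11]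
      push_cast
      linear_combination (a 3 * r ^ 2 + a 1 * r + a 0) * hr
        + (a 3 * r ^ 2 + a 1 * r + a 0) * ((a 3 * r ^ 2 + a 1 * r + a 0) * hc1'
          + (r * hc1' + hc0') * ((a 3 - 1) * r + a 8 - (2 * a 3 * r + a 1)))) with h | h
    · exact h.2
    · exfalso
      rw [h10] at h
      push_cast at h
      exact hgc (by linear_combination h.1 - hc1')
  obtain ⟨s, hs2⟩ := exists_sq ((a 8 : ℂ) ^ 2 + (a 3 - 1) * ((a 3 - 1) * a 0 + a 8 ^ 2 - a 1 * a 8))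
  have key2 : ∀ t : ℂ, t ^ 2 = s ^ 2 → ∀ r, r = (t - a 8) / (a 3 - 1) →
      (a 3 : ℂ) * r ^ 2 + a 1 * r + a 0 = 0 ∧ t * (t - (2 * a 3 * r + a 1)) = 0 := by
    intro t ht r hr
    have hr' : (a 3 - 1) * r + a 8 = t := by rw [hr]; field_simp; ring
    have h0 : (a 3 - 1) * (a 3 * r ^ 2 + a 1 * r + a 0) + ((a 3 - 1) * r + a 8) ^ 2
      - ((a 3 - 1) * r + a 8) * (2 * a 3 * r + a 1) = 0 := by
      apply mul_left_cancel₀ hgc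
      rw [← hr'] at ht
      linear_combination -ht - hs2
    have h3 := key r h0
    rw [hr', h3] at h0
    exact ⟨h3, by linear_combination h0⟩
  by_cases hs0 : s = 0
  · exfalso
    obtain ⟨r, hr⟩ : ∃ r : ℝ, r = -a 8 / (a 3 - 1) := ⟨_, rfl⟩
    have hr' : (a 3 - 1) * r + a 8 = 0 := by rw [hr]; field_simp; ring
    have h3 := (key2 s rfl r (by rw [hr, hs0]; push_cast; ring)).1
    have h3' : a 3 * r ^ 2 + a 1 * r + a 0 = 0 := by exact_mod_cast h3
    obtain ⟨d, hd⟩ : ∃ d : ℝ, d = -a 7 / (a 3 - 1) := ⟨_, rfl⟩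
    have hdc : (d : ℂ) = c := by
      rw [hd]; push_cast; field_simp; linear_combination -hc1'
    have hc0r : a 8 * d + a 6 = 0 := by rw [← hdc] at hc0'; exact_mod_cast hc0'
    have hc1r : (a 3 - 1) * d + a 7 = 0 := by rw [← hdc] at hc1'; exact_mod_cast hc1'
    refine hq.1.not_common_vertical r (fun y => ?_) fun y => ?_
    · rw [eval_p', h2, h4, h5]; linear_combination h3'
    · rw [eval_q', h9, h10, h11]; linear_combination (y - d) * hr' + hc0r + r * hc1r
  · obtain ⟨-, f1⟩ := key2 s rfl _ rfl
    obtain ⟨-, f2⟩ := key2 (-s) (by ring) _ rfl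
    have f1 := (mul_eq_zero.1 f1).resolve_left hs0
    have f2 := (mul_eq_zero.1 f2).resolve_left (neg_ne_zero.2 hs0)
    field_simp at f1 f2
    have hgm : a 3 = -1 := by
      have : (a 3 : ℂ) = -1 := by
        apply mul_left_cancel₀ hs0
        linear_combination -(f1 - f2) / 2
      exact_mod_cast this
    have h8 : a 8 = a 1 := by
      rw [hgm] at f1 f2
      have : (a 8 : ℂ) = a 1 := by push_cast at f1 f2; linear_combination -(f1 + f2) / 4
      exact_mod_cast this
    rw [hgm] at hc1' h10
    rw [h8] at hc0'
    have h6 : a 6 = -(a 1 * a 7 / 2) := by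
      have : (a 6 : ℂ) = -(a 1 * a 7 / 2) := by push_cast at hc1'; linear_combination hc0' + a 1 / 2 * hc1'
      exact_mod_cast this
    norm_num at h10
    have e := eq_vec a
    rw [h2, hgm, h4, h5, h6, h8, h9, h10, h11] at e
    have := sameOrbit_rep7_rep8 e
    rcases lt_trichotomy (a 1 ^ 2 + 4 * a 0) 0 with h | h | h
    · exact ⟨8, this.2 h⟩
    · exfalso
      refine hq.1.not_common_vertical (a 1 / 2) (fun y => ?_) fun y => ?_
      · rw [eval_p', h2, h4, h5, hgm]; linear_combination h / 4
      · rw [eval_q', h9, h10, h11, h6, h8]; ring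
    · exact ⟨7, this.1 h⟩

theorem IsQSL6.orbit_of_twofold_zero {a : Sys} (hq : IsQSL6 a) (hC : C2 a = cf 0 1 0 0) (h3 : a 3 = 0) :
    ∃ i, SameOrbit (rep i) a := by
  have hs := hq.splits
  have h11 := hq.twofold_normal hC
  obtain ⟨h4, h5, h9, h10⟩ := twofold_of_C2 hC
  rw [h11, zero_div] at h4
  have h10' : a 10 = -1 / 2 := by rw [h10, h3]; norm_num
  have e5 : ∀ x y, ext5 a x y = 0 := fun x y => by
    simp only [ext5, h3, h4, h5, h9, h10', h11]; push_cast; ring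
  have e4 : ∀ x y, ext4 a x y = a 1 * x ^ 3 * y := fun x y => by
    simp only [ext4, h3, h4, h5, h9, h10', h11]; push_cast; ring
  by_cases h1 : a 1 = 0
  · exfalso
    have e4' : ∀ x y, ext4 a x y = 0 := fun x y => by rw [e4, h1]; push_cast; ring
    have e3 : ∀ x y, ext3 a x y = y * ((a 2 * a 7 + a 0) * x ^ 2 - a 2 ^ 2 * y ^ 2) := fun x y => by
      simp only [ext3, h1, h3, h4, h5, h9, h10', h11]; push_cast; ring
    by_cases h2 : a 2 = 0
    · have h0 : a 0 ≠ 0 := by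
        intro h0
        apply hq.1.p_ne_zero
        rw [p_eq_qf, h0, h1, h2, h3, h4, h5]
        simp [lf, qf]
      obtain ⟨l, hl, hxy⟩ := hs.line_of_ext3 e5 e4' (x := 0) (y := 1) (x' := 1) (y' := 1)
        (by rw [e3, h2]; push_cast; ring) (by rw [e3, h2]; simpa using h0)
      obtain ⟨-, c, -, -, -, e0⟩ := hl.vertical (by simpa using hxy)
      rw [h1, h3] at e0
      apply h0
      have : (a 0 : ℂ) = 0 := by push_cast at e0; linear_combination e0
      exact_mod_cast this
    · have h2' : (a 2 : ℂ) ≠ 0 := by exact_mod_cast h2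
      have hne : ext3 a 0 1 ≠ 0 := by rw [e3]; simpa using h2
      obtain ⟨s, hs2⟩ := exists_sq ((a 2 : ℂ) * a 7 + a 0)
      obtain ⟨l, hl, hxy⟩ := hs.line_of_ext3 e5 e4' (x := (a 2 : ℂ)) (y := s)
        (by rw [e3]; linear_combination -(s * a 2 ^ 2) * hs2) hne
      have := direction_of_C2 hC hl hxy
      push_cast at this
      have h6 : (a 2 : ℂ) ^ 2 * s = 0 := by linear_combination this
      have h7 := (mul_eq_zero.1 h6).resolve_left (pow_ne_zero 2 h2')
      rw [h7] at hs2
      have h8 : a 2 * a 7 + a 0 = 0 := by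
        have : (a 2 : ℂ) * a 7 + a 0 = 0 := by linear_combination -hs2
        exact_mod_cast this
      obtain ⟨l, hl, hxy⟩ := hs.line_of_ext3 e5 e4' (x := 1) (y := 0) (by rw [e3]; ring) hne
      obtain ⟨-, c, -, -, e2, e0⟩ := hl.horizontal (by simpa using hxy)
      rw [h10'] at e2
      rw [h11] at e0
      have h9' : a 8 * a 7 + a 6 = 0 := by
        have : (a 8 : ℂ) * a 7 + a 6 = 0 := by push_cast at e2 e0; linear_combination e0 + a 8 * e2
        exact_mod_cast this
      refine hq.1.not_common_line (l := ![0, 1, -a 7]) (by simp) (fun x y hxy => ?_) fun x y hxy => ?_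
      · have : y = a 7 := by simp at hxy; linarith
        rw [eval_p', h1, h3, h4, h5, this]; linear_combination h8
      · have : y = a 7 := by simp at hxy; linarith
        rw [eval_q', h9, h10', h11, this]; linear_combination h9'
  · have hne : ext4 a 1 1 ≠ 0 := by rw [e4]; simpa using h1
    obtain ⟨l, hl, hxy⟩ := hs.line_of_ext4 e5 (x := 0) (y := 1) (by rw [e4]; ring) hne
    obtain ⟨-, c, -, -, e2, -⟩ := hl.vertical (by simpa using hxy)
    rw [h4] at e2
    obtain ⟨l, hl, hxy⟩ := hs.line_of_ext4 e5 (x := 1) (y := 0) (by rw [e4]; ring) hne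
    obtain ⟨-, c, -, -, f2, f0⟩ := hl.horizontal (by simpa using hxy)
    exact hq.orbit_of_twofold_ne_one hC (by rw [h3]; norm_num) (by simpa using e2) f2 f0

theorem IsQSL6.orbit_of_twofold_one {a : Sys} (hq : IsQSL6 a) (hC : C2 a = cf 0 1 0 0) (h3 : a 3 = 1) :
    ∃ i, SameOrbit (rep i) a := by
  have hs := hq.splits
  have h11 := hq.twofold_normal hC
  obtain ⟨h4, h5, h9, h10'⟩ := twofold_of_C2 hC
  rw [h11, zero_div] at h4
  have h10 : a 10 = 0 := by rw [h10', h3]; norm_num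
  have e5 : ∀ x y, ext5 a x y = 0 := fun x y => by
    simp only [ext5, h3, h4, h5, h9, h10, h11]; push_cast; ring
  have e4 : ∀ x y, ext4 a x y = -x ^ 3 * (a 7 * x + 2 * a 8 * y) := fun x y => by
    simp only [ext4, h3, h4, h5, h9, h10, h11]; push_cast; ring
  by_cases h8 : a 8 = 0
  · by_cases h7 : a 7 = 0
    · have e4' : ∀ x y, ext4 a x y = 0 := fun x y => by rw [e4, h7, h8]; push_cast; ring
      have e3 : ∀ x y, ext3 a x y = -2 * a 6 * x ^ 3 := fun x y => by
        simp only [ext3, h3, h4, h5, h7, h8, h9, h10, h11]; push_cast; ring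
      have h6 : a 6 ≠ 0 := by
        intro h6
        apply hq.1.q_ne_zero
        rw [q_eq_qf, h6, h7, h8, h9, h10, h11]
        simp [lf, qf]
      obtain ⟨l, hl, hxy⟩ := hs.line_of_ext3 e5 e4' (x := 0) (y := 1) (x' := 1) (y' := 0)
        (by rw [e3]; ring) (by rw [e3]; simpa using h6)
      obtain ⟨-, c, -, -, e2, -⟩ := hl.vertical (by simpa using hxy)
      rw [h4] at e2
      have h2 : a 2 = 0 := by simpa using e2
      have h0 : a 0 = a 1 ^ 2 / 4 := by
        rcases hs.line_of_twofold hC (x := -a 1 / 2) (y := 0) (by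
          rw [eval_extactic]
          simp only [Pv, Qv, dP0, dP1, dQ0, dQ1, Matrix.cons_val, h2, h3, h4, h5, h7, h8, h9, h10, h11]
          push_cast
          ring) with h | h
        · have := h.2
          rw [h3] at this
          have : (a 0 : ℂ) = a 1 ^ 2 / 4 := by push_cast at this; linear_combination this
          exact_mod_cast this
        · exact absurd (by simpa using h.2) h6
      have e := eq_vec a
      rw [h0, h2, h3, h4, h5, h7, h8, h9, h10, h11] at e
      exact ⟨9, sameOrbit_rep9 h6 e⟩
    · exfalso
      have h7' : (a 7 : ℂ) ≠ 0 := by exact_mod_cast h7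
      obtain ⟨l, hl, hxy⟩ := hs.line_of_ext4 e5 (x := 0) (y := 1) (x' := 1) (y' := 0)
        (by rw [e4]; ring) (by rw [e4]; simpa using h7)
      obtain ⟨-, c, -, -, e2, -⟩ := hl.vertical (by simpa using hxy)
      rw [h4] at e2
      have h2 : a 2 = 0 := by simpa using e2
      obtain ⟨s, hs2⟩ := exists_sq ((a 6 : ℂ) ^ 2 + a 7 * (a 0 * a 7 - a 1 * a 6))
      have key : ∀ t : ℂ, t ^ 2 = s ^ 2 → ∀ r, r = (t - a 6) / a 7 →
          r ^ 2 + a 1 * r + a 0 = 0 ∧ t * (2 * r + a 1) = 0 := by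
        intro t ht r hr
        have hr' : a 7 * r + a 6 = t := by rw [hr]; field_simp; ring
        have hF : a 7 * (r ^ 2 + a 1 * r + a 0) - t * (2 * r + a 1) = 0 := by
          apply mul_left_cancel₀ h7'
          rw [← hr'] at ht ⊢
          linear_combination -ht - hs2
        have hp : r ^ 2 + a 1 * r + a 0 = 0 := by
          rcases hs.line_of_twofold hC (x := r) (y := 0) (by
            rw [eval_extactic]
            simp only [Pv, Qv, dP0, dP1, dQ0, dQ1, Matrix.cons_val, h2, h3, h4, h5, h8, h9, h10, h11]
            push_cast
            rw [← hr'] at hF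
            linear_combination (r ^ 2 + a 1 * r + a 0) * hF) with h | h
          · have := h.2
            rw [h3] at this
            push_cast at this
            linear_combination this
          · rw [h10] at h
            exact absurd (by simpa using h.1) h7
        rw [hp] at hF
        exact ⟨hp, by linear_combination -hF⟩
      by_cases hs0 : s = 0
      · obtain ⟨r, hr⟩ : ∃ r : ℝ, r = -a 6 / a 7 := ⟨_, rfl⟩
        have h0 := (key s rfl r (by rw [hr, hs0]; push_cast; ring)).1
        have h0' : r ^ 2 + a 1 * r + a 0 = 0 := by exact_mod_cast h0
        refine hq.1.not_common_vertical r (fun y => ?_) fun y => ?_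
        · rw [eval_p', h2, h3, h4, h5]; linear_combination h0'
        · rw [eval_q', h8, h9, h10, h11, hr]; field_simp; ring
      · obtain ⟨-, f1⟩ := key s rfl _ rfl
        obtain ⟨-, f2⟩ := key (-s) (by ring) _ rfl
        have f1 := (mul_eq_zero.1 f1).resolve_left hs0
        have f2 := (mul_eq_zero.1 f2).resolve_left (neg_ne_zero.2 hs0)
        field_simp at f1 f2
        exact hs0 (by linear_combination (f1 - f2) / 4)
  · have h8' : (a 8 : ℂ) ≠ 0 := by exact_mod_cast h8
    have hne : ∃ y', ext4 a 1 y' ≠ 0 := by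
      by_contra! h0
      have k1 := h0 1
      have k2 := h0 0
      rw [e4] at k1 k2
      apply h8'
      linear_combination -(k1 - k2) / 2
    obtain ⟨y', hne⟩ := hne
    have h7 : a 7 = 0 := by
      obtain ⟨l, hl, hxy⟩ := hs.line_of_ext4 e5 (x := (2 * a 8 : ℂ)) (y := -a 7) (by rw [e4]; ring) hne
      have := direction_of_C2 hC hl hxy
      push_cast at this
      have h6 : (a 8 : ℂ) ^ 2 * a 7 = 0 := by linear_combination -this / 4
      have := (mul_eq_zero.1 h6).resolve_left (pow_ne_zero 2 h8')
      exact_mod_cast this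
    obtain ⟨l, hl, hxy⟩ := hs.line_of_ext4 e5 (x := 0) (y := 1) (by rw [e4]; ring) hne
    obtain ⟨-, c, -, -, e2, -⟩ := hl.vertical (by simpa using hxy)
    rw [h4] at e2
    have h2 : a 2 = 0 := by simpa using e2
    have hr : a 1 ^ 2 - 4 * a 0 = a 8 ^ 2 := by
      have : ((a 8 - a 1 : ℂ) / 2) ^ 2 + a 1 * ((a 8 - a 1 : ℂ) / 2) + a 0 = 0 := by
        rcases hs.line_of_twofold hC (x := (a 8 - a 1 : ℂ) / 2) (y := -a 6 / a 8 + 1) (by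
          rw [eval_extactic]
          simp only [Pv, Qv, dP0, dP1, dQ0, dQ1, Matrix.cons_val, h2, h3, h4, h5, h7, h9, h10, h11]
          push_cast
          ring) with h | h
        · have := h.2
          rw [h3] at this
          push_cast at this
          linear_combination this
        · exfalso
          have := h.2
          rw [h11] at this
          apply h8'
          have e : (a 8 : ℂ) * (-a 6 / a 8) = -a 6 := by field_simp
          push_cast at this
          linear_combination this - e
      have : (a 1 : ℂ) ^ 2 - 4 * a 0 = a 8 ^ 2 := by linear_combination -4 * this
      exact_mod_cast this
    have e := eq_vec a
    rw [h2, h3, h4, h5, h7, h9, h10, h11] at e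
    exact ⟨6, sameOrbit_rep6 h8 hr e⟩

theorem IsQSL6.orbit_of_twofold {a : Sys} (hq : IsQSL6 a) (hC : C2 a = cf 0 1 0 0) :
    ∃ i, SameOrbit (rep i) a := by
  by_cases h0 : a 3 = 0
  · exact hq.orbit_of_twofold_zero hC h0
  by_cases h1 : a 3 = 1
  · exact hq.orbit_of_twofold_one hC h1
  have hs := hq.splits
  have h11 := hq.twofold_normal hC
  obtain ⟨h4, h5, h9, h10⟩ := twofold_of_C2 hC
  rw [h11, zero_div] at h4
  have e5 : ∀ x y, ext5 a x y = -(a 3 * (a 3 - 1)) * (x ^ 4 * y) := fun x y => by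
    simp only [ext5, h4, h5, h9, h10, h11]; push_cast; ring
  have hg : (a 3 : ℂ) - 1 ≠ 0 := sub_ne_zero.2 (by exact_mod_cast h1)
  have hg0 : (a 3 : ℂ) ≠ 0 := by exact_mod_cast h0
  have hne : ext5 a 1 1 ≠ 0 := by rw [e5]; simpa using ⟨h0, hg⟩
  obtain ⟨l, hl, hxy⟩ := hs.line_of_ext5 (x := 0) (y := 1) (by rw [e5]; ring) hne
  obtain ⟨-, c, -, -, e2, -⟩ := hl.vertical (by simpa using hxy)
  rw [h4] at e2
  obtain ⟨l, hl, hxy⟩ := hs.line_of_ext5 (x := 1) (y := 0) (by rw [e5]; ring) hne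
  obtain ⟨-, c, -, -, f2, f0⟩ := hl.horizontal (by simpa using hxy)
  exact hq.orbit_of_twofold_ne_one hC h1 (by simpa using e2) f2 f0

/-! ### A triple point at infinity -/

/-- The quadratic parts with `C₂ = x³`. -/
theorem triple_of_C2 {a : Sys} (hC : C2 a = cf 1 0 0 0) :
    a 4 = a 11 / 2 ∧ a 5 = 0 ∧ a 9 = -1 ∧ a 10 = a 3 / 2 := by
  obtain ⟨h9, h3, h11, h5⟩ := C2_coef hC
  refine ⟨?_, h5, ?_, ?_⟩ <;> linarith

theorem Splits.line_of_triple {a : Sys} (hs : Splits a (extactic a)) (hC : C2 a = cf 1 0 0 0) {x y : ℂ}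
    (h : eval ![x, y, 1] (extactic a) = 0) : (a 3 : ℂ) * x ^ 2 + a 1 * x + a 0 = 0 := by
  obtain ⟨l, hl, -, hxy⟩ := hs.exists_affine h
  have := direction_of_C2 hC hl (x := l 1) (y := -l 0) (by ring)
  push_cast at this
  have h1 : l 1 ^ 3 = 0 := by linear_combination this
  have h1 := pow_eq_zero_iff (three_ne_zero) |>.1 h1
  obtain ⟨hl0, c, hc, -, e2, e0⟩ := hl.vertical h1
  have h2 : l 2 = l 0 * -c := by simpa using congrFun hc 2
  have : c = x := by
    apply mul_left_cancel₀ hl0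
    rw [h1, h2] at hxy
    linear_combination -hxy
  rw [← this]
  exact e0

theorem IsQSL6.triple_normal {a : Sys} (hq : IsQSL6 a) (hC : C2 a = cf 1 0 0 0) : a 11 = 0 := by
  by_contra hh
  have hs := hq.splits
  obtain ⟨h4, h5, h9, h10⟩ := triple_of_C2 hC
  have hhc : (a 11 : ℂ) ≠ 0 := by exact_mod_cast hh
  have e5 : ∀ x y, ext5 a x y = -x ^ 3 * ((a 3 * x + a 11 * y) ^ 2 + a 11 * x ^ 2) :=
    fun x y => by simp only [ext5, h4, h5, h9, h10]; push_cast; ring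
  have hne : ∃ y', ext5 a 1 y' ≠ 0 := by
    by_contra! h0
    have k1 := h0 1
    have k2 := h0 (-1)
    have k3 := h0 0
    rw [e5] at k1 k2 k3
    apply pow_ne_zero 2 hhc
    linear_combination -(k1 + k2) / 2 + k3
  obtain ⟨y', hne⟩ := hne
  obtain ⟨s, hs2⟩ := exists_sq (-a 11 : ℂ)
  obtain ⟨l, hl, hxy⟩ := hs.line_of_ext5 (x := (a 11 : ℂ)) (y := s - a 3)
    (by rw [e5]; linear_combination (-(a 11 : ℂ) ^ 3 * a 11 ^ 2) * hs2) hne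
  have := direction_of_C2 hC hl hxy
  push_cast at this
  apply pow_ne_zero 3 hhc
  linear_combination this

theorem IsQSL6.a2_eq_zero_of_triple {a : Sys} (hq : IsQSL6 a) (hC : C2 a = cf 1 0 0 0) : a 2 = 0 := by
  have hs := hq.splits
  have h11 := hq.triple_normal hC
  obtain ⟨h4, h5, h9, h10⟩ := triple_of_C2 hC
  rw [h11, zero_div] at h4
  have e5 : ∀ x y, ext5 a x y = -(a 3 : ℂ) ^ 2 * x ^ 5 :=
    fun x y => by simp only [ext5, h4, h5, h9, h10, h11]; push_cast; ring
  by_contra h2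
  suffices ∃ l, IsInvAffineLine a l ∧ l 0 * 0 + l 1 * 1 = 0 by
    obtain ⟨l, hl, hxy⟩ := this
    obtain ⟨-, c, -, -, e2, -⟩ := hl.vertical (by simpa using hxy)
    rw [h4] at e2
    exact h2 (by simpa using e2)
  by_cases h3 : a 3 = 0
  · have e5' : ∀ x y, ext5 a x y = 0 := fun x y => by rw [e5, h3]; push_cast; ring
    have e4 : ∀ x y, ext4 a x y = -a 2 * x ^ 4 :=
      fun x y => by simp only [ext4, h3, h4, h5, h9, h10, h11]; push_cast; ring
    exact hs.line_of_ext4 e5' (x' := 1) (y' := 0) (by rw [e4]; ring) (by rw [e4]; simpa using h2)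
  · exact hs.line_of_ext5 (x' := 1) (y' := 0) (by rw [e5]; ring) (by rw [e5]; simpa using h3)

theorem IsQSL6.orbit_of_triple {a : Sys} (hq : IsQSL6 a) (hC : C2 a = cf 1 0 0 0) :
    ∃ i, SameOrbit (rep i) a := by
  have hs := hq.splits
  have h11 := hq.triple_normal hC
  have h2 := hq.a2_eq_zero_of_triple hC
  obtain ⟨h4, h5, h9, h10⟩ := triple_of_C2 hC
  rw [h11, zero_div] at h4
  have key : ∀ x y : ℂ, (a 3 * x ^ 2 + a 1 * x + a 0) * (a 7 + a 3 * y - 2 * x)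
      + (a 6 + a 7 * x + a 8 * y - x ^ 2 + a 3 * x * y) * (a 8 - a 1 - a 3 * x) = 0 →
      (a 3 : ℂ) * x ^ 2 + a 1 * x + a 0 = 0 := by
    intro x y hxy
    refine hs.line_of_triple hC (y := y) ?_
    rw [eval_extactic]
    simp only [Pv, Qv, dP0, dP1, dQ0, dQ1, Matrix.cons_val, h2, h4, h5, h9, h10, h11]
    push_cast
    linear_combination (a 3 * x ^ 2 + a 1 * x + a 0) * hxy
  have hp : ∃ x : ℂ, (a 3 : ℂ) * x ^ 2 + a 1 * x + a 0 ≠ 0 := by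
    by_contra! h0
    have k0 := h0 0
    have k1 := h0 1
    have k2 := h0 (-1)
    apply hq.1.p_ne_zero
    have e0 : (a 0 : ℂ) = 0 := by linear_combination k0
    have e1 : (a 1 : ℂ) = 0 := by linear_combination (k1 - k2) / 2
    have e3 : (a 3 : ℂ) = 0 := by linear_combination (k1 + k2) / 2 - k0
    have e0 : a 0 = 0 := by exact_mod_cast e0
    have e1 : a 1 = 0 := by exact_mod_cast e1
    have e3 : a 3 = 0 := by exact_mod_cast e3
    rw [p_eq_qf, e0, e1, h2, e3, h4, h5]
    simp [lf, qf]
  have he : a 3 * a 0 + a 8 ^ 2 - a 1 * a 8 = 0 := by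
    by_contra he
    have he' : (a 3 : ℂ) * a 0 + a 8 ^ 2 - a 1 * a 8 ≠ 0 := by exact_mod_cast he
    obtain ⟨x, hx⟩ := hp
    refine hx (key x (-((a 3 * x ^ 2 + a 1 * x + a 0) * (a 7 - 2 * x)
      + (a 6 + a 7 * x - x ^ 2) * (a 8 - a 1 - a 3 * x)) / (a 3 * a 0 + a 8 ^ 2 - a 1 * a 8)) ?_)
    field_simp
    ring
  by_cases h3 : a 3 = 0
  · rw [h3] at he h10 key
    rw [zero_div] at h10
    have he2 : a 8 * (a 8 - a 1) = 0 := by linarith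
    by_cases h1 : a 1 = 0
    · exfalso
      rw [h1] at he2 key hp
      have h8 : a 8 = 0 := by simpa using he2
      have := key (a 7 / 2) 0 (by rw [h8]; push_cast; ring)
      obtain ⟨x, hx⟩ := hp
      apply hx
      rw [h3]
      push_cast at this ⊢
      linear_combination this
    · rcases mul_eq_zero.1 he2 with h8 | h8
      · exfalso
        have h1' : (a 1 : ℂ) ≠ 0 := by exact_mod_cast h1
        rw [h8] at key
        obtain ⟨r, hr⟩ : ∃ r : ℝ, r = -a 0 / a 1 := ⟨_, rfl⟩
        have hr' : a 0 = -(a 1 * r) := by rw [hr]; field_simp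
        rw [hr'] at key
        obtain ⟨s, hs2⟩ := exists_sq ((r : ℂ) ^ 2 - a 7 * r - a 6)
        have := key (r + s) 0 (by push_cast; linear_combination -a 1 * hs2)
        have hs0 : s = 0 := by
          push_cast at this
          apply mul_left_cancel₀ h1'
          linear_combination this
        rw [hs0] at hs2
        have h6 : r ^ 2 - a 7 * r - a 6 = 0 := by
          have : (r : ℂ) ^ 2 - a 7 * r - a 6 = 0 := by linear_combination -hs2
          exact_mod_cast this
        refine hq.1.not_common_vertical r (fun y => ?_) fun y => ?_
        · rw [eval_p', h2, h3, h4, h5, hr']; ring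
        · rw [eval_q', h8, h9, h10, h11]; linear_combination -h6
      · have h8 : a 8 = a 1 := by linarith
        have h0 := key (a 7 / 2) 0 (by rw [h8]; push_cast; ring)
        have h0' : a 0 = -(a 1 * a 7 / 2) := by
          have : (a 0 : ℂ) = -(a 1 * a 7 / 2) := by push_cast at h0; linear_combination h0
          exact_mod_cast this
        have e := eq_vec a
        rw [h0', h2, h3, h4, h5, h8, h9, h10, h11] at e
        exact ⟨10, sameOrbit_rep10 h1 e⟩
  · exfalso
    have h3' : (a 3 : ℂ) ≠ 0 := by exact_mod_cast h3
    obtain ⟨r, hr⟩ : ∃ r : ℝ, r = -a 8 / a 3 := ⟨_, rfl⟩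
    have h8 : a 8 = -(a 3 * r) := by rw [hr]; field_simp
    have h0 : a 0 = -(a 3 * r ^ 2 + a 1 * r) := by
      apply mul_left_cancel₀ h3
      rw [h8] at he
      linear_combination he
    rw [h8, h0] at key
    obtain ⟨s, hs2⟩ := exists_sq ((r : ℂ) ^ 2 - a 7 * r - a 6)
    have key2 : ∀ t : ℂ, t ^ 2 = s ^ 2 → t * (a 3 * t + 2 * a 3 * r + a 1) = 0 := by
      intro t ht
      have := key (r + t) 0 (by
        push_cast
        linear_combination -(a 3 * t + 2 * a 3 * r + a 1) * (ht + hs2))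
      push_cast at this
      linear_combination this
    have k1 := key2 s rfl
    have k2 := key2 (-s) (by ring)
    have h6 : r ^ 2 - a 7 * r - a 6 = 0 := by
      have : (a 3 : ℂ) * (r ^ 2 - a 7 * r - a 6) = 0 := by linear_combination (k1 + k2) / 2 - a 3 * hs2
      have := (mul_eq_zero.1 this).resolve_left h3'
      exact_mod_cast this
    refine hq.1.not_common_vertical r (fun y => ?_) fun y => ?_
    · rw [eval_p', h0, h2, h4, h5]; ring
    · rw [eval_q', h8, h9, h10, h11]; linear_combination -h6

/-- The systems in `QSL₆` are in the orbits of the representatives. -/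
theorem IsQSL6.exists_sameOrbit {a : Sys} (hq : IsQSL6 a) : ∃ i, SameOrbit (rep i) a := by
  obtain ⟨g, -, h⟩ := exists_pull_normal a hq.C2_ne_zero
  have hq' := hq.pull g (s := 1) one_ne_zero
  suffices ∃ i, SameOrbit (rep i) (QuadSL.pull g 1 a) by
    obtain ⟨i, hi⟩ := this
    exact ⟨i, hi.trans (sameOrbit_pull g one_ne_zero a)⟩
  rcases h with h | h | h | h
  · exact hq'.orbit_of_threefold h
  · exact hq'.orbit_of_onefold h
  · exact hq'.orbit_of_twofold h
  · exact hq'.orbit_of_triple h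

/-! ### Lines and multiplicities from a factorization of the extactic polynomial -/

/-- The forms `l` and `m` are linearly independent. -/
def CrossNe (l m : Fin 3 → ℂ) : Prop :=
  l 0 * m 1 ≠ l 1 * m 0 ∨ l 0 * m 2 ≠ l 2 * m 0 ∨ l 1 * m 2 ≠ l 2 * m 1

theorem CrossNe.ne_smul {l m : Fin 3 → ℂ} (h : CrossNe l m) (c : ℂ) : l ≠ c • m := by
  rintro rfl
  simp only [CrossNe, Pi.smul_apply, smul_eq_mul] at h
  rcases h with h | h | h <;> exact h (by ring)

theorem CrossNe.symm {l m : Fin 3 → ℂ} (h : CrossNe l m) : CrossNe m l := by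
  rcases h with h | h | h
  · exact Or.inl fun e => h (by linear_combination -e)
  · exact Or.inr (Or.inl fun e => h (by linear_combination -e))
  · exact Or.inr (Or.inr fun e => h (by linear_combination -e))

theorem isInvAffineLine_of_cofactor {a : Sys} {l : Fin 3 → ℂ} (hl : (l 0, l 1) ≠ (0, 0)) (k : ℂ → ℂ → ℂ)
    (h : ∀ x y, l 0 * Pv a ![x, y, 1] + l 1 * Qv a ![x, y, 1] = (l 0 * x + l 1 * y + l 2) * k x y) :
    IsInvAffineLine a l :=
  (isInvAffineLine_iff_affine a l).2 ⟨hl, fun x y hxy => by rw [h, hxy, zero_mul]⟩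

theorem le_lineMult {a : Sys} {l : Fin 3 → ℂ} {m : ℕ} (h : IsLimitOfLines a l m) :
    (open scoped Classical in if IsLineAtInfinity l then 1 else 0) + (m : ℕ∞) ≤ lineMult a l := by
  unfold lineMult
  exact add_le_add le_rfl (le_iSup₂_of_le m h le_rfl)

theorem one_le_lineMult {a : Sys} (ha : IsQuadratic a) {l : Fin 3 → ℂ} (h : IsInvLine a l) : 1 ≤ lineMult a l := by
  rcases h with h | h
  · unfold lineMult
    rw [if_pos h]
    exact le_self_add
  · refine le_trans ?_ (le_lineMult (m := 1) ⟨fun _ => a, fun _ _ => l, fun _ => ha, tendsto_const_nhds,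
      fun _ _ => h, fun _ i j hij => (hij (Subsingleton.elim i j)).elim, fun _ => tendsto_const_nhds⟩)
    exact le_add_self

theorem isLimitOfLines_of_family {a : Sys} {l : Fin 3 → ℂ} {n : ℕ} (A : ℝ → Sys) (L : Fin n → ℝ → Fin 3 → ℂ)
    (hA : Continuous A) (hA0 : A 0 = a) (hL : ∀ j, Continuous (L j)) (hL0 : ∀ j, L j 0 = l)
    (hQ : ∀ ε, ε ≠ 0 → IsQuadratic (A ε)) (hinv : ∀ ε, ε ≠ 0 → ∀ j, IsInvAffineLine (A ε) (L j ε))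
    (hne : ∀ ε, ε ≠ 0 → ∀ i j, i < j → CrossNe (L i ε) (L j ε)) : IsLimitOfLines a l n := by
  have h0 : ∀ k : ℕ, 1 / ((k : ℝ) + 1) ≠ 0 := fun k => by positivity
  have hlim : Tendsto (fun k : ℕ => 1 / ((k : ℝ) + 1)) atTop (𝓝 0) := tendsto_one_div_add_atTop_nhds_zero_nat
  refine ⟨fun k => A (1 / ((k : ℝ) + 1)), fun k j => L j (1 / ((k : ℝ) + 1)), fun k => hQ _ (h0 k), ?_,
    fun k j => hinv _ (h0 k) j, fun k i j hij c => ?_, fun j => ?_⟩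
  · exact hA0 ▸ (hA.tendsto 0).comp hlim
  · rcases lt_or_gt_of_ne hij with h | h
    · exact (hne _ (h0 k) i j h).ne_smul c
    · exact (hne _ (h0 k) j i h).symm.ne_smul c
  · exact hL0 j ▸ ((hL j).tendsto 0).comp hlim

/-- The lines `L i` are invariant with multiplicities at least `m i`, and they account for the extactic polynomial. -/
structure LineFactors (a : Sys) {n : ℕ} (L : Fin n → Fin 3 → ℂ) (m : Fin n → ℕ) : Prop where
  inv : ∀ i, IsInvLine a (L i)
  indep : ∀ i j, i < j → CrossNe (L i) (L j)
  factor : ∃ κ : ℂ, κ ≠ 0 ∧ X 2 * extactic a = C κ * ∏ i, linForm (L i) ^ m i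
  lower : ∀ i, (m i : ℕ∞) ≤ lineMult a (L i)

namespace LineFactors

variable {a : Sys} {n : ℕ} {L : Fin n → Fin 3 → ℂ} {m : Fin n → ℕ}

theorem ne_smul (h : LineFactors a L m) {i j : Fin n} (hij : i ≠ j) (c : ℂ) : L i ≠ c • L j := by
  rcases lt_or_gt_of_ne hij with h' | h'
  · exact (h.indep i j h').ne_smul c
  · exact (h.indep j i h').symm.ne_smul c

theorem linForm_of_isLineAtInfinity {l : Fin 3 → ℂ} (hl : IsLineAtInfinity l) : linForm l = C (l 2) * X 2 := by
  rw [linForm, hl.1, hl.2.1]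
  simp

theorem not_dvd_C {l : Fin 3 → ℂ} (hl : l ≠ 0) {κ : ℂ} (hκ : κ ≠ 0) : ¬ linForm l ∣ C κ := fun hd =>
  (linForm_prime hl).not_unit (isUnit_of_dvd_unit hd ((isUnit_iff_ne_zero.2 hκ).map C))

theorem exists_smul (h : LineFactors a L m) {l : Fin 3 → ℂ} (hl : IsInvLine a l) : ∃ i, ∃ c : ℂ, c ≠ 0 ∧ l = c • L i := by
  obtain ⟨κ, hκ, hE⟩ := h.factor
  have hd : linForm l ∣ X 2 * extactic a := by
    rcases hl with hl | hl
    · rw [linForm_of_isLineAtInfinity hl]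
      refine Dvd.dvd.mul_right ⟨C (l 2)⁻¹, ?_⟩ _
      rw [mul_right_comm, ← C_mul, mul_inv_cancel₀ hl.2.2, C_1, one_mul]
    · exact hl.dvd_extactic.mul_left _
  have hp := linForm_prime hl.ne_zero
  rw [hE] at hd
  have hd := (hp.dvd_or_dvd hd).resolve_left (not_dvd_C hl.ne_zero hκ)
  obtain ⟨i, -, hi⟩ := (hp.dvd_finsetProd_iff _).1 hd
  obtain ⟨c, hc⟩ := linForm_dvd_linForm hl.ne_zero (hp.dvd_of_dvd_pow hi)
  have hc0 : c ≠ 0 := by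
    rintro rfl
    exact (h.inv i).ne_zero (by rw [hc, zero_smul])
  exact ⟨i, c⁻¹, inv_ne_zero hc0, by rw [hc, smul_smul, inv_mul_cancel₀ hc0, one_smul]⟩

theorem not_pow_dvd (h : LineFactors a L m) (i : Fin n) : ¬ linForm (L i) ^ (m i + 1) ∣ X 2 * extactic a := by
  obtain ⟨κ, hκ, hE⟩ := h.factor
  have hp := linForm_prime (h.inv i).ne_zero
  intro hd
  rw [hE, ← Finset.mul_prod_erase _ _ (Finset.mem_univ i), mul_left_comm, pow_succ,
    mul_dvd_mul_iff_left (pow_ne_zero _ hp.ne_zero)] at hd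
  have hd := (hp.dvd_or_dvd hd).resolve_left (not_dvd_C (h.inv i).ne_zero hκ)
  obtain ⟨j, hj, hd⟩ := (hp.dvd_finsetProd_iff _).1 hd
  obtain ⟨c, hc⟩ := linForm_dvd_linForm (h.inv i).ne_zero (hp.dvd_of_dvd_pow hd)
  exact h.ne_smul (Finset.ne_of_mem_erase hj) c hc

theorem lineMult_eq (h : LineFactors a L m) (i : Fin n) : lineMult a (L i) = m i := by
  classical
  refine le_antisymm ?_ (h.lower i)
  have h0 := (h.inv i).ne_zero
  by_cases hinf : IsLineAtInfinity (L i)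
  · have hX : linForm (L i) ∣ X 2 := by
      rw [linForm_of_isLineAtInfinity hinf]
      exact ⟨C (L i 2)⁻¹, by rw [mul_right_comm, ← C_mul, mul_inv_cancel₀ hinf.2.2, C_1, one_mul]⟩
    have hm : m i ≠ 0 := by
      intro hm
      apply h.not_pow_dvd i
      rw [hm, zero_add, pow_one]
      exact hX.mul_right _
    obtain ⟨k, hk⟩ := Nat.exists_eq_succ_of_ne_zero hm
    refine (lineMult_le h0 (n := k) fun hd => h.not_pow_dvd i ?_).trans ?_
    · rw [hk, pow_succ']
      exact mul_dvd_mul hX hd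
    · rw [if_pos hinf, hk]
      push_cast
      rw [add_comm]
  · refine (lineMult_le h0 (n := m i) fun hd => h.not_pow_dvd i (hd.mul_left _)).trans ?_
    rw [if_neg hinf, zero_add]

theorem hasTotalMult (h : LineFactors a L m) : HasTotalMult a (∑ i, m i) := by
  set φ : Fin n → Projectivization ℂ (Fin 3 → ℂ) := fun i => Projectivization.mk ℂ (L i) (h.inv i).ne_zero with hφ
  have hinj : Function.Injective φ := by
    intro i j hij
    by_contra hne
    obtain ⟨c, hc⟩ := (Projectivization.mk_eq_mk_iff' _ _ _ _ _).1 hij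
    exact h.ne_smul hne c hc.symm
  have hIL : IL a = Set.range φ := by
    ext l
    constructor
    · intro hl
      obtain ⟨i, c, hc, e⟩ := h.exists_smul (show IsInvLine a l.rep from hl)
      refine ⟨i, ?_⟩
      rw [← l.mk_rep, hφ]
      simp only
      rw [Projectivization.mk_eq_mk_iff']
      exact ⟨c⁻¹, by rw [e, smul_smul, inv_mul_cancel₀ hc, one_smul]⟩
    · rintro ⟨i, rfl⟩
      exact (mem_IL_mk _).2 (h.inv i)
  refine ⟨hIL ▸ Set.finite_range φ, ?_⟩
  rw [hIL, finsum_mem_range hinj, finsum_eq_sum_of_fintype]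
  push_cast
  exact Finset.sum_congr rfl fun i _ => by rw [hφ, lineMult_mk, h.lineMult_eq]

theorem pullLine_id (l : Fin 3 → ℂ) : AffTransf.id.pullLine l = l := by
  ext i
  fin_cases i <;> simp [AffTransf.pullLine, AffTransf.id]

theorem config_lines (h : LineFactors a L m) {K : List ((Fin 3 → ℂ) × ℕ∞)}
    (hK : K = List.ofFn fun i => (L i, (m i : ℕ∞))) :
    (∀ l, IsInvLine a l → ∃ e ∈ K, ∃ c : ℂ, c ≠ 0 ∧ AffTransf.id.pullLine l = c • e.1) ∧
      ∀ e ∈ K, ∀ l, AffTransf.id.pullLine l = e.1 → IsInvLine a l ∧ lineMult a l = e.2 := by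
  subst hK
  constructor
  · intro l hl
    obtain ⟨i, c, hc, e⟩ := h.exists_smul hl
    exact ⟨_, List.mem_ofFn.2 ⟨i, rfl⟩, c, hc, by rw [pullLine_id, e]⟩
  · intro e he l hl
    obtain ⟨i, rfl⟩ := List.mem_ofFn.1 he
    rw [pullLine_id] at hl
    rw [hl]
    exact ⟨h.inv i, h.lineMult_eq i⟩

end LineFactors

/-! ### The invariant lines of the representatives -/

theorem rep_isQuadratic (i : Fin 11) : IsQuadratic (rep i) := by
  rw [isQuadratic_iff]
  fin_cases i <;> simp [rep]

theorem isInvLine_infinity (a : Sys) : IsInvLine a ![0, 0, 1] := Or.inl ⟨rfl, rfl, one_ne_zero⟩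

theorem lineFactors_rep0 : LineFactors (rep 0)
    ![![1, 0, -1], ![1, 0, 1], ![0, 1, -1], ![0, 1, 1], ![1, -1, 0], ![0, 0, 1]]
    ![1, 1, 1, 1, 1, 1] := by
  have inv : ∀ i, IsInvLine (rep 0) ((![![1, 0, -1], ![1, 0, 1], ![0, 1, -1], ![0, 1, 1], ![1, -1, 0], ![0, 0, 1]] :
      Fin 6 → Fin 3 → ℂ) i) := by
    intro i
    fin_cases i
    · refine Or.inr (isInvAffineLine_of_cofactor (by simp) (fun x y => x + 1) fun x y => ?_)
      simp [Pv, Qv, rep] <;> ring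
    · refine Or.inr (isInvAffineLine_of_cofactor (by simp) (fun x y => x - 1) fun x y => ?_)
      simp [Pv, Qv, rep] <;> ring
    · refine Or.inr (isInvAffineLine_of_cofactor (by simp) (fun x y => y + 1) fun x y => ?_)
      simp [Pv, Qv, rep] <;> ring
    · refine Or.inr (isInvAffineLine_of_cofactor (by simp) (fun x y => y - 1) fun x y => ?_)
      simp [Pv, Qv, rep] <;> ring
    · refine Or.inr (isInvAffineLine_of_cofactor (by simp) (fun x y => x + y) fun x y => ?_)
      simp [Pv, Qv, rep] <;> ring
    · exact isInvLine_infinity _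
  refine ⟨inv, ?_, ⟨-2, by norm_num, ?_⟩, fun i => ?_⟩
  · intro i j hij
    fin_cases i <;> fin_cases j <;> first
      | exact absurd hij (by decide)
      | (simp [CrossNe, Complex.ext_iff] <;> norm_num)
  · refine MvPolynomial.funext fun z => ?_
    rw [map_mul, eval_extactic]
    simp [Pv, Qv, dP0, dP1, dQ0, dQ1, rep, eval_linForm, Fin.prod_univ_succ]
    ring
  · have := one_le_lineMult (rep_isQuadratic 0) (inv i)
    fin_cases i <;> simpa using this

theorem lineFactors_rep1 : LineFactors (rep 1)
    ![![1, 0, -Complex.I], ![1, 0, Complex.I], ![0, 1, -Complex.I], ![0, 1, Complex.I], ![1, -1, 0], ![0, 0, 1]]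
    ![1, 1, 1, 1, 1, 1] := by
  have inv : ∀ i, IsInvLine (rep 1) ((![![1, 0, -Complex.I], ![1, 0, Complex.I], ![0, 1, -Complex.I], ![0, 1, Complex.I], ![1, -1, 0], ![0, 0, 1]] :
      Fin 6 → Fin 3 → ℂ) i) := by
    intro i
    fin_cases i
    · refine Or.inr (isInvAffineLine_of_cofactor (by simp) (fun x y => x + Complex.I) fun x y => ?_)
      simp [Pv, Qv, rep]
      ring_nf
      simp only [Complex.I_sq, Complex.I_pow_three]
      ring
    · refine Or.inr (isInvAffineLine_of_cofactor (by simp) (fun x y => x - Complex.I) fun x y => ?_)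
      simp [Pv, Qv, rep]
      ring_nf
      simp only [Complex.I_sq, Complex.I_pow_three]
      ring
    · refine Or.inr (isInvAffineLine_of_cofactor (by simp) (fun x y => y + Complex.I) fun x y => ?_)
      simp [Pv, Qv, rep]
      ring_nf
      simp only [Complex.I_sq, Complex.I_pow_three]
      ring
    · refine Or.inr (isInvAffineLine_of_cofactor (by simp) (fun x y => y - Complex.I) fun x y => ?_)
      simp [Pv, Qv, rep]
      ring_nf
      simp only [Complex.I_sq, Complex.I_pow_three]
      ring
    · refine Or.inr (isInvAffineLine_of_cofactor (by simp) (fun x y => x + y) fun x y => ?_)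
      simp [Pv, Qv, rep] <;> ring
    · exact isInvLine_infinity _
  refine ⟨inv, ?_, ⟨-2, by norm_num, ?_⟩, fun i => ?_⟩
  · intro i j hij
    fin_cases i <;> fin_cases j <;> first
      | exact absurd hij (by decide)
      | (simp [CrossNe, Complex.ext_iff] <;> norm_num)
  · refine MvPolynomial.funext fun z => ?_
    rw [map_mul, eval_extactic]
    simp [Pv, Qv, dP0, dP1, dQ0, dQ1, rep, eval_linForm, Fin.prod_univ_succ]
    ring_nf
    simp only [Complex.I_sq, Complex.I_pow_three, Complex.I_pow_four]
    ring
  · have := one_le_lineMult (rep_isQuadratic 1) (inv i)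
    fin_cases i <;> simpa using this

theorem lineFactors_rep2 : LineFactors (rep 2)
    ![![1, 0, 0], ![1, Complex.I, -Complex.I], ![1, Complex.I, Complex.I], ![1, -Complex.I, -Complex.I], ![1, -Complex.I, Complex.I], ![0, 0, 1]]
    ![1, 1, 1, 1, 1, 1] := by
  have inv : ∀ i, IsInvLine (rep 2) ((![![1, 0, 0], ![1, Complex.I, -Complex.I], ![1, Complex.I, Complex.I], ![1, -Complex.I, -Complex.I], ![1, -Complex.I, Complex.I], ![0, 0, 1]] :
      Fin 6 → Fin 3 → ℂ) i) := by
    intro i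
    fin_cases i
    · refine Or.inr (isInvAffineLine_of_cofactor (by simp) (fun x y => 2 * y) fun x y => ?_)
      simp [Pv, Qv, rep] <;> ring
    · refine Or.inr (isInvAffineLine_of_cofactor (by simp) (fun x y => -Complex.I * (x + Complex.I * y - (-Complex.I))) fun x y => ?_)
      simp [Pv, Qv, rep]
      ring_nf
      simp only [Complex.I_sq, Complex.I_pow_three]
      ring
    · refine Or.inr (isInvAffineLine_of_cofactor (by simp) (fun x y => -Complex.I * (x + Complex.I * y - (Complex.I))) fun x y => ?_)
      simp [Pv, Qv, rep]
      ring_nf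
      simp only [Complex.I_sq, Complex.I_pow_three]
      ring
    · refine Or.inr (isInvAffineLine_of_cofactor (by simp) (fun x y => Complex.I * (x - Complex.I * y - (-Complex.I))) fun x y => ?_)
      simp [Pv, Qv, rep]
      ring_nf
      simp only [Complex.I_sq, Complex.I_pow_three]
      ring
    · refine Or.inr (isInvAffineLine_of_cofactor (by simp) (fun x y => Complex.I * (x - Complex.I * y - (Complex.I))) fun x y => ?_)
      simp [Pv, Qv, rep]
      ring_nf
      simp only [Complex.I_sq, Complex.I_pow_three]
      ring
    · exact isInvLine_infinity _
  refine ⟨inv, ?_, ⟨-2, by norm_num, ?_⟩, fun i => ?_⟩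
  · intro i j hij
    fin_cases i <;> fin_cases j <;> first
      | exact absurd hij (by decide)
      | (simp [CrossNe, Complex.ext_iff] <;> norm_num)
  · refine MvPolynomial.funext fun z => ?_
    rw [map_mul, eval_extactic]
    simp [Pv, Qv, dP0, dP1, dQ0, dQ1, rep, eval_linForm, Fin.prod_univ_succ]
    ring_nf
    simp only [Complex.I_sq, Complex.I_pow_three, Complex.I_pow_four]
    ring
  · have := one_le_lineMult (rep_isQuadratic 2) (inv i)
    fin_cases i <;> simpa using this

theorem lineFactors_rep3 : LineFactors (rep 3)
    ![![1, 0, 0], ![1, Complex.I, -1], ![1, Complex.I, 1], ![1, -Complex.I, -1], ![1, -Complex.I, 1], ![0, 0, 1]]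
    ![1, 1, 1, 1, 1, 1] := by
  have inv : ∀ i, IsInvLine (rep 3) ((![![1, 0, 0], ![1, Complex.I, -1], ![1, Complex.I, 1], ![1, -Complex.I, -1], ![1, -Complex.I, 1], ![0, 0, 1]] :
      Fin 6 → Fin 3 → ℂ) i) := by
    intro i
    fin_cases i
    · refine Or.inr (isInvAffineLine_of_cofactor (by simp) (fun x y => 2 * y) fun x y => ?_)
      simp [Pv, Qv, rep] <;> ring
    · refine Or.inr (isInvAffineLine_of_cofactor (by simp) (fun x y => -Complex.I * (x + Complex.I * y - (-1))) fun x y => ?_)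
      simp [Pv, Qv, rep]
      ring_nf
      simp only [Complex.I_sq, Complex.I_pow_three]
      ring
    · refine Or.inr (isInvAffineLine_of_cofactor (by simp) (fun x y => -Complex.I * (x + Complex.I * y - (1))) fun x y => ?_)
      simp [Pv, Qv, rep]
      ring_nf
      simp only [Complex.I_sq, Complex.I_pow_three]
      ring
    · refine Or.inr (isInvAffineLine_of_cofactor (by simp) (fun x y => Complex.I * (x - Complex.I * y - (-1))) fun x y => ?_)
      simp [Pv, Qv, rep]
      ring_nf
      simp only [Complex.I_sq, Complex.I_pow_three]
      ring
    · refine Or.inr (isInvAffineLine_of_cofactor (by simp) (fun x y => Complex.I * (x - Complex.I * y - (1))) fun x y => ?_)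
      simp [Pv, Qv, rep]
      ring_nf
      simp only [Complex.I_sq, Complex.I_pow_three]
      ring
    · exact isInvLine_infinity _
  refine ⟨inv, ?_, ⟨-2, by norm_num, ?_⟩, fun i => ?_⟩
  · intro i j hij
    fin_cases i <;> fin_cases j <;> first
      | exact absurd hij (by decide)
      | (simp [CrossNe, Complex.ext_iff] <;> norm_num)
  · refine MvPolynomial.funext fun z => ?_
    rw [map_mul, eval_extactic]
    simp [Pv, Qv, dP0, dP1, dQ0, dQ1, rep, eval_linForm, Fin.prod_univ_succ]
    ring_nf
    simp only [Complex.I_sq, Complex.I_pow_three, Complex.I_pow_four]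
    ring
  · have := one_le_lineMult (rep_isQuadratic 3) (inv i)
    fin_cases i <;> simpa using this

theorem lineFactors_rep4 : LineFactors (rep 4)
    ![![1, 0, 0], ![0, 1, 0], ![1, -1, 0], ![0, 0, 1]]
    ![2, 2, 1, 1] := by
  have inv : ∀ i, IsInvLine (rep 4) ((![![1, 0, 0], ![0, 1, 0], ![1, -1, 0], ![0, 0, 1]] :
      Fin 4 → Fin 3 → ℂ) i) := by
    intro i
    fin_cases i
    · refine Or.inr (isInvAffineLine_of_cofactor (by simp) (fun x y => x) fun x y => ?_)
      simp [Pv, Qv, rep] <;> ring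
    · refine Or.inr (isInvAffineLine_of_cofactor (by simp) (fun x y => y) fun x y => ?_)
      simp [Pv, Qv, rep] <;> ring
    · refine Or.inr (isInvAffineLine_of_cofactor (by simp) (fun x y => x + y) fun x y => ?_)
      simp [Pv, Qv, rep] <;> ring
    · exact isInvLine_infinity _
  refine ⟨inv, ?_, ⟨-2, by norm_num, ?_⟩, fun i => ?_⟩
  · intro i j hij
    fin_cases i <;> fin_cases j <;> first
      | exact absurd hij (by decide)
      | (simp [CrossNe, Complex.ext_iff] <;> norm_num)
  · refine MvPolynomial.funext fun z => ?_
    rw [map_mul, eval_extactic]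
    simp [Pv, Qv, dP0, dP1, dQ0, dQ1, rep, eval_linForm, Fin.prod_univ_succ]
    ring
  · have h1 := one_le_lineMult (rep_isQuadratic 4) (inv i)
    fin_cases i
    · have := le_lineMult (isLimitOfLines_of_family (a := rep 4) (l := ![1, 0, 0]) (fun ε => ![-ε ^ 2, 0, 0, 1, 0, 0, 0, 0, 0, 0, 0, 1])
        (![fun ε => ![1, 0, (ε : ℂ)], fun ε => ![1, 0, -(ε : ℂ)]]) (by fun_prop)
        (by ext i; fin_cases i <;> simp [rep]) (fun j => by
          fin_cases j
          · exact (by fun_prop : Continuous fun ε : ℝ => (![1, 0, (ε : ℂ)] : Fin 3 → ℂ))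
          · exact (by fun_prop : Continuous fun ε : ℝ => (![1, 0, -(ε : ℂ)] : Fin 3 → ℂ)))
        (fun j => by fin_cases j <;> simp) (fun ε hε => by rw [isQuadratic_iff]; simp [hε])
        (fun ε hε j => by
          fin_cases j
          · refine isInvAffineLine_of_cofactor (by simp [hε]) (fun x y => x - ε) fun x y => ?_
            simp [Pv, Qv] <;> ring
          · refine isInvAffineLine_of_cofactor (by simp [hε]) (fun x y => x + ε) fun x y => ?_
            simp [Pv, Qv] <;> ring)
        (fun ε hε i j hij => by
          fin_cases i <;> fin_cases j <;> first
            | exact absurd hij (by decide)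
            | (simp [CrossNe, Complex.ext_iff, hε] <;> first
                | (intro h; exact hε (by linarith))
                | exact Or.inl fun h => hε (by linarith)
                | exact Or.inr fun h => hε (by linarith))))
      simpa [IsLineAtInfinity] using this
    · have := le_lineMult (isLimitOfLines_of_family (a := rep 4) (l := ![0, 1, 0]) (fun ε => ![0, 0, 0, 1, 0, 0, -ε ^ 2, 0, 0, 0, 0, 1])
        (![fun ε => ![0, 1, (ε : ℂ)], fun ε => ![0, 1, -(ε : ℂ)]]) (by fun_prop)
        (by ext i; fin_cases i <;> simp [rep]) (fun j => by
          fin_cases j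
          · exact (by fun_prop : Continuous fun ε : ℝ => (![0, 1, (ε : ℂ)] : Fin 3 → ℂ))
          · exact (by fun_prop : Continuous fun ε : ℝ => (![0, 1, -(ε : ℂ)] : Fin 3 → ℂ)))
        (fun j => by fin_cases j <;> simp) (fun ε hε => by rw [isQuadratic_iff]; simp [hε])
        (fun ε hε j => by
          fin_cases j
          · refine isInvAffineLine_of_cofactor (by simp [hε]) (fun x y => y - ε) fun x y => ?_
            simp [Pv, Qv] <;> ring
          · refine isInvAffineLine_of_cofactor (by simp [hε]) (fun x y => y + ε) fun x y => ?_
            simp [Pv, Qv] <;> ring)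
        (fun ε hε i j hij => by
          fin_cases i <;> fin_cases j <;> first
            | exact absurd hij (by decide)
            | (simp [CrossNe, Complex.ext_iff, hε] <;> first
                | (intro h; exact hε (by linarith))
                | exact Or.inl fun h => hε (by linarith)
                | exact Or.inr fun h => hε (by linarith))))
      simpa [IsLineAtInfinity] using this
    · simpa using h1
    · simpa using h1

theorem lineFactors_rep5 : LineFactors (rep 5)
    ![![1, 0, 0], ![1, Complex.I, 0], ![1, -Complex.I, 0], ![0, 0, 1]]
    ![1, 2, 2, 1] := by
  have inv : ∀ i, IsInvLine (rep 5) ((![![1, 0, 0], ![1, Complex.I, 0], ![1, -Complex.I, 0], ![0, 0, 1]] :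
      Fin 4 → Fin 3 → ℂ) i) := by
    intro i
    fin_cases i
    · refine Or.inr (isInvAffineLine_of_cofactor (by simp) (fun x y => 2 * y) fun x y => ?_)
      simp [Pv, Qv, rep] <;> ring
    · refine Or.inr (isInvAffineLine_of_cofactor (by simp) (fun x y => -Complex.I * (x + Complex.I * y - (0))) fun x y => ?_)
      simp [Pv, Qv, rep]
      ring_nf
      simp only [Complex.I_sq, Complex.I_pow_three]
      ring
    · refine Or.inr (isInvAffineLine_of_cofactor (by simp) (fun x y => Complex.I * (x - Complex.I * y - (0))) fun x y => ?_)
      simp [Pv, Qv, rep]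
      ring_nf
      simp only [Complex.I_sq, Complex.I_pow_three]
      ring
    · exact isInvLine_infinity _
  refine ⟨inv, ?_, ⟨-2, by norm_num, ?_⟩, fun i => ?_⟩
  · intro i j hij
    fin_cases i <;> fin_cases j <;> first
      | exact absurd hij (by decide)
      | (simp [CrossNe, Complex.ext_iff] <;> norm_num)
  · refine MvPolynomial.funext fun z => ?_
    rw [map_mul, eval_extactic]
    simp [Pv, Qv, dP0, dP1, dQ0, dQ1, rep, eval_linForm, Fin.prod_univ_succ]
    ring_nf
    simp only [Complex.I_sq, Complex.I_pow_three, Complex.I_pow_four]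
    ring
  · have h1 := one_le_lineMult (rep_isQuadratic 5) (inv i)
    fin_cases i
    · simpa using h1
    · have := le_lineMult (isLimitOfLines_of_family (a := rep 5) (l := ![1, Complex.I, 0]) (fun ε => ![0, 0, 0, 0, 1, 0, ε ^ 2, 0, 0, -1, 0, 1])
        (![fun ε => ![1, Complex.I, (ε : ℂ)], fun ε => ![1, Complex.I, -(ε : ℂ)]]) (by fun_prop)
        (by ext i; fin_cases i <;> simp [rep]) (fun j => by
          fin_cases j
          · exact (by fun_prop : Continuous fun ε : ℝ => (![1, Complex.I, (ε : ℂ)] : Fin 3 → ℂ))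
          · exact (by fun_prop : Continuous fun ε : ℝ => (![1, Complex.I, -(ε : ℂ)] : Fin 3 → ℂ)))
        (fun j => by fin_cases j <;> simp) (fun ε hε => by rw [isQuadratic_iff]; simp [hε])
        (fun ε hε j => by
          fin_cases j
          · refine isInvAffineLine_of_cofactor (by simp [hε]) (fun x y => -Complex.I * (x + Complex.I * y - ε)) fun x y => ?_
            simp [Pv, Qv]
            ring_nf
            simp only [Complex.I_sq, Complex.I_pow_three]
            ring
          · refine isInvAffineLine_of_cofactor (by simp [hε]) (fun x y => -Complex.I * (x + Complex.I * y + ε)) fun x y => ?_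
            simp [Pv, Qv]
            ring_nf
            simp only [Complex.I_sq, Complex.I_pow_three]
            ring)
        (fun ε hε i j hij => by
          fin_cases i <;> fin_cases j <;> first
            | exact absurd hij (by decide)
            | (simp [CrossNe, Complex.ext_iff, hε] <;> first
                | (intro h; exact hε (by linarith))
                | exact Or.inl fun h => hε (by linarith)
                | exact Or.inr fun h => hε (by linarith))))
      simpa [IsLineAtInfinity] using this
    · have := le_lineMult (isLimitOfLines_of_family (a := rep 5) (l := ![1, -Complex.I, 0]) (fun ε => ![0, 0, 0, 0, 1, 0, ε ^ 2, 0, 0, -1, 0, 1])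
        (![fun ε => ![1, -Complex.I, (ε : ℂ)], fun ε => ![1, -Complex.I, -(ε : ℂ)]]) (by fun_prop)
        (by ext i; fin_cases i <;> simp [rep]) (fun j => by
          fin_cases j
          · exact (by fun_prop : Continuous fun ε : ℝ => (![1, -Complex.I, (ε : ℂ)] : Fin 3 → ℂ))
          · exact (by fun_prop : Continuous fun ε : ℝ => (![1, -Complex.I, -(ε : ℂ)] : Fin 3 → ℂ)))
        (fun j => by fin_cases j <;> simp) (fun ε hε => by rw [isQuadratic_iff]; simp [hε])
        (fun ε hε j => by
          fin_cases j
          · refine isInvAffineLine_of_cofactor (by simp [hε]) (fun x y => Complex.I * (x - Complex.I * y - ε)) fun x y => ?_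
            simp [Pv, Qv]
            ring_nf
            simp only [Complex.I_sq, Complex.I_pow_three]
            ring
          · refine isInvAffineLine_of_cofactor (by simp [hε]) (fun x y => Complex.I * (x - Complex.I * y + ε)) fun x y => ?_
            simp [Pv, Qv]
            ring_nf
            simp only [Complex.I_sq, Complex.I_pow_three]
            ring)
        (fun ε hε i j hij => by
          fin_cases i <;> fin_cases j <;> first
            | exact absurd hij (by decide)
            | (simp [CrossNe, Complex.ext_iff, hε] <;> first
                | (intro h; exact hε (by linarith))
                | exact Or.inl fun h => hε (by linarith)
                | exact Or.inr fun h => hε (by linarith))))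
      simpa [IsLineAtInfinity] using this
    · simpa using h1

theorem lineFactors_rep6 : LineFactors (rep 6)
    ![![1, 0, -1], ![1, 0, 1], ![0, 1, 0], ![0, 0, 1]]
    ![2, 1, 1, 2] := by
  have inv : ∀ i, IsInvLine (rep 6) ((![![1, 0, -1], ![1, 0, 1], ![0, 1, 0], ![0, 0, 1]] :
      Fin 4 → Fin 3 → ℂ) i) := by
    intro i
    fin_cases i
    · refine Or.inr (isInvAffineLine_of_cofactor (by simp) (fun x y => x + 1) fun x y => ?_)
      simp [Pv, Qv, rep] <;> ring
    · refine Or.inr (isInvAffineLine_of_cofactor (by simp) (fun x y => x - 1) fun x y => ?_)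
      simp [Pv, Qv, rep] <;> ring
    · refine Or.inr (isInvAffineLine_of_cofactor (by simp) (fun x y => 2) fun x y => ?_)
      simp [Pv, Qv, rep] <;> ring
    · exact isInvLine_infinity _
  refine ⟨inv, ?_, ⟨-4, by norm_num, ?_⟩, fun i => ?_⟩
  · intro i j hij
    fin_cases i <;> fin_cases j <;> first
      | exact absurd hij (by decide)
      | (simp [CrossNe, Complex.ext_iff] <;> norm_num)
  · refine MvPolynomial.funext fun z => ?_
    rw [map_mul, eval_extactic]
    simp [Pv, Qv, dP0, dP1, dQ0, dQ1, rep, eval_linForm, Fin.prod_univ_succ]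
    ring
  · have h1 := one_le_lineMult (rep_isQuadratic 6) (inv i)
    fin_cases i
    · have := le_lineMult (isLimitOfLines_of_family (a := rep 6) (l := ![1, 0, -1]) (fun ε => ![-1, 0, 0, 1, 0, 0, 0, 0, 2, 0, 0, ε])
        (![fun ε => ![1, 0, -1], fun ε => ![1, -(ε : ℂ), -1]]) (by fun_prop)
        (by ext i; fin_cases i <;> simp [rep]) (fun j => by
          fin_cases j
          · exact (by fun_prop : Continuous fun ε : ℝ => (![1, 0, -1] : Fin 3 → ℂ))
          · exact (by fun_prop : Continuous fun ε : ℝ => (![1, -(ε : ℂ), -1] : Fin 3 → ℂ)))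
        (fun j => by fin_cases j <;> simp) (fun ε hε => by rw [isQuadratic_iff]; simp [hε])
        (fun ε hε j => by
          fin_cases j
          · refine isInvAffineLine_of_cofactor (by simp [hε]) (fun x y => x + 1) fun x y => ?_
            simp [Pv, Qv] <;> ring
          · refine isInvAffineLine_of_cofactor (by simp [hε]) (fun x y => x + ε * y + 1) fun x y => ?_
            simp [Pv, Qv] <;> ring)
        (fun ε hε i j hij => by
          fin_cases i <;> fin_cases j <;> first
            | exact absurd hij (by decide)
            | (simp [CrossNe, Complex.ext_iff, hε] <;> first
                | (intro h; exact hε (by linarith))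
                | exact Or.inl fun h => hε (by linarith)
                | exact Or.inr fun h => hε (by linarith))))
      simpa [IsLineAtInfinity] using this
    · simpa using h1
    · simpa using h1
    · have := le_lineMult (isLimitOfLines_of_family (a := rep 6) (l := ![0, 0, 1]) (fun ε => ![-1, 0, 0, 1, 0, 0, 0, 0, 2, 0, 0, ε])
        (![fun ε => ![0, (ε : ℂ) / 2, 1]]) (by fun_prop)
        (by ext i; fin_cases i <;> simp [rep]) (fun j => by
          fin_cases j
          · exact (by fun_prop : Continuous fun ε : ℝ => (![0, (ε : ℂ) / 2, 1] : Fin 3 → ℂ)))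
        (fun j => by fin_cases j <;> simp) (fun ε hε => by rw [isQuadratic_iff]; simp [hε])
        (fun ε hε j => by
          fin_cases j
          · refine isInvAffineLine_of_cofactor (by simp [hε]) (fun x y => ε * y) fun x y => ?_
            simp [Pv, Qv] <;> ring)
        (fun ε hε i j hij => by
          fin_cases i <;> fin_cases j <;> first
            | exact absurd hij (by decide)
            | (simp [CrossNe, Complex.ext_iff, hε] <;> first
                | (intro h; exact hε (by linarith))
                | exact Or.inl fun h => hε (by linarith)
                | exact Or.inr fun h => hε (by linarith))))
      rw [if_pos ⟨rfl, rfl, one_ne_zero⟩] at this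
      change ((2 : ℕ) : ℕ∞) ≤ lineMult (rep 6) ![0, 0, 1]
      exact_mod_cast this

theorem lineFactors_rep7 : LineFactors (rep 7)
    ![![1, 0, -1], ![1, 0, 1], ![0, 1, 0], ![0, 0, 1]]
    ![2, 2, 1, 1] := by
  have inv : ∀ i, IsInvLine (rep 7) ((![![1, 0, -1], ![1, 0, 1], ![0, 1, 0], ![0, 0, 1]] :
      Fin 4 → Fin 3 → ℂ) i) := by
    intro i
    fin_cases i
    · refine Or.inr (isInvAffineLine_of_cofactor (by simp) (fun x y => -(x + 1)) fun x y => ?_)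
      simp [Pv, Qv, rep] <;> ring
    · refine Or.inr (isInvAffineLine_of_cofactor (by simp) (fun x y => -(x - 1)) fun x y => ?_)
      simp [Pv, Qv, rep] <;> ring
    · refine Or.inr (isInvAffineLine_of_cofactor (by simp) (fun x y => -2 * x) fun x y => ?_)
      simp [Pv, Qv, rep] <;> ring
    · exact isInvLine_infinity _
  refine ⟨inv, ?_, ⟨-2, by norm_num, ?_⟩, fun i => ?_⟩
  · intro i j hij
    fin_cases i <;> fin_cases j <;> first
      | exact absurd hij (by decide)
      | (simp [CrossNe, Complex.ext_iff] <;> norm_num)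
  · refine MvPolynomial.funext fun z => ?_
    rw [map_mul, eval_extactic]
    simp [Pv, Qv, dP0, dP1, dQ0, dQ1, rep, eval_linForm, Fin.prod_univ_succ]
    ring
  · have h1 := one_le_lineMult (rep_isQuadratic 7) (inv i)
    fin_cases i
    · have := le_lineMult (isLimitOfLines_of_family (a := rep 7) (l := ![1, 0, -1]) (fun ε => ![1, 0, 0, -1, 0, -ε ^ 2, 0, 0, 0, 0, -1, 0])
        (![fun ε => ![1, (ε : ℂ), -1], fun ε => ![1, -(ε : ℂ), -1]]) (by fun_prop)
        (by ext i; fin_cases i <;> simp [rep]) (fun j => by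
          fin_cases j
          · exact (by fun_prop : Continuous fun ε : ℝ => (![1, (ε : ℂ), -1] : Fin 3 → ℂ))
          · exact (by fun_prop : Continuous fun ε : ℝ => (![1, -(ε : ℂ), -1] : Fin 3 → ℂ)))
        (fun j => by fin_cases j <;> simp) (fun ε hε => by rw [isQuadratic_iff]; simp [hε])
        (fun ε hε j => by
          fin_cases j
          · refine isInvAffineLine_of_cofactor (by simp [hε]) (fun x y => -(x + ε * y + 1)) fun x y => ?_
            simp [Pv, Qv] <;> ring
          · refine isInvAffineLine_of_cofactor (by simp [hε]) (fun x y => -(x - ε * y + 1)) fun x y => ?_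
            simp [Pv, Qv] <;> ring)
        (fun ε hε i j hij => by
          fin_cases i <;> fin_cases j <;> first
            | exact absurd hij (by decide)
            | (simp [CrossNe, Complex.ext_iff, hε] <;> first
                | (intro h; exact hε (by linarith))
                | exact Or.inl fun h => hε (by linarith)
                | exact Or.inr fun h => hε (by linarith))))
      simpa [IsLineAtInfinity] using this
    · have := le_lineMult (isLimitOfLines_of_family (a := rep 7) (l := ![1, 0, 1]) (fun ε => ![1, 0, 0, -1, 0, -ε ^ 2, 0, 0, 0, 0, -1, 0])
        (![fun ε => ![1, (ε : ℂ), 1], fun ε => ![1, -(ε : ℂ), 1]]) (by fun_prop)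
        (by ext i; fin_cases i <;> simp [rep]) (fun j => by
          fin_cases j
          · exact (by fun_prop : Continuous fun ε : ℝ => (![1, (ε : ℂ), 1] : Fin 3 → ℂ))
          · exact (by fun_prop : Continuous fun ε : ℝ => (![1, -(ε : ℂ), 1] : Fin 3 → ℂ)))
        (fun j => by fin_cases j <;> simp) (fun ε hε => by rw [isQuadratic_iff]; simp [hε])
        (fun ε hε j => by
          fin_cases j
          · refine isInvAffineLine_of_cofactor (by simp [hε]) (fun x y => -(x + ε * y - 1)) fun x y => ?_
            simp [Pv, Qv] <;> ring
          · refine isInvAffineLine_of_cofactor (by simp [hε]) (fun x y => -(x - ε * y - 1)) fun x y => ?_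
            simp [Pv, Qv] <;> ring)
        (fun ε hε i j hij => by
          fin_cases i <;> fin_cases j <;> first
            | exact absurd hij (by decide)
            | (simp [CrossNe, Complex.ext_iff, hε] <;> first
                | (intro h; exact hε (by linarith))
                | exact Or.inl fun h => hε (by linarith)
                | exact Or.inr fun h => hε (by linarith))))
      simpa [IsLineAtInfinity] using this
    · simpa using h1
    · simpa using h1

theorem lineFactors_rep8 : LineFactors (rep 8)
    ![![1, 0, -Complex.I], ![1, 0, Complex.I], ![0, 1, 0], ![0, 0, 1]]
    ![2, 2, 1, 1] := by
  have inv : ∀ i, IsInvLine (rep 8) ((![![1, 0, -Complex.I], ![1, 0, Complex.I], ![0, 1, 0], ![0, 0, 1]] :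
      Fin 4 → Fin 3 → ℂ) i) := by
    intro i
    fin_cases i
    · refine Or.inr (isInvAffineLine_of_cofactor (by simp) (fun x y => -(x + Complex.I)) fun x y => ?_)
      simp [Pv, Qv, rep]
      ring_nf
      simp only [Complex.I_sq, Complex.I_pow_three]
      ring
    · refine Or.inr (isInvAffineLine_of_cofactor (by simp) (fun x y => -(x - Complex.I)) fun x y => ?_)
      simp [Pv, Qv, rep]
      ring_nf
      simp only [Complex.I_sq, Complex.I_pow_three]
      ring
    · refine Or.inr (isInvAffineLine_of_cofactor (by simp) (fun x y => -2 * x) fun x y => ?_)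
      simp [Pv, Qv, rep] <;> ring
    · exact isInvLine_infinity _
  refine ⟨inv, ?_, ⟨-2, by norm_num, ?_⟩, fun i => ?_⟩
  · intro i j hij
    fin_cases i <;> fin_cases j <;> first
      | exact absurd hij (by decide)
      | (simp [CrossNe, Complex.ext_iff] <;> norm_num)
  · refine MvPolynomial.funext fun z => ?_
    rw [map_mul, eval_extactic]
    simp [Pv, Qv, dP0, dP1, dQ0, dQ1, rep, eval_linForm, Fin.prod_univ_succ]
    ring_nf
    simp only [Complex.I_sq, Complex.I_pow_three, Complex.I_pow_four]
    ring
  · have h1 := one_le_lineMult (rep_isQuadratic 8) (inv i)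
    fin_cases i
    · have := le_lineMult (isLimitOfLines_of_family (a := rep 8) (l := ![1, 0, -Complex.I]) (fun ε => ![-1, 0, 0, -1, 0, -ε ^ 2, 0, 0, 0, 0, -1, 0])
        (![fun ε => ![1, (ε : ℂ), -Complex.I], fun ε => ![1, -(ε : ℂ), -Complex.I]]) (by fun_prop)
        (by ext i; fin_cases i <;> simp [rep]) (fun j => by
          fin_cases j
          · exact (by fun_prop : Continuous fun ε : ℝ => (![1, (ε : ℂ), -Complex.I] : Fin 3 → ℂ))
          · exact (by fun_prop : Continuous fun ε : ℝ => (![1, -(ε : ℂ), -Complex.I] : Fin 3 → ℂ)))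
        (fun j => by fin_cases j <;> simp) (fun ε hε => by rw [isQuadratic_iff]; simp [hε])
        (fun ε hε j => by
          fin_cases j
          · refine isInvAffineLine_of_cofactor (by simp [hε]) (fun x y => -(x + ε * y + Complex.I)) fun x y => ?_
            simp [Pv, Qv]
            ring_nf
            simp only [Complex.I_sq, Complex.I_pow_three]
            ring
          · refine isInvAffineLine_of_cofactor (by simp [hε]) (fun x y => -(x - ε * y + Complex.I)) fun x y => ?_
            simp [Pv, Qv]
            ring_nf
            simp only [Complex.I_sq, Complex.I_pow_three]
            ring)
        (fun ε hε i j hij => by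
          fin_cases i <;> fin_cases j <;> first
            | exact absurd hij (by decide)
            | (simp [CrossNe, Complex.ext_iff, hε] <;> first
                | (intro h; exact hε (by linarith))
                | exact Or.inl fun h => hε (by linarith)
                | exact Or.inr fun h => hε (by linarith))))
      simpa [IsLineAtInfinity] using this
    · have := le_lineMult (isLimitOfLines_of_family (a := rep 8) (l := ![1, 0, Complex.I]) (fun ε => ![-1, 0, 0, -1, 0, -ε ^ 2, 0, 0, 0, 0, -1, 0])
        (![fun ε => ![1, (ε : ℂ), Complex.I], fun ε => ![1, -(ε : ℂ), Complex.I]]) (by fun_prop)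
        (by ext i; fin_cases i <;> simp [rep]) (fun j => by
          fin_cases j
          · exact (by fun_prop : Continuous fun ε : ℝ => (![1, (ε : ℂ), Complex.I] : Fin 3 → ℂ))
          · exact (by fun_prop : Continuous fun ε : ℝ => (![1, -(ε : ℂ), Complex.I] : Fin 3 → ℂ)))
        (fun j => by fin_cases j <;> simp) (fun ε hε => by rw [isQuadratic_iff]; simp [hε])
        (fun ε hε j => by
          fin_cases j
          · refine isInvAffineLine_of_cofactor (by simp [hε]) (fun x y => -(x + ε * y - Complex.I)) fun x y => ?_
            simp [Pv, Qv]
            ring_nf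
            simp only [Complex.I_sq, Complex.I_pow_three]
            ring
          · refine isInvAffineLine_of_cofactor (by simp [hε]) (fun x y => -(x - ε * y - Complex.I)) fun x y => ?_
            simp [Pv, Qv]
            ring_nf
            simp only [Complex.I_sq, Complex.I_pow_three]
            ring)
        (fun ε hε i j hij => by
          fin_cases i <;> fin_cases j <;> first
            | exact absurd hij (by decide)
            | (simp [CrossNe, Complex.ext_iff, hε] <;> first
                | (intro h; exact hε (by linarith))
                | exact Or.inl fun h => hε (by linarith)
                | exact Or.inr fun h => hε (by linarith))))
      simpa [IsLineAtInfinity] using this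
    · simpa using h1
    · simpa using h1

theorem lineFactors_rep9 : LineFactors (rep 9)
    ![![1, 0, 0], ![0, 0, 1]]
    ![3, 3] := by
  have inv : ∀ i, IsInvLine (rep 9) ((![![1, 0, 0], ![0, 0, 1]] :
      Fin 2 → Fin 3 → ℂ) i) := by
    intro i
    fin_cases i
    · refine Or.inr (isInvAffineLine_of_cofactor (by simp) (fun x y => x) fun x y => ?_)
      simp [Pv, Qv, rep] <;> ring
    · exact isInvLine_infinity _
  refine ⟨inv, ?_, ⟨-2, by norm_num, ?_⟩, fun i => ?_⟩
  · intro i j hij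
    fin_cases i <;> fin_cases j <;> first
      | exact absurd hij (by decide)
      | (simp [CrossNe, Complex.ext_iff] <;> norm_num)
  · refine MvPolynomial.funext fun z => ?_
    rw [map_mul, eval_extactic]
    simp [Pv, Qv, dP0, dP1, dQ0, dQ1, rep, eval_linForm, Fin.prod_univ_succ]
    ring
  · have h1 := one_le_lineMult (rep_isQuadratic 9) (inv i)
    fin_cases i
    · have := le_lineMult (isLimitOfLines_of_family (a := rep 9) (l := ![1, 0, 0]) (fun ε => ![-ε ^ 2, 0, 0, 1, 0, 0, 1, 0, 0, 0, 0, -ε ^ 2])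
        (![fun ε => ![1, 0, (ε : ℂ)], fun ε => ![1, 0, -(ε : ℂ)], fun ε => ![1, (ε : ℂ) ^ 2, 0]]) (by fun_prop)
        (by ext i; fin_cases i <;> simp [rep]) (fun j => by
          fin_cases j
          · exact (by fun_prop : Continuous fun ε : ℝ => (![1, 0, (ε : ℂ)] : Fin 3 → ℂ))
          · exact (by fun_prop : Continuous fun ε : ℝ => (![1, 0, -(ε : ℂ)] : Fin 3 → ℂ))
          · exact (by fun_prop : Continuous fun ε : ℝ => (![1, (ε : ℂ) ^ 2, 0] : Fin 3 → ℂ)))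
        (fun j => by fin_cases j <;> simp) (fun ε hε => by rw [isQuadratic_iff]; simp [hε])
        (fun ε hε j => by
          fin_cases j
          · refine isInvAffineLine_of_cofactor (by simp [hε]) (fun x y => x - ε) fun x y => ?_
            simp [Pv, Qv] <;> ring
          · refine isInvAffineLine_of_cofactor (by simp [hε]) (fun x y => x + ε) fun x y => ?_
            simp [Pv, Qv] <;> ring
          · refine isInvAffineLine_of_cofactor (by simp [hε]) (fun x y => x - ε ^ 2 * y) fun x y => ?_
            simp [Pv, Qv] <;> ring)
        (fun ε hε i j hij => by
          fin_cases i <;> fin_cases j <;> first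
            | exact absurd hij (by decide)
            | (simp [CrossNe, Complex.ext_iff, hε] <;> first
                | (intro h; exact hε (by linarith))
                | exact Or.inl fun h => hε (by linarith)
                | exact Or.inr fun h => hε (by linarith))))
      simpa [IsLineAtInfinity] using this
    · have := le_lineMult (isLimitOfLines_of_family (a := rep 9) (l := ![0, 0, 1]) (fun ε => ![-ε ^ 2, 0, 0, 1, 0, 0, 1, 0, 0, 0, 0, -ε ^ 2])
        (![fun ε => ![0, (ε : ℂ), 1], fun ε => ![0, -(ε : ℂ), 1]]) (by fun_prop)
        (by ext i; fin_cases i <;> simp [rep]) (fun j => by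
          fin_cases j
          · exact (by fun_prop : Continuous fun ε : ℝ => (![0, (ε : ℂ), 1] : Fin 3 → ℂ))
          · exact (by fun_prop : Continuous fun ε : ℝ => (![0, -(ε : ℂ), 1] : Fin 3 → ℂ)))
        (fun j => by fin_cases j <;> simp) (fun ε hε => by rw [isQuadratic_iff]; simp [hε])
        (fun ε hε j => by
          fin_cases j
          · refine isInvAffineLine_of_cofactor (by simp [hε]) (fun x y => ε * (1 - ε * y)) fun x y => ?_
            simp [Pv, Qv] <;> ring
          · refine isInvAffineLine_of_cofactor (by simp [hε]) (fun x y => -ε * (1 + ε * y)) fun x y => ?_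
            simp [Pv, Qv] <;> ring)
        (fun ε hε i j hij => by
          fin_cases i <;> fin_cases j <;> first
            | exact absurd hij (by decide)
            | (simp [CrossNe, Complex.ext_iff, hε] <;> first
                | (intro h; exact hε (by linarith))
                | exact Or.inl fun h => hε (by linarith)
                | exact Or.inr fun h => hε (by linarith))))
      rw [if_pos ⟨rfl, rfl, one_ne_zero⟩] at this
      change ((3 : ℕ) : ℕ∞) ≤ lineMult (rep 9) ![0, 0, 1]
      exact_mod_cast this

theorem lineFactors_rep10 : LineFactors (rep 10)
    ![![1, 0, 0], ![0, 0, 1]]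
    ![3, 3] := by
  have inv : ∀ i, IsInvLine (rep 10) ((![![1, 0, 0], ![0, 0, 1]] :
      Fin 2 → Fin 3 → ℂ) i) := by
    intro i
    fin_cases i
    · refine Or.inr (isInvAffineLine_of_cofactor (by simp) (fun x y => 1) fun x y => ?_)
      simp [Pv, Qv, rep] <;> ring
    · exact isInvLine_infinity _
  refine ⟨inv, ?_, ⟨-2, by norm_num, ?_⟩, fun i => ?_⟩
  · intro i j hij
    fin_cases i <;> fin_cases j <;> first
      | exact absurd hij (by decide)
      | (simp [CrossNe, Complex.ext_iff] <;> norm_num)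
  · refine MvPolynomial.funext fun z => ?_
    rw [map_mul, eval_extactic]
    simp [Pv, Qv, dP0, dP1, dQ0, dQ1, rep, eval_linForm, Fin.prod_univ_succ]
    ring
  · have h1 := one_le_lineMult (rep_isQuadratic 10) (inv i)
    fin_cases i
    · have := le_lineMult (isLimitOfLines_of_family (a := rep 10) (l := ![1, 0, 0]) (fun ε => ![0, 1, 0, 0, -ε ^ 2, 0, 0, 0, 1, -1, 0, -ε ^ 2])
        (![fun ε => ![1, 0, 0], fun ε => ![1, (ε : ℂ), 0], fun ε => ![1, -(ε : ℂ), 0]]) (by fun_prop)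
        (by ext i; fin_cases i <;> simp [rep]) (fun j => by
          fin_cases j
          · exact (by fun_prop : Continuous fun ε : ℝ => (![1, 0, 0] : Fin 3 → ℂ))
          · exact (by fun_prop : Continuous fun ε : ℝ => (![1, (ε : ℂ), 0] : Fin 3 → ℂ))
          · exact (by fun_prop : Continuous fun ε : ℝ => (![1, -(ε : ℂ), 0] : Fin 3 → ℂ)))
        (fun j => by fin_cases j <;> simp) (fun ε hε => by rw [isQuadratic_iff]; simp [hε])
        (fun ε hε j => by
          fin_cases j
          · refine isInvAffineLine_of_cofactor (by simp [hε]) (fun x y => 1 - 2 * ε ^ 2 * y) fun x y => ?_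
            simp [Pv, Qv] <;> ring
          · refine isInvAffineLine_of_cofactor (by simp [hε]) (fun x y => 1 - ε * x - ε ^ 2 * y) fun x y => ?_
            simp [Pv, Qv] <;> ring
          · refine isInvAffineLine_of_cofactor (by simp [hε]) (fun x y => 1 + ε * x - ε ^ 2 * y) fun x y => ?_
            simp [Pv, Qv] <;> ring)
        (fun ε hε i j hij => by
          fin_cases i <;> fin_cases j <;> first
            | exact absurd hij (by decide)
            | (simp [CrossNe, Complex.ext_iff, hε] <;> first
                | (intro h; exact hε (by linarith))
                | exact Or.inl fun h => hε (by linarith)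
                | exact Or.inr fun h => hε (by linarith))))
      simpa [IsLineAtInfinity] using this
    · have := le_lineMult (isLimitOfLines_of_family (a := rep 10) (l := ![0, 0, 1]) (fun ε => ![0, 1, 0, 0, -ε ^ 2, 0, 0, 0, 1, -1, 0, -ε ^ 2])
        (![fun ε => ![-(ε : ℂ), -(ε : ℂ) ^ 2, 1], fun ε => ![(ε : ℂ), -(ε : ℂ) ^ 2, 1]]) (by fun_prop)
        (by ext i; fin_cases i <;> simp [rep]) (fun j => by
          fin_cases j
          · exact (by fun_prop : Continuous fun ε : ℝ => (![-(ε : ℂ), -(ε : ℂ) ^ 2, 1] : Fin 3 → ℂ))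
          · exact (by fun_prop : Continuous fun ε : ℝ => (![(ε : ℂ), -(ε : ℂ) ^ 2, 1] : Fin 3 → ℂ)))
        (fun j => by fin_cases j <;> simp) (fun ε hε => by rw [isQuadratic_iff]; simp [hε])
        (fun ε hε j => by
          fin_cases j
          · refine isInvAffineLine_of_cofactor (by simp [hε]) (fun x y => -(ε * x + ε ^ 2 * y)) fun x y => ?_
            simp [Pv, Qv] <;> ring
          · refine isInvAffineLine_of_cofactor (by simp [hε]) (fun x y => ε * x - ε ^ 2 * y) fun x y => ?_
            simp [Pv, Qv] <;> ring)
        (fun ε hε i j hij => by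
          fin_cases i <;> fin_cases j <;> first
            | exact absurd hij (by decide)
            | (simp [CrossNe, Complex.ext_iff, hε] <;> first
                | (intro h; exact hε (by linarith))
                | exact Or.inl fun h => hε (by linarith)
                | exact Or.inr fun h => hε (by linarith))))
      rw [if_pos ⟨rfl, rfl, one_ne_zero⟩] at this
      change ((3 : ℕ) : ℕ∞) ≤ lineMult (rep 10) ![0, 0, 1]
      exact_mod_cast this

/-! ### The representatives are in `QSL₆` -/

theorem degreeOf_eq_zero_of_dvd {σ K : Type*} [Field K] {f d : MvPolynomial σ K} (hf : f ≠ 0) (h : d ∣ f) {i : σ}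
    (hi : degreeOf i f = 0) : degreeOf i d = 0 := by
  obtain ⟨g, rfl⟩ := h
  rw [degreeOf_mul_eq (left_ne_zero_of_mul hf) (right_ne_zero_of_mul hf)] at hi
  omega

theorem degreeOf_cubic {i j : Fin 2} (hij : i ≠ j) (c : Fin 4 → ℝ) :
    degreeOf i (C (c 0) + C (c 1) * X j + C (c 2) * X j ^ 2 + C (c 3) * X j ^ 3 : Poly) = 0 := by
  have h : ∀ (c : ℝ) (k : ℕ), degreeOf i (C c * X j ^ k : Poly) ≤ 0 := fun c k => by
    refine (degreeOf_C_mul_le _ _ _).trans ((degreeOf_pow_le _ _ _).trans ?_)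
    rw [degreeOf_X_of_ne hij, mul_zero]
  have h0 := h (c 0) 0
  have h1 := h (c 1) 1
  rw [pow_zero, mul_one] at h0
  rw [pow_one] at h1
  refine Nat.le_zero.1 ((degreeOf_add_le _ _ _).trans (max_le ?_ (h _ _)))
  refine (degreeOf_add_le _ _ _).trans (max_le ?_ (h _ _))
  exact (degreeOf_add_le _ _ _).trans (max_le h0 h1)

/-- Two polynomials are coprime if their ideal contains nonzero polynomials in `x` and in `y` only. -/
theorem isRelPrime_of_combination {f g : Poly} (c d : Fin 4 → ℝ) (u v u' v' : Poly)
    (hx : u * f + v * g = C (c 0) + C (c 1) * X 0 + C (c 2) * X 0 ^ 2 + C (c 3) * X 0 ^ 3)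
    (hy : u' * f + v' * g = C (d 0) + C (d 1) * X 1 + C (d 2) * X 1 ^ 2 + C (d 3) * X 1 ^ 3)
    (hx0 : ∃ z, eval z (u * f + v * g) ≠ 0) (hy0 : ∃ z, eval z (u' * f + v' * g) ≠ 0) : IsRelPrime f g := by
  intro e hf hg
  have hx1 : u * f + v * g ≠ 0 := by
    rintro h
    rw [h] at hx0
    simp at hx0
  have hy1 : u' * f + v' * g ≠ 0 := by
    rintro h
    rw [h] at hy0
    simp at hy0
  have k1 := degreeOf_eq_zero_of_dvd (i := 1) hx1 (dvd_add (hf.mul_left u) (hg.mul_left v))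
    (by rw [hx]; exact degreeOf_cubic (by decide) c)
  have k0 := degreeOf_eq_zero_of_dvd (i := 0) hy1 (dvd_add (hf.mul_left u') (hg.mul_left v'))
    (by rw [hy]; exact degreeOf_cubic (by decide) d)
  have ht : e.totalDegree = 0 := by
    rw [totalDegree_eq_zero_iff]
    intro m hm x
    fin_cases x
    · exact Nat.le_zero.1 (k0 ▸ monomial_le_degreeOf _ hm)
    · exact Nat.le_zero.1 (k1 ▸ monomial_le_degreeOf _ hm)
  rw [totalDegree_eq_zero_iff_eq_C] at ht
  have he : e ≠ 0 := by
    rintro rfl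
    exact hx1 (zero_dvd_iff.1 (dvd_add (hf.mul_left u) (hg.mul_left v)))
  rw [ht]
  refine (isUnit_iff_ne_zero.2 fun h => he ?_).map C
  rw [ht, h, C_0]

theorem rep_isQS (i : Fin 11) : IsQS (rep i) := by
  refine ⟨?_, rep_isQuadratic i⟩
  have key : ∀ c d : Fin 4 → ℝ, ∀ u v u' v' : Poly,
    u * p (rep i) + v * q (rep i) = C (c 0) + C (c 1) * X 0 + C (c 2) * X 0 ^ 2 + C (c 3) * X 0 ^ 3 →
    u' * p (rep i) + v' * q (rep i) = C (d 0) + C (d 1) * X 1 + C (d 2) * X 1 ^ 2 + C (d 3) * X 1 ^ 3 →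
    eval ![2, 2] (u * p (rep i) + v * q (rep i)) ≠ 0 → eval ![2, 2] (u' * p (rep i) + v' * q (rep i)) ≠ 0 →
    IsRelPrime (p (rep i)) (q (rep i)) := fun c d u v u' v' h1 h2 h3 h4 =>
    isRelPrime_of_combination c d u v u' v' h1 h2 ⟨_, h3⟩ ⟨_, h4⟩
  have ident : ∀ {f g : Poly}, (∀ z, eval z f = eval z g) → f = g := fun h => MvPolynomial.funext h
  fin_cases i
  · exact key ![-1, 0, 1, 0] ![-1, 0, 1, 0] 1 0 0 1 (ident fun z => by simp [p, p0, p1, p2, q, q0, q1, q2, rep] <;> ring)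
      (ident fun z => by simp [p, p0, p1, p2, q, q0, q1, q2, rep] <;> ring)
      (by simp [p, p0, p1, p2, q, q0, q1, q2, rep] <;> norm_num) (by simp [p, p0, p1, p2, q, q0, q1, q2, rep] <;> norm_num)
  · exact key ![1, 0, 1, 0] ![1, 0, 1, 0] 1 0 0 1 (ident fun z => by simp [p, p0, p1, p2, q, q0, q1, q2, rep] <;> ring)
      (ident fun z => by simp [p, p0, p1, p2, q, q0, q1, q2, rep] <;> ring)
      (by simp [p, p0, p1, p2, q, q0, q1, q2, rep] <;> norm_num) (by simp [p, p0, p1, p2, q, q0, q1, q2, rep] <;> norm_num)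
  · exact key ![0, 2, 0, 2] ![0, -2, 0, 2] (X 1) (-2 * X 0) (X 0) (2 * X 1) (ident fun z => by simp [p, p0, p1, p2, q, q0, q1, q2, rep] <;> ring)
      (ident fun z => by simp [p, p0, p1, p2, q, q0, q1, q2, rep] <;> ring)
      (by simp [p, p0, p1, p2, q, q0, q1, q2, rep] <;> norm_num) (by simp [p, p0, p1, p2, q, q0, q1, q2, rep] <;> norm_num)
  · exact key ![0, -2, 0, 2] ![0, 2, 0, 2] (X 1) (-2 * X 0) (X 0) (2 * X 1) (ident fun z => by simp [p, p0, p1, p2, q, q0, q1, q2, rep] <;> ring)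
      (ident fun z => by simp [p, p0, p1, p2, q, q0, q1, q2, rep] <;> ring)
      (by simp [p, p0, p1, p2, q, q0, q1, q2, rep] <;> norm_num) (by simp [p, p0, p1, p2, q, q0, q1, q2, rep] <;> norm_num)
  · exact key ![0, 0, 1, 0] ![0, 0, 1, 0] 1 0 0 1 (ident fun z => by simp [p, p0, p1, p2, q, q0, q1, q2, rep] <;> ring)
      (ident fun z => by simp [p, p0, p1, p2, q, q0, q1, q2, rep] <;> ring)
      (by simp [p, p0, p1, p2, q, q0, q1, q2, rep] <;> norm_num) (by simp [p, p0, p1, p2, q, q0, q1, q2, rep] <;> norm_num)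
  · exact key ![0, 0, 0, 2] ![0, 0, 0, 2] (X 1) (-2 * X 0) (X 0) (2 * X 1) (ident fun z => by simp [p, p0, p1, p2, q, q0, q1, q2, rep] <;> ring)
      (ident fun z => by simp [p, p0, p1, p2, q, q0, q1, q2, rep] <;> ring)
      (by simp [p, p0, p1, p2, q, q0, q1, q2, rep] <;> norm_num) (by simp [p, p0, p1, p2, q, q0, q1, q2, rep] <;> norm_num)
  · exact key ![-1, 0, 1, 0] ![0, 2, 0, 0] 1 0 0 1 (ident fun z => by simp [p, p0, p1, p2, q, q0, q1, q2, rep] <;> ring)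
      (ident fun z => by simp [p, p0, p1, p2, q, q0, q1, q2, rep] <;> ring)
      (by simp [p, p0, p1, p2, q, q0, q1, q2, rep] <;> norm_num) (by simp [p, p0, p1, p2, q, q0, q1, q2, rep] <;> norm_num)
  · exact key ![1, 0, -1, 0] ![0, 2, 0, 0] 1 0 (2 * X 1) (-X 0) (ident fun z => by simp [p, p0, p1, p2, q, q0, q1, q2, rep] <;> ring)
      (ident fun z => by simp [p, p0, p1, p2, q, q0, q1, q2, rep] <;> ring)
      (by simp [p, p0, p1, p2, q, q0, q1, q2, rep] <;> norm_num) (by simp [p, p0, p1, p2, q, q0, q1, q2, rep] <;> norm_num)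
  · exact key ![-1, 0, -1, 0] ![0, -2, 0, 0] 1 0 (2 * X 1) (-X 0) (ident fun z => by simp [p, p0, p1, p2, q, q0, q1, q2, rep] <;> ring)
      (ident fun z => by simp [p, p0, p1, p2, q, q0, q1, q2, rep] <;> ring)
      (by simp [p, p0, p1, p2, q, q0, q1, q2, rep] <;> norm_num) (by simp [p, p0, p1, p2, q, q0, q1, q2, rep] <;> norm_num)
  · exact key ![0, 0, 1, 0] ![1, 0, 0, 0] 1 0 0 1 (ident fun z => by simp [p, p0, p1, p2, q, q0, q1, q2, rep] <;> ring)
      (ident fun z => by simp [p, p0, p1, p2, q, q0, q1, q2, rep] <;> ring)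
      (by simp [p, p0, p1, p2, q, q0, q1, q2, rep] <;> norm_num) (by simp [p, p0, p1, p2, q, q0, q1, q2, rep] <;> norm_num)
  · exact key ![0, 1, 0, 0] ![0, 1, 0, 0] 1 0 (X 0) 1 (ident fun z => by simp [p, p0, p1, p2, q, q0, q1, q2, rep] <;> ring)
      (ident fun z => by simp [p, p0, p1, p2, q, q0, q1, q2, rep] <;> ring)
      (by simp [p, p0, p1, p2, q, q0, q1, q2, rep] <;> norm_num) (by simp [p, p0, p1, p2, q, q0, q1, q2, rep] <;> norm_num)

theorem rep_C2_ne_zero (i : Fin 11) : C2 (rep i) ≠ 0 := by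
  intro h
  have e : ∀ x y : ℝ, eval ![x, y] (C2 (rep i)) = 0 := fun x y => by rw [h, map_zero]
  have e1 := e 1 0
  have e2 := e 1 2
  fin_cases i <;> simp [C2, p2, q2, rep] at e1 e2 <;> norm_num at e2

/-- The lines of the configuration, with multiplicities, account for the extactic polynomial. -/
theorem exists_lineFactors (i : Fin 11) : ∃ (n : ℕ) (L : Fin n → Fin 3 → ℂ) (m : Fin n → ℕ),
    LineFactors (rep i) L m ∧ ∑ j, m j = 6 ∧ (config i).lines = List.ofFn fun j => (L j, (m j : ℕ∞)) := by
  fin_cases i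
  · exact ⟨_, _, _, lineFactors_rep0, by simp [Fin.sum_univ_succ], by simp [config, List.ofFn_succ]⟩
  · exact ⟨_, _, _, lineFactors_rep1, by simp [Fin.sum_univ_succ], by simp [config, List.ofFn_succ]⟩
  · exact ⟨_, _, _, lineFactors_rep2, by simp [Fin.sum_univ_succ], by simp [config, List.ofFn_succ]⟩
  · exact ⟨_, _, _, lineFactors_rep3, by simp [Fin.sum_univ_succ], by simp [config, List.ofFn_succ]⟩
  · exact ⟨_, _, _, lineFactors_rep4, by simp [Fin.sum_univ_succ], by simp [config, List.ofFn_succ]⟩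
  · exact ⟨_, _, _, lineFactors_rep5, by simp [Fin.sum_univ_succ], by simp [config, List.ofFn_succ]⟩
  · exact ⟨_, _, _, lineFactors_rep6, by simp [Fin.sum_univ_succ], by simp [config, List.ofFn_succ]⟩
  · exact ⟨_, _, _, lineFactors_rep7, by simp [Fin.sum_univ_succ], by simp [config, List.ofFn_succ]⟩
  · exact ⟨_, _, _, lineFactors_rep8, by simp [Fin.sum_univ_succ], by simp [config, List.ofFn_succ]⟩
  · exact ⟨_, _, _, lineFactors_rep9, by simp [Fin.sum_univ_succ], by simp [config, List.ofFn_succ]⟩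
  · exact ⟨_, _, _, lineFactors_rep10, by simp [Fin.sum_univ_succ], by simp [config, List.ofFn_succ]⟩

theorem rep_isQSL6 (i : Fin 11) : IsQSL6 (rep i) := by
  obtain ⟨n, L, m, h, hm, -⟩ := exists_lineFactors i
  exact ⟨rep_isQS i, fun hd => rep_C2_ne_zero i ((X2_dvd_CP_iff _).1 hd), hm ▸ h.hasTotalMult⟩

theorem SameOrbit.exists_pull {a b : Sys} (h : SameOrbit b a) : ∃ (g : AffTransf) (s : ℝ), s ≠ 0 ∧
    a = QuadSL.pull g s b := by
  obtain ⟨g, r, hr, hg⟩ := h.symm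
  exact ⟨g, _, one_div_ne_zero (mul_ne_zero hr g.det_ne), hg.eq_pull hr⟩

theorem isQSL6_of_sameOrbit {i : Fin 11} {a : Sys} (h : SameOrbit (rep i) a) : IsQSL6 a := by
  obtain ⟨g, s, hs, rfl⟩ := h.exists_pull
  exact (rep_isQSL6 i).pull g hs

/-! ### Local rings of the plane and intersection numbers -/

section LocalRing

variable {c c' : Fin 2 → ℂ}

theorem mem_pointIdeal {f : MvPolynomial (Fin 2) ℂ} : f ∈ pointIdeal c ↔ eval c f = 0 := RingHom.mem_ker

/-- The value at `c` of an element of the local ring. -/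
def evLoc (c : Fin 2 → ℂ) : LocalRingAt c →ₐ[ℂ] ℂ :=
  IsLocalization.liftAlgHom (M := (pointIdeal c).primeCompl) (f := (aeval c : MvPolynomial (Fin 2) ℂ →ₐ[ℂ] ℂ))
    fun y => isUnit_iff_ne_zero.2 fun h => y.2 (mem_pointIdeal.2 (by simpa using h))

theorem evLoc_algebraMap (f : MvPolynomial (Fin 2) ℂ) : evLoc c (algebraMap (MvPolynomial (Fin 2) ℂ) _ f) = eval c f := by
  simp [evLoc]

theorem isUnit_iff_evLoc {x : LocalRingAt c} : IsUnit x ↔ evLoc c x ≠ 0 := by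
  refine ⟨fun h => (h.map (evLoc c)).ne_zero, fun h => ?_⟩
  obtain ⟨f, s, rfl⟩ := IsLocalization.exists_mk'_eq (pointIdeal c).primeCompl x
  rw [IsLocalization.AtPrime.isUnit_mk'_iff (LocalRingAt c) (pointIdeal c)]
  intro hf
  apply h
  have h1 := congrArg (evLoc c) (IsLocalization.mk'_spec (LocalRingAt c) f s)
  rw [map_mul, evLoc_algebraMap, evLoc_algebraMap, mem_pointIdeal.1 hf] at h1
  exact (mul_eq_zero.1 h1).resolve_right fun h2 => s.2 (mem_pointIdeal.2 h2)

theorem evLoc_aeval (u : Fin 2 → LocalRingAt c') (f : MvPolynomial (Fin 2) ℂ) :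
    evLoc c' (aeval u f) = eval (fun i => evLoc c' (u i)) f := by
  have : (evLoc c').comp (aeval u) = aeval fun i => evLoc c' (u i) := by
    apply MvPolynomial.algHom_ext; intro i; simp
  simpa [MvPolynomial.coe_aeval_eq_eval] using DFunLike.congr_fun this f

/-- The homomorphism of local rings given by the images of the coordinates. -/
theorem exists_localHom (u : Fin 2 → LocalRingAt c') (hu : ∀ i, evLoc c' (u i) = c i) :
    ∃ φ : LocalRingAt c →ₐ[ℂ] LocalRingAt c', ∀ f, φ (algebraMap (MvPolynomial (Fin 2) ℂ) _ f) = aeval u f := by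
  refine ⟨IsLocalization.liftAlgHom (M := (pointIdeal c).primeCompl) (f := aeval u) fun y => ?_, fun f => by simp⟩
  rw [isUnit_iff_evLoc, evLoc_aeval, funext hu]
  exact fun h => y.2 (mem_pointIdeal.2 h)

theorem localHom_ext {A : Type*} [CommSemiring A] [Algebra ℂ A] {φ ψ : LocalRingAt c →ₐ[ℂ] A}
    (h : ∀ i, φ (algebraMap (MvPolynomial (Fin 2) ℂ) _ (X i)) = ψ (algebraMap (MvPolynomial (Fin 2) ℂ) _ (X i))) : φ = ψ := by
  refine IsLocalization.algHom_ext (pointIdeal c).primeCompl ?_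
  apply MvPolynomial.algHom_ext
  exact h

/-- The intersection number is invariant under isomorphisms of local rings. -/
theorem affInt_congr (e : LocalRingAt c ≃ₐ[ℂ] LocalRingAt c') {f g f' g' : MvPolynomial (Fin 2) ℂ}
    (h : Ideal.span {e (algebraMap (MvPolynomial (Fin 2) ℂ) _ f), e (algebraMap (MvPolynomial (Fin 2) ℂ) _ g)} =
      Ideal.span {algebraMap (MvPolynomial (Fin 2) ℂ) (LocalRingAt c') f', algebraMap (MvPolynomial (Fin 2) ℂ) _ g'}) : affInt f g c = affInt f' g' c' := by
  unfold affInt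
  congr 1
  refine LinearEquiv.rank_eq (Ideal.quotientEquivAlg _ _ e ?_).toLinearEquiv
  rw [← h, Ideal.map_span]
  congr 1
  ext x
  simp [Set.image_insert_eq]

theorem affInt_eq_of_span {f g f' g' : MvPolynomial (Fin 2) ℂ}
    (h : Ideal.span {algebraMap (MvPolynomial (Fin 2) ℂ) (LocalRingAt c) f, algebraMap (MvPolynomial (Fin 2) ℂ) _ g} =
      Ideal.span {algebraMap (MvPolynomial (Fin 2) ℂ) (LocalRingAt c) f', algebraMap (MvPolynomial (Fin 2) ℂ) _ g'}) : affInt f g c = affInt f' g' c :=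
  affInt_congr AlgEquiv.refl h

/-- Mutually inverse changes of coordinates. -/
theorem affInt_congr_of_homs {φ : LocalRingAt c →ₐ[ℂ] LocalRingAt c'} {ψ : LocalRingAt c' →ₐ[ℂ] LocalRingAt c}
    (h1 : ∀ i, φ (ψ (algebraMap (MvPolynomial (Fin 2) ℂ) _ (X i))) = algebraMap (MvPolynomial (Fin 2) ℂ) _ (X i))
    (h2 : ∀ i, ψ (φ (algebraMap (MvPolynomial (Fin 2) ℂ) _ (X i))) = algebraMap (MvPolynomial (Fin 2) ℂ) _ (X i)) {f g f' g' : MvPolynomial (Fin 2) ℂ}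
    (h : Ideal.span {φ (algebraMap (MvPolynomial (Fin 2) ℂ) _ f), φ (algebraMap (MvPolynomial (Fin 2) ℂ) _ g)} =
      Ideal.span {algebraMap (MvPolynomial (Fin 2) ℂ) (LocalRingAt c') f', algebraMap (MvPolynomial (Fin 2) ℂ) _ g'}) : affInt f g c = affInt f' g' c' :=
  affInt_congr (AlgEquiv.ofAlgHom φ ψ (localHom_ext h1) (localHom_ext h2)) h

/-- The intersection number is zero at a point that is not on one of the curves. -/
theorem affInt_eq_zero {f g : MvPolynomial (Fin 2) ℂ} (h : eval c f ≠ 0 ∨ eval c g ≠ 0) : affInt f g c = 0 := by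
  have htop : Ideal.span {algebraMap (MvPolynomial (Fin 2) ℂ) (LocalRingAt c) f, algebraMap (MvPolynomial (Fin 2) ℂ) _ g} = ⊤ := by
    rcases h with h | h
    · refine Ideal.eq_top_of_isUnit_mem _ (Ideal.subset_span (Set.mem_insert _ _)) ?_
      rwa [isUnit_iff_evLoc, evLoc_algebraMap]
    · refine Ideal.eq_top_of_isUnit_mem _ (Ideal.subset_span (Set.mem_insert_of_mem _ rfl)) ?_
      rwa [isUnit_iff_evLoc, evLoc_algebraMap]
  unfold affInt
  rw [htop]
  have : Subsingleton (LocalRingAt c ⧸ (⊤ : Ideal (LocalRingAt c))) := Ideal.Quotient.subsingleton_iff.2 rfl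
  rw [rank_subsingleton']
  simp

end LocalRing

/-! ### Projective changes of coordinates -/

/-- The homogeneous coordinates in the local ring at a point of the `i`-th chart. -/
def hat (i : Fin 3) (w : Fin 3 → ℂ) : Fin 3 → LocalRingAt (chartPt i w) :=
  i.insertNth 1 fun k => algebraMap (MvPolynomial (Fin 2) ℂ) _ (X k)

theorem hat_self (i : Fin 3) (w : Fin 3 → ℂ) : hat i w i = 1 := by simp [hat]

theorem hat_succAbove (i : Fin 3) (w : Fin 3 → ℂ) (k : Fin 2) :
    hat i w (i.succAbove k) = algebraMap (MvPolynomial (Fin 2) ℂ) _ (X k) := by simp [hat]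

theorem evLoc_hat {i : Fin 3} {w : Fin 3 → ℂ} (hi : w i ≠ 0) (k : Fin 3) :
    evLoc _ (hat i w k) = w k / w i := by
  rcases Fin.eq_self_or_eq_succAbove i k with rfl | ⟨k, rfl⟩
  · rw [hat_self, map_one, div_self hi]
  · rw [hat_succAbove, evLoc_algebraMap, eval_X, chartPt]

/-- Composition of a form with a linear map. -/
def subst3 (T : Matrix (Fin 3) (Fin 3) ℂ) (F : MvPolynomial (Fin 3) ℂ) : MvPolynomial (Fin 3) ℂ :=
  aeval (fun k => ∑ l, C (T k l) * X l) F

theorem algebraMap_dehom (i : Fin 3) (w : Fin 3 → ℂ) (F : MvPolynomial (Fin 3) ℂ) :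
    algebraMap (MvPolynomial (Fin 2) ℂ) (LocalRingAt (chartPt i w)) (dehom i F) = aeval (hat i w) F := by
  have : (Algebra.algHom ℂ (MvPolynomial (Fin 2) ℂ) (LocalRingAt (chartPt i w))).comp
      (aeval (i.insertNth (1 : MvPolynomial (Fin 2) ℂ) (fun j => X j) : Fin 3 → MvPolynomial (Fin 2) ℂ)) =
      aeval (hat i w) := by
    apply MvPolynomial.algHom_ext
    intro k
    rcases Fin.eq_self_or_eq_succAbove i k with rfl | ⟨k, rfl⟩
    · simp [hat_self]
    · simp [hat_succAbove]
      rfl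
  exact DFunLike.congr_fun this F

theorem aeval_subst3 {A : Type*} [CommRing A] [Algebra ℂ A] (T : Matrix (Fin 3) (Fin 3) ℂ)
    (F : MvPolynomial (Fin 3) ℂ) (y : Fin 3 → A) :
    aeval y (subst3 T F) = aeval (fun k => ∑ l, algebraMap ℂ A (T k l) * y l) F := by
  have : (aeval y).comp (aeval (fun k => ∑ l, C (T k l) * X l)) =
      aeval (fun k => ∑ l, algebraMap ℂ A (T k l) * y l) := by
    apply MvPolynomial.algHom_ext
    intro k
    simp
  exact DFunLike.congr_fun this F

theorem eval_subst3 (T : Matrix (Fin 3) (Fin 3) ℂ) (F : MvPolynomial (Fin 3) ℂ) (z : Fin 3 → ℂ) :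
    eval z (subst3 T F) = eval (T.mulVec z) F := by
  rw [← coe_aeval_eq_eval, ← coe_aeval_eq_eval]
  exact aeval_subst3 T F z

theorem IsHomogeneous.aeval_mul {A : Type*} [CommRing A] [Algebra ℂ A] {F : MvPolynomial (Fin 3) ℂ} {d : ℕ}
    (hF : F.IsHomogeneous d) (t : A) (y : Fin 3 → A) : aeval (fun k => t * y k) F = t ^ d * aeval y F := by
  rw [aeval_def, aeval_def, eval₂_eq', eval₂_eq', Finset.mul_sum]
  refine Finset.sum_congr rfl fun m hm => ?_
  have h := hF (mem_support_iff.1 hm)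
  rw [Finsupp.weight_apply, Finsupp.sum_fintype _ _ (by simp)] at h
  simp only [Pi.one_apply, smul_eq_mul, mul_one] at h
  simp only [mul_pow, Finset.prod_mul_distrib, Finset.prod_pow_eq_pow_sum, h]
  ring

theorem exists_chartHom {T : Matrix (Fin 3) (Fin 3) ℂ} {w w' : Fin 3 → ℂ} (hT : T.mulVec w = w') {i j : Fin 3}
    (hi : w i ≠ 0) (hj : w' j ≠ 0) :
    ∃ (φ : LocalRingAt (chartPt j w') →ₐ[ℂ] LocalRingAt (chartPt i w)) (t : LocalRingAt (chartPt i w)), IsUnit t ∧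
      ∀ k, φ (hat j w' k) = t * ∑ l, algebraMap ℂ _ (T k l) * hat i w l := by
  set y : Fin 3 → LocalRingAt (chartPt i w) := fun k => ∑ l, algebraMap ℂ _ (T k l) * hat i w l with hy
  have hev : ∀ k, evLoc _ (y k) = w' k / w i := by
    intro k
    rw [← hT, hy]
    simp only [map_sum, map_mul, evLoc_hat hi, AlgHom.commutes, Matrix.mulVec, dotProduct, Finset.sum_div]
    exact Finset.sum_congr rfl fun l _ => by simp [mul_div_assoc]
  have hu : IsUnit (y j) := by
    rw [isUnit_iff_evLoc, hev]
    exact div_ne_zero hj hi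
  obtain ⟨v, hv⟩ := hu
  have hvi : evLoc _ ((v⁻¹ : Units _) : LocalRingAt (chartPt i w)) = w i / w' j := by
    have h1 : ((v⁻¹ : Units _) : LocalRingAt (chartPt i w)) * y j = 1 := by rw [← hv, Units.inv_mul]
    have h2 := congrArg (evLoc (chartPt i w)) h1
    rw [map_mul, map_one, hev] at h2
    field_simp at h2 ⊢
    exact h2
  obtain ⟨φ, hφ⟩ := exists_localHom (c := chartPt j w')
    (fun k => ((v⁻¹ : Units _) : LocalRingAt (chartPt i w)) * y (j.succAbove k)) (fun k => by
      rw [map_mul, hvi, hev, chartPt]; field_simp)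
  refine ⟨φ, ((v⁻¹ : Units _) : LocalRingAt (chartPt i w)), Units.isUnit _, fun k => ?_⟩
  change _ = _ * y k
  rcases Fin.eq_self_or_eq_succAbove j k with rfl | ⟨k, rfl⟩
  · rw [hat_self, map_one, ← hv, Units.inv_mul]
  · rw [hat_succAbove, hφ, aeval_X]

theorem span_pair_mul_unit {A : Type*} [CommRing A] {f g u v : A} (hu : IsUnit u) (hv : IsUnit v) :
    Ideal.span {u * f, v * g} = Ideal.span {f, g} := by
  rw [Ideal.span_insert, Ideal.span_insert, Ideal.span_singleton_mul_left_unit hu,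
    Ideal.span_singleton_mul_left_unit hv]

theorem affInt_chart {T S : Matrix (Fin 3) (Fin 3) ℂ} (hST : S * T = 1) {w w' : Fin 3 → ℂ}
    (hT : T.mulVec w = w') {i j : Fin 3} (hi : w i ≠ 0) (hj : w' j ≠ 0) {F G : MvPolynomial (Fin 3) ℂ} {d e : ℕ}
    (hF : F.IsHomogeneous d) (hG : G.IsHomogeneous e) :
    affInt (dehom j F) (dehom j G) (chartPt j w') =
      affInt (dehom i (subst3 T F)) (dehom i (subst3 T G)) (chartPt i w) := by
  have hTS : T * S = 1 := mul_eq_one_comm.1 hST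
  have hS : S.mulVec w' = w := by rw [← hT, Matrix.mulVec_mulVec, hST, Matrix.one_mulVec]
  obtain ⟨φ, t, ht, hφ⟩ := exists_chartHom hT hi hj
  obtain ⟨ψ, s, hs, hψ⟩ := exists_chartHom hS hj hi
  have comp : ∀ {T S : Matrix (Fin 3) (Fin 3) ℂ} {w w' : Fin 3 → ℂ} {i j : Fin 3}
      {φ : LocalRingAt (chartPt j w') →ₐ[ℂ] LocalRingAt (chartPt i w)}
      {ψ : LocalRingAt (chartPt i w) →ₐ[ℂ] LocalRingAt (chartPt j w')} {t s}, S * T = 1 →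
      (∀ k, φ (hat j w' k) = t * ∑ l, algebraMap ℂ _ (T k l) * hat i w l) →
      (∀ k, ψ (hat i w k) = s * ∑ l, algebraMap ℂ _ (S k l) * hat j w' l) →
      ∀ k, φ (ψ (algebraMap (MvPolynomial (Fin 2) ℂ) _ (X k))) = algebraMap (MvPolynomial (Fin 2) ℂ) _ (X k) := by
    intro T S w w' i j φ ψ t s hST hφ hψ k
    have h1 : ∀ k, φ (ψ (hat i w k)) = φ s * t * hat i w k := by
      intro k
      rw [hψ, map_mul, map_sum, mul_assoc]
      congr 1
      simp only [map_mul, AlgHom.commutes, hφ]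
      have : hat i w k = ∑ m, algebraMap ℂ _ ((S * T) k m) * hat i w m := by
        rw [hST]
        simp [Matrix.one_apply]
      rw [this]
      simp only [Matrix.mul_apply, map_sum, map_mul, Finset.mul_sum, Finset.sum_mul]
      rw [Finset.sum_comm]
      exact Finset.sum_congr rfl fun m _ => Finset.sum_congr rfl fun l _ => by ring
    have h2 := h1 i
    rw [hat_self, map_one, map_one, mul_one] at h2
    rw [← hat_succAbove, h1, ← h2, one_mul]
  refine affInt_congr_of_homs (comp hST hφ hψ) (comp hTS hψ hφ) ?_
  have key : ∀ {F : MvPolynomial (Fin 3) ℂ} {d : ℕ}, F.IsHomogeneous d →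
      φ (algebraMap (MvPolynomial (Fin 2) ℂ) _ (dehom j F)) = t ^ d * algebraMap (MvPolynomial (Fin 2) ℂ) _ (dehom i (subst3 T F)) := by
    intro F d hF
    rw [algebraMap_dehom, algebraMap_dehom, aeval_subst3, ← IsHomogeneous.aeval_mul hF]
    have : φ.comp (aeval (hat j w')) = aeval (fun k => t * ∑ l, algebraMap ℂ _ (T k l) * hat i w l) := by
      apply MvPolynomial.algHom_ext
      intro k
      simp [hφ]
    exact DFunLike.congr_fun this F
  rw [key hF, key hG, span_pair_mul_unit (ht.pow d) (ht.pow e)]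

/-! ### Dimensions -/

theorem isUnit_mk_of_pow_mem {I : Ideal (MvPolynomial (Fin 2) ℂ)} {a b : ℕ} (h0 : X 0 ^ a ∈ I) (h1 : X 1 ^ b ∈ I)
    {s : MvPolynomial (Fin 2) ℂ} (hs : eval 0 s ≠ 0) : IsUnit (Ideal.Quotient.mk I s) := by
  have hX : ∀ i, IsNilpotent (Ideal.Quotient.mk I (X i)) := by
    intro i
    fin_cases i
    · exact ⟨a, by rw [← map_pow]; exact Ideal.Quotient.eq_zero_iff_mem.2 h0⟩
    · exact ⟨b, by rw [← map_pow]; exact Ideal.Quotient.eq_zero_iff_mem.2 h1⟩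
  have key : ∀ f : MvPolynomial (Fin 2) ℂ, IsNilpotent (Ideal.Quotient.mk I (f - C (eval 0 f))) := by
    intro f
    induction f using MvPolynomial.induction_on with
    | C c => simp
    | add f g hf hg =>
      have := (Commute.all _ _).isNilpotent_add hf hg
      rw [← map_add] at this
      have e : f + g - C (eval 0 (f + g)) = f - C (eval 0 f) + (g - C (eval 0 g)) := by rw [map_add, map_add]; ring
      rw [e]
      exact this
    | mul_X f i hf =>
      rw [map_mul, eval_X, Pi.zero_apply, mul_zero, C_0, sub_zero, map_mul]
      exact (Commute.all _ _).isNilpotent_mul_left (hX i)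
  have hu : IsUnit (Ideal.Quotient.mk I (C (eval 0 s))) :=
    ((isUnit_iff_ne_zero.2 hs).map C).map _
  have := (key s).isUnit_add_left_of_commute hu (Commute.all _ _)
  rwa [← map_add, add_sub_cancel] at this

/-- The local intersection number as the dimension of a quotient of the polynomial ring. -/
theorem affInt_eq_of_isUnit {f g : MvPolynomial (Fin 2) ℂ} {c : Fin 2 → ℂ}
    (h : ∀ s, eval c s ≠ 0 → IsUnit (Ideal.Quotient.mk (Ideal.span {f, g}) s)) :
    affInt f g c = Cardinal.toENat (Module.rank ℂ (MvPolynomial (Fin 2) ℂ ⧸ Ideal.span {f, g})) := by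
  set I := Ideal.span {f, g} with hI
  set J : Ideal (LocalRingAt c) := Ideal.span
      {algebraMap (MvPolynomial (Fin 2) ℂ) (LocalRingAt c) f, algebraMap _ _ g} with hJ
  have hIJ : J = I.map (algebraMap (MvPolynomial (Fin 2) ℂ) (LocalRingAt c)) := by
    rw [hI, hJ, Ideal.map_span, Set.image_pair]
  have hinv : ∀ s, eval c s ≠ 0 → ∃ t, s * t - 1 ∈ I := by
    intro s hs
    obtain ⟨t, ht⟩ := (h s hs).exists_right_inv
    obtain ⟨t, rfl⟩ := Ideal.Quotient.mk_surjective t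
    refine ⟨t, Ideal.Quotient.eq_zero_iff_mem.1 ?_⟩
    rw [map_sub, map_mul, ht, map_one, sub_self]
  set φ : MvPolynomial (Fin 2) ℂ →ₐ[ℂ] LocalRingAt c ⧸ J :=
    (Ideal.Quotient.mkₐ ℂ J).comp (Algebra.algHom ℂ (MvPolynomial (Fin 2) ℂ) (LocalRingAt c)) with hφ
  have hφe : ∀ f, φ f = Ideal.Quotient.mk J (algebraMap (MvPolynomial (Fin 2) ℂ) (LocalRingAt c) f) := fun f => rfl
  have hsurj : Function.Surjective φ := by
    intro x
    obtain ⟨x, rfl⟩ := Ideal.Quotient.mk_surjective x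
    obtain ⟨f, s, rfl⟩ := IsLocalization.exists_mk'_eq (pointIdeal c).primeCompl x
    obtain ⟨t, ht⟩ := hinv s fun h0 => s.2 (mem_pointIdeal.2 h0)
    refine ⟨f * t, ?_⟩
    rw [hφe, Ideal.Quotient.eq]
    have h1 := IsLocalization.mk'_spec (LocalRingAt c) f s
    have h2 : algebraMap (MvPolynomial (Fin 2) ℂ) (LocalRingAt c) (s * t - 1) ∈ J := by
      rw [hIJ]; exact Ideal.mem_map_of_mem _ ht
    have h3 := J.mul_mem_left (IsLocalization.mk' (LocalRingAt c) f s) h2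
    convert h3 using 1
    rw [map_mul, ← h1, map_sub, map_mul, map_one]
    ring
  have hker : RingHom.ker φ = I := by
    ext f
    rw [RingHom.mem_ker, hφe, Ideal.Quotient.eq_zero_iff_mem, hIJ,
      IsLocalization.algebraMap_mem_map_algebraMap_iff (pointIdeal c).primeCompl]
    constructor
    · rintro ⟨s, hs, hsf⟩
      obtain ⟨t, ht⟩ := hinv s fun h0 => hs (mem_pointIdeal.2 h0)
      have := I.sub_mem (I.mul_mem_left t hsf) (I.mul_mem_left f ht)
      convert this using 1
      ring
    · intro hf
      exact ⟨1, Submonoid.one_mem _, by simpa using hf⟩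
  unfold affInt
  rw [← LinearEquiv.rank_eq (Ideal.quotientKerAlgEquivOfSurjective hsurj).toLinearEquiv,
    LinearEquiv.rank_eq (Ideal.quotientEquivAlgOfEq ℂ hker).toLinearEquiv]

theorem rank_eq_of_surjective {U V W : Type} [AddCommGroup U] [AddCommGroup V] [AddCommGroup W] [Module ℂ U]
    [Module ℂ V] [Module ℂ W] {π : U →ₗ[ℂ] V} {Λ : U →ₗ[ℂ] W} (hπ : Function.Surjective π)
    (hΛ : Function.Surjective Λ) (h : ∀ x, π x = 0 ↔ Λ x = 0) : Module.rank ℂ V = Module.rank ℂ W := by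
  have hI : LinearMap.ker π = LinearMap.ker Λ := by
    ext f
    rw [LinearMap.mem_ker, LinearMap.mem_ker, h]
  rw [← (π.quotKerEquivOfSurjective hπ).rank_eq, ← (Λ.quotKerEquivOfSurjective hΛ).rank_eq,
    (Submodule.quotEquivOfEq _ _ hI).rank_eq]

theorem rank_quotient_of_linearMap {I : Ideal (MvPolynomial (Fin 2) ℂ)} {ι : Type} [Fintype ι]
    (Λ : MvPolynomial (Fin 2) ℂ →ₗ[ℂ] (ι → ℂ)) (hs : Function.Surjective Λ) (hk : ∀ f, Λ f = 0 ↔ f ∈ I) :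
    Cardinal.toENat (Module.rank ℂ (MvPolynomial (Fin 2) ℂ ⧸ I)) = Fintype.card ι := by
  rw [rank_eq_of_surjective (π := (Ideal.Quotient.mkₐ ℂ I).toLinearMap) (Ideal.Quotient.mkₐ_surjective ℂ I) hs
    fun f => Ideal.Quotient.eq_zero_iff_mem.trans (hk f).symm]
  simp

theorem span_pair_le {A : Type*} [CommRing A] {a b : A} {I : Ideal A} : Ideal.span {a, b} ≤ I ↔ a ∈ I ∧ b ∈ I := by
  rw [Ideal.span_le, Set.insert_subset_iff, Set.singleton_subset_iff]
  rfl

theorem affInt_X_pow (a b : ℕ) : affInt (X 0 ^ a) (X 1 ^ b) 0 = (a * b : ℕ) := by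
  classical
  have h0 : X 0 ^ a ∈ (Ideal.span {X 0 ^ a, X 1 ^ b} : Ideal (MvPolynomial (Fin 2) ℂ)) :=
    Ideal.subset_span (Set.mem_insert _ _)
  have h1 : X 1 ^ b ∈ (Ideal.span {X 0 ^ a, X 1 ^ b} : Ideal (MvPolynomial (Fin 2) ℂ)) :=
    Ideal.subset_span (Set.mem_insert_of_mem _ rfl)
  rw [affInt_eq_of_isUnit fun s hs => isUnit_mk_of_pow_mem h0 h1 hs]
  set ν : Fin a × Fin b → (Fin 2 →₀ ℕ) := fun k => Finsupp.single 0 (k.1 : ℕ) + Finsupp.single 1 (k.2 : ℕ) with hν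
  have hν0 : ∀ k, ν k 0 = k.1 := fun k => by simp [hν]
  have hν1 : ∀ k, ν k 1 = k.2 := fun k => by simp [hν]
  have hinj : Function.Injective ν := by
    intro k l h
    have h0 := DFunLike.congr_fun h 0
    have h1 := DFunLike.congr_fun h 1
    rw [hν0, hν0] at h0
    rw [hν1, hν1] at h1
    exact Prod.ext (Fin.ext h0) (Fin.ext h1)
  set Λ : MvPolynomial (Fin 2) ℂ →ₗ[ℂ] (Fin a × Fin b → ℂ) := LinearMap.pi fun k => lcoeff ℂ (ν k) with hΛ
  have hΛe : ∀ f k, Λ f k = coeff (ν k) f := fun f k => rfl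
  rw [rank_quotient_of_linearMap Λ]
  · simp
  · intro v
    refine ⟨∑ k, monomial (ν k) (v k), ?_⟩
    ext k
    rw [hΛe, coeff_sum]
    simp [coeff_monomial, hinj.eq_iff]
  · intro f
    have hset : ({X 0 ^ a, X 1 ^ b} : Set (MvPolynomial (Fin 2) ℂ)) =
        (fun s => monomial s (1 : ℂ)) '' {Finsupp.single 0 a, Finsupp.single 1 b} := by
      rw [Set.image_pair, X_pow_eq_monomial, X_pow_eq_monomial]
    rw [hset, mem_ideal_span_monomial_image]
    constructor
    · intro h m hm
      by_contra! hlt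
      have h0 : m 0 < a := by
        by_contra! hle
        exact hlt (Finsupp.single 0 a) (by simp) (by rwa [Finsupp.single_le_iff])
      have h1 : m 1 < b := by
        by_contra! hle
        exact hlt (Finsupp.single 1 b) (by simp) (by rwa [Finsupp.single_le_iff])
      have := congrFun h (⟨m 0, h0⟩, ⟨m 1, h1⟩)
      rw [hΛe] at this
      have hm' : ν (⟨m 0, h0⟩, ⟨m 1, h1⟩) = m := by
        ext i; fin_cases i
        · exact hν0 _
        · exact hν1 _
      rw [hm'] at this
      exact mem_support_iff.1 hm this
    · intro h
      ext k
      rw [hΛe]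
      by_contra hne
      obtain ⟨s, hs, hle⟩ := h _ (mem_support_iff.2 hne)
      rcases hs with rfl | rfl
      · have := Finsupp.single_le_iff.1 hle
        rw [hν0] at this
        omega
      · have := Finsupp.single_le_iff.1 hle
        rw [hν1] at this
        omega

/-! ### Intersection numbers at points of the projective plane -/

theorem chartOf_ne_zero {w : Fin 3 → ℂ} (hw : w ≠ 0) : w (chartOf w) ≠ 0 := by
  unfold chartOf
  split_ifs with h2 h1
  · exact h2
  · exact h1
  · intro h0
    apply hw
    ext i
    fin_cases i
    · exact h0
    · simpa using h1
    · simpa using h2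

theorem projInt_mulVec {T S : Matrix (Fin 3) (Fin 3) ℂ} (hST : S * T = 1) {w w' : Fin 3 → ℂ} (hw : w ≠ 0)
    (hT : T.mulVec w = w') {F G : MvPolynomial (Fin 3) ℂ} {d e : ℕ}
    (hF : F.IsHomogeneous d) (hG : G.IsHomogeneous e) :
    projInt F G w' = projInt (subst3 T F) (subst3 T G) w := by
  have hw' : w' ≠ 0 := by
    rintro rfl
    apply hw
    rw [← Matrix.one_mulVec w, ← hST, ← Matrix.mulVec_mulVec, hT, Matrix.mulVec_zero]
  exact affInt_chart hST hT (chartOf_ne_zero hw) (chartOf_ne_zero hw') hF hG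

theorem projInt_congr {F G F' G' : MvPolynomial (Fin 3) ℂ} (h : Ideal.span {F, G} = Ideal.span {F', G'})
    (w : Fin 3 → ℂ) : projInt F G w = projInt F' G' w := by
  refine affInt_eq_of_span ?_
  have h1 := congrArg (Ideal.map ((algebraMap (MvPolynomial (Fin 2) ℂ) (LocalRingAt (chartPt (chartOf w) w))).comp
    (aeval ((chartOf w).insertNth (1 : MvPolynomial (Fin 2) ℂ) (fun j => X j) :
      Fin 3 → MvPolynomial (Fin 2) ℂ)).toRingHom)) h
  rw [Ideal.map_span, Ideal.map_span, Set.image_pair, Set.image_pair] at h1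
  exact h1

theorem eval_dehom (i : Fin 3) (F : MvPolynomial (Fin 3) ℂ) (c : Fin 2 → ℂ) :
    eval c (dehom i F) = eval (i.insertNth 1 c : Fin 3 → ℂ) F := by
  have : (aeval c).comp (aeval (i.insertNth (1 : MvPolynomial (Fin 2) ℂ) (fun j => X j) :
      Fin 3 → MvPolynomial (Fin 2) ℂ)) = aeval (i.insertNth 1 c : Fin 3 → ℂ) := by
    apply MvPolynomial.algHom_ext
    intro k
    rcases Fin.eq_self_or_eq_succAbove i k with rfl | ⟨k, rfl⟩ <;> simp
  exact DFunLike.congr_fun this F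

theorem eval_dehom_chartPt {i : Fin 3} {w : Fin 3 → ℂ} (hi : w i ≠ 0) {F : MvPolynomial (Fin 3) ℂ} {d : ℕ}
    (hF : F.IsHomogeneous d) : eval (chartPt i w) (dehom i F) = (w i)⁻¹ ^ d * eval w F := by
  rw [eval_dehom]
  have e : (i.insertNth 1 (chartPt i w) : Fin 3 → ℂ) = fun k => (w i)⁻¹ * w k := by
    ext k
    rcases Fin.eq_self_or_eq_succAbove i k with rfl | ⟨k, rfl⟩
    · simp [hi]
    · simp [chartPt, div_eq_inv_mul]
  rw [e]
  exact IsHomogeneous.aeval_mul (A := ℂ) hF _ _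

theorem projInt_eq_zero {F G : MvPolynomial (Fin 3) ℂ} {d e : ℕ} (hF : F.IsHomogeneous d) (hG : G.IsHomogeneous e)
    {w : Fin 3 → ℂ} (hw : w ≠ 0) (h : eval w F ≠ 0 ∨ eval w G ≠ 0) : projInt F G w = 0 := by
  have hi := chartOf_ne_zero hw
  refine affInt_eq_zero ?_
  rw [eval_dehom_chartPt hi hF, eval_dehom_chartPt hi hG]
  exact h.imp (mul_ne_zero (pow_ne_zero _ (inv_ne_zero hi))) (mul_ne_zero (pow_ne_zero _ (inv_ne_zero hi)))

theorem chartOf_origin : chartOf ![0, 0, 1] = 2 := by simp [chartOf]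

theorem chartPt_origin : chartPt 2 ![0, 0, 1] = 0 := by
  ext k
  fin_cases k
  · simp [chartPt, show (2 : Fin 3).succAbove 0 = 0 from rfl]
  · simp [chartPt, show (2 : Fin 3).succAbove 1 = 1 from rfl]

theorem insertNth_two (z : Fin 2 → ℂ) : ((2 : Fin 3).insertNth 1 z : Fin 3 → ℂ) = ![z 0, z 1, 1] := by
  ext k
  fin_cases k
  · exact Fin.insertNth_apply_succAbove (α := fun _ => ℂ) (2 : Fin 3) 1 z 0
  · exact Fin.insertNth_apply_succAbove (α := fun _ => ℂ) (2 : Fin 3) 1 z 1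
  · exact Fin.insertNth_apply_same (α := fun _ => ℂ) (2 : Fin 3) 1 z

theorem eval_dehom_subst3 (T : Matrix (Fin 3) (Fin 3) ℂ) (F : MvPolynomial (Fin 3) ℂ) (z : Fin 2 → ℂ) :
    eval z (dehom 2 (subst3 T F)) = eval (T.mulVec ![z 0, z 1, 1]) F := by
  rw [eval_dehom, eval_subst3, insertNth_two]

theorem vec_origin_ne : (![0, 0, 1] : Fin 3 → ℂ) ≠ 0 := fun h => one_ne_zero (congrFun h 2)

theorem projInt_eq_affInt_zero {T S : Matrix (Fin 3) (Fin 3) ℂ} (hST : S * T = 1) {w : Fin 3 → ℂ}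
    (hT : T.mulVec ![0, 0, 1] = w) {F G : MvPolynomial (Fin 3) ℂ} {d e : ℕ}
    (hF : F.IsHomogeneous d) (hG : G.IsHomogeneous e) :
    projInt F G w = affInt (dehom 2 (subst3 T F)) (dehom 2 (subst3 T G)) 0 := by
  rw [projInt_mulVec hST vec_origin_ne hT hF hG, projInt, chartOf_origin, chartPt_origin]

/-- An ideal that is locally generated by powers of the coordinates. -/
theorem affInt_eq_mul {f g : MvPolynomial (Fin 2) ℂ} (a b : ℕ) (s α β s' γ δ κ l μ ν : MvPolynomial (Fin 2) ℂ)
    (hs : eval 0 s ≠ 0) (hs' : eval 0 s' ≠ 0)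
    (h1 : ∀ z, eval z s * z 0 ^ a = eval z α * eval z f + eval z β * eval z g)
    (h2 : ∀ z, eval z s' * z 1 ^ b = eval z γ * eval z f + eval z δ * eval z g)
    (h3 : ∀ z, eval z f = eval z κ * z 0 ^ a + eval z l * z 1 ^ b)
    (h4 : ∀ z, eval z g = eval z μ * z 0 ^ a + eval z ν * z 1 ^ b) : affInt f g 0 = (a * b : ℕ) := by
  have e1 : s * X 0 ^ a = α * f + β * g := MvPolynomial.funext fun z => by simpa using h1 z
  have e2 : s' * X 1 ^ b = γ * f + δ * g := MvPolynomial.funext fun z => by simpa using h2 z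
  have e3 : f = κ * X 0 ^ a + l * X 1 ^ b := MvPolynomial.funext fun z => by simpa using h3 z
  have e4 : g = μ * X 0 ^ a + ν * X 1 ^ b := MvPolynomial.funext fun z => by simpa using h4 z
  rw [← affInt_X_pow]
  refine affInt_eq_of_span ?_
  set φ := algebraMap (MvPolynomial (Fin 2) ℂ) (LocalRingAt 0)
  have hu : IsUnit (φ s) := by rwa [isUnit_iff_evLoc, evLoc_algebraMap]
  have hu' : IsUnit (φ s') := by rwa [isUnit_iff_evLoc, evLoc_algebraMap]
  rw [← span_pair_mul_unit (f := φ (X 0 ^ a)) (g := φ (X 1 ^ b)) hu hu']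
  apply le_antisymm
  · rw [span_pair_mul_unit hu hu', span_pair_le]
    rw [e3, e4]
    simp only [map_add, map_mul]
    exact ⟨Ideal.mem_span_pair.2 ⟨_, _, rfl⟩, Ideal.mem_span_pair.2 ⟨_, _, rfl⟩⟩
  · rw [span_pair_le, ← map_mul, ← map_mul, e1, e2]
    simp only [map_add, map_mul]
    exact ⟨Ideal.mem_span_pair.2 ⟨_, _, rfl⟩, Ideal.mem_span_pair.2 ⟨_, _, rfl⟩⟩

/-! ### Intersection numbers for quadratic systems -/

theorem cplxP_isHomogeneous (a : Sys) : (cplx (P a)).IsHomogeneous 2 := (P_isHomogeneous a).map _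

theorem cplxQ_isHomogeneous (a : Sys) : (cplx (Q a)).IsHomogeneous 2 := (Q_isHomogeneous a).map _

theorem cplxCP_isHomogeneous (a : Sys) : (cplx (CP a)).IsHomogeneous 3 :=
  (((isHomogeneous_X ℝ 1).mul (P_isHomogeneous a)).sub ((isHomogeneous_X ℝ 0).mul (Q_isHomogeneous a))).map _

theorem eval_CP (a : Sys) (z : Fin 3 → ℂ) : eval z (cplx (CP a)) = z 1 * Pv a z - z 0 * Qv a z := by
  rw [← eval_P, ← eval_Q]
  simp [cplx, CP]

theorem dehom_cplxP (a : Sys) : dehom 2 (cplx (P a)) = cplx (p a) :=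
  MvPolynomial.funext fun z => by rw [eval_dehom, insertNth_two, eval_P, eval_cplx_p]

theorem dehom_cplxQ (a : Sys) : dehom 2 (cplx (Q a)) = cplx (q a) :=
  MvPolynomial.funext fun z => by rw [eval_dehom, insertNth_two, eval_Q, eval_cplx_q]

/-- The homogeneous coordinates of a real point of the affine plane. -/
def affPt (z : Fin 2 → ℝ) : Fin 3 → ℂ := ![(z 0 : ℂ), (z 1 : ℂ), 1]

theorem affInt_eq_projInt (a : Sys) (z : Fin 2 → ℝ) :
    affInt (cplx (p a)) (cplx (q a)) (toC z) = projInt (cplx (P a)) (cplx (Q a)) (affPt z) := by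
  have h : chartOf (affPt z) = 2 := by simp [chartOf, affPt]
  have h' : chartPt 2 (affPt z) = toC z := by
    ext k
    fin_cases k
    · simp [chartPt, affPt, toC, show (2 : Fin 3).succAbove 0 = 0 from rfl]
    · simp [chartPt, affPt, toC, show (2 : Fin 3).succAbove 1 = 1 from rfl]
  rw [projInt, h, h', dehom_cplxP, dehom_cplxQ]

theorem projInt_X2 {T S : Matrix (Fin 3) (Fin 3) ℂ} (hST : S * T = 1) {w : Fin 3 → ℂ}
    (hT : T.mulVec ![0, 0, 1] = w) (hT2 : ∀ x y, T.mulVec ![x, y, 1] 2 = y) {F : MvPolynomial (Fin 3) ℂ} {d : ℕ}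
    (hF : F.IsHomogeneous d) (n : ℕ) (s v : MvPolynomial (Fin 2) ℂ) (hs : eval 0 s ≠ 0)
    (h : ∀ z : Fin 2 → ℂ, eval (T.mulVec ![z 0, z 1, 1]) F = eval z s * z 0 ^ n + eval z v * z 1) :
    projInt F (X 2) w = n := by
  rw [projInt_eq_affInt_zero hST hT hF (isHomogeneous_X ℂ 2)]
  rw [affInt_eq_mul n 1 s 1 (-v) 1 0 1 s v 0 1 hs (by simp) (fun z => ?_) (fun z => ?_) (fun z => ?_) fun z => ?_]
  · simp
  all_goals simp only [eval_dehom_subst3, h, eval_X, hT2, map_zero, map_one, map_neg]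
  all_goals ring

/-- The intersection number of `P` and `Q` if they locally generate an ideal of powers of the coordinates. -/
theorem projInt_PQ_eq_mul {T S : Matrix (Fin 3) (Fin 3) ℂ} (hST : S * T = 1) {w : Fin 3 → ℂ}
    (hT : T.mulVec ![0, 0, 1] = w) (A : Sys) (f g : (Fin 2 → ℂ) → ℂ)
    (hf : ∀ z, Pv A (T.mulVec ![z 0, z 1, 1]) = f z) (hg : ∀ z, Qv A (T.mulVec ![z 0, z 1, 1]) = g z)
    (a b : ℕ) (s α β s' γ δ κ l μ ν : MvPolynomial (Fin 2) ℂ)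
    (hs : eval 0 s ≠ 0) (hs' : eval 0 s' ≠ 0)
    (h1 : ∀ z, eval z s * z 0 ^ a = eval z α * f z + eval z β * g z)
    (h2 : ∀ z, eval z s' * z 1 ^ b = eval z γ * f z + eval z δ * g z)
    (h3 : ∀ z, f z = eval z κ * z 0 ^ a + eval z l * z 1 ^ b)
    (h4 : ∀ z, g z = eval z μ * z 0 ^ a + eval z ν * z 1 ^ b) :
    projInt (cplx (P A)) (cplx (Q A)) w = (a * b : ℕ) := by
  have hf' : ∀ z, eval z (dehom 2 (subst3 T (cplx (P A)))) = f z := fun z => by rw [eval_dehom_subst3, eval_P, hf]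
  have hg' : ∀ z, eval z (dehom 2 (subst3 T (cplx (Q A)))) = g z := fun z => by rw [eval_dehom_subst3, eval_Q, hg]
  rw [projInt_eq_affInt_zero hST hT (cplxP_isHomogeneous A) (cplxQ_isHomogeneous A)]
  exact affInt_eq_mul a b s α β s' γ δ κ l μ ν hs hs' (fun z => by rw [hf', hg', h1])
    (fun z => by rw [hf', hg', h2]) (fun z => by rw [hf', h3]) (fun z => by rw [hg', h4])

theorem projInt_PQ_eq_zero (A : Sys) {w : Fin 3 → ℂ} (hw : w ≠ 0) (h : Pv A w ≠ 0 ∨ Qv A w ≠ 0) :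
    projInt (cplx (P A)) (cplx (Q A)) w = 0 :=
  projInt_eq_zero (cplxP_isHomogeneous A) (cplxQ_isHomogeneous A) hw (by rwa [eval_P, eval_Q])

/-- Coordinates at the point `[0 : 1 : 0]`. -/
def T010 : Matrix (Fin 3) (Fin 3) ℂ := !![1, 0, 0; 0, 0, 1; 0, 1, 0]

/-- Coordinates at the point `[1 : 0 : 0]`. -/
def T100 : Matrix (Fin 3) (Fin 3) ℂ := !![0, 0, 1; 1, 0, 0; 0, 1, 0]

/-- Coordinates at the point `[1 : 1 : 0]`. -/
def T110 : Matrix (Fin 3) (Fin 3) ℂ := !![1, 0, 1; 0, 0, 1; 0, 1, 0]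

/-- Coordinates at a finite point. -/
def Taff (s t : ℂ) : Matrix (Fin 3) (Fin 3) ℂ := !![1, 0, s; 0, 1, t; 0, 0, 1]

theorem T010_inv : T010 * T010 = 1 := by
  ext i j
  fin_cases i <;> fin_cases j <;> simp [T010, Matrix.mul_apply, Fin.sum_univ_three]

theorem T100_inv : !![0, 1, 0; 0, 0, 1; 1, 0, 0] * T100 = 1 := by
  ext i j
  fin_cases i <;> fin_cases j <;> simp [T100, Matrix.mul_apply, Fin.sum_univ_three]

theorem T110_inv : !![1, -1, 0; 0, 0, 1; 0, 1, 0] * T110 = 1 := by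
  ext i j
  fin_cases i <;> fin_cases j <;> simp [T110, Matrix.mul_apply, Fin.sum_univ_three]

theorem Taff_inv (s t : ℂ) : Taff (-s) (-t) * Taff s t = 1 := by
  ext i j
  fin_cases i <;> fin_cases j <;> simp [Taff, Matrix.mul_apply, Fin.sum_univ_three]

theorem T010_mulVec (x y : ℂ) : T010.mulVec ![x, y, 1] = ![x, 1, y] := by
  ext i; fin_cases i <;> simp [T010, Matrix.mulVec, dotProduct, Fin.sum_univ_three]

theorem T100_mulVec (x y : ℂ) : T100.mulVec ![x, y, 1] = ![1, x, y] := by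
  ext i; fin_cases i <;> simp [T100, Matrix.mulVec, dotProduct, Fin.sum_univ_three]

theorem T110_mulVec (x y : ℂ) : T110.mulVec ![x, y, 1] = ![x + 1, 1, y] := by
  ext i; fin_cases i <;> simp [T110, Matrix.mulVec, dotProduct, Fin.sum_univ_three]

theorem Taff_mulVec (s t x y : ℂ) : (Taff s t).mulVec ![x, y, 1] = ![x + s, y + t, 1] := by
  ext i; fin_cases i <;> simp [Taff, Matrix.mulVec, dotProduct, Fin.sum_univ_three]

theorem projInt_CZ_010 (a : Sys) (n : ℕ) (s v : MvPolynomial (Fin 2) ℂ) (hs : eval 0 s ≠ 0)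
    (h : ∀ z : Fin 2 → ℂ, Pv a ![z 0, 1, z 1] - z 0 * Qv a ![z 0, 1, z 1] = eval z s * z 0 ^ n + eval z v * z 1) :
    projInt (cplx (CP a)) (X 2) (infPt ![0, 1]) = n :=
  projInt_X2 T010_inv (by rw [T010_mulVec]; simp [infPt]) (fun x y => by rw [T010_mulVec]; rfl)
    (cplxCP_isHomogeneous a) n s v hs fun z => by
      rw [T010_mulVec, eval_CP, ← h]; simp

theorem projInt_CZ_100 (a : Sys) (n : ℕ) (s v : MvPolynomial (Fin 2) ℂ) (hs : eval 0 s ≠ 0)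
    (h : ∀ z : Fin 2 → ℂ, z 0 * Pv a ![1, z 0, z 1] - Qv a ![1, z 0, z 1] = eval z s * z 0 ^ n + eval z v * z 1) :
    projInt (cplx (CP a)) (X 2) (infPt ![1, 0]) = n :=
  projInt_X2 T100_inv (by rw [T100_mulVec]; simp [infPt]) (fun x y => by rw [T100_mulVec]; rfl)
    (cplxCP_isHomogeneous a) n s v hs fun z => by
      rw [T100_mulVec, eval_CP, ← h]; simp

theorem projInt_CZ_110 (a : Sys) (n : ℕ) (s v : MvPolynomial (Fin 2) ℂ) (hs : eval 0 s ≠ 0)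
    (h : ∀ z : Fin 2 → ℂ, Pv a ![z 0 + 1, 1, z 1] - (z 0 + 1) * Qv a ![z 0 + 1, 1, z 1] =
      eval z s * z 0 ^ n + eval z v * z 1) :
    projInt (cplx (CP a)) (X 2) (infPt ![1, 1]) = n :=
  projInt_X2 T110_inv (by rw [T110_mulVec]; simp [infPt]) (fun x y => by rw [T110_mulVec]; rfl)
    (cplxCP_isHomogeneous a) n s v hs fun z => by
      rw [T110_mulVec, eval_CP, ← h]; simp

/-- A tangency of higher order. -/
theorem affInt_parabola : affInt (X 0 * X 1) (X 1 - X 0 ^ 2) 0 = 3 := by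
  obtain ⟨φ, hφ⟩ := exists_localHom (c := 0) (c' := 0)
    ![algebraMap (MvPolynomial (Fin 2) ℂ) _ (X 0), algebraMap (MvPolynomial (Fin 2) ℂ) _ (X 1 + X 0 ^ 2)]
    (fun i => by fin_cases i <;> simp [evLoc_algebraMap])
  obtain ⟨ψ, hψ⟩ := exists_localHom (c := 0) (c' := 0)
    ![algebraMap (MvPolynomial (Fin 2) ℂ) _ (X 0), algebraMap (MvPolynomial (Fin 2) ℂ) _ (X 1 - X 0 ^ 2)]
    (fun i => by fin_cases i <;> simp [evLoc_algebraMap])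
  have h31 : (3 : ℕ∞) = ((3 * 1 : ℕ) : ℕ∞) := rfl
  rw [h31, ← affInt_X_pow]
  refine affInt_congr_of_homs (φ := φ) (ψ := ψ) (fun i => ?_) (fun i => ?_) ?_
  · fin_cases i <;> simp [hψ, hφ, map_add, map_sub, map_pow]
  · fin_cases i <;> simp [hψ, hφ, map_add, map_sub, map_pow]
  · simp only [hφ, map_add, map_sub, map_mul, map_pow, aeval_X, Matrix.cons_val_zero, Matrix.cons_val_one, pow_one,
      add_sub_cancel_right]
    apply le_antisymm
    · rw [span_pair_le, Ideal.mem_span_pair, Ideal.mem_span_pair]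
      exact ⟨⟨1, algebraMap (MvPolynomial (Fin 2) ℂ) _ (X 0), by ring⟩, ⟨0, 1, by ring⟩⟩
    · rw [span_pair_le, Ideal.mem_span_pair, Ideal.mem_span_pair]
      exact ⟨⟨1, -algebraMap (MvPolynomial (Fin 2) ℂ) _ (X 0), by ring⟩, ⟨0, 1, by ring⟩⟩

/-! ### The configurations of the representatives -/

theorem constantCoeff_two : constantCoeff (2 : MvPolynomial (Fin 2) ℂ) = 2 := map_ofNat _ 2

theorem apply_id (z : Fin 2 → ℝ) : AffTransf.id.apply z = z := by
  simp [AffTransf.apply, AffTransf.id]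

theorem mulVec_id (z : Fin 2 → ℝ) : AffTransf.id.M.mulVec z = z := by
  simp [AffTransf.id]

theorem vec2_eta (z : Fin 2 → ℝ) : ![z 0, z 1] = z := by ext i; fin_cases i <;> rfl

theorem isSing_iff (a : Sys) (z : Fin 2 → ℝ) : IsSing a z ↔
    a 0 + (a 1 * z 0 + a 2 * z 1) + (a 3 * z 0 ^ 2 + 2 * a 4 * z 0 * z 1 + a 5 * z 1 ^ 2) = 0 ∧
      a 6 + (a 7 * z 0 + a 8 * z 1) + (a 9 * z 0 ^ 2 + 2 * a 10 * z 0 * z 1 + a 11 * z 1 ^ 2) = 0 := by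
  rw [← eval_p', ← eval_q', vec2_eta]
  rfl

theorem isSingInf_iff (a : Sys) (w : Fin 2 → ℝ) : IsSingInf a w ↔ w ≠ 0 ∧
    w 1 * (a 3 * w 0 ^ 2 + 2 * a 4 * w 0 * w 1 + a 5 * w 1 ^ 2)
      - w 0 * (a 9 * w 0 ^ 2 + 2 * a 10 * w 0 * w 1 + a 11 * w 1 ^ 2) = 0 := by
  refine and_congr_right fun _ => ?_
  rw [eval_CP, infPt, Pv_eq, Qv_eq, ← Complex.ofReal_eq_zero]
  push_cast
  simp

theorem onInvLine_of {a : Sys} {l : Fin 3 → ℂ} (hl : IsInvLine a l) {z : Fin 2 → ℝ} (h0 : ¬ (l 0 = 0 ∧ l 1 = 0))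
    (h : l 0 * z 0 + l 1 * z 1 + l 2 = 0) : OnInvLine a z := by
  refine ⟨l, hl.resolve_left fun h1 => h0 ⟨h1.1, h1.2.1⟩, ?_⟩
  rw [lineForm_eq, eval_affForm]
  exact h

theorem eq_smul_10 {w : Fin 2 → ℝ} (hw : w ≠ 0) (h : w 1 = 0) : ∃ c : ℝ, c ≠ 0 ∧ w = c • ![1, 0] := by
  refine ⟨w 0, fun h0 => hw ?_, ?_⟩ <;> ext i <;> fin_cases i <;> simp [h] <;> assumption

theorem eq_smul_01 {w : Fin 2 → ℝ} (hw : w ≠ 0) (h : w 0 = 0) : ∃ c : ℝ, c ≠ 0 ∧ w = c • ![0, 1] := by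
  refine ⟨w 1, fun h0 => hw ?_, ?_⟩ <;> ext i <;> fin_cases i <;> simp [h] <;> assumption

theorem eq_smul_11 {w : Fin 2 → ℝ} (hw : w ≠ 0) (h : w 0 = w 1) : ∃ c : ℝ, c ≠ 0 ∧ w = c • ![1, 1] := by
  refine ⟨w 1, fun h0 => hw ?_, ?_⟩ <;> ext i <;> fin_cases i <;> simp [h] <;> assumption

theorem infPt_ne_zero {w : Fin 2 → ℝ} (hw : w ≠ 0) : infPt w ≠ 0 := by
  intro h
  apply hw
  have h0 : (w 0 : ℂ) = 0 := by simpa [infPt] using congrFun h 0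
  have h1 : (w 1 : ℂ) = 0 := by simpa [infPt] using congrFun h 1
  ext i
  fin_cases i
  · exact_mod_cast h0
  · exact_mod_cast h1

/-- The part of a configuration at infinity. -/
def HasInf (a : Sys) (K : List ((Fin 2 → ℝ) × ℕ∞ × ℕ∞)) : Prop :=
  (∀ w, IsSingInf a w → ∃ e ∈ K, ∃ c : ℝ, c ≠ 0 ∧ w = c • e.1) ∧
    ∀ e ∈ K, IsSingInf a e.1 ∧ projInt (cplx (CP a)) (X 2) (infPt e.1) = e.2.1 ∧
      projInt (cplx (P a)) (cplx (Q a)) (infPt e.1) = e.2.2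

/-- The finite points of a configuration. -/
def HasFin (a : Sys) (K : List ((Fin 2 → ℝ) × ℕ∞)) : Prop :=
  (∀ z, IsSing a z → ∃ e ∈ K, z = e.1) ∧ ∀ e ∈ K, IsSing a e.1 ∧ OnInvLine a e.1 ∧
    projInt (cplx (P a)) (cplx (Q a)) (affPt e.1) = e.2

theorem hasInf_diagonal (t : ℝ) : HasInf ![t, 0, 0, 1, 0, 0, t, 0, 0, 0, 0, 1]
    [(![1, 0], 1, 0), (![0, 1], 1, 0), (![1, 1], 1, 0)] := by
  constructor
  · intro w hw
    rw [isSingInf_iff] at hw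
    obtain ⟨hw0, h⟩ := hw
    simp at h
    have h : w 1 * (w 0 * (w 0 - w 1)) = 0 := by linear_combination h
    rcases mul_eq_zero.1 h with h | h
    · obtain ⟨c, hc, e⟩ := eq_smul_10 hw0 h
      exact ⟨_, List.mem_cons_self .., c, hc, e⟩
    rcases mul_eq_zero.1 h with h | h
    · obtain ⟨c, hc, e⟩ := eq_smul_01 hw0 h
      exact ⟨_, List.mem_cons_of_mem _ (List.mem_cons_self ..), c, hc, e⟩
    · obtain ⟨c, hc, e⟩ := eq_smul_11 hw0 (sub_eq_zero.1 h)
      exact ⟨_, List.mem_cons_of_mem _ (List.mem_cons_of_mem _ (List.mem_cons_self ..)), c, hc, e⟩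
  · intro e he
    simp at he
    rcases he with rfl | rfl | rfl
    · refine ⟨by rw [isSingInf_iff]; simp, ?_, ?_⟩
      · exact projInt_CZ_100 _ 1 (1 - X 0) (C (t : ℂ) * (X 0 * X 1 - X 1)) (by simp) fun z => by
          simp [Pv, Qv]; ring
      · exact projInt_PQ_eq_zero _ (infPt_ne_zero (by simp)) (by simp [Pv, Qv, infPt])
    · refine ⟨by rw [isSingInf_iff]; simp, ?_, ?_⟩
      · exact projInt_CZ_010 _ 1 (X 0 - 1) (C (t : ℂ) * (X 1 - X 0 * X 1)) (by simp) fun z => by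
          simp [Pv, Qv]; ring
      · exact projInt_PQ_eq_zero _ (infPt_ne_zero (by simp)) (by simp [Pv, Qv, infPt])
    · refine ⟨by rw [isSingInf_iff]; simp, ?_, ?_⟩
      · exact projInt_CZ_110 _ 1 (1 + X 0) (C (t : ℂ) * (-X 0 * X 1)) (by simp) fun z => by
          simp [Pv, Qv]; ring
      · exact projInt_PQ_eq_zero _ (infPt_ne_zero (by simp)) (by simp [Pv, Qv, infPt])

theorem hasInf_conformal (t : ℝ) : HasInf ![0, 0, 0, 0, 1, 0, t, 0, 0, -1, 0, 1] [(![0, 1], 1, 0)] := by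
  constructor
  · intro w hw
    rw [isSingInf_iff] at hw
    obtain ⟨hw0, h⟩ := hw
    simp at h
    have h : w 0 * (w 0 ^ 2 + w 1 ^ 2) = 0 := by linear_combination h
    have h0 : w 0 = 0 := by
      rcases mul_eq_zero.1 h with h | h
      · exact h
      · nlinarith [sq_nonneg (w 0), sq_nonneg (w 1)]
    obtain ⟨c, hc, e⟩ := eq_smul_01 hw0 h0
    exact ⟨_, List.mem_cons_self .., c, hc, e⟩
  · intro e he
    simp at he
    rcases he with rfl
    refine ⟨by rw [isSingInf_iff]; simp, ?_, ?_⟩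
    · exact projInt_CZ_010 _ 1 (1 + X 0 ^ 2) (-C (t : ℂ) * (X 0 * X 1)) (by simp) fun z => by
        simp [Pv, Qv]; ring
    · exact projInt_PQ_eq_zero _ (infPt_ne_zero (by simp)) (by simp [Pv, Qv, infPt])

/-- Isotropic coordinates. -/
def Tiso : Matrix (Fin 3) (Fin 3) ℂ := !![1 / 2, 1 / 2, 0; -Complex.I / 2, Complex.I / 2, 0; 0, 0, 1]

theorem Tiso_inv : !![1, Complex.I, 0; 1, -Complex.I, 0; 0, 0, 1] * Tiso = 1 := by
  ext i j
  fin_cases i <;> fin_cases j <;> simp [Tiso, Matrix.mul_apply, Fin.sum_univ_three] <;> ring_nf <;>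
    simp only [Complex.I_sq] <;> norm_num

theorem Tiso_mulVec (x y : ℂ) : Tiso.mulVec ![x, y, 1] = ![(x + y) / 2, -Complex.I * (x - y) / 2, 1] := by
  ext i; fin_cases i <;> simp [Tiso, Matrix.mulVec, dotProduct, Fin.sum_univ_three] <;> ring

theorem hasInf_rep6 : HasInf (rep 6)
    [(![0, 1], 2, 2), (![1, 0], 1, 0)] := by
  constructor
  · intro w hw
    rw [isSingInf_iff] at hw
    obtain ⟨hw0, h⟩ := hw
    simp [rep] at h
    have h : w 0 ^ 2 * w 1 = 0 := by rcases h with h | h <;> rw [h] <;> ring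
    rcases mul_eq_zero.1 h with h | h
    · obtain ⟨c, hc, e⟩ := eq_smul_01 hw0 (pow_eq_zero_iff two_ne_zero |>.1 h)
      exact ⟨_, List.mem_cons_self .., c, hc, e⟩
    · obtain ⟨c, hc, e⟩ := eq_smul_10 hw0 h
      exact ⟨_, List.mem_cons_of_mem _ (List.mem_cons_self ..), c, hc, e⟩
  · intro e he
    simp at he
    rcases he with rfl | rfl
    · refine ⟨by rw [isSingInf_iff]; simp [rep], ?_, ?_⟩
      · exact projInt_CZ_010 _ 2 1 (-X 1 - 2 * X 0) (by simp) fun z => by simp [Pv, Qv, rep] <;> ring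
      · exact projInt_PQ_eq_mul T010_inv (by rw [T010_mulVec]; simp [infPt]) _ (fun z => z 0 ^ 2 - z 1 ^ 2) (fun z => 2 * z 1)
          (fun z => by rw [T010_mulVec]; simp [Pv, rep] <;> ring) (fun z => by rw [T010_mulVec]; simp [Qv, rep] <;> ring) 2 1
          (1) (1) (C (1 / 2) * X 1) (1) (0) (C (1 / 2)) (1) (-X 1) (0) (2) (by simp [constantCoeff_two]) (by simp [constantCoeff_two])
          (fun z => by simp <;> ring) (fun z => by simp <;> ring) (fun z => by simp <;> ring) (fun z => by simp <;> ring)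
    · refine ⟨by rw [isSingInf_iff]; simp [rep], ?_, ?_⟩
      · exact projInt_CZ_100 _ 1 1 (-X 0 * X 1 - 2 * X 0) (by simp) fun z => by simp [Pv, Qv, rep] <;> ring
      · exact projInt_PQ_eq_zero _ (infPt_ne_zero (by simp)) (by simp [Pv, Qv, infPt, rep])

theorem hasInf_rep7 : HasInf (rep 7)
    [(![0, 1], 2, 2), (![1, 0], 1, 0)] := by
  constructor
  · intro w hw
    rw [isSingInf_iff] at hw
    obtain ⟨hw0, h⟩ := hw
    simp [rep] at h
    have h : w 0 ^ 2 * w 1 = 0 := by linear_combination h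
    rcases mul_eq_zero.1 h with h | h
    · obtain ⟨c, hc, e⟩ := eq_smul_01 hw0 (pow_eq_zero_iff two_ne_zero |>.1 h)
      exact ⟨_, List.mem_cons_self .., c, hc, e⟩
    · obtain ⟨c, hc, e⟩ := eq_smul_10 hw0 h
      exact ⟨_, List.mem_cons_of_mem _ (List.mem_cons_self ..), c, hc, e⟩
  · intro e he
    simp at he
    rcases he with rfl | rfl
    · refine ⟨by rw [isSingInf_iff]; simp [rep], ?_, ?_⟩
      · exact projInt_CZ_010 _ 2 1 (1 * X 1) (by simp) fun z => by simp [Pv, Qv, rep] <;> ring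
      · exact projInt_PQ_eq_mul T010_inv (by rw [T010_mulVec]; simp [infPt]) _ (fun z => 1 * z 1 ^ 2 - z 0 ^ 2) (fun z => -2 * z 0)
          (fun z => by rw [T010_mulVec]; simp [Pv, rep] <;> ring) (fun z => by rw [T010_mulVec]; simp [Qv, rep] <;> ring) 1 2
          (1) (0) (-C (1 / 2)) (1) (1) (-(1 * C (1 / 2) * X 0)) (-X 0) (1) (-2) (0) (by simp [constantCoeff_two]) (by simp [constantCoeff_two])
          (fun z => by simp <;> ring) (fun z => by simp <;> ring) (fun z => by simp <;> ring) (fun z => by simp <;> ring)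
    · refine ⟨by rw [isSingInf_iff]; simp [rep], ?_, ?_⟩
      · exact projInt_CZ_100 _ 1 1 (1 * (X 0 * X 1)) (by simp) fun z => by simp [Pv, Qv, rep] <;> ring
      · exact projInt_PQ_eq_zero _ (infPt_ne_zero (by simp)) (by simp [Pv, Qv, infPt, rep])

theorem hasInf_rep8 : HasInf (rep 8)
    [(![0, 1], 2, 2), (![1, 0], 1, 0)] := by
  constructor
  · intro w hw
    rw [isSingInf_iff] at hw
    obtain ⟨hw0, h⟩ := hw
    simp [rep] at h
    have h : w 0 ^ 2 * w 1 = 0 := by linear_combination h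
    rcases mul_eq_zero.1 h with h | h
    · obtain ⟨c, hc, e⟩ := eq_smul_01 hw0 (pow_eq_zero_iff two_ne_zero |>.1 h)
      exact ⟨_, List.mem_cons_self .., c, hc, e⟩
    · obtain ⟨c, hc, e⟩ := eq_smul_10 hw0 h
      exact ⟨_, List.mem_cons_of_mem _ (List.mem_cons_self ..), c, hc, e⟩
  · intro e he
    simp at he
    rcases he with rfl | rfl
    · refine ⟨by rw [isSingInf_iff]; simp [rep], ?_, ?_⟩
      · exact projInt_CZ_010 _ 2 1 (-1 * X 1) (by simp) fun z => by simp [Pv, Qv, rep] <;> ring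
      · exact projInt_PQ_eq_mul T010_inv (by rw [T010_mulVec]; simp [infPt]) _ (fun z => -1 * z 1 ^ 2 - z 0 ^ 2) (fun z => -2 * z 0)
          (fun z => by rw [T010_mulVec]; simp [Pv, rep] <;> ring) (fun z => by rw [T010_mulVec]; simp [Qv, rep] <;> ring) 1 2
          (1) (0) (-C (1 / 2)) (1) (-1) (-(-1 * C (1 / 2) * X 0)) (-X 0) (-1) (-2) (0) (by simp [constantCoeff_two]) (by simp [constantCoeff_two])
          (fun z => by simp <;> ring) (fun z => by simp <;> ring) (fun z => by simp <;> ring) (fun z => by simp <;> ring)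
    · refine ⟨by rw [isSingInf_iff]; simp [rep], ?_, ?_⟩
      · exact projInt_CZ_100 _ 1 1 (-1 * (X 0 * X 1)) (by simp) fun z => by simp [Pv, Qv, rep] <;> ring
      · exact projInt_PQ_eq_zero _ (infPt_ne_zero (by simp)) (by simp [Pv, Qv, infPt, rep])

theorem hasInf_rep9 : HasInf (rep 9)
    [(![0, 1], 2, 4), (![1, 0], 1, 0)] := by
  constructor
  · intro w hw
    rw [isSingInf_iff] at hw
    obtain ⟨hw0, h⟩ := hw
    simp [rep] at h
    have h : w 0 ^ 2 * w 1 = 0 := by rcases h with h | h <;> rw [h] <;> ring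
    rcases mul_eq_zero.1 h with h | h
    · obtain ⟨c, hc, e⟩ := eq_smul_01 hw0 (pow_eq_zero_iff two_ne_zero |>.1 h)
      exact ⟨_, List.mem_cons_self .., c, hc, e⟩
    · obtain ⟨c, hc, e⟩ := eq_smul_10 hw0 h
      exact ⟨_, List.mem_cons_of_mem _ (List.mem_cons_self ..), c, hc, e⟩
  · intro e he
    simp at he
    rcases he with rfl | rfl
    · refine ⟨by rw [isSingInf_iff]; simp [rep], ?_, ?_⟩
      · exact projInt_CZ_010 _ 2 1 (-X 0 * X 1) (by simp) fun z => by simp [Pv, Qv, rep] <;> ring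
      · exact projInt_PQ_eq_mul T010_inv (by rw [T010_mulVec]; simp [infPt]) _ (fun z => z 0 ^ 2) (fun z => z 1 ^ 2)
          (fun z => by rw [T010_mulVec]; simp [Pv, rep] <;> ring) (fun z => by rw [T010_mulVec]; simp [Qv, rep] <;> ring) 2 2
          (1) (1) (0) (1) (0) (1) (1) (0) (0) (1) (by simp [constantCoeff_two]) (by simp [constantCoeff_two])
          (fun z => by simp <;> ring) (fun z => by simp <;> ring) (fun z => by simp <;> ring) (fun z => by simp <;> ring)
    · refine ⟨by rw [isSingInf_iff]; simp [rep], ?_, ?_⟩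
      · exact projInt_CZ_100 _ 1 1 (-X 1) (by simp) fun z => by simp [Pv, Qv, rep] <;> ring
      · exact projInt_PQ_eq_zero _ (infPt_ne_zero (by simp)) (by simp [Pv, Qv, infPt, rep])

theorem hasInf_rep10 : HasInf (rep 10) [(![0, 1], 3, 3)] := by
  constructor
  · intro w hw
    rw [isSingInf_iff] at hw
    obtain ⟨hw0, h⟩ := hw
    simp [rep] at h
    obtain ⟨c, hc, e⟩ := eq_smul_01 hw0 h
    exact ⟨_, List.mem_cons_self .., c, hc, e⟩
  · intro e he
    simp at he
    rcases he with rfl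
    refine ⟨by rw [isSingInf_iff]; simp [rep], ?_, ?_⟩
    · exact projInt_CZ_010 _ 3 1 0 (by simp) fun z => by simp [Pv, Qv, rep] <;> ring
    · rw [projInt_eq_affInt_zero T010_inv (by rw [T010_mulVec]; simp [infPt]) (cplxP_isHomogeneous _)
        (cplxQ_isHomogeneous _), ← affInt_parabola]
      congr 1
      · refine MvPolynomial.funext fun z => ?_
        rw [eval_dehom_subst3, T010_mulVec, eval_P]
        simp [Pv, rep]
      · refine MvPolynomial.funext fun z => ?_
        rw [eval_dehom_subst3, T010_mulVec, eval_Q]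
        simp [Qv, rep]
        ring

theorem hasFin_rep0 : HasFin (rep 0) [(![1, 1], 1), (![1, -1], 1), (![-1, 1], 1), (![-1, -1], 1)] := by
  constructor
  · intro z hz
    rw [isSing_iff] at hz
    simp [rep] at hz
    obtain ⟨h1, h2⟩ := hz
    have e0 : (z 0 - 1) * (z 0 + 1) = 0 := by linear_combination h1
    have e1 : (z 1 - 1) * (z 1 + 1) = 0 := by linear_combination h2
    rw [← vec2_eta z]
    rcases mul_eq_zero.1 e0 with e0 | e0 <;> rcases mul_eq_zero.1 e1 with e1 | e1
    · rw [sub_eq_zero.1 e0, sub_eq_zero.1 e1]; exact ⟨_, List.mem_cons_self .., rfl⟩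
    · rw [sub_eq_zero.1 e0, eq_neg_of_add_eq_zero_left e1]
      exact ⟨_, List.mem_cons_of_mem _ (List.mem_cons_self ..), rfl⟩
    · rw [eq_neg_of_add_eq_zero_left e0, sub_eq_zero.1 e1]
      exact ⟨_, List.mem_cons_of_mem _ (List.mem_cons_of_mem _ (List.mem_cons_self ..)), rfl⟩
    · rw [eq_neg_of_add_eq_zero_left e0, eq_neg_of_add_eq_zero_left e1]
      exact ⟨_, List.mem_cons_of_mem _ (List.mem_cons_of_mem _ (List.mem_cons_of_mem _ (List.mem_cons_self ..))), rfl⟩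
  · intro e he
    simp at he
    rcases he with rfl | rfl | rfl | rfl
    · refine ⟨by rw [isSing_iff]; simp [rep], onInvLine_of (lineFactors_rep0.inv 0) (by simp) (by simp), ?_⟩
      exact projInt_PQ_eq_mul (Taff_inv (1) (1)) (by rw [Taff_mulVec]; simp [affPt]) _ (fun z => z 0 * (z 0 + 2 * (1))) (fun z => z 1 * (z 1 + 2 * (1)))
          (fun z => by rw [Taff_mulVec]; simp [Pv, rep] <;> ring) (fun z => by rw [Taff_mulVec]; simp [Qv, rep] <;> ring) 1 1
          (X 0 + 2 * (1)) (1) (0) (X 1 + 2 * (1)) (0) (1) (X 0 + 2 * (1)) (0) (0) (X 1 + 2 * (1)) (by simp [constantCoeff_two]) (by simp [constantCoeff_two])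
          (fun z => by simp <;> ring) (fun z => by simp <;> ring) (fun z => by simp <;> ring) (fun z => by simp <;> ring)
    · refine ⟨by rw [isSing_iff]; simp [rep], onInvLine_of (lineFactors_rep0.inv 0) (by simp) (by simp), ?_⟩
      exact projInt_PQ_eq_mul (Taff_inv (1) (-1)) (by rw [Taff_mulVec]; simp [affPt]) _ (fun z => z 0 * (z 0 + 2 * (1))) (fun z => z 1 * (z 1 + 2 * (-1)))
          (fun z => by rw [Taff_mulVec]; simp [Pv, rep] <;> ring) (fun z => by rw [Taff_mulVec]; simp [Qv, rep] <;> ring) 1 1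
          (X 0 + 2 * (1)) (1) (0) (X 1 + 2 * (-1)) (0) (1) (X 0 + 2 * (1)) (0) (0) (X 1 + 2 * (-1)) (by simp [constantCoeff_two]) (by simp [constantCoeff_two])
          (fun z => by simp <;> ring) (fun z => by simp <;> ring) (fun z => by simp <;> ring) (fun z => by simp <;> ring)
    · refine ⟨by rw [isSing_iff]; simp [rep], onInvLine_of (lineFactors_rep0.inv 1) (by simp) (by simp), ?_⟩
      exact projInt_PQ_eq_mul (Taff_inv (-1) (1)) (by rw [Taff_mulVec]; simp [affPt]) _ (fun z => z 0 * (z 0 + 2 * (-1))) (fun z => z 1 * (z 1 + 2 * (1)))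
          (fun z => by rw [Taff_mulVec]; simp [Pv, rep] <;> ring) (fun z => by rw [Taff_mulVec]; simp [Qv, rep] <;> ring) 1 1
          (X 0 + 2 * (-1)) (1) (0) (X 1 + 2 * (1)) (0) (1) (X 0 + 2 * (-1)) (0) (0) (X 1 + 2 * (1)) (by simp [constantCoeff_two]) (by simp [constantCoeff_two])
          (fun z => by simp <;> ring) (fun z => by simp <;> ring) (fun z => by simp <;> ring) (fun z => by simp <;> ring)
    · refine ⟨by rw [isSing_iff]; simp [rep], onInvLine_of (lineFactors_rep0.inv 1) (by simp) (by simp), ?_⟩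
      exact projInt_PQ_eq_mul (Taff_inv (-1) (-1)) (by rw [Taff_mulVec]; simp [affPt]) _ (fun z => z 0 * (z 0 + 2 * (-1))) (fun z => z 1 * (z 1 + 2 * (-1)))
          (fun z => by rw [Taff_mulVec]; simp [Pv, rep] <;> ring) (fun z => by rw [Taff_mulVec]; simp [Qv, rep] <;> ring) 1 1
          (X 0 + 2 * (-1)) (1) (0) (X 1 + 2 * (-1)) (0) (1) (X 0 + 2 * (-1)) (0) (0) (X 1 + 2 * (-1)) (by simp [constantCoeff_two]) (by simp [constantCoeff_two])
          (fun z => by simp <;> ring) (fun z => by simp <;> ring) (fun z => by simp <;> ring) (fun z => by simp <;> ring)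

theorem hasFin_rep1 : HasFin (rep 1) [] := by
  constructor
  · intro z hz
    rw [isSing_iff] at hz
    simp [rep] at hz
    obtain ⟨h1, h2⟩ := hz
    nlinarith [sq_nonneg (z 0)]
  · intro e he
    simp at he

theorem hasFin_rep2 : HasFin (rep 2) [(![0, 1], 1), (![0, -1], 1)] := by
  constructor
  · intro z hz
    rw [isSing_iff] at hz
    simp [rep] at hz
    obtain ⟨h1, h2⟩ := hz
    have e0 : z 0 = 0 := by
      rcases h1 with h1 | h1
      · exact h1
      · rw [h1] at h2; nlinarith [sq_nonneg (z 0)]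
    rw [e0] at h2
    have e1 : (z 1 - 1) * (z 1 + 1) = 0 := by linear_combination h2
    rw [← vec2_eta z, e0]
    rcases mul_eq_zero.1 e1 with e1 | e1
    · rw [sub_eq_zero.1 e1]; exact ⟨_, List.mem_cons_self .., rfl⟩
    · rw [eq_neg_of_add_eq_zero_left e1]
      exact ⟨_, List.mem_cons_of_mem _ (List.mem_cons_self ..), rfl⟩
  · intro e he
    simp at he
    rcases he with rfl | rfl
    · refine ⟨by rw [isSing_iff]; simp [rep], onInvLine_of (lineFactors_rep2.inv 0) (by simp) (by simp), ?_⟩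
      exact projInt_PQ_eq_mul (Taff_inv (0) (1)) (by rw [Taff_mulVec]; simp [affPt]) _ (fun z => 2 * z 0 * (z 1 + (1))) (fun z => z 1 * (z 1 + 2 * (1)) - z 0 ^ 2)
          (fun z => by rw [Taff_mulVec]; simp [Pv, rep] <;> ring) (fun z => by rw [Taff_mulVec]; simp [Qv, rep] <;> ring) 1 1
          (2 * (X 1 + (1))) (1) (0) ((X 1 + 2 * (1)) * (2 * (X 1 + (1)))) (X 0) (2 * (X 1 + (1))) (2 * (X 1 + (1))) (0) (-X 0) (X 1 + 2 * (1)) (by simp [constantCoeff_two]) (by simp [constantCoeff_two])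
          (fun z => by simp <;> ring) (fun z => by simp <;> ring) (fun z => by simp <;> ring) (fun z => by simp <;> ring)
    · refine ⟨by rw [isSing_iff]; simp [rep], onInvLine_of (lineFactors_rep2.inv 0) (by simp) (by simp), ?_⟩
      exact projInt_PQ_eq_mul (Taff_inv (0) (-1)) (by rw [Taff_mulVec]; simp [affPt]) _ (fun z => 2 * z 0 * (z 1 + (-1))) (fun z => z 1 * (z 1 + 2 * (-1)) - z 0 ^ 2)
          (fun z => by rw [Taff_mulVec]; simp [Pv, rep] <;> ring) (fun z => by rw [Taff_mulVec]; simp [Qv, rep] <;> ring) 1 1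
          (2 * (X 1 + (-1))) (1) (0) ((X 1 + 2 * (-1)) * (2 * (X 1 + (-1)))) (X 0) (2 * (X 1 + (-1))) (2 * (X 1 + (-1))) (0) (-X 0) (X 1 + 2 * (-1)) (by simp [constantCoeff_two]) (by simp [constantCoeff_two])
          (fun z => by simp <;> ring) (fun z => by simp <;> ring) (fun z => by simp <;> ring) (fun z => by simp <;> ring)

theorem hasFin_rep3 : HasFin (rep 3) [(![1, 0], 1), (![-1, 0], 1)] := by
  constructor
  · intro z hz
    rw [isSing_iff] at hz
    simp [rep] at hz
    obtain ⟨h1, h2⟩ := hz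
    have e0 : z 1 = 0 := by
      rcases h1 with h1 | h1
      · rw [h1] at h2; nlinarith [sq_nonneg (z 1)]
      · exact h1
    rw [e0] at h2
    have e1 : (z 0 - 1) * (z 0 + 1) = 0 := by linear_combination -h2
    rw [← vec2_eta z, e0]
    rcases mul_eq_zero.1 e1 with e1 | e1
    · rw [sub_eq_zero.1 e1]; exact ⟨_, List.mem_cons_self .., rfl⟩
    · rw [eq_neg_of_add_eq_zero_left e1]
      exact ⟨_, List.mem_cons_of_mem _ (List.mem_cons_self ..), rfl⟩
  · intro e he
    simp at he
    rcases he with rfl | rfl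
    · refine ⟨by rw [isSing_iff]; simp [rep], onInvLine_of (lineFactors_rep3.inv 1) (by simp) (by simp), ?_⟩
      exact projInt_PQ_eq_mul (Taff_inv (1) (0)) (by rw [Taff_mulVec]; simp [affPt]) _ (fun z => 2 * (z 0 + (1)) * z 1) (fun z => z 1 ^ 2 - z 0 * (z 0 + 2 * (1)))
          (fun z => by rw [Taff_mulVec]; simp [Pv, rep] <;> ring) (fun z => by rw [Taff_mulVec]; simp [Qv, rep] <;> ring) 1 1
          ((X 0 + 2 * (1)) * (2 * (X 0 + (1)))) (X 1) (-2 * (X 0 + (1))) (2 * (X 0 + (1))) (1) (0) (0) (2 * (X 0 + (1))) (-(X 0 + 2 * (1))) (X 1) (by simp [constantCoeff_two]) (by simp [constantCoeff_two])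
          (fun z => by simp <;> ring) (fun z => by simp <;> ring) (fun z => by simp <;> ring) (fun z => by simp <;> ring)
    · refine ⟨by rw [isSing_iff]; simp [rep], onInvLine_of (lineFactors_rep3.inv 2) (by simp) (by simp), ?_⟩
      exact projInt_PQ_eq_mul (Taff_inv (-1) (0)) (by rw [Taff_mulVec]; simp [affPt]) _ (fun z => 2 * (z 0 + (-1)) * z 1) (fun z => z 1 ^ 2 - z 0 * (z 0 + 2 * (-1)))
          (fun z => by rw [Taff_mulVec]; simp [Pv, rep] <;> ring) (fun z => by rw [Taff_mulVec]; simp [Qv, rep] <;> ring) 1 1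
          ((X 0 + 2 * (-1)) * (2 * (X 0 + (-1)))) (X 1) (-2 * (X 0 + (-1))) (2 * (X 0 + (-1))) (1) (0) (0) (2 * (X 0 + (-1))) (-(X 0 + 2 * (-1))) (X 1) (by simp [constantCoeff_two]) (by simp [constantCoeff_two])
          (fun z => by simp <;> ring) (fun z => by simp <;> ring) (fun z => by simp <;> ring) (fun z => by simp <;> ring)

theorem hasFin_rep4 : HasFin (rep 4) [(![0, 0], 4)] := by
  constructor
  · intro z hz
    rw [isSing_iff] at hz
    simp [rep] at hz
    obtain ⟨h1, h2⟩ := hz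
    have e0 : z 0 = 0 := h1
    have e1 : z 1 = 0 := h2
    rw [← vec2_eta z, e0, e1]
    exact ⟨_, List.mem_cons_self .., rfl⟩
  · intro e he
    simp at he
    rcases he with rfl
    · refine ⟨by rw [isSing_iff]; simp [rep], onInvLine_of (lineFactors_rep4.inv 0) (by simp) (by simp), ?_⟩
      exact projInt_PQ_eq_mul (Taff_inv (0) (0)) (by rw [Taff_mulVec]; simp [affPt]) _ (fun z => z 0 ^ 2) (fun z => z 1 ^ 2)
          (fun z => by rw [Taff_mulVec]; simp [Pv, rep] <;> ring) (fun z => by rw [Taff_mulVec]; simp [Qv, rep] <;> ring) 2 2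
          (1) (1) (0) (1) (0) (1) (1) (0) (0) (1) (by simp [constantCoeff_two]) (by simp [constantCoeff_two])
          (fun z => by simp <;> ring) (fun z => by simp <;> ring) (fun z => by simp <;> ring) (fun z => by simp <;> ring)

theorem hasFin_rep5 : HasFin (rep 5) [(![0, 0], 4)] := by
  constructor
  · intro z hz
    rw [isSing_iff] at hz
    simp [rep] at hz
    obtain ⟨h1, h2⟩ := hz
    have e0 : z 0 = 0 := by
      rcases h1 with h1 | h1
      · exact h1
      · rw [h1] at h2; nlinarith [sq_nonneg (z 0)]
    have e1 : z 1 = 0 := by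
      rw [e0] at h2; nlinarith [sq_nonneg (z 1)]
    rw [← vec2_eta z, e0, e1]
    exact ⟨_, List.mem_cons_self .., rfl⟩
  · intro e he
    simp at he
    rcases he with rfl
    · refine ⟨by rw [isSing_iff]; simp [rep], onInvLine_of (lineFactors_rep5.inv 0) (by simp) (by simp), ?_⟩
      exact projInt_PQ_eq_mul Tiso_inv (by rw [Tiso_mulVec]; simp [affPt]) _ (fun z => -Complex.I * (z 0 ^ 2 - z 1 ^ 2) / 2) (fun z => -(z 0 ^ 2 + z 1 ^ 2) / 2)
          (fun z => by rw [Tiso_mulVec]; simp [Pv, rep] <;> ring_nf <;> simp only [Complex.I_sq] <;> ring) (fun z => by rw [Tiso_mulVec]; simp [Qv, rep] <;> ring_nf <;> simp only [Complex.I_sq] <;> ring) 2 2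
          (1) (C Complex.I) (-1) (1) (-C Complex.I) (-1) (-C (Complex.I / 2)) (C (Complex.I / 2)) (-C (1 / 2)) (-C (1 / 2)) (by simp [constantCoeff_two]) (by simp [constantCoeff_two])
          (fun z => by simp <;> ring_nf <;> simp only [Complex.I_sq] <;> ring) (fun z => by simp <;> ring_nf <;> simp only [Complex.I_sq] <;> ring) (fun z => by simp <;> ring_nf <;> simp only [Complex.I_sq] <;> ring) (fun z => by simp <;> ring_nf <;> simp only [Complex.I_sq] <;> ring)

theorem hasFin_rep6 : HasFin (rep 6) [(![1, 0], 1), (![-1, 0], 1)] := by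
  constructor
  · intro z hz
    rw [isSing_iff] at hz
    simp [rep] at hz
    obtain ⟨h1, h2⟩ := hz
    have e0 : z 1 = 0 := h2
    have e1 : (z 0 - 1) * (z 0 + 1) = 0 := by linear_combination h1
    rw [← vec2_eta z, e0]
    rcases mul_eq_zero.1 e1 with e1 | e1
    · rw [sub_eq_zero.1 e1]; exact ⟨_, List.mem_cons_self .., rfl⟩
    · rw [eq_neg_of_add_eq_zero_left e1]
      exact ⟨_, List.mem_cons_of_mem _ (List.mem_cons_self ..), rfl⟩
  · intro e he
    simp at he
    rcases he with rfl | rfl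
    · refine ⟨by rw [isSing_iff]; simp [rep], onInvLine_of (lineFactors_rep6.inv 2) (by simp) (by simp), ?_⟩
      exact projInt_PQ_eq_mul (Taff_inv (1) (0)) (by rw [Taff_mulVec]; simp [affPt]) _ (fun z => z 0 * (z 0 + 2 * (1))) (fun z => 2 * z 1)
          (fun z => by rw [Taff_mulVec]; simp [Pv, rep] <;> ring) (fun z => by rw [Taff_mulVec]; simp [Qv, rep] <;> ring) 1 1
          (X 0 + 2 * (1)) (1) (0) (2) (0) (1) (X 0 + 2 * (1)) (0) (0) (2) (by simp [constantCoeff_two]) (by simp [constantCoeff_two])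
          (fun z => by simp <;> ring) (fun z => by simp <;> ring) (fun z => by simp <;> ring) (fun z => by simp <;> ring)
    · refine ⟨by rw [isSing_iff]; simp [rep], onInvLine_of (lineFactors_rep6.inv 2) (by simp) (by simp), ?_⟩
      exact projInt_PQ_eq_mul (Taff_inv (-1) (0)) (by rw [Taff_mulVec]; simp [affPt]) _ (fun z => z 0 * (z 0 + 2 * (-1))) (fun z => 2 * z 1)
          (fun z => by rw [Taff_mulVec]; simp [Pv, rep] <;> ring) (fun z => by rw [Taff_mulVec]; simp [Qv, rep] <;> ring) 1 1
          (X 0 + 2 * (-1)) (1) (0) (2) (0) (1) (X 0 + 2 * (-1)) (0) (0) (2) (by simp [constantCoeff_two]) (by simp [constantCoeff_two])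
          (fun z => by simp <;> ring) (fun z => by simp <;> ring) (fun z => by simp <;> ring) (fun z => by simp <;> ring)

theorem hasFin_rep7 : HasFin (rep 7) [(![1, 0], 1), (![-1, 0], 1)] := by
  constructor
  · intro z hz
    rw [isSing_iff] at hz
    simp [rep] at hz
    obtain ⟨h1, h2⟩ := hz
    have e0 : z 1 = 0 := by
      rcases h2 with h2 | h2
      · rw [h2] at h1; norm_num at h1
      · exact h2
    have e1 : (z 0 - 1) * (z 0 + 1) = 0 := by linear_combination -h1
    rw [← vec2_eta z, e0]
    rcases mul_eq_zero.1 e1 with e1 | e1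
    · rw [sub_eq_zero.1 e1]; exact ⟨_, List.mem_cons_self .., rfl⟩
    · rw [eq_neg_of_add_eq_zero_left e1]
      exact ⟨_, List.mem_cons_of_mem _ (List.mem_cons_self ..), rfl⟩
  · intro e he
    simp at he
    rcases he with rfl | rfl
    · refine ⟨by rw [isSing_iff]; simp [rep], onInvLine_of (lineFactors_rep7.inv 2) (by simp) (by simp), ?_⟩
      exact projInt_PQ_eq_mul (Taff_inv (1) (0)) (by rw [Taff_mulVec]; simp [affPt]) _ (fun z => -(z 0 * (z 0 + 2 * (1)))) (fun z => -2 * (z 0 + (1)) * z 1)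
          (fun z => by rw [Taff_mulVec]; simp [Pv, rep] <;> ring) (fun z => by rw [Taff_mulVec]; simp [Qv, rep] <;> ring) 1 1
          (X 0 + 2 * (1)) (-1) (0) (2 * (X 0 + (1))) (0) (-1) (-(X 0 + 2 * (1))) (0) (0) (-2 * (X 0 + (1))) (by simp [constantCoeff_two]) (by simp [constantCoeff_two])
          (fun z => by simp <;> ring) (fun z => by simp <;> ring) (fun z => by simp <;> ring) (fun z => by simp <;> ring)
    · refine ⟨by rw [isSing_iff]; simp [rep], onInvLine_of (lineFactors_rep7.inv 2) (by simp) (by simp), ?_⟩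
      exact projInt_PQ_eq_mul (Taff_inv (-1) (0)) (by rw [Taff_mulVec]; simp [affPt]) _ (fun z => -(z 0 * (z 0 + 2 * (-1)))) (fun z => -2 * (z 0 + (-1)) * z 1)
          (fun z => by rw [Taff_mulVec]; simp [Pv, rep] <;> ring) (fun z => by rw [Taff_mulVec]; simp [Qv, rep] <;> ring) 1 1
          (X 0 + 2 * (-1)) (-1) (0) (2 * (X 0 + (-1))) (0) (-1) (-(X 0 + 2 * (-1))) (0) (0) (-2 * (X 0 + (-1))) (by simp [constantCoeff_two]) (by simp [constantCoeff_two])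
          (fun z => by simp <;> ring) (fun z => by simp <;> ring) (fun z => by simp <;> ring) (fun z => by simp <;> ring)

theorem hasFin_rep8 : HasFin (rep 8) [] := by
  constructor
  · intro z hz
    rw [isSing_iff] at hz
    simp [rep] at hz
    obtain ⟨h1, h2⟩ := hz
    nlinarith [sq_nonneg (z 0)]
  · intro e he
    simp at he

theorem hasFin_rep9 : HasFin (rep 9) [] := by
  constructor
  · intro z hz
    rw [isSing_iff] at hz
    simp [rep] at hz
  · intro e he
    simp at he

theorem hasFin_rep10 : HasFin (rep 10) [(![0, 0], 1)] := by
  constructor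
  · intro z hz
    rw [isSing_iff] at hz
    simp [rep] at hz
    obtain ⟨h1, h2⟩ := hz
    have e0 : z 0 = 0 := h1
    have e1 : z 1 = 0 := by rw [e0] at h2; simpa using h2
    rw [← vec2_eta z, e0, e1]
    exact ⟨_, List.mem_cons_self .., rfl⟩
  · intro e he
    simp at he
    rcases he with rfl
    · refine ⟨by rw [isSing_iff]; simp [rep], onInvLine_of (lineFactors_rep10.inv 0) (by simp) (by simp), ?_⟩
      exact projInt_PQ_eq_mul (Taff_inv (0) (0)) (by rw [Taff_mulVec]; simp [affPt]) _ (fun z => z 0) (fun z => z 1 - z 0 ^ 2)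
          (fun z => by rw [Taff_mulVec]; simp [Pv, rep] <;> ring) (fun z => by rw [Taff_mulVec]; simp [Qv, rep] <;> ring) 1 1
          (1) (1) (0) (1) (X 0) (1) (1) (0) (-X 0) (1) (by simp [constantCoeff_two]) (by simp [constantCoeff_two])
          (fun z => by simp <;> ring) (fun z => by simp <;> ring) (fun z => by simp <;> ring) (fun z => by simp <;> ring)

/-! ### The configurations of the representatives and of the systems in their orbits -/

theorem HasFin.hasConfig {a : Sys} {K : ConfigData} {n : ℕ} {L : Fin n → Fin 3 → ℂ} {m : Fin n → ℕ}
    (hfin : HasFin a K.fin) (hinf : HasInf a K.inf) (hL : LineFactors a L m)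
    (hK : K.lines = List.ofFn fun j => (L j, (m j : ℕ∞))) : HasConfig a AffTransf.id K := by
  refine ⟨hL.config_lines hK, ⟨fun z hz _ => ?_, fun e he => ?_⟩, fun w hw => ?_, fun e he => ?_⟩
  · simpa only [apply_id] using hfin.1 z hz
  · simpa only [apply_id, affInt_eq_projInt] using hfin.2 e he
  · simpa only [mulVec_id] using hinf.1 w hw
  · simpa only [mulVec_id] using hinf.2 e he

theorem hasFin_rep (i : Fin 11) : HasFin (rep i) (config i).fin := by
  fin_cases i
  exacts [hasFin_rep0, hasFin_rep1, hasFin_rep2, hasFin_rep3, hasFin_rep4, hasFin_rep5, hasFin_rep6, hasFin_rep7,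
    hasFin_rep8, hasFin_rep9, hasFin_rep10]

theorem hasInf_rep (i : Fin 11) : HasInf (rep i) (config i).inf := by
  fin_cases i
  exacts [hasInf_diagonal (-1), hasInf_diagonal 1, hasInf_conformal (-1), hasInf_conformal 1, hasInf_diagonal 0,
    hasInf_conformal 0, hasInf_rep6, hasInf_rep7, hasInf_rep8, hasInf_rep9, hasInf_rep10]

theorem hasConfig_rep (i : Fin 11) : HasConfig (rep i) AffTransf.id (config i) := by
  obtain ⟨n, L, m, h, -, hK⟩ := exists_lineFactors i
  exact (hasFin_rep i).hasConfig (hasInf_rep i) h hK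

/-- The matrix of the homogenized affine transformation. -/
def AffTransf.mat (g : AffTransf) : Matrix (Fin 3) (Fin 3) ℂ :=
  !![g.M 0 0, g.M 0 1, g.b 0; g.M 1 0, g.M 1 1, g.b 1; 0, 0, 1]

theorem mat_mulVec (g : AffTransf) (z : Fin 3 → ℂ) : g.mat.mulVec z = g.act z := by
  ext i
  fin_cases i <;> simp [AffTransf.mat, AffTransf.act, Matrix.mulVec, dotProduct, Fin.sum_univ_three]

theorem mat_inv_mul (g : AffTransf) : g.inv.mat * g.mat = 1 := by
  refine mul_eq_one_comm.1 (Matrix.toLin'.injective (LinearMap.ext fun z => ?_))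
  simp only [Matrix.toLin'_apply, ← Matrix.mulVec_mulVec, mat_mulVec, act_inv, Matrix.one_mulVec]

theorem act_affPt (g : AffTransf) (z : Fin 2 → ℝ) : g.act (affPt z) = affPt (g.apply z) := by
  ext i
  fin_cases i <;> simp [AffTransf.act, affPt, AffTransf.apply, Matrix.mulVec, dotProduct, Fin.sum_univ_two]

theorem act_infPt (g : AffTransf) (w : Fin 2 → ℝ) : g.act (infPt w) = infPt (g.M.mulVec w) := by
  ext i
  fin_cases i <;> simp [AffTransf.act, infPt, Matrix.mulVec, dotProduct, Fin.sum_univ_two]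

theorem affPt_ne_zero (z : Fin 2 → ℝ) : affPt z ≠ 0 := fun h => one_ne_zero (congrFun h 2)

theorem mulVec_ne_zero (g : AffTransf) {w : Fin 2 → ℝ} (hw : w ≠ 0) : g.M.mulVec w ≠ 0 := fun h => hw <| by
  rw [← Matrix.one_mulVec w, ← g.inv_mul_M, ← Matrix.mulVec_mulVec, h, Matrix.mulVec_zero]

theorem projInt_PQ_pull (g : AffTransf) {s : ℝ} (hs : s ≠ 0) (a : Sys) {w : Fin 3 → ℂ} (hw : w ≠ 0) :
    projInt (cplx (P (pull g s a))) (cplx (Q (pull g s a))) w = projInt (cplx (P a)) (cplx (Q a)) (g.act w) := by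
  rw [projInt_mulVec (mat_inv_mul g) hw (mat_mulVec g w) (cplxP_isHomogeneous a) (cplxQ_isHomogeneous a)]
  obtain ⟨δ, hδ⟩ : ∃ δ : ℂ, δ = g.M 0 0 * g.M 1 1 - g.M 0 1 * g.M 1 0 := ⟨_, rfl⟩
  have hd : δ ≠ 0 := hδ ▸ det_ne' g
  have hs' : (s : ℂ) ≠ 0 := by exact_mod_cast hs
  refine projInt_congr (le_antisymm (span_pair_le.2 ⟨?_, ?_⟩) (span_pair_le.2 ⟨?_, ?_⟩)) w <;>
    rw [Ideal.mem_span_pair]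
  · refine ⟨C (s * g.M 1 1 : ℂ), C (-(s * g.M 0 1) : ℂ), MvPolynomial.funext fun z => ?_⟩
    simp only [map_add, map_mul, eval_C, eval_subst3, eval_P, eval_Q, mat_mulVec, Pv_pull]
    ring
  · refine ⟨C (-(s * g.M 1 0) : ℂ), C (s * g.M 0 0 : ℂ), MvPolynomial.funext fun z => ?_⟩
    simp only [map_add, map_mul, eval_C, eval_subst3, eval_P, eval_Q, mat_mulVec, Qv_pull]
    ring
  · refine ⟨C (g.M 0 0 / (s * δ) : ℂ),
      C (g.M 0 1 / (s * δ) : ℂ), MvPolynomial.funext fun z => ?_⟩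
    simp only [map_add, map_mul, eval_C, eval_subst3, eval_P, eval_Q, mat_mulVec, Pv_pull, Qv_pull]
    field_simp
    rw [hδ]
    ring
  · refine ⟨C (g.M 1 0 / (s * δ) : ℂ),
      C (g.M 1 1 / (s * δ) : ℂ), MvPolynomial.funext fun z => ?_⟩
    simp only [map_add, map_mul, eval_C, eval_subst3, eval_P, eval_Q, mat_mulVec, Pv_pull, Qv_pull]
    field_simp
    rw [hδ]
    ring

theorem eval_CP_pull (g : AffTransf) (s : ℝ) (a : Sys) (z : Fin 3 → ℂ) : eval z (cplx (CP (pull g s a))) =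
    s * (eval (g.act z) (cplx (CP a)) - z 2 * (g.b 1 * Pv a (g.act z) - g.b 0 * Qv a (g.act z))) := by
  rw [eval_CP, eval_CP, Pv_pull, Qv_pull]
  generalize hP : Pv a (g.act z) = P
  generalize hQ : Qv a (g.act z) = Q
  simp only [AffTransf.act, Matrix.cons_val]
  ring

theorem projInt_CZ_pull (g : AffTransf) {s : ℝ} (hs : s ≠ 0) (a : Sys) {w : Fin 3 → ℂ} (hw : w ≠ 0) :
    projInt (cplx (CP (pull g s a))) (X 2) w = projInt (cplx (CP a)) (X 2) (g.act w) := by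
  rw [projInt_mulVec (mat_inv_mul g) hw (mat_mulVec g w) (cplxCP_isHomogeneous a) (isHomogeneous_X ℂ 2)]
  have hs' : (s : ℂ) ≠ 0 := by exact_mod_cast hs
  have hX : subst3 g.mat (X 2) = X 2 := MvPolynomial.funext fun z => by
    rw [eval_subst3, mat_mulVec, eval_X, eval_X]; rfl
  rw [hX]
  set R := C (g.b 1 : ℂ) * subst3 g.mat (cplx (P a)) - C (g.b 0 : ℂ) * subst3 g.mat (cplx (Q a)) with hR
  refine projInt_congr (le_antisymm (span_pair_le.2 ⟨?_, ?_⟩) (span_pair_le.2 ⟨?_, ?_⟩)) w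
  · refine Ideal.mem_span_pair.2 ⟨C (s : ℂ), -C (s : ℂ) * R, MvPolynomial.funext fun z => ?_⟩
    simp only [hR, map_add, map_sub, map_neg, map_mul, eval_C, eval_X, eval_subst3, eval_P, eval_Q, mat_mulVec,
      eval_CP_pull]
    ring
  · exact Ideal.subset_span (by simp)
  · refine Ideal.mem_span_pair.2 ⟨C (s⁻¹ : ℂ), R, MvPolynomial.funext fun z => ?_⟩
    simp only [hR, map_add, map_sub, map_neg, map_mul, eval_C, eval_X, eval_subst3, eval_P, eval_Q, mat_mulVec,
      eval_CP_pull]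
    field_simp
    ring
  · exact Ideal.subset_span (by simp)

theorem isSing_iff_Pv (a : Sys) (z : Fin 2 → ℝ) : IsSing a z ↔ Pv a (affPt z) = 0 ∧ Qv a (affPt z) = 0 := by
  rw [isSing_iff, affPt, Pv_eq, Qv_eq, ← Complex.ofReal_eq_zero, ← Complex.ofReal_eq_zero]
  push_cast
  simp only [one_pow, mul_one]

theorem isSing_pull (g : AffTransf) {s : ℝ} (hs : s ≠ 0) (a : Sys) (z : Fin 2 → ℝ) :
    IsSing (pull g s a) z ↔ IsSing a (g.apply z) := by
  rw [isSing_iff_Pv, isSing_iff_Pv, Pv_pull, Qv_pull, act_affPt]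
  have hd := det_ne' g
  have hs' : (s : ℂ) ≠ 0 := by exact_mod_cast hs
  constructor
  · rintro ⟨h0, h1⟩
    replace h0 := (mul_eq_zero.1 h0).resolve_left hs'
    replace h1 := (mul_eq_zero.1 h1).resolve_left hs'
    constructor <;> apply mul_right_cancel₀ hd
    · linear_combination (g.M 0 0 : ℂ) * h0 + (g.M 0 1 : ℂ) * h1
    · linear_combination (g.M 1 0 : ℂ) * h0 + (g.M 1 1 : ℂ) * h1
  · rintro ⟨h0, h1⟩
    simp [h0, h1]

theorem isSingInf_pull (g : AffTransf) {s : ℝ} (hs : s ≠ 0) (a : Sys) {w : Fin 2 → ℝ} (hw : w ≠ 0) :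
    IsSingInf (pull g s a) w ↔ IsSingInf a (g.M.mulVec w) := by
  have hs' : (s : ℂ) ≠ 0 := by exact_mod_cast hs
  have h2 : infPt w 2 = 0 := rfl
  rw [IsSingInf, IsSingInf, eval_CP_pull, act_infPt, h2, zero_mul, sub_zero, mul_eq_zero, or_iff_right hs']
  exact ⟨fun h => ⟨mulVec_ne_zero g hw, h.2⟩, fun h => ⟨hw, h.2⟩⟩

theorem onInvLine_pull (g : AffTransf) {s : ℝ} (hs : s ≠ 0) (a : Sys) (z : Fin 2 → ℝ) :
    OnInvLine (pull g s a) z ↔ OnInvLine a (g.apply z) := by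
  have e : ∀ (l : Fin 3 → ℂ), eval (toC z) (lineForm (g.pullLine l)) = eval (toC (g.apply z)) (lineForm l) := by
    intro l
    rw [lineForm_eq, lineForm_eq, eval_affForm, eval_affForm]
    have := pullLine_dot g l (affPt z)
    rw [act_affPt] at this
    simpa [affPt, toC] using this
  unfold OnInvLine
  rw [(pullLine_bijective g).2.exists]
  simp only [isInvAffineLine_pull g hs, e]

theorem HasConfig.pull {a : Sys} {K : ConfigData} (h : HasConfig a AffTransf.id K) (g : AffTransf) {s : ℝ}
    (hs : s ≠ 0) : HasConfig (QuadSL.pull g s a) g.inv K := by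
  obtain ⟨⟨l1, l2⟩, ⟨f1, f2⟩, i1, i2⟩ := h
  simp only [LineFactors.pullLine_id, apply_id, mulVec_id] at l1 l2 f1 f2 i1 i2
  have hM : ∀ w, g.M.mulVec (g.inv.M.mulVec w) = w := fun w => by
    rw [show g.inv.M = g.M⁻¹ from rfl, Matrix.mulVec_mulVec, g.mul_inv_M, Matrix.one_mulVec]
  have hM' : ∀ w, g.inv.M.mulVec (g.M.mulVec w) = w := fun w => by
    rw [show g.inv.M = g.M⁻¹ from rfl, Matrix.mulVec_mulVec, g.inv_mul_M, Matrix.one_mulVec]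
  refine ⟨⟨fun l hl => ?_, fun e he l hl => ?_⟩, ⟨fun z hz hz' => ?_, fun e he => ?_⟩, fun w hw => ?_, fun e he => ?_⟩
  · obtain ⟨m, rfl⟩ := (pullLine_bijective g).2 l
    rw [pullLine_pullLine_inv]
    exact l1 m ((isInvLine_pull g hs a m).1 hl)
  · obtain ⟨m, rfl⟩ := (pullLine_bijective g).2 l
    rw [pullLine_pullLine_inv] at hl
    rw [isInvLine_pull g hs, lineMult_pull g hs]
    exact l2 e he m hl
  · obtain ⟨e, he, h⟩ := f1 _ ((isSing_pull g hs a z).1 hz) ((onInvLine_pull g hs a z).1 hz')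
    exact ⟨e, he, by rw [← h, g.inv_apply_apply]⟩
  · rw [isSing_pull g hs, onInvLine_pull g hs, affInt_eq_projInt, projInt_PQ_pull g hs a (affPt_ne_zero _),
      act_affPt, g.apply_inv_apply, ← affInt_eq_projInt]
    exact f2 e he
  · obtain ⟨e, he, c, hc, h⟩ := i1 _ ((isSingInf_pull g hs a hw.1).1 hw)
    exact ⟨e, he, c, hc, by rw [← Matrix.mulVec_smul, ← h, hM']⟩
  · have h0 := mulVec_ne_zero g.inv (i2 e he).1.1
    rw [isSingInf_pull g hs a h0, projInt_CZ_pull g hs a (infPt_ne_zero h0), projInt_PQ_pull g hs a (infPt_ne_zero h0),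
      act_infPt, hM]
    exact i2 e he

theorem SameOrbit.exists_hasConfig {a : Sys} {i : Fin 11} (h : SameOrbit (rep i) a) :
    ∃ g, HasConfig a g (config i) := by
  obtain ⟨g, s, hs, rfl⟩ := h.exists_pull
  exact ⟨_, (hasConfig_rep i).pull g hs⟩

/-! ### A configuration determines the orbit -/

theorem infPt_smul (c : ℝ) (w : Fin 2 → ℝ) : infPt (c • w) = (c : ℂ) • infPt w := by
  ext i
  fin_cases i <;> simp [infPt]

theorem projInt_smul (F G : MvPolynomial (Fin 3) ℂ) {c : ℂ} (hc : c ≠ 0) (w : Fin 3 → ℂ) :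
    projInt F G (c • w) = projInt F G w := by
  have h : chartOf (c • w) = chartOf w := by simp [chartOf, hc]
  have h' : ∀ i, chartPt i (c • w) = chartPt i w := fun i => by
    ext j
    exact mul_div_mul_left _ _ hc
  rw [projInt, h, h', projInt]

section

variable {a : Sys} {g : AffTransf} {K : ConfigData}

theorem HasConfig.lineMult_infinity (h : HasConfig a g K) {m : ℕ∞} (hm : (![0, 0, 1], m) ∈ K.lines) :
    lineMult a ![0, 0, 1] = m :=
  (h.1.2 _ hm _ (by simp [AffTransf.pullLine])).2

theorem HasConfig.exists_inf_iff (h : HasConfig a g K) (m n : ℕ∞) : (∃ w, IsSingInf a w ∧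
    projInt (cplx (CP a)) (X 2) (infPt w) = m ∧ projInt (cplx (P a)) (cplx (Q a)) (infPt w) = n) ↔
      (m, n) ∈ K.inf.map Prod.snd := by
  rw [List.mem_map]
  constructor
  · rintro ⟨w, hw, rfl, rfl⟩
    obtain ⟨e, he, c, hc, rfl⟩ := h.2.2.1 w hw
    have hc' : (c : ℂ) ≠ 0 := by exact_mod_cast hc
    have := h.2.2.2 e he
    rw [infPt_smul, projInt_smul _ _ hc', projInt_smul _ _ hc', this.2.1, this.2.2]
    exact ⟨e, he, rfl⟩
  · rintro ⟨e, he, h1⟩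
    have := h.2.2.2 e he
    rw [h1] at this
    exact ⟨_, this⟩

theorem HasConfig.exists_fin_iff (h : HasConfig a g K) (n : ℕ∞) : (∃ z, IsSing a z ∧ OnInvLine a z ∧
    affInt (cplx (p a)) (cplx (q a)) (toC z) = n) ↔ n ∈ K.fin.map Prod.snd := by
  rw [List.mem_map]
  constructor
  · rintro ⟨z, hz, hz', rfl⟩
    obtain ⟨e, he, rfl⟩ := h.2.1.1 z hz hz'
    exact ⟨e, he, (h.2.1.2 e he).2.2.symm⟩
  · rintro ⟨e, he, rfl⟩
    exact ⟨_, h.2.1.2 e he⟩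

theorem mulVec_ext (g : AffTransf) {v w : Fin 2 → ℝ} (h : g.M.mulVec v = g.M.mulVec w) : v = w := by
  by_contra hne
  exact mulVec_ne_zero g (sub_ne_zero.2 hne) (by rw [Matrix.mulVec_sub, h, sub_self])

/-- The real singular points at infinity coincide. -/
def UniqueInf (a : Sys) : Prop := ∀ v w, IsSingInf a v → IsSingInf a w → ∃ c : ℝ, v = c • w

theorem HasConfig.uniqueInf (h : HasConfig a g K) {e} (hK : K.inf = [e]) : UniqueInf a := by
  have key : ∀ w, IsSingInf a w → ∃ c : ℝ, c ≠ 0 ∧ w = c • g.M.mulVec e.1 := fun w hw => by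
    simpa [hK] using h.2.2.1 w hw
  intro v w hv hw
  obtain ⟨c, hc, rfl⟩ := key v hv
  obtain ⟨d, hd, rfl⟩ := key w hw
  exact ⟨c / d, by rw [smul_smul, div_mul_cancel₀ _ hd]⟩

theorem HasConfig.not_uniqueInf (h : HasConfig a g K) {v w} (hv : (![1, 0], v) ∈ K.inf) (hw : (![0, 1], w) ∈ K.inf) :
    ¬ UniqueInf a := by
  intro hu
  obtain ⟨c, hc⟩ := hu _ _ (h.2.2.2 _ hv).1 (h.2.2.2 _ hw).1
  rw [← Matrix.mulVec_smul] at hc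
  simpa using congrFun (mulVec_ext g hc) 0

theorem HasConfig.uniqueInf_iff {i : Fin 11} (h : HasConfig a g (config i)) :
    UniqueInf a ↔ i = 2 ∨ i = 3 ∨ i = 5 ∨ i = 10 := by
  have h1 := fun e => h.uniqueInf (e := e)
  have h2 := fun v w => h.not_uniqueInf (v := v) (w := w)
  fin_cases i
  · exact iff_of_false (h2 (1, 0) (1, 0) (by simp [config]) (by simp [config])) (by decide)
  · exact iff_of_false (h2 (1, 0) (1, 0) (by simp [config]) (by simp [config])) (by decide)
  · exact iff_of_true (h1 _ rfl) (by decide)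
  · exact iff_of_true (h1 _ rfl) (by decide)
  · exact iff_of_false (h2 (1, 0) (1, 0) (by simp [config]) (by simp [config])) (by decide)
  · exact iff_of_true (h1 _ rfl) (by decide)
  · exact iff_of_false (h2 (1, 0) (2, 2) (by simp [config]) (by simp [config])) (by decide)
  · exact iff_of_false (h2 (1, 0) (2, 2) (by simp [config]) (by simp [config])) (by decide)
  · exact iff_of_false (h2 (1, 0) (2, 2) (by simp [config]) (by simp [config])) (by decide)
  · exact iff_of_false (h2 (1, 0) (2, 4) (by simp [config]) (by simp [config])) (by decide)
  · exact iff_of_true (h1 _ rfl) (by decide)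

/-- An invariant line contains the real finite singular points of the configuration. -/
def HasCommonLine (a : Sys) : Prop := ∃ l, IsInvLine a l ∧ ∀ z, IsSing a z → OnInvLine a z →
  l 0 * z 0 + l 1 * z 1 + l 2 = 0

theorem pullLine_apply (g : AffTransf) (l : Fin 3 → ℂ) (z : Fin 2 → ℝ) :
    g.pullLine l 0 * z 0 + g.pullLine l 1 * z 1 + g.pullLine l 2 =
      l 0 * g.apply z 0 + l 1 * g.apply z 1 + l 2 := by
  have := pullLine_dot g l (affPt z)
  rw [act_affPt] at this
  simpa [affPt] using this

theorem HasConfig.hasCommonLine (h : HasConfig a g (config 2)) : HasCommonLine a := by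
  obtain ⟨l, hl⟩ := (pullLine_bijective g).2 ![1, 0, 0]
  refine ⟨l, (h.1.2 (![1, 0, 0], 1) (by simp [config]) l hl).1, fun z hz hz' => ?_⟩
  obtain ⟨e, he, rfl⟩ := h.2.1.1 z hz hz'
  rw [← pullLine_apply, hl]
  simp [config] at he
  rcases he with rfl | rfl <;> simp

theorem HasConfig.not_hasCommonLine (h : HasConfig a g (config 3)) : ¬ HasCommonLine a := by
  rintro ⟨l, hl, h0⟩
  obtain ⟨e, he, c, hc, e1⟩ := h.1.1 l hl
  have key : ∀ t : ℝ, (![t, 0], (1 : ℕ∞)) ∈ (config 3).fin → e.1 0 * t + e.1 2 = 0 := by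
    intro t ht
    have h2 := h.2.1.2 _ ht
    have h3 := h0 _ h2.1 h2.2.1
    rw [← pullLine_apply, e1] at h3
    have h4 : c * (e.1 0 * t + e.1 2) = 0 := by simpa [mul_add, mul_assoc] using h3
    exact (mul_eq_zero.1 h4).resolve_left hc
  have k1 := key 1 (by simp [config])
  have k2 := key (-1) (by simp [config])
  simp [config] at he
  rcases he with rfl | rfl | rfl | rfl | rfl | rfl <;> simp at k1 k2

theorem HasConfig.index_unique {g' : AffTransf} {i j : Fin 11} (hi : HasConfig a g (config i))
    (hj : HasConfig a g' (config j)) : i = j := by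
  have e (m n : ℕ∞) := (hi.exists_inf_iff m n).symm.trans (hj.exists_inf_iff m n)
  have f (n : ℕ∞) := (hi.exists_fin_iff n).symm.trans (hj.exists_fin_iff n)
  have t1 : ∀ i : Fin 11, ((2 : ℕ∞), (2 : ℕ∞)) ∈ (config i).inf.map Prod.snd ↔ i = 6 ∨ i = 7 ∨ i = 8 := by
    intro i; fin_cases i <;> simp [config]
  have t2 : ∀ i : Fin 11, ((2 : ℕ∞), (4 : ℕ∞)) ∈ (config i).inf.map Prod.snd ↔ i = 9 := by
    intro i; fin_cases i <;> simp [config]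
  have t3 : ∀ i : Fin 11, (1 : ℕ∞) ∈ (config i).fin.map Prod.snd ↔
      i = 0 ∨ i = 2 ∨ i = 3 ∨ i = 6 ∨ i = 7 ∨ i = 10 := by
    intro i; fin_cases i <;> simp [config]
  have t4 : ∀ i : Fin 11, (4 : ℕ∞) ∈ (config i).fin.map Prod.snd ↔ i = 4 ∨ i = 5 := by
    intro i; fin_cases i <;> simp [config]
  have t5 : ∀ i : Fin 11, ((3 : ℕ∞), (3 : ℕ∞)) ∈ (config i).inf.map Prod.snd ↔ i = 10 := by
    intro i; fin_cases i <;> simp [config]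
  have e1 := e 2 2
  have e2 := e 2 4
  have e3 := e 3 3
  have f1 := f 1
  have f4 := f 4
  rw [t1, t1] at e1
  rw [t2, t2] at e2
  rw [t5, t5] at e3
  rw [t3, t3] at f1
  rw [t4, t4] at f4
  have u := hi.uniqueInf_iff.symm.trans hj.uniqueInf_iff
  have c1 : ¬ (i = 2 ∧ j = 3) := by
    rintro ⟨rfl, rfl⟩; exact hj.not_hasCommonLine hi.hasCommonLine
  have c2 : ¬ (i = 3 ∧ j = 2) := by
    rintro ⟨rfl, rfl⟩; exact hi.not_hasCommonLine hj.hasCommonLine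
  have d : ∀ {g g' : AffTransf}, HasConfig a g (config 6) → HasConfig a g' (config 7) → False := by
    intro g g' h6 h7
    have h := (h6.lineMult_infinity (m := 2) (by simp [config])).symm.trans
      (h7.lineMult_infinity (m := 1) (by simp [config]))
    norm_num at h
  have d1 : ¬ (i = 6 ∧ j = 7) := by
    rintro ⟨rfl, rfl⟩; exact d hi hj
  have d2 : ¬ (i = 7 ∧ j = 6) := by
    rintro ⟨rfl, rfl⟩; exact d hj hi
  clear hi hj e f t1 t2 t3 t4 t5 d
  lia

end

theorem sameOrbit_iff_hasConfig {a : Sys} (ha : IsQSL6 a) (i : Fin 11) :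
    SameOrbit (rep i) a ↔ ∃ g : AffTransf, HasConfig a g (config i) := by
  refine ⟨SameOrbit.exists_hasConfig, fun ⟨g, hg⟩ => ?_⟩
  obtain ⟨j, hj⟩ := ha.exists_sameOrbit
  obtain ⟨g', hg'⟩ := hj.exists_hasConfig
  rwa [hg.index_unique hg']

theorem existsUnique_sameOrbit {a : Sys} (ha : IsQSL6 a) : ∃! i : Fin 11, SameOrbit (rep i) a := by
  obtain ⟨i, hi⟩ := ha.exists_sameOrbit
  exact ⟨i, hi, fun j hj => orbitCond_unique (orbitCond_of_sameOrbit hj) (orbitCond_of_sameOrbit hi)⟩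

end

end QuadSL

theorem theorem5p1 :
    -- the class QSL₆ is the disjoint union of the eleven orbits of the representatives
    (∀ (i : Fin 11) (a : Sys), SameOrbit (rep i) a → IsQSL6 a) ∧
    (∀ a : Sys, IsQSL6 a → ∃! i : Fin 11, SameOrbit (rep i) a) ∧
    -- the representatives have the eleven configurations, and the configuration determines the orbit
    (∀ i : Fin 11, HasConfig (rep i) AffTransf.id (config i)) ∧
    (∀ a : Sys, IsQSL6 a → ∀ i : Fin 11,
      (SameOrbit (rep i) a ↔ ∃ g : AffTransf, HasConfig a g (config i))) ∧
    -- the orbits are characterized by comitants, among all nondegenerate quadratic systems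
    (∀ a : Sys, IsQS a → ∀ i : Fin 11, (SameOrbit (rep i) a ↔ OrbitCond i a)) ∧
    -- the conditions are invariant under the affine group and time rescaling
    (∀ (i : Fin 11) (g : AffTransf) (r : ℝ) (a a' : Sys), r ≠ 0 → Transforms g r a a' →
      (OrbitCond i a ↔ OrbitCond i a')) ∧
    -- the polynomials used are CT-comitants
    (IsCTComitant H1 Set.univ ∧ IsCTComitant H2 Set.univ ∧ IsCTComitant H3 Set.univ ∧
      IsCTComitant N1 {a | eta a = 0 ∧ H a = 0} ∧
      IsCTComitant N2 {a | eta a = 0 ∧ H a = 0 ∧ B3 a = 0} ∧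
      IsCTComitant N3 {a | M a = 0 ∧ N a = 0} ∧
      IsCTComitant N4 {a | M a = 0 ∧ N a = 0 ∧ N3 a = 0}) :=
  ⟨fun _ _ => isQSL6_of_sameOrbit, fun _ => existsUnique_sameOrbit, hasConfig_rep,
    fun _ => sameOrbit_iff_hasConfig, fun _ ha i => ⟨orbitCond_of_sameOrbit, sameOrbit_of_orbitCond ha i⟩,
    orbitCond_transforms, comitants⟩
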